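/- **Setting.** Let $n\ge 1$ and let $X$ be a balanced Euclidean conical space of pure dimension $n$: a second countable space with an equivalence class (equivalent $=$ having a common subdivision) of conical polyhedral complexes $\Pi$ on $X$ (finite closed coverings of $X$ by strictly convex polyhedral cones with their linear structures, containing all faces of each cone, the intersection of two cones being a union of common faces), a map $\iota:X\to N$ to a finite dimensional Euclidean space that is linear and injective on each cone, and a balancing cycle $[X]$. Here $R(X)$ is the set of complexes in the class on whose cones $\iota$ is linear and injective, and $\Pi(k)$ is the set of $k$-dimensional cones of $\Pi$. For $\tau\in\Pi(k-1)$ a facet of $\sigma\in\Pi(k)$, $\hat v_{\sigma/\tau}$ is the unit vector in the span of $\sigma$ in $N$ that is orthogonal to $\tau$ and points towards $\sigma$. A $k$-dimensional Minkowski weight on $\Pi$ is a map $c:\Pi(k)\to\mathbb R$ with $\sum_{\sigma\succ\tau}c(\sigma)\hat v_{\sigma/\tau}=0$ for all $\tau\in\Pi(k-1)$; tropical $k$-cycles are Minkowski weights modulo pull-back to subdivisions, and they are positive if represented by a nonnegative weight. The cycle $[X]$ is represented by an $n$-dimensional Minkowski weight that is positive on all $n$-dimensional cones of some complex. For $\phi$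 linear on the cones of $\Pi$, given on $\sigma$ by the linear form $\phi_\sigma$, put $$(\phi\cdot c)(\tau)=\sum_{\sigma\succ\tau}-\phi_\sigma(\hat v_{\sigma/\tau})\,c(\sigma),$$ a $(k-1)$-dimensional Minkowski weight; this defines the product with a tropical cycle of a piecewise linear (PL) function, i.e. a function $X\to\mathbb R$ that is linear on each cone of some $\Pi\in R(X)$. The degree of a $0$-cycle $c$ is $\deg c=\sum_{v\in\Pi(0)}c(v)$. Let $\mathbb S^X=\{x\in X:\|\iota(x)\|=1\}$. For a $1$-cycle $z$ represented on $\Pi$ put $\mu_z=\sum_{\rho\in\Pi(1)}z(\rho)\,\delta_{\hat v_\rho}$, where $\hat v_\rho$ is the point of $\rho\cap\mathbb S^X$. An admissible family $\mathcal C$ is a convex cone of PL functions on $X$ such that $\phi_1\cdots\phi_r\cdot[X]$ is positive for all $r\le n$ and $\phi_1,\dots,\phi_r\in\mathcal C$, and such that $\mathcal C-\mathcal C$ is dense in $C^0(\mathbb S^X)$ for uniform convergence. Fix one. A function $\psi:X\to\mathbb R$ is $\mathcal C$-concave if it is conical ($\psi(\lambda x)=\lambda\psi(x)$ for $\lambda\ge0$)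 and a limit of elements of $\mathcal C$ for pointwise convergence (it lies in the closure of $\mathcal C$). The Monge–Ampère measure $\mu_\psi$ of a $\mathcal C$-concave function $\psi$ is the finite measure on $\mathbb S^X$ that is the weak limit of $\mu_{\phi^{n-1}\cdot[X]}$ as $\phi\in\mathcal C$ tends to $\psi$ pointwise. **Statement.** 1. For every $\mathcal C$-concave $\psi$ the measure $\mu_\psi$ exists and is unique, $\psi$ is integrable for it, and for every sequence $(\phi_j)$ in $\mathcal C$ converging pointwise to $\psi$ the limit $\deg(\psi):=\lim_j\deg(\phi_j^n\cdot[X])$ exists, is finite, and equals $-\int_{\mathbb S^X}\psi\,d\mu_\psi$. 2. There is a unique symmetric map $(\psi_1,\dots,\psi_{n-1})\mapsto\mu_{\psi_1,\dots,\psi_{n-1}}$ from $(n-1)$-tuples of $\mathcal C$-concave functions to finite measures on $\mathbb S^X$ (the mixed Monge–Ampère measure) such that, for all $\ell$, all $\mathcal C$-concave $\psi_1,\dots,\psi_\ell$ and all real $\lambda_1,\dots,\lambda_\ell\ge0$, $$\mu_{\lambda_1\psi_1+\dots+\lambda_\ell\psi_\ell}=\sum_{i_1,\dots,i_{n-1}=1}^{\ell}\lambda_{i_1}\cdots\lambda_{i_{n-1}}\,\mu_{\psi_{i_1},\dots,\psi_{i_{n-1}}}.$$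 It is multilinear over the nonnegative real numbers. 3. Let $\psi_1,\dots,\psi_n$ be $\mathcal C$-concave. For all sequences $(\phi_{i,j})_{j\in\mathbb N}$ in $\mathcal C$, $i=1,\dots,n$, converging pointwise to $\psi_i$, the limit $\deg(\psi_1\cdots\psi_n):=\lim_j\deg(\phi_{1,j}\cdots\phi_{n,j}\cdot[X])$ exists, is finite, and equals $$-\int_{\mathbb S^X}\psi_1\,d\mu_{\psi_2,\dots,\psi_n}.$$ Moreover, for every $1\le i\le n$, $\psi_i$ is integrable for $\mu_{\psi_1,\dots,\widehat{\psi_i},\dots,\psi_n}$ and $$\int_{\mathbb S^X}\psi_1\,d\mu_{\psi_2,\dots,\psi_n}=\int_{\mathbb S^X}\psi_i\,d\mu_{\psi_1,\dots,\widehat{\psi_i},\dots,\psi_n}.$$ -/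

import Mathlib

open Set Filter Topology MeasureTheory
open scoped NNReal

noncomputable section

namespace Conical

/-! ### Conical polyhedral structures -/

section Cones

variable {X : Type*}

/-- Restriction of functions from `σ` to a subset `τ`. -/
def restr {τ σ : Set X} (h : τ ⊆ σ) : (σ → ℝ) →ₗ[ℝ] (τ → ℝ) :=
  LinearMap.funLeft ℝ ℝ (Set.inclusion h)

/-- For a vector space `M` of functions on `σ`, the evaluation map
`σ → N = Hom(M, ℝ)`, `v ↦ (u ↦ u(v))`. -/
def evalMap {σ : Set X} (M : Submodule ℝ (σ → ℝ)) (v : σ) : Module.Dual ℝ M :=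
  (LinearMap.proj v).comp M.subtype

/-- `τ` is (the preimage under the evaluation map of) a face of the cone `σ`. A face of the
polyhedral cone in `N = Hom(M, ℝ)` is the zero locus, in the cone, of a linear form on `N` that
is nonnegative on the cone; since `M` is finite dimensional, such a form is an element `u` of `M`. -/
def IsFace {σ : Set X} (M : Submodule ℝ (σ → ℝ)) (τ : Set X) : Prop :=
  ∃ u ∈ M, (∀ v, 0 ≤ u v) ∧ τ = (fun v : σ => (v : X)) '' {v | u v = 0}

/-- `M` is a finite dimensional space of continuous functions on `σ`, and the evaluation map sends
`σ` homeomorphically onto a strictly convex, full-dimensional polyhedral cone in `N = Hom(M, ℝ)`.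
The topology of the finite dimensional space `N` is the one of pointwise convergence on `M`. -/
structure IsConeChart [TopologicalSpace X] {σ : Set X} (M : Submodule ℝ (σ → ℝ)) : Prop where
  finiteDimensional : FiniteDimensional ℝ M
  continuous : ∀ u ∈ M, Continuous u
  isEmbedding : IsEmbedding (fun (v : σ) (u : M) => evalMap M v u)
  polyhedral : ∃ s : Finset (Module.Dual ℝ M),
    range (evalMap M) = (PointedCone.hull ℝ (s : Set (Module.Dual ℝ M)) : Set (Module.Dual ℝ M))
  strictlyConvex : ∀ v ∈ range (evalMap M), -v ∈ range (evalMap M) → v = 0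
  fullDimensional : Submodule.span ℝ (range (evalMap M)) = ⊤

end Cones

/-- A conical polyhedral structure on `X`, given by its finite set of cones `σ` and by the
vector space `M σ` of linear functions on each of them. -/
structure ConicalComplex (X : Type*) [TopologicalSpace X] where
  /-- the cones -/
  cones : Finset (Set X)
  /-- the linear functions on a cone (only meaningful on members of `cones`) -/
  M : (σ : Set X) → Submodule ℝ (σ → ℝ)
  isClosed : ∀ σ ∈ cones, IsClosed σ
  cover : ⋃ σ ∈ cones, σ = univ
  chart : ∀ σ ∈ cones, IsConeChart (M σ)
  face_mem : ∀ σ ∈ cones, ∀ τ, IsFace (M σ) τ → τ ∈ cones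
  face_M : ∀ σ ∈ cones, ∀ τ, IsFace (M σ) τ → ∀ h : τ ⊆ σ, M τ = (M σ).map (restr h)
  inter : ∀ σ ∈ cones, ∀ τ ∈ cones, ∃ S : Set (Set X),
    (∀ ρ ∈ S, IsFace (M σ) ρ ∧ IsFace (M τ) ρ) ∧ σ ∩ τ = ⋃₀ S

namespace ConicalComplex

variable {X : Type*} [TopologicalSpace X]

/-- The dimension of a cone. -/
def dim (P : ConicalComplex X) (σ : Set X) : ℕ := Module.finrank ℝ (P.M σ)

open Classical in
/-- The set `Π(k)` of cones of dimension `k`. -/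
def conesOfDim (P : ConicalComplex X) (k : ℕ) : Finset (Set X) := P.cones.filter (fun σ => P.dim σ = k)

/-- `τ ≺ σ`: the set `τ` is a face of the cone `σ`. -/
def Face (P : ConicalComplex X) (τ σ : Set X) : Prop := IsFace (P.M σ) τ

/-- The restriction of `φ` to each cone is linear. -/
def LinearOn (P : ConicalComplex X) (φ : X → ℝ) : Prop :=
  ∀ σ ∈ P.cones, (fun v : σ => φ v) ∈ P.M σ

/-- `P'` is a subdivision of `P`: each cone of `P'` lies in a cone of `P`, the inclusion being
linear (that is, linear functions restrict to linear functions). -/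
def IsSubdivision (P' P : ConicalComplex X) : Prop :=
  ∀ σ' ∈ P'.cones, ∃ σ ∈ P.cones, ∃ h : σ' ⊆ σ, (P.M σ).map (restr h) ≤ P'.M σ'

/-- Two structures are equivalent if they have a common subdivision. -/
def Equivalent (P Q : ConicalComplex X) : Prop :=
  ∃ R : ConicalComplex X, R.IsSubdivision P ∧ R.IsSubdivision Q

/-- The map `ι` to a real vector space is linear and injective on each cone. -/
def QuasiEmbeds {N : Type*} [AddCommGroup N] [Module ℝ N] (P : ConicalComplex X) (ι : X → N) : Prop :=
  (∀ ℓ : Module.Dual ℝ N, P.LinearOn (fun v => ℓ (ι v))) ∧ ∀ σ ∈ P.cones, InjOn ι σ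

/-- Every maximal cone has dimension `n`. -/
def PureDim (P : ConicalComplex X) (n : ℕ) : Prop :=
  ∀ σ ∈ P.cones, (∀ σ' ∈ P.cones, σ ⊆ σ' → σ' = σ) → P.dim σ = n

/-- `σ` is the minimal cone of `P` that contains `σ'`. -/
def IsMinimalCone (P : ConicalComplex X) (σ' σ : Set X) : Prop :=
  σ ∈ P.cones ∧ σ' ⊆ σ ∧ ∀ ρ ∈ P.cones, σ' ⊆ ρ → σ ⊆ ρ

open Classical in
/-- The pull-back of a weight `c` on `P` to a subdivision `P'`: its value on a cone `σ'` of `P'`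
is `c σ`, where `σ` is the minimal cone of `P` containing `σ'`, if `dim σ = dim σ'`, and it is zero
otherwise. (The sum has at most one term.) -/
def pullback (P P' : ConicalComplex X) (c : Set X → ℝ) (σ' : Set X) : ℝ :=
  if σ' ∈ P'.cones then
    ∑ σ ∈ P.cones.filter (fun σ => P.IsMinimalCone σ' σ ∧ P.dim σ = P'.dim σ'), c σ
  else 0

/-- The degree of a zero-dimensional weight. -/
def degree (P : ConicalComplex X) (c : Set X → ℝ) : ℝ := ∑ v ∈ P.conesOfDim 0, c v

end ConicalComplex

/-! ### Euclidean conical spaces and tropical intersection -/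

/-- A structure of Euclidean conical space on `X`: an equivalence class of conical polyhedral
structures, given by a representative, and a quasi-embedding `ι` into the Euclidean space `N`. -/
structure EuclideanConicalSpace (X N : Type*) [TopologicalSpace X] [NormedAddCommGroup N]
    [InnerProductSpace ℝ N] where
  /-- a representative of the class of conical structures -/
  base : ConicalComplex X
  /-- the quasi-embedding -/
  ι : X → N
  quasiEmbeds : base.QuasiEmbeds ι

namespace EuclideanConicalSpace

variable {X N : Type*} [TopologicalSpace X] [NormedAddCommGroup N] [InnerProductSpace ℝ N]
variable (E : EuclideanConicalSpace X N)

/-- The set `R(X)` of conical complexes on the Euclidean conical space `X`. -/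
def R : Set (ConicalComplex X) := {P | P.Equivalent E.base ∧ P.QuasiEmbeds E.ι}

/-- `v` is a unit vector in the span of `σ`, orthogonal to the span of the face `τ`, and pointing
in the direction of `σ`. -/
def IsNormal (σ τ : Set X) (v : N) : Prop :=
  ‖v‖ = 1 ∧ v ∈ Submodule.span ℝ (E.ι '' σ) ∧
    (∀ x ∈ τ, inner ℝ v (E.ι x) = 0) ∧ ∀ x ∈ σ, 0 ≤ inner ℝ v (E.ι x)

/-- The Euclidean normal vector of `σ` relative to a facet `τ`. -/
def normal (σ τ : Set X) : N := Classical.epsilon (E.IsNormal σ τ)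

/-- A linear form on `N` that represents on the cone `σ` a function `φ` which is linear on `σ`. -/
def linearPart (φ : X → ℝ) (σ : Set X) : Module.Dual ℝ N :=
  Classical.epsilon (fun ℓ => ∀ x ∈ σ, φ x = ℓ (E.ι x))

open Classical in
/-- `c` is a `k`-dimensional Euclidean Minkowski weight on `P`: it vanishes outside `P(k)`, and
it satisfies the balancing condition at each cone of dimension `k - 1`. -/
def IsMinkowski (P : ConicalComplex X) (k : ℕ) (c : Set X → ℝ) : Prop :=
  (∀ σ, σ ∉ P.conesOfDim k → c σ = 0) ∧
  ∀ τ ∈ P.cones, P.dim τ + 1 = k →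
    ∑ σ ∈ (P.conesOfDim k).filter (fun σ => P.Face τ σ), c σ • E.normal σ τ = 0

/-- The Minkowski weights `c` on `P` and `c'` on `P'` define the same tropical cycle: their
pull-backs to some common subdivision agree. -/
def SameCycle (P : ConicalComplex X) (c : Set X → ℝ) (P' : ConicalComplex X) (c' : Set X → ℝ) : Prop :=
  ∃ Q ∈ E.R, Q.IsSubdivision P ∧ Q.IsSubdivision P' ∧ P.pullback Q c = P'.pullback Q c'

open Classical in
/-- The tropical intersection product `φ · c` on `P`,
`(φ · c)(τ) = ∑_{σ ≻ τ} -φ_σ(v̂_{σ/τ}) c(σ)`, the sum being over the cones `σ` having `τ` as a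
face of codimension one. -/
def inter (P : ConicalComplex X) (φ : X → ℝ) (c : Set X → ℝ) (τ : Set X) : ℝ :=
  ∑ σ ∈ P.cones.filter (fun σ => P.Face τ σ ∧ P.dim σ = P.dim τ + 1),
    -(E.linearPart φ σ (E.normal σ τ)) * c σ

/-- The space `PL(X)` of piecewise linear functions. -/
def PL : Set (X → ℝ) := {φ | ∃ P ∈ E.R, P.LinearOn φ}

/-- The space `Conic(X)` of conical functions: `ψ (t x) = t ψ(x)` for `t ≥ 0`. Here `y = t x`
means that `y` lies in a cone `σ` containing `x` and that `y` is `t` times `x` in `N^σ`. -/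
def conic : Set (X → ℝ) :=
  {ψ | ∀ σ ∈ E.base.cones, ∀ x y : σ, ∀ t : ℝ, 0 ≤ t →
    evalMap (E.base.M σ) y = t • evalMap (E.base.M σ) x → ψ y = t * ψ x}

/-- The unit sphere `𝕊^X` of `X`. -/
def sphere : Set X := {x | ‖E.ι x‖ = 1}

open Classical in
/-- The value of `f : 𝕊^X → ℝ` at the unit vector of the ray `ρ`. -/
def evalRay (f : E.sphere → ℝ) (ρ : Set X) : ℝ :=
  if h : ∃ x : E.sphere, (x : X) ∈ ρ then f h.choose else 0

end EuclideanConicalSpace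

/-- A balanced Euclidean conical space of pure dimension `n`. The representative `base` of the
conical structure is taken to be a complex on which the balancing cycle `[X]` is defined by a
weight that is positive on the maximal cones. -/
structure BalancedSpace (X N : Type*) [TopologicalSpace X] [NormedAddCommGroup N]
    [InnerProductSpace ℝ N] (n : ℕ) extends EuclideanConicalSpace X N where
  pureDim : base.PureDim n
  /-- the weight that represents `[X]` -/
  weight : Set X → ℝ
  isMinkowski : toEuclideanConicalSpace.IsMinkowski base n weight
  weight_pos : ∀ σ ∈ base.conesOfDim n, 0 < weight σ

namespace BalancedSpace

variable {X N : Type*} [TopologicalSpace X] [NormedAddCommGroup N] [InnerProductSpace ℝ N]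
variable {n : ℕ} (E : BalancedSpace X N n)

/-- The complex `P` and the weight `z` on it represent the tropical cycle `φ₁ ⋯ φ_r · [X]`: the
functions `φ_i` are defined on `P`, the cycle `[X]` is represented on `P` by a Minkowski
weight `c`, and `z = φ₁ · (φ₂ ⋯ (φ_r · c))`. -/
def Represents (φs : List (X → ℝ)) (P : ConicalComplex X) (z : Set X → ℝ) : Prop :=
  P ∈ E.R ∧ (∀ φ ∈ φs, P.LinearOn φ) ∧
    ∃ c : Set X → ℝ, E.IsMinkowski P n c ∧ E.SameCycle P c E.base E.weight ∧
      z = φs.foldr (E.inter P) c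

/-- The tropical cycle `φ₁ ⋯ φ_r · [X]` is positive. -/
def IsPositive (φs : List (X → ℝ)) : Prop :=
  ∃ P z, E.Represents φs P z ∧ ∀ σ, 0 ≤ z σ

/-- The degree of the zero cycle `φ₁ ⋯ φ_n · [X]`, computed on any complex where
this cycle is represented. -/
def deg (φ : Fin n → X → ℝ) : ℝ :=
  Classical.epsilon (fun d => ∃ P z, E.Represents (List.ofFn φ) P z ∧ d = P.degree z)

/-- The discrete measure `μ_z = ∑_ρ z(ρ) δ_{v̂_ρ}` on `𝕊^X` of the one-dimensional cycle
`z = φ₁ ⋯ φ_{n-1} · [X]`, as the linear form `f ↦ ∫ f dμ_z = ∑_ρ z(ρ) f(v̂_ρ)` on `C⁰(𝕊^X)`,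
computed on any complex where this cycle is represented. With the sign of the product above,
`φ · z` has degree `-∫ φ dμ_z`. -/
def discreteMeasure (φs : List (X → ℝ)) (f : C(E.sphere, ℝ)) : ℝ :=
  Classical.epsilon (fun I => ∃ P z, E.Represents φs P z ∧
    I = ∑ ρ ∈ P.conesOfDim 1, z ρ * E.evalRay f ρ)

/-- An admissible family of concave functions on `X`. -/
structure AdmissibleFamily where
  /-- the functions of the family -/
  carrier : Set (X → ℝ)
  subset_PL : carrier ⊆ E.PL
  isPositive : ∀ φs : List (X → ℝ), φs.length ≤ n → (∀ φ ∈ φs, φ ∈ carrier) → E.IsPositive φs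
  add_mem : ∀ φ ∈ carrier, ∀ φ' ∈ carrier, φ + φ' ∈ carrier
  smul_mem : ∀ t : ℝ, 0 < t → ∀ φ ∈ carrier, t • φ ∈ carrier
  dense : Dense {f : C(E.sphere, ℝ) | ∃ φ ∈ carrier, ∃ φ' ∈ carrier,
    ∀ x : E.sphere, f x = φ x - φ' x}

namespace AdmissibleFamily

variable {E} (C : E.AdmissibleFamily)

theorem nonempty : C.carrier.Nonempty := by
  obtain ⟨f, φ, hφ, -⟩ := C.dense.nonempty
  exact ⟨φ, hφ⟩

theorem zero_mem_closure : (0 : X → ℝ) ∈ closure C.carrier := by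
  obtain ⟨φ, hφ⟩ := C.nonempty
  have h : Tendsto (fun t : ℝ => t • φ) (𝓝[>] 0) (𝓝 (0 : X → ℝ)) := by
    have h0 : Tendsto (fun t : ℝ => t • φ) (𝓝 0) (𝓝 ((0 : ℝ) • φ)) :=
      (continuous_id.smul continuous_const).tendsto 0
    rw [zero_smul] at h0
    exact h0.mono_left nhdsWithin_le_nhds
  refine mem_closure_of_tendsto h ?_
  filter_upwards [self_mem_nhdsWithin] with t ht using C.smul_mem t ht φ hφ

/-- The space `Conic(X)_C` of `C`-concave functions on `X`, the closure of the family in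
`Conic(X)` for pointwise convergence. It is a convex cone. -/
def concave : Submodule ℝ≥0 (X → ℝ) where
  carrier := E.conic ∩ closure C.carrier
  zero_mem' := by
    refine ⟨?_, C.zero_mem_closure⟩
    intro σ _ x y t _ _
    simp
  add_mem' := by
    rintro ψ ψ' ⟨h1, h2⟩ ⟨h1', h2'⟩
    refine ⟨?_, map_mem_closure₂ continuous_add h2 h2' C.add_mem⟩
    intro σ hσ x y t ht h
    simp only [Pi.add_apply, h1 σ hσ x y t ht h, h1' σ hσ x y t ht h]
    ring
  smul_mem' := by
    rintro s ψ ⟨h1, h2⟩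
    refine ⟨?_, ?_⟩
    · intro σ hσ x y t ht h
      simp only [Pi.smul_apply, NNReal.smul_def, smul_eq_mul, h1 σ hσ x y t ht h]
      ring
    · rcases eq_or_ne s 0 with rfl | hs
      · rw [zero_smul]
        exact C.zero_mem_closure
      · refine map_mem_closure (f := fun φ : X → ℝ => s • φ) (continuous_const_smul s) h2 ?_
        intro φ hφ
        exact C.smul_mem (s : ℝ) (by exact_mod_cast pos_iff_ne_zero.mpr hs) φ hφ

variable [MeasurableSpace X]

/-- `μ` is the Monge--Ampère measure `μ_ψ` of the `C`-concave function `ψ`: the value at `ψ` of the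
extension by continuity, from the family to `Conic(X)_C`, of the operator that sends `φ` to the
discrete Monge--Ampère measure of `φ^{n-1} · [X]`. Measures carry the weak topology. -/
def IsMongeAmpere (ψ : C.concave) (μ : FiniteMeasure E.sphere) : Prop :=
  ∀ f : C(E.sphere, ℝ),
    Tendsto (fun φ : X → ℝ => E.discreteMeasure (List.replicate (n - 1) φ) f)
      (𝓝[C.carrier] (ψ : X → ℝ)) (𝓝 (∫ x, f x ∂(μ : Measure E.sphere)))

/-- `mu` is the mixed Monge--Ampère measure: it is symmetric, and it gives the coefficients of
`μ_{λ₁ψ₁ + ⋯ + λ_ℓψ_ℓ}` as a polynomial in the nonnegative numbers `λ₁, …, λ_ℓ`. -/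
def IsMixedMongeAmpere (mu : (Fin (n - 1) → C.concave) → FiniteMeasure E.sphere) : Prop :=
  (∀ (e : Equiv.Perm (Fin (n - 1))) (ψ : Fin (n - 1) → C.concave), mu (ψ ∘ e) = mu ψ) ∧
  ∀ (l : ℕ) (c : Fin l → ℝ≥0) (ψ : Fin l → C.concave),
    C.IsMongeAmpere (∑ i, c i • ψ i)
      (∑ I : Fin (n - 1) → Fin l, (∏ k, c (I k)) • mu (ψ ∘ I))

end AdmissibleFamily

end BalancedSpace

end Conical

end

/-! The measures are obtained as weak limits, and everything rests on two facts: for functions of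
the family, pointwise convergence is uniform on the sphere, and the masses of the discrete measures
of uniformly bounded functions are bounded.

The tropical algebra comes first. Every complex in the class embeds conewise in `N`, and finitely
many of them have a common subdivision, obtained by cutting with hyperplanes (`exists_common`). The
product commutes with pull-back to subdivisions (`inter_pullback`) and is commutative
(`inter_comm`), because the contribution of a cone above a face of codimension two is symmetric in
the two functions. Hence degrees and discrete measures can be computed on any sufficiently fine
complex. Since the degree of `φ · z` is minus the integral of `φ` against the measure of `z`
(`degree_inter`), the integrand can be exchanged with any factor of the measure
(`discreteMeasure_cons_comm`); this is integration by parts.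

Uniform convergence uses only that `φ · [X]` is positive. Multiplying `[X]` by functions `min 0 ℓ`
preserves positivity and, near a chosen maximal cone, cuts `[X]` down to a plane slice through a
point `x`. By commutativity the product of `φ` with the slice is still positive: the weighted sum of
the slopes of `φ` at `x`, in the directions of the slice, is nonpositive. Inside a maximal cone
there are only two such directions, with equal weights, so `φ` is concave there, and superadditive
by homogeneity (`onCone_add_le`). At an arbitrary `x ≠ 0`, superadditivity bounds all slopes from
below, and the inequality then bounds each slope along the cone from above. This gives a Lipschitz
estimate at `x` whose constant depends only on a global bound for `φ` (`exists_lipschitz_at`), and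
such a bound follows from finitely many values of `φ` (`exists_bound`). So the functions of the
family that are pointwise close to `ψ` are equicontinuous on the compact sphere, where pointwise
convergence becomes uniform (`tendstoUniformly_of_positive`).

For the masses, density provides `γ, γ'` in the family with `γ - γ' ≥ 1` on the sphere. The mass is
at most the integral of `γ - γ'`; exchanging a bounded factor with `γ` and `γ'` lowers the number of
free factors, and induction concludes (`exists_mass_bound`). Replacing factors one at a time in the
same way shows that integrals of functions of the family depend continuously on the factors
(`abs_sub_le_of_close`). By density, the integrals of every continuous function are Cauchy, and the
Riesz theorem turns the limit into a measure.

The limit is taken for tuples from the start, so the mixed measure is built first. Symmetry and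
multilinearity pass to the limit, and the Monge–Ampère measure is the diagonal value. Uniqueness of
the mixed measure is polarization (`apply_id_eq_zero_of_symmetric`). Finally the degree of a tuple
is minus the integral of any one factor against the measure of the others; uniform convergence and
bounded mass carry this formula to the limit (`tendsto_deg`), which also gives the symmetry of the
integrals. -/

noncomputable section

set_option linter.unusedSectionVars false

namespace Conical

/-! ### Polyhedral cones in a Euclidean space -/

section PolyhedralCones

variable {N : Type*} [NormedAddCommGroup N] [InnerProductSpace ℝ N]

/-- A finitely generated cone. -/
def IsPolyCone (K : Set N) : Prop := ∃ s : Finset N, K = (PointedCone.hull ℝ (s : Set N) : Set N)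

/-- The relative interior of a cone, described by duality: the points at which a nonnegative linear
form vanishes only if it vanishes on the whole cone. -/
def relint (K : Set N) : Set N :=
  {p | p ∈ K ∧ ∀ ℓ : Module.Dual ℝ N, (∀ y ∈ K, 0 ≤ ℓ y) → ℓ p = 0 → ∀ y ∈ K, ℓ y = 0}

theorem relint_subset {K : Set N} : relint K ⊆ K := fun _ h => h.1

/-- Finitely many lower bounds and upper bounds that are compatible can be separated. -/
theorem exists_between_finset {α β : Type*} (A : Finset α) (B : Finset β) (a : α → ℝ) (b : β → ℝ)
    (h : ∀ i ∈ A, ∀ j ∈ B, a i ≤ b j) : ∃ t : ℝ, (∀ i ∈ A, a i ≤ t) ∧ ∀ j ∈ B, t ≤ b j := by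
  rcases A.eq_empty_or_nonempty with rfl | hA
  · rcases B.eq_empty_or_nonempty with rfl | hB
    · exact ⟨0, by simp, by simp⟩
    · exact ⟨B.inf' hB b, by simp, fun j hj => Finset.inf'_le _ hj⟩
  · exact ⟨A.sup' hA a, fun i hi => Finset.le_sup' _ hi,
      fun j hj => Finset.sup'_le _ _ fun i hi => h i hi j hj⟩

/-- Supplies constants that are uniform over finitely many linear forms or cones. If all values
vanish, any positive constant does. -/
theorem exists_pos_le_of_ne_zero {α : Type*} (L : Finset α) (f : α → ℝ) (hf : ∀ i ∈ L, 0 ≤ f i) :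
    ∃ c > (0 : ℝ), ∀ i ∈ L, f i ≠ 0 → c ≤ f i := by
  classical
  rcases (L.filter fun i => f i ≠ 0).eq_empty_or_nonempty with h | h
  · exact ⟨1, one_pos, fun i hi h0 => absurd (Finset.mem_filter.2 ⟨hi, h0⟩) (by rw [h]; simp)⟩
  · refine ⟨_, (Finset.lt_inf'_iff h (f := f)).2 fun i hi => ?_,
      fun i hi h0 => Finset.inf'_le _ (Finset.mem_filter.2 ⟨hi, h0⟩)⟩
    obtain ⟨h1, h2⟩ := Finset.mem_filter.1 hi
    exact lt_of_le_of_ne (hf i h1) (Ne.symm h2)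

theorem _root_.Finset.sum_trichotomy {α G : Type*} [AddCommMonoid G] (s : Finset α) (h : α → ℝ)
    (f : α → G) : ∑ v ∈ s, f v = ∑ v ∈ s with 0 < h v, f v + ∑ v ∈ s with h v = 0, f v +
      ∑ v ∈ s with h v < 0, f v := by
  classical
  rw [← Finset.sum_filter_add_sum_filter_not s (fun v => 0 < h v),
    ← Finset.sum_filter_add_sum_filter_not (s.filter fun v => ¬ 0 < h v) (fun v => h v = 0),
    Finset.filter_filter, Finset.filter_filter, add_assoc]
  congr 2
  · exact Finset.sum_congr (Finset.filter_congr fun v _ => by grind) fun _ _ => rfl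
  · exact Finset.sum_congr (Finset.filter_congr fun v _ => by grind) fun _ _ => rfl

namespace IsPolyCone

variable {K : Set N}

theorem zero_mem (hK : IsPolyCone K) : (0 : N) ∈ K := by
  obtain ⟨s, rfl⟩ := hK
  exact Submodule.zero_mem _

theorem add_mem (hK : IsPolyCone K) {x y : N} (hx : x ∈ K) (hy : y ∈ K) : x + y ∈ K := by
  obtain ⟨s, rfl⟩ := hK
  exact Submodule.add_mem _ hx hy

theorem smul_mem (hK : IsPolyCone K) {x : N} {t : ℝ} (ht : 0 ≤ t) (hx : x ∈ K) : t • x ∈ K := by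
  obtain ⟨s, rfl⟩ := hK
  exact PointedCone.smul_mem _ ht hx

theorem convex (hK : IsPolyCone K) : Convex ℝ K := by
  obtain ⟨s, rfl⟩ := hK
  exact PointedCone.convex _

theorem sum_mem (hK : IsPolyCone K) {α : Type*} (s : Finset α) (f : α → N) (h : ∀ i ∈ s, f i ∈ K) :
    ∑ i ∈ s, f i ∈ K := by
  obtain ⟨s, rfl⟩ := hK
  exact Submodule.sum_mem _ h

/-- A polyhedral cone is the set of nonnegative combinations of finitely many of its points. -/
theorem exists_generators (hK : IsPolyCone K) : ∃ s : Finset N, (∀ v ∈ s, v ∈ K) ∧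
    ∀ x, x ∈ K ↔ ∃ a : N → ℝ, (∀ v, 0 ≤ a v) ∧ x = ∑ v ∈ s, a v • v := by
  obtain ⟨s, hs⟩ := id hK
  have hsK : ∀ v ∈ s, v ∈ K := fun v hv => hs ▸ PointedCone.subset_hull (by exact_mod_cast hv)
  refine ⟨s, hsK, fun x => ⟨fun hx => ?_, ?_⟩⟩
  · rw [hs] at hx
    obtain ⟨f, -, hf⟩ := Submodule.mem_span_finset.1 hx
    exact ⟨fun v => (f v : ℝ), fun v => (f v).2, hf.symm⟩
  · rintro ⟨a, ha, rfl⟩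
    exact hK.sum_mem _ _ fun v hv => hK.smul_mem (ha v) (hsK v hv)

/-- The intersection of a polyhedral cone with a half-space is polyhedral. -/
theorem inter_halfSpace (hK : IsPolyCone K) (h : Module.Dual ℝ N) :
    IsPolyCone (K ∩ {v | 0 ≤ h v}) := by
  classical
  obtain ⟨s, hs, hK'⟩ := hK.exists_generators
  let P := s.filter fun v => 0 < h v
  let Z := s.filter fun v => h v = 0
  let M := s.filter fun v => h v < 0
  -- `g (v, w)` is the positive combination of a generator on each side of the hyperplane that falls
  -- on the hyperplane. Together with the generators on the nonnegative side these generate the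
  -- intersection.
  let g : N × N → N := fun q => h q.1 • q.2 - h q.2 • q.1
  let S : Finset N := (P ∪ Z) ∪ (P ×ˢ M).image g
  refine ⟨S, Set.Subset.antisymm ?_ ?_⟩
  · rintro x ⟨hx, hhx⟩
    obtain ⟨a, ha, rfl⟩ := (hK' x).1 hx
    set A := ∑ v ∈ P, a v * h v with hA
    set B := ∑ v ∈ M, a v * -h v with hB
    have hAP : ∀ v ∈ P, 0 ≤ a v * h v := fun v hv =>
      mul_nonneg (ha v) (Finset.mem_filter.1 hv).2.le
    have hBM : ∀ v ∈ M, 0 ≤ a v * -h v := fun v hv =>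
      mul_nonneg (ha v) (by linarith [(Finset.mem_filter.1 hv).2])
    have hA0 : 0 ≤ A := Finset.sum_nonneg hAP
    have hB0 : 0 ≤ B := Finset.sum_nonneg hBM
    have hAB : B ≤ A := by
      have h1 : h (∑ v ∈ s, a v • v) = A - B := by
        rw [map_sum, Finset.sum_trichotomy s h, hA, hB]
        have : ∑ v ∈ Z, h (a v • v) = 0 := Finset.sum_eq_zero fun v hv => by
          rw [map_smul, (Finset.mem_filter.1 hv).2, smul_zero]
        rw [this]
        simp only [map_smul, smul_eq_mul, mul_neg, Finset.sum_neg_distrib]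
        ring
      have h2 : 0 ≤ h (∑ v ∈ s, a v • v) := hhx
      linarith
    have memS : ∀ v, v ∈ S → v ∈ PointedCone.hull ℝ (S : Set N) := fun v hv =>
      PointedCone.subset_hull (by exact_mod_cast hv)
    have memP : ∀ v ∈ P, v ∈ PointedCone.hull ℝ (S : Set N) := fun v hv => memS v <| by
      simp only [S, Finset.mem_union]; tauto
    have memZ : ∀ v ∈ Z, v ∈ PointedCone.hull ℝ (S : Set N) := fun v hv => memS v <| by
      simp only [S, Finset.mem_union]; tauto
    have memg : ∀ v ∈ P, ∀ w ∈ M, g (v, w) ∈ PointedCone.hull ℝ (S : Set N) := fun v hv w hw =>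
      memS _ <| by
        simp only [S, Finset.mem_union]
        exact Or.inr (Finset.mem_image_of_mem _ (Finset.mem_product.2 ⟨hv, hw⟩))
    rcases hA0.eq_or_lt with hA1 | hA1
    · have hBz : ∑ v ∈ M, a v • v = 0 := Finset.sum_eq_zero fun v hv => by
        have := (Finset.sum_eq_zero_iff_of_nonneg hBM).1 (by linarith : B = 0) v hv
        have h3 := (Finset.mem_filter.1 hv).2
        have : a v = 0 := by
          rcases mul_eq_zero.1 this with h4 | h4
          · exact h4
          · linarith
        rw [this, zero_smul]
      change _ ∈ PointedCone.hull ℝ (S : Set N)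
      rw [Finset.sum_trichotomy s h, hBz, add_zero]
      exact Submodule.add_mem _
        (Submodule.sum_mem _ fun v hv => PointedCone.smul_mem _ (ha v) (memP v hv))
        (Submodule.sum_mem _ fun v hv => PointedCone.smul_mem _ (ha v) (memZ v hv))
    -- The total height `A` of the positive part outweighs the depth `B` of the negative part: each
    -- positive generator spends the fraction `B / A` of its coefficient to lift the negative ones
    -- onto the hyperplane, which are shared out in proportion to `a v * h v`.
    · have key : ∑ v ∈ s, a v • v = ∑ v ∈ P, ((1 - B / A) * a v) • v + ∑ v ∈ Z, a v • v +
          ∑ v ∈ P, ∑ w ∈ M, (a v * a w / A) • g (v, w) := by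
        rw [Finset.sum_trichotomy s h]
        have e1 : ∑ v ∈ P, ∑ w ∈ M, (a v * a w / A) • g (v, w) =
            ∑ w ∈ M, a w • w + ∑ v ∈ P, (B / A * a v) • v := by
          have : ∀ v ∈ P, ∑ w ∈ M, (a v * a w / A) • g (v, w) =
              (a v * h v / A) • ∑ w ∈ M, a w • w + (B / A * a v) • v := by
            intro v _
            have e2 : (B / A * a v) • v = ∑ w ∈ M, (a w * -h w * (a v / A)) • v := by
              rw [← Finset.sum_smul, ← Finset.sum_mul, ← hB]
              congr 1; ring
            rw [e2, Finset.smul_sum, ← Finset.sum_add_distrib]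
            refine Finset.sum_congr rfl fun w _ => ?_
            simp only [g]
            module
          rw [Finset.sum_congr rfl this, Finset.sum_add_distrib, ← Finset.sum_smul,
            ← Finset.sum_div, ← hA, div_self hA1.ne', one_smul]
        rw [e1]
        have e3 : ∑ v ∈ P, a v • v = ∑ v ∈ P, ((1 - B / A) * a v) • v +
            ∑ v ∈ P, (B / A * a v) • v := by
          rw [← Finset.sum_add_distrib]
          exact Finset.sum_congr rfl fun v _ => by module
        rw [e3]; abel
      change _ ∈ PointedCone.hull ℝ (S : Set N)
      rw [key]
      have h1 : 0 ≤ 1 - B / A := by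
        rw [sub_nonneg, div_le_one hA1]; exact hAB
      refine Submodule.add_mem _ (Submodule.add_mem _ ?_ ?_) ?_
      · exact Submodule.sum_mem _ fun v hv =>
          PointedCone.smul_mem _ (mul_nonneg h1 (ha v)) (memP v hv)
      · exact Submodule.sum_mem _ fun v hv => PointedCone.smul_mem _ (ha v) (memZ v hv)
      · exact Submodule.sum_mem _ fun v hv => Submodule.sum_mem _ fun w hw =>
          PointedCone.smul_mem _ (div_nonneg (mul_nonneg (ha v) (ha w)) hA1.le) (memg v hv w hw)
  · have hT : (PointedCone.hull ℝ (S : Set N) : Set N) ⊆ K ∩ {v | 0 ≤ h v} := by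
      obtain ⟨s0, rfl⟩ := hK
      have : PointedCone.hull ℝ (S : Set N) ≤
          PointedCone.hull ℝ (s0 : Set N) ⊓ (PointedCone.positive ℝ ℝ).comap h := by
        refine Submodule.span_le.2 fun v hv => ?_
        simp only [S, Finset.coe_union, Set.mem_union, Finset.mem_coe] at hv
        rcases hv with (hv | hv) | hv
        · exact ⟨hs v (Finset.mem_filter.1 hv).1, (Finset.mem_filter.1 hv).2.le⟩
        · exact ⟨hs v (Finset.mem_filter.1 hv).1, (Finset.mem_filter.1 hv).2.ge⟩
        · obtain ⟨⟨v, w⟩, hvw, rfl⟩ := Finset.mem_image.1 hv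
          obtain ⟨h1, h2⟩ := Finset.mem_product.1 hvw
          obtain ⟨h1, h1'⟩ := Finset.mem_filter.1 h1
          obtain ⟨h2, h2'⟩ := Finset.mem_filter.1 h2
          dsimp only at h1 h2 h1' h2'
          refine ⟨?_, ?_⟩
          · have : g (v, w) = h v • w + (-h w) • v := by simp only [g]; module
            change g (v, w) ∈ PointedCone.hull ℝ (s0 : Set N)
            rw [this]
            exact Submodule.add_mem _ (PointedCone.smul_mem _ h1'.le (hs w h2))
              (PointedCone.smul_mem _ (by linarith) (hs v h1))
          · change 0 ≤ h (g (v, w))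
            simp only [g, map_sub, map_smul, smul_eq_mul]
            apply le_of_eq; ring
      exact fun v hv => this hv
    exact hT

/-- Every polyhedral cone is a finite intersection of half-spaces. -/
theorem exists_halfSpaces [FiniteDimensional ℝ N] (hK : IsPolyCone K) :
    ∃ L : Finset (Module.Dual ℝ N), ∀ v, v ∈ K ↔ ∀ ℓ ∈ L, 0 ≤ ℓ v := by
  classical
  obtain ⟨s, rfl⟩ := hK
  induction s using Finset.induction_on with
  | empty =>
    let b := Module.finBasis ℝ N
    refine ⟨Finset.univ.image b.coord ∪ Finset.univ.image (fun i => -b.coord i), fun v => ?_⟩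
    simp only [Finset.coe_empty, PointedCone.hull, Submodule.span_empty, SetLike.mem_coe,
      Submodule.mem_bot]
    constructor
    · rintro rfl; simp
    · intro h
      refine b.ext_elem fun i => ?_
      have h1 := h (b.coord i) (by simp)
      have h2 := h (-b.coord i) (by simp)
      simp only [LinearMap.neg_apply, Module.Basis.coord_apply] at h1 h2
      simp only [map_zero, Finsupp.coe_zero, Pi.zero_apply]
      linarith
  | insert w s _ ih =>
    obtain ⟨L, hL⟩ := ih
    -- Fourier–Motzkin elimination of `t ≥ 0` from the condition that `v - t • w` lie in the smaller
    -- cone: forms positive at `w` bound `t` from above, forms negative at `w` from below, and each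
    -- new form says that one pair of bounds is compatible.
    let P := L.filter fun ℓ => 0 < ℓ w
    let M := L.filter fun ℓ => ℓ w < 0
    refine ⟨L.filter (fun ℓ => 0 ≤ ℓ w) ∪ (P ×ˢ M).image (fun q => q.1 w • q.2 - q.2 w • q.1),
      fun v => ?_⟩
    have hv : v ∈ (PointedCone.hull ℝ ((insert w s : Finset N) : Set N) : Set N) ↔
        ∃ t : ℝ, 0 ≤ t ∧ ∀ ℓ ∈ L, 0 ≤ ℓ (v - t • w) := by
      simp only [PointedCone.hull, Finset.coe_insert, SetLike.mem_coe, Submodule.mem_span_insert]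
      constructor
      · rintro ⟨t, z, hz, rfl⟩
        refine ⟨t, t.2, fun ℓ hℓ => ?_⟩
        have : t • w + z - (t : ℝ) • w = z := by simp
        rw [this]; exact (hL z).1 hz ℓ hℓ
      · rintro ⟨t, ht, h⟩
        exact ⟨⟨t, ht⟩, v - t • w, (hL _).2 h, by simp⟩
    rw [hv]
    constructor
    · rintro ⟨t, ht, h⟩ ℓ hℓ
      rcases Finset.mem_union.1 hℓ with hℓ | hℓ
      · obtain ⟨h1, h2⟩ := Finset.mem_filter.1 hℓ
        have := h ℓ h1
        rw [map_sub, map_smul, smul_eq_mul] at this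
        nlinarith
      · obtain ⟨⟨p, q⟩, hpq, rfl⟩ := Finset.mem_image.1 hℓ
        obtain ⟨hp, hq⟩ := Finset.mem_product.1 hpq
        obtain ⟨hp, hp'⟩ := Finset.mem_filter.1 hp
        obtain ⟨hq, hq'⟩ := Finset.mem_filter.1 hq
        dsimp only at hp hq hp' hq' ⊢
        have h1 := h p hp
        have h2 := h q hq
        simp only [map_sub, map_smul, smul_eq_mul, LinearMap.sub_apply, LinearMap.smul_apply]
          at h1 h2 ⊢
        nlinarith [mul_nonneg hp'.le h2, mul_nonneg (neg_nonneg.2 hq'.le) h1]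
    · intro h
      -- `none` stands for the lower bound `0 ≤ t`.
      obtain ⟨t, ht1, ht2⟩ := exists_between_finset (Finset.insertNone M) P
        (fun q => q.elim 0 fun q => q v / q w) (fun p => p v / p w) (by
          intro q hq p hp
          obtain ⟨hp, hp'⟩ := Finset.mem_filter.1 hp
          cases q with
          | none =>
            exact div_nonneg (h p (Finset.mem_union_left _ (Finset.mem_filter.2 ⟨hp, hp'.le⟩)))
              hp'.le
          | some q =>
            rw [Finset.some_mem_insertNone] at hq
            have hq0 := (Finset.mem_filter.1 hq).2
            have := h (p w • q - q w • p) (Finset.mem_union_right _ (Finset.mem_image.2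
              ⟨(p, q), Finset.mem_product.2 ⟨Finset.mem_filter.2 ⟨hp, hp'⟩, hq⟩, rfl⟩))
            simp only [LinearMap.sub_apply, LinearMap.smul_apply, smul_eq_mul] at this
            change q v / q w ≤ p v / p w
            rw [div_le_iff_of_neg hq0, div_mul_eq_mul_div, div_le_iff₀ hp']
            linarith)
      refine ⟨t, ht1 none (by simp), fun ℓ hℓ => ?_⟩
      rw [map_sub, map_smul, smul_eq_mul]
      rcases lt_trichotomy (ℓ w) 0 with h0 | h0 | h0
      · have := ht1 (some ℓ) (by simp [M, hℓ, h0])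
        change ℓ v / ℓ w ≤ t at this
        rw [div_le_iff_of_neg h0] at this
        linarith
      · have := h ℓ (Finset.mem_union_left _ (Finset.mem_filter.2 ⟨hℓ, h0.ge⟩))
        rw [h0]; linarith
      · have := ht2 ℓ (by simp [P, hℓ, h0])
        rw [le_div_iff₀ h0] at this
        linarith

/-- The sum of the generators works: a nonnegative form that vanishes on it vanishes on every
generator. -/
theorem relint_nonempty (hK : IsPolyCone K) : (relint K).Nonempty := by
  obtain ⟨s, hs, hK'⟩ := hK.exists_generators
  refine ⟨∑ v ∈ s, v, hK.sum_mem _ _ hs, fun ℓ hℓ h0 y hy => ?_⟩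
  obtain ⟨a, -, rfl⟩ := (hK' y).1 hy
  rw [map_sum] at h0 ⊢
  have := (Finset.sum_eq_zero_iff_of_nonneg fun v hv => hℓ v (hs v hv)).1 h0
  exact Finset.sum_eq_zero fun v hv => by rw [map_smul, this v hv, smul_zero]

theorem add_mem_relint (hK : IsPolyCone K) {p y : N} (hp : p ∈ relint K) (hy : y ∈ K) :
    p + y ∈ relint K := by
  refine ⟨hK.add_mem hp.1 hy, fun ℓ hℓ h0 => hp.2 ℓ hℓ ?_⟩
  rw [map_add] at h0
  linarith [hℓ p hp.1, hℓ y hy]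

theorem smul_mem_relint (hK : IsPolyCone K) {p : N} (hp : p ∈ relint K) {t : ℝ} (ht : 0 < t) :
    t • p ∈ relint K := by
  refine ⟨hK.smul_mem ht.le hp.1, fun ℓ hℓ h0 => hp.2 ℓ hℓ ?_⟩
  rw [map_smul, smul_eq_mul, mul_eq_zero] at h0
  exact h0.resolve_left ht.ne'

theorem exists_bound [FiniteDimensional ℝ N] (L : Finset (Module.Dual ℝ N)) :
    ∃ C : ℝ, 0 < C ∧ ∀ ℓ ∈ L, ∀ v, |ℓ v| ≤ C * ‖v‖ := by
  refine ⟨1 + ∑ ℓ ∈ L, ‖LinearMap.toContinuousLinearMap ℓ‖, by positivity, fun ℓ hℓ v => ?_⟩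
  have h1 := (LinearMap.toContinuousLinearMap ℓ).le_opNorm v
  have h2 := Finset.single_le_sum (f := fun ℓ => ‖LinearMap.toContinuousLinearMap ℓ‖)
    (fun _ _ => norm_nonneg _) hℓ
  simp only [LinearMap.coe_toContinuousLinearMap', Real.norm_eq_abs] at h1 h2
  refine h1.trans (mul_le_mul_of_nonneg_right ?_ (norm_nonneg _))
  linarith

theorem eq_zero_of_mem_span {ℓ : Module.Dual ℝ N} (h : ∀ y ∈ K, ℓ y = 0) {q : N}
    (hq : q ∈ Submodule.span ℝ K) : ℓ q = 0 := by
  have : Submodule.span ℝ K ≤ LinearMap.ker ℓ := Submodule.span_le.2 fun y hy => h y hy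
  exact this hq

theorem eq_of_mem_span {ℓ ℓ' : Module.Dual ℝ N} (h : ∀ y ∈ K, ℓ y = ℓ' y) {q : N}
    (hq : q ∈ Submodule.span ℝ K) : ℓ q = ℓ' q := by
  have : Submodule.span ℝ K ≤ LinearMap.eqLocus ℓ ℓ' := Submodule.span_le.2 fun y hy => h y hy
  exact this hq

/-- A point of the relative interior has a neighbourhood in the linear span that is contained
in the cone. -/
theorem exists_ball [FiniteDimensional ℝ N] (hK : IsPolyCone K) {p : N} (hp : p ∈ relint K) :
    ∃ η : ℝ, 0 < η ∧ ∀ q ∈ Submodule.span ℝ K, ‖q‖ ≤ η → p + q ∈ K := by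
  classical
  obtain ⟨L, hL⟩ := hK.exists_halfSpaces
  obtain ⟨C, hC, hCL⟩ := exists_bound L
  obtain ⟨c, hc, hcL⟩ := exists_pos_le_of_ne_zero L (fun ℓ => ℓ p) fun ℓ hℓ => (hL p).1 hp.1 ℓ hℓ
  refine ⟨c / C, by positivity, fun q hq hqn => (hL _).2 fun ℓ hℓ => ?_⟩
  rw [map_add]
  by_cases h0 : ℓ p = 0
  · rw [h0, eq_zero_of_mem_span (hp.2 ℓ (fun y hy => (hL y).1 hy ℓ hℓ) h0) hq, add_zero]
  · have h1 := hCL ℓ hℓ q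
    have h2 : C * ‖q‖ ≤ c := by
      rw [le_div_iff₀ hC] at hqn; linarith
    linarith [hcL ℓ hℓ h0, neg_abs_le (ℓ q)]

theorem exists_add_smul_mem [FiniteDimensional ℝ N] (hK : IsPolyCone K) {p : N}
    (hp : p ∈ relint K) {q : N} (hq : q ∈ Submodule.span ℝ K) :
    ∃ ε : ℝ, 0 < ε ∧ ∀ t : ℝ, |t| ≤ ε → p + t • q ∈ K := by
  obtain ⟨η, hη, h⟩ := hK.exists_ball hp
  refine ⟨η / (‖q‖ + 1), by positivity, fun t ht => h _ (Submodule.smul_mem _ _ hq) ?_⟩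
  rw [norm_smul, Real.norm_eq_abs]
  rw [le_div_iff₀ (by positivity)] at ht
  nlinarith [abs_nonneg t]

/-- Near a point `x` in the relative interior of the face `F` of `K`, all points of `K` that are
near a point `p` of `F` are obtained by adding to a multiple of `p` a small element of `K`. -/
theorem exists_sub_smul_mem [FiniteDimensional ℝ N] (hK : IsPolyCone K) {F : Set N} (hF : F ⊆ K)
    {x : N} (hx : x ∈ relint F) : ∃ c > (0 : ℝ), ∃ r > (0 : ℝ), ∀ p ∈ F, ‖p - x‖ ≤ r → ∀ y ∈ K,
      ∀ δ : ℝ, ‖y - p‖ ≤ c * δ → y - (1 - δ) • p ∈ K := by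
  classical
  obtain ⟨L, hL⟩ := hK.exists_halfSpaces
  obtain ⟨C, hC, hCL⟩ := exists_bound L
  obtain ⟨c, hc, hcL⟩ := exists_pos_le_of_ne_zero L (fun ℓ => ℓ x) fun ℓ hℓ => (hL x).1 (hF hx.1) ℓ hℓ
  refine ⟨c / (2 * C), by positivity, c / (2 * C), by positivity,
    fun p hp hpx y hy δ hδ => (hL _).2 fun ℓ hℓ => ?_⟩
  have hδ0 : 0 ≤ δ := by
    have : 0 ≤ c / (2 * C) * δ := (norm_nonneg _).trans hδ
    exact nonneg_of_mul_nonneg_right this (by positivity)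
  -- A form that vanishes at `x` vanishes on `F`, so subtracting a multiple of `p` does not change
  -- it. Any other form is at least `c / 2` at `p`, and `δ` times this absorbs its value at `y - p`.
  by_cases h0 : ℓ x = 0
  · have := hx.2 ℓ (fun y hy => (hL y).1 (hF hy) ℓ hℓ) h0 p hp
    rw [map_sub, map_smul, this, smul_zero, sub_zero]
    exact (hL y).1 hy ℓ hℓ
  · have e : y - (1 - δ) • p = (y - p) + δ • ((p - x) + x) := by module
    rw [e, map_add, map_smul, map_add, smul_eq_mul]
    have h1 := hCL ℓ hℓ (y - p)
    have h2 := hCL ℓ hℓ (p - x)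
    have h3 := hcL ℓ hℓ h0
    have h4 : C * ‖y - p‖ ≤ c / 2 * δ := by
      calc C * ‖y - p‖ ≤ C * (c / (2 * C) * δ) := by gcongr
        _ = c / 2 * δ := by field_simp
    have h5 : C * ‖p - x‖ ≤ c / 2 := by
      calc C * ‖p - x‖ ≤ C * (c / (2 * C)) := by gcongr
        _ = c / 2 := by field_simp
    have h6 : c / 2 ≤ ℓ (p - x) + ℓ x := by linarith [neg_abs_le (ℓ (p - x))]
    nlinarith [neg_abs_le (ℓ (y - p)), mul_le_mul_of_nonneg_left h6 hδ0]

/-- A linear form that is nonnegative on the part of a polyhedral cone in a half-space is the sum of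
a linear form that is nonnegative on the cone and of a nonnegative multiple of the form defining the
half-space. -/
theorem exists_sub_smul_nonneg (hK : IsPolyCone K) {u h : Module.Dual ℝ N}
    (hu : ∀ v ∈ K, 0 ≤ h v → 0 ≤ u v) : ∃ t : ℝ, 0 ≤ t ∧ ∀ v ∈ K, 0 ≤ u v - t * h v := by
  classical
  obtain ⟨s, hs, hK'⟩ := hK.exists_generators
  -- The number `t` must separate the ratios `u / h` at the generators on the two sides of the
  -- hyperplane; compatibility is tested on the combination of two generators that lies on it.
  obtain ⟨t, ht1, ht2⟩ := exists_between_finset (Finset.insertNone (s.filter fun v => h v < 0))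
    (s.filter fun v => 0 < h v) (fun q => q.elim 0 fun q => u q / h q) (fun p => u p / h p) (by
      intro w hw v hv
      obtain ⟨hv, hv'⟩ := Finset.mem_filter.1 hv
      cases w with
      | none => exact div_nonneg (hu v (hs v hv) hv'.le) hv'.le
      | some w =>
        obtain ⟨hw, hw'⟩ := Finset.mem_filter.1 (Finset.some_mem_insertNone.1 hw)
        have h1 := hu (h v • w + (-h w) • v) (hK.add_mem (hK.smul_mem hv'.le (hs w hw))
          (hK.smul_mem (by linarith) (hs v hv))) (by
            simp only [map_add, map_smul, smul_eq_mul]; apply le_of_eq; ring)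
        simp only [map_add, map_smul, smul_eq_mul] at h1
        change u w / h w ≤ u v / h v
        rw [div_le_iff_of_neg hw', div_mul_eq_mul_div, div_le_iff₀ hv']
        linarith)
  refine ⟨t, ht1 none (by simp), fun v hv => ?_⟩
  obtain ⟨a, ha, rfl⟩ := (hK' v).1 hv
  have e : u (∑ v ∈ s, a v • v) - t * h (∑ v ∈ s, a v • v) =
      ∑ v ∈ s, a v * (u v - t * h v) := by
    simp only [map_sum, map_smul, smul_eq_mul, Finset.mul_sum, ← Finset.sum_sub_distrib]
    exact Finset.sum_congr rfl fun v _ => by ring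
  rw [e]
  refine Finset.sum_nonneg fun v hv => mul_nonneg (ha v) ?_
  rcases lt_trichotomy (h v) 0 with h0 | h0 | h0
  · have := ht1 (some v) (by simp [hv, h0])
    change u v / h v ≤ t at this
    rw [div_le_iff_of_neg h0] at this
    linarith
  · rw [h0, mul_zero, sub_zero]; exact hu v (hs v hv) h0.ge
  · have := ht2 v (by simp [hv, h0])
    rw [le_div_iff₀ h0] at this
    linarith

theorem isClosed [FiniteDimensional ℝ N] (hK : IsPolyCone K) : IsClosed K := by
  obtain ⟨L, hL⟩ := hK.exists_halfSpaces
  have : K = ⋂ ℓ ∈ L, {v | 0 ≤ ℓ v} := by ext v; simp [hL]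
  rw [this]
  exact isClosed_biInter fun ℓ _ =>
    isClosed_le continuous_const (LinearMap.continuous_of_finiteDimensional ℓ)

end IsPolyCone

end PolyhedralCones


/-! ### Cones embedded by a map to a Euclidean space -/

section EmbeddedCones

variable {X N : Type*} [NormedAddCommGroup N] [InnerProductSpace ℝ N]

/-- The set `σ` is closed and is embedded by `ι` as a strictly convex polyhedral cone. -/
structure IsEmbCone [TopologicalSpace X] (ι : X → N) (σ : Set X) : Prop where
  isClosed : IsClosed σ
  isEmbedding : IsEmbedding (fun x : σ => ι x)
  poly : IsPolyCone (ι '' σ)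
  pointed : ∀ v ∈ ι '' σ, -v ∈ ι '' σ → v = 0

/-- `τ` is the zero locus in `σ` of a linear form that is nonnegative on `σ`. -/
def FaceOf (ι : X → N) (τ σ : Set X) : Prop :=
  ∃ ℓ : Module.Dual ℝ N, (∀ x ∈ σ, 0 ≤ ℓ (ι x)) ∧ τ = {x | x ∈ σ ∧ ℓ (ι x) = 0}

/-- The relative interior of `σ`. -/
def ri (ι : X → N) (σ : Set X) : Set X := {x | x ∈ σ ∧ ι x ∈ relint (ι '' σ)}

/-- The linear span of `σ`. -/
def cspan (ι : X → N) (σ : Set X) : Submodule ℝ N := Submodule.span ℝ (ι '' σ)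

/-- The dimension of `σ`. -/
def cdim (ι : X → N) (σ : Set X) : ℕ := Module.finrank ℝ (cspan ι σ)

variable {ι : X → N} {σ τ ρ : Set X}

theorem mem_cspan {x : X} (hx : x ∈ σ) : ι x ∈ cspan ι σ :=
  Submodule.subset_span (mem_image_of_mem _ hx)

theorem cspan_mono (h : τ ⊆ σ) : cspan ι τ ≤ cspan ι σ := Submodule.span_mono (image_mono h)

theorem eq_of_mem_cspan {ℓ ℓ' : Module.Dual ℝ N} (h : ∀ x ∈ σ, ℓ (ι x) = ℓ' (ι x)) {q : N}
    (hq : q ∈ cspan ι σ) : ℓ q = ℓ' q :=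
  IsPolyCone.eq_of_mem_span (by rintro _ ⟨x, hx, rfl⟩; exact h x hx) hq

theorem eq_zero_of_mem_cspan {ℓ : Module.Dual ℝ N} (h : ∀ x ∈ σ, ℓ (ι x) = 0) {q : N}
    (hq : q ∈ cspan ι σ) : ℓ q = 0 :=
  IsPolyCone.eq_zero_of_mem_span (by rintro _ ⟨x, hx, rfl⟩; exact h x hx) hq

theorem cdim_mono [FiniteDimensional ℝ N] (h : τ ⊆ σ) : cdim ι τ ≤ cdim ι σ :=
  Submodule.finrank_mono (cspan_mono h)

theorem ri_subset : ri ι σ ⊆ σ := fun _ h => h.1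

theorem mem_ri_iff {x : X} : x ∈ ri ι σ ↔ x ∈ σ ∧ ∀ ℓ : Module.Dual ℝ N,
    (∀ y ∈ σ, 0 ≤ ℓ (ι y)) → ℓ (ι x) = 0 → ∀ y ∈ σ, ℓ (ι y) = 0 := by
  simp only [ri, relint, Set.mem_ofPred_eq, forall_mem_image]
  exact ⟨fun h => ⟨h.1, h.2.2⟩, fun h => ⟨h.1, mem_image_of_mem _ h.1, h.2⟩⟩

namespace FaceOf

theorem subset (h : FaceOf ι τ σ) : τ ⊆ σ := by
  obtain ⟨ℓ, -, rfl⟩ := h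
  exact fun x hx => hx.1

theorem refl (ι : X → N) (σ : Set X) : FaceOf ι σ σ := ⟨0, by simp, by simp⟩

theorem inter (h : FaceOf ι τ σ) (h' : FaceOf ι ρ σ) : FaceOf ι (τ ∩ ρ) σ := by
  obtain ⟨ℓ, h1, rfl⟩ := h
  obtain ⟨ℓ', h1', rfl⟩ := h'
  refine ⟨ℓ + ℓ', fun x hx => add_nonneg (h1 x hx) (h1' x hx), ?_⟩
  ext x
  simp only [Set.mem_inter_iff, Set.mem_ofPred_eq, LinearMap.add_apply]
  constructor
  · rintro ⟨⟨h2, h3⟩, -, h4⟩; exact ⟨h2, by rw [h3, h4, add_zero]⟩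
  · rintro ⟨h2, h3⟩
    have := h1 x h2; have := h1' x h2
    exact ⟨⟨h2, by linarith⟩, h2, by linarith⟩

theorem mono (h : FaceOf ι τ σ) (hτ : τ ⊆ ρ) (hρ : ρ ⊆ σ) : FaceOf ι τ ρ := by
  obtain ⟨ℓ, h1, rfl⟩ := h
  exact ⟨ℓ, fun x hx => h1 x (hρ hx), Set.Subset.antisymm (fun x hx => ⟨hτ hx, hx.2⟩)
    fun x hx => ⟨hρ hx.1, hx.2⟩⟩

/-- The form that defines the face is nonnegative on `ρ` and vanishes at a relative interior point
of `ρ`, hence on all of `ρ`. -/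
theorem subset_of_ri (h : FaceOf ι τ σ) (hρ : ρ ⊆ σ) {x : X} (hx : x ∈ ri ι ρ) (hxτ : x ∈ τ) :
    ρ ⊆ τ := by
  obtain ⟨ℓ, h1, rfl⟩ := h
  exact fun y hy => ⟨hρ hy, (mem_ri_iff.1 hx).2 ℓ (fun z hz => h1 z (hρ hz)) hxτ.2 y hy⟩

theorem eq_of_ri (h : FaceOf ι τ σ) {x : X} (hx : x ∈ ri ι σ) (hxτ : x ∈ τ) : τ = σ :=
  h.subset.antisymm (h.subset_of_ri Subset.rfl hx hxτ)

theorem mem_of_mem_cspan (h : FaceOf ι τ σ) {x : X} (hx : x ∈ σ) (hxs : ι x ∈ cspan ι τ) :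
    x ∈ τ := by
  obtain ⟨ℓ, h1, h2⟩ := h
  rw [h2]
  refine ⟨hx, eq_zero_of_mem_cspan (σ := τ) (fun y hy => ?_) hxs⟩
  rw [h2] at hy
  exact hy.2

/-- A face is the trace on the cone of its own linear span, and equal dimensions force equal spans.
-/
theorem eq_of_cdim_le [FiniteDimensional ℝ N] (h : FaceOf ι τ σ) (hd : cdim ι σ ≤ cdim ι τ) :
    τ = σ := by
  have : cspan ι τ = cspan ι σ := Submodule.eq_of_le_of_finrank_le (cspan_mono h.subset) hd
  exact h.subset.antisymm fun x hx => h.mem_of_mem_cspan hx (this ▸ mem_cspan hx)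

end FaceOf

theorem image_inter_halfSpace (ℓ : Module.Dual ℝ N) :
    ι '' (σ ∩ {x | 0 ≤ ℓ (ι x)}) = ι '' σ ∩ {v | 0 ≤ ℓ v} := by
  ext v
  constructor
  · rintro ⟨x, ⟨hx, h1⟩, rfl⟩; exact ⟨mem_image_of_mem _ hx, h1⟩
  · rintro ⟨⟨x, hx, rfl⟩, h1⟩; exact ⟨x, ⟨hx, h1⟩, rfl⟩

namespace IsEmbCone

variable [TopologicalSpace X]

theorem injOn (h : IsEmbCone ι σ) : InjOn ι σ := fun x hx y hy hxy =>
  congrArg Subtype.val (h.isEmbedding.injective (a₁ := ⟨x, hx⟩) (a₂ := ⟨y, hy⟩) hxy)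

theorem exists_ri (h : IsEmbCone ι σ) : (ri ι σ).Nonempty := by
  obtain ⟨p, hp⟩ := h.poly.relint_nonempty
  obtain ⟨x, hx, rfl⟩ := hp.1
  exact ⟨x, hx, hp⟩

theorem of_subset (h : IsEmbCone ι σ) (hτ : τ ⊆ σ) (hc : IsClosed τ) (hp : IsPolyCone (ι '' τ)) :
    IsEmbCone ι τ where
  isClosed := hc
  isEmbedding := h.isEmbedding.comp (.inclusion hτ)
  poly := hp
  pointed v hv hv' := h.pointed v (image_mono hτ hv) (image_mono hτ hv')

theorem continuousOn (h : IsEmbCone ι σ) : ContinuousOn ι σ :=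
  continuousOn_iff_continuous_domRestrict.2 h.isEmbedding.continuous

/-- The part of an embedded cone in a half-space. -/
theorem halfSpace [FiniteDimensional ℝ N] (h : IsEmbCone ι σ) (ℓ : Module.Dual ℝ N) :
    IsEmbCone ι (σ ∩ {x | 0 ≤ ℓ (ι x)}) := by
  refine h.of_subset inter_subset_left ?_ ?_
  · exact ((LinearMap.continuous_of_finiteDimensional ℓ).comp_continuousOn
      h.continuousOn).preimage_isClosed_of_isClosed h.isClosed isClosed_Ici
  · rw [image_inter_halfSpace]; exact h.poly.inter_halfSpace ℓ

end IsEmbCone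

end EmbeddedCones

/-! ### Conical complexes seen through a quasi-embedding. -/

namespace ConicalComplex

variable {X N : Type*} [TopologicalSpace X] [NormedAddCommGroup N] [InnerProductSpace ℝ N]
  [FiniteDimensional ℝ N] {P Q : ConicalComplex X} {ι : X → N}

/-- The differences of points of a cone already form a linear subspace, since the cone is stable
under sums and nonnegative multiples. -/
theorem span_range_evalMap {σ : Set X} (hσ : σ ∈ P.cones) (d : Module.Dual ℝ (P.M σ)) :
    ∃ x y : σ, d = evalMap (P.M σ) x - evalMap (P.M σ) y := by
  obtain ⟨s, hs⟩ := (P.chart σ hσ).polyhedral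
  have hd : d ∈ Submodule.span ℝ (range (evalMap (P.M σ))) := by
    rw [(P.chart σ hσ).fullDimensional]; trivial
  have hadd : ∀ x y : σ, ∃ z : σ, evalMap (P.M σ) z = evalMap (P.M σ) x + evalMap (P.M σ) y := by
    intro x y
    have : evalMap (P.M σ) x + evalMap (P.M σ) y ∈ range (evalMap (P.M σ)) := by
      have hx : evalMap (P.M σ) x ∈ range (evalMap (P.M σ)) := mem_range_self x
      have hy : evalMap (P.M σ) y ∈ range (evalMap (P.M σ)) := mem_range_self y
      rw [hs] at hx hy ⊢
      exact Submodule.add_mem _ hx hy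
    exact this
  have hsmul : ∀ (t : ℝ) (x : σ), 0 ≤ t → ∃ z : σ, evalMap (P.M σ) z = t • evalMap (P.M σ) x := by
    intro t x ht
    have : t • evalMap (P.M σ) x ∈ range (evalMap (P.M σ)) := by
      have hx : evalMap (P.M σ) x ∈ range (evalMap (P.M σ)) := mem_range_self x
      rw [hs] at hx ⊢
      exact PointedCone.smul_mem _ ht hx
    exact this
  have h0 : ∃ z : σ, evalMap (P.M σ) z = 0 := by
    have : (0 : Module.Dual ℝ (P.M σ)) ∈ range (evalMap (P.M σ)) := by
      rw [hs]; exact Submodule.zero_mem _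
    exact this
  obtain ⟨z, hz⟩ := h0
  induction hd using Submodule.span_induction with
  | mem d hd => obtain ⟨x, rfl⟩ := hd; exact ⟨x, z, by rw [hz, sub_zero]⟩
  | zero => exact ⟨z, z, by rw [sub_self]⟩
  | add d e _ _ hd he =>
    obtain ⟨x, y, rfl⟩ := hd
    obtain ⟨x', y', rfl⟩ := he
    obtain ⟨a, ha⟩ := hadd x x'
    obtain ⟨b, hb⟩ := hadd y y'
    exact ⟨a, b, by rw [ha, hb]; abel⟩
  | smul t d _ hd =>
    obtain ⟨x, y, rfl⟩ := hd
    rcases le_total 0 t with ht | ht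
    · obtain ⟨a, ha⟩ := hsmul t x ht
      obtain ⟨b, hb⟩ := hsmul t y ht
      exact ⟨a, b, by rw [ha, hb, smul_sub]⟩
    · obtain ⟨a, ha⟩ := hsmul (-t) x (by linarith)
      obtain ⟨b, hb⟩ := hsmul (-t) y (by linarith)
      exact ⟨b, a, by rw [ha, hb]; module⟩

namespace QuasiEmbeds

variable (hP : P.QuasiEmbeds ι) {σ τ : Set X} (hσ : σ ∈ P.cones)
include hP hσ

/-- The restriction to a cone of linear forms on `N`. -/
def pull : Module.Dual ℝ N →ₗ[ℝ] P.M σ where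
  toFun ℓ := ⟨fun v => ℓ (ι v), hP.1 ℓ σ hσ⟩
  map_add' _ _ := rfl
  map_smul' _ _ := rfl

/-- A form on `M σ` that kills all restrictions is a difference of two evaluations, at points with
the same image in `N`; injectivity of `ι` on the cone makes it zero. This replaces the abstract
linear structures by linear forms on `N` from here on. -/
theorem pull_surjective : Function.Surjective (pull hP hσ) := by
  rw [← LinearMap.range_eq_top]
  by_contra hne
  obtain ⟨d, hd, hle⟩ := Submodule.exists_le_ker_of_lt_top _ (lt_top_iff_ne_top.2 hne)
  obtain ⟨x, y, rfl⟩ := span_range_evalMap hσ d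
  have hxy : ι x = ι y := by
    rw [← sub_eq_zero, ← Module.forall_dual_apply_eq_zero_iff ℝ]
    intro ℓ
    have := hle ⟨ℓ, rfl⟩
    rw [map_sub]; exact this
  have : x = y := Subtype.ext (hP.2 σ hσ x.2 y.2 hxy)
  exact hd (by rw [this, sub_self])

theorem mem_M_iff {u : σ → ℝ} : u ∈ P.M σ ↔ ∃ ℓ : Module.Dual ℝ N, ∀ v : σ, u v = ℓ (ι v) := by
  constructor
  · intro hu
    obtain ⟨ℓ, hℓ⟩ := pull_surjective hP hσ ⟨u, hu⟩
    exact ⟨ℓ, fun v => (congrFun (congrArg Subtype.val hℓ) v).symm⟩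
  · rintro ⟨ℓ, hℓ⟩
    have : u = fun v : σ => ℓ (ι v) := funext hℓ
    rw [this]; exact hP.1 ℓ σ hσ

/-- The linear extension of `ι` from a cone to its ambient space. -/
def extend : Module.Dual ℝ (P.M σ) →ₗ[ℝ] N :=
  (Module.evalEquiv ℝ N).symm.toLinearMap ∘ₗ (pull hP hσ).dualMap

theorem apply_extend (ℓ : Module.Dual ℝ N) (d : Module.Dual ℝ (P.M σ)) :
    ℓ (extend hP hσ d) = d (pull hP hσ ℓ) :=
  Module.apply_evalEquiv_symm_apply ℝ N ℓ _

theorem extend_evalMap (x : σ) : extend hP hσ (evalMap (P.M σ) x) = ι x := by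
  rw [← sub_eq_zero, ← Module.forall_dual_apply_eq_zero_iff ℝ]
  intro ℓ
  rw [map_sub, apply_extend, sub_eq_zero]
  rfl

theorem extend_injective : Function.Injective (extend hP hσ) := by
  rw [← LinearMap.ker_eq_bot, LinearMap.ker_eq_bot']
  intro d hd
  ext u
  obtain ⟨ℓ, rfl⟩ := pull_surjective hP hσ u
  rw [← apply_extend, hd, map_zero, LinearMap.zero_apply]

theorem image_eq : ι '' σ = extend hP hσ '' range (evalMap (P.M σ)) := by
  rw [← range_comp, image_eq_range]
  congr 1
  ext x
  exact (extend_evalMap hP hσ x).symm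

/-- The algebraic properties are carried to `N` by the injective map `extend`. For the topology, the
functions in `M σ` are linear forms composed with `ι`, so the embedding given by the chart factors
through `ι`. -/
theorem isEmbCone : IsEmbCone ι σ where
  isClosed := P.isClosed σ hσ
  isEmbedding := by
    have hc : Continuous (fun x : σ => ι x) := by
      have b := Module.finBasis ℝ N
      have : (fun x : σ => ι x) = fun x : σ => ∑ i, b.coord i (ι x) • b i := by
        ext x; exact (b.sum_repr (ι x)).symm
      rw [this]
      exact continuous_finsetSum _ fun i _ =>
        ((P.chart σ hσ).continuous _ (hP.1 (b.coord i) σ hσ)).smul continuous_const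
    choose ℓ hℓ using pull_surjective hP hσ
    have hg : Continuous (fun (n : N) (u : P.M σ) => ℓ u n) := continuous_pi fun u =>
      LinearMap.continuous_of_finiteDimensional (ℓ u)
    refine IsEmbedding.of_comp hc hg ?_
    convert (P.chart σ hσ).isEmbedding using 1
    ext x u
    exact congrFun (congrArg Subtype.val (hℓ u)) x
  poly := by
    classical
    obtain ⟨s, hs⟩ := (P.chart σ hσ).polyhedral
    refine ⟨s.image (extend hP hσ), ?_⟩
    rw [image_eq hP hσ, hs, Finset.coe_image, ← PointedCone.coe_map, PointedCone.map,
      PointedCone.hull, PointedCone.hull, Submodule.map_span]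
    rfl
  pointed v hv hv' := by
    rw [image_eq hP hσ] at hv hv'
    obtain ⟨d, hd, rfl⟩ := hv
    obtain ⟨e, he, h⟩ := hv'
    rw [← map_neg] at h
    rw [extend_injective hP hσ h] at he
    rw [(P.chart σ hσ).strictlyConvex d hd he, map_zero]

theorem dim_eq : P.dim σ = cdim ι σ := by
  have h1 : cspan ι σ = LinearMap.range (extend hP hσ) := by
    rw [cspan, image_eq hP hσ, ← Submodule.map_span, (P.chart σ hσ).fullDimensional,
      Submodule.map_top]
  have := (P.chart σ hσ).finiteDimensional
  rw [cdim, h1, LinearMap.finrank_range_of_inj (extend_injective hP hσ),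
    Subspace.dual_finrank_eq, dim]

theorem face_iff : P.Face τ σ ↔ FaceOf ι τ σ := by
  constructor
  · rintro ⟨u, hu, h0, rfl⟩
    obtain ⟨ℓ, hℓ⟩ := (mem_M_iff hP hσ).1 hu
    refine ⟨ℓ, fun x hx => (hℓ ⟨x, hx⟩) ▸ h0 ⟨x, hx⟩, ?_⟩
    ext x
    constructor
    · rintro ⟨v, hv, rfl⟩; exact ⟨v.2, (hℓ v) ▸ hv⟩
    · rintro ⟨hx, h⟩; exact ⟨⟨x, hx⟩, (hℓ ⟨x, hx⟩).trans h, rfl⟩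
  · rintro ⟨ℓ, h0, rfl⟩
    refine ⟨fun v => ℓ (ι v), hP.1 ℓ σ hσ, fun v => h0 v v.2, ?_⟩
    ext x
    constructor
    · rintro ⟨hx, h⟩; exact ⟨⟨x, hx⟩, h, rfl⟩
    · rintro ⟨v, hv, rfl⟩; exact ⟨v.2, hv⟩

theorem face_mem (h : FaceOf ι τ σ) : τ ∈ P.cones := P.face_mem σ hσ τ ((face_iff hP hσ).2 h)

end QuasiEmbeds

/-! ### Carriers of points and minimal cones of subdivisions. -/

section Carriers

variable (hP : P.QuasiEmbeds ι)
include hP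

theorem QuasiEmbeds.exists_faces {σ τ : Set X} (hσ : σ ∈ P.cones) (hτ : τ ∈ P.cones) {x : X}
    (hxσ : x ∈ σ) (hxτ : x ∈ τ) : ∃ ρ, x ∈ ρ ∧ FaceOf ι ρ σ ∧ FaceOf ι ρ τ := by
  obtain ⟨S, hS, h⟩ := P.inter σ hσ τ hτ
  obtain ⟨ρ, hρ, hx⟩ : x ∈ ⋃₀ S := h ▸ ⟨hxσ, hxτ⟩
  exact ⟨ρ, hx, (hP.face_iff hσ).1 (hS ρ hρ).1, (hP.face_iff hτ).1 (hS ρ hρ).2⟩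

/-- The two cones have a common face through `x`, and a face of `τ` that meets its relative interior
is `τ` itself. -/
theorem QuasiEmbeds.faceOf_of_ri {σ τ : Set X} (hτ : τ ∈ P.cones) (hσ : σ ∈ P.cones) {x : X}
    (hx : x ∈ ri ι τ) (hxσ : x ∈ σ) : FaceOf ι τ σ := by
  obtain ⟨ρ, hxρ, h1, h2⟩ := hP.exists_faces hτ hσ (ri_subset hx) hxσ
  rwa [h1.eq_of_ri hx hxρ] at h2

theorem QuasiEmbeds.eq_of_ri {σ τ : Set X} (hτ : τ ∈ P.cones) (hσ : σ ∈ P.cones) {x : X}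
    (hx : x ∈ ri ι τ) (hxσ : x ∈ ri ι σ) : τ = σ :=
  (hP.faceOf_of_ri hτ hσ hx (ri_subset hxσ)).subset.antisymm
    (hP.faceOf_of_ri hσ hτ hxσ (ri_subset hx)).subset

/-- A minimal cone containing `x` works: a form showing that `x` is not in the relative interior
would cut out a smaller cone of the complex containing `x`. -/
theorem QuasiEmbeds.exists_ri (x : X) : ∃ σ ∈ P.cones, x ∈ ri ι σ := by
  have hx : x ∈ ⋃ σ ∈ P.cones, σ := P.cover ▸ mem_univ x
  simp only [mem_iUnion] at hx
  obtain ⟨σ₀, hσ₀, hx₀⟩ := hx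
  classical
  obtain ⟨σ, hσ, hmin⟩ := (P.cones.filter fun σ => x ∈ σ).exists_minimal
    ⟨σ₀, Finset.mem_filter.2 ⟨hσ₀, hx₀⟩⟩
  obtain ⟨hσ1, hσ2⟩ := Finset.mem_filter.1 hσ
  refine ⟨σ, hσ1, mem_ri_iff.2 ⟨hσ2, fun ℓ h0 hℓ y hy => ?_⟩⟩
  have hf : FaceOf ι {z | z ∈ σ ∧ ℓ (ι z) = 0} σ := ⟨ℓ, h0, rfl⟩
  exact (hmin (Finset.mem_filter.2 ⟨hP.face_mem hσ1 hf, hσ2, hℓ⟩) hf.subset hy).2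

variable (hQ : Q.QuasiEmbeds ι)
include hQ

/-- Linear functions on both complexes are restrictions of the same forms on `N`, so only the
inclusions of cones matter. -/
theorem QuasiEmbeds.isSubdivision_iff :
    Q.IsSubdivision P ↔ ∀ σ' ∈ Q.cones, ∃ σ ∈ P.cones, σ' ⊆ σ := by
  constructor
  · intro h σ' hσ'
    obtain ⟨σ, hσ, hs, -⟩ := h σ' hσ'
    exact ⟨σ, hσ, hs⟩
  · intro h σ' hσ'
    obtain ⟨σ, hσ, hs⟩ := h σ' hσ'
    refine ⟨σ, hσ, hs, ?_⟩
    rintro _ ⟨u, hu, rfl⟩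
    obtain ⟨ℓ, hℓ⟩ := (hP.mem_M_iff hσ).1 hu
    exact (hQ.mem_M_iff hσ').2 ⟨ℓ, fun v => hℓ (inclusion hs v)⟩

variable (hQP : Q.IsSubdivision P)
include hQP

/-- A cone of a subdivision that meets a cone `σ` in its relative interior lies in `σ`. -/
theorem QuasiEmbeds.subset_of_ri {τ σ : Set X} (hτ : τ ∈ Q.cones) (hσ : σ ∈ P.cones) {x : X}
    (hx : x ∈ ri ι τ) (hxσ : x ∈ σ) : τ ⊆ σ := by
  obtain ⟨β, hβ, hτβ, -⟩ := hQP τ hτ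
  obtain ⟨ρ, hxρ, h1, h2⟩ := hP.exists_faces hβ hσ (hτβ (ri_subset hx)) hxσ
  exact (h1.subset_of_ri hτβ hx hxρ).trans h2.subset

theorem QuasiEmbeds.isMinimalCone_iff {τ σ : Set X} (hτ : τ ∈ Q.cones) (hσ : σ ∈ P.cones) {x : X}
    (hx : x ∈ ri ι τ) : P.IsMinimalCone τ σ ↔ x ∈ ri ι σ := by
  constructor
  · rintro ⟨-, h1, h2⟩
    obtain ⟨ρ, hρ, hxρ⟩ := hP.exists_ri x
    have h3 := h2 ρ hρ (hP.subset_of_ri hQ hQP hτ hρ hx (ri_subset hxρ))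
    have h4 := (hP.faceOf_of_ri hρ hσ hxρ (h1 (ri_subset hx))).subset
    rwa [h3.antisymm h4]
  · intro h
    exact ⟨hσ, hP.subset_of_ri hQ hQP hτ hσ hx (ri_subset h), fun ρ hρ hτρ =>
      (hP.faceOf_of_ri hσ hρ h (hτρ (ri_subset hx))).subset⟩

/-- One interior point of the small cone determines its minimal cone, so the sum in the definition
reduces to the carrier of that point. -/
theorem QuasiEmbeds.pullback_eq (c : Set X → ℝ) {τ σ : Set X} (hτ : τ ∈ Q.cones) (hσ : σ ∈ P.cones)
    {x : X} (hx : x ∈ ri ι τ) (hxσ : x ∈ ri ι σ) :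
    P.pullback Q c τ = if cdim ι σ = cdim ι τ then c σ else 0 := by
  classical
  rw [pullback, if_pos hτ, hQ.dim_eq hτ]
  have : (P.cones.filter fun ρ => P.IsMinimalCone τ ρ ∧ P.dim ρ = cdim ι τ) =
      ({σ} : Finset (Set X)).filter fun _ => cdim ι σ = cdim ι τ := by
    ext ρ
    simp only [Finset.mem_filter, Finset.mem_singleton]
    constructor
    · rintro ⟨hρ, h1, h2⟩
      have h3 := (hP.isMinimalCone_iff hQ hQP hτ hρ hx).1 h1
      have h4 := hP.eq_of_ri hρ hσ h3 hxσ
      exact ⟨h4, by rw [← h4, ← hP.dim_eq hρ, h2]⟩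
    · rintro ⟨rfl, h2⟩
      exact ⟨hσ, (hP.isMinimalCone_iff hQ hQP hτ hσ hx).2 hxσ, by rw [hP.dim_eq hσ, h2]⟩
  rw [this, Finset.sum_filter, Finset.sum_singleton]

end Carriers

end ConicalComplex


/-! ### Refinements -/

section Cells

variable {X N : Type*} [NormedAddCommGroup N] [InnerProductSpace ℝ N]

/-- The part of `σ` on which the linear form `h` has the sign `b` (in the weak sense). -/
def cell (ι : X → N) (h : Module.Dual ℝ N) (σ : Set X) (b : SignType) : Set X :=
  {x | x ∈ σ ∧ (b ≠ -1 → 0 ≤ h (ι x)) ∧ (b ≠ 1 → h (ι x) ≤ 0)}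

variable {ι : X → N} {h : Module.Dual ℝ N} {σ τ ρ : Set X}

theorem cell_subset {b : SignType} : cell ι h σ b ⊆ σ := fun _ hx => hx.1

theorem cell_one : cell ι h σ 1 = σ ∩ {x | 0 ≤ h (ι x)} := by
  ext x; simp [cell, show (1 : SignType) ≠ -1 by decide]

theorem cell_neg_one : cell ι h σ (-1) = σ ∩ {x | 0 ≤ (-h) (ι x)} := by
  ext x; simp [cell, show (-1 : SignType) ≠ 1 by decide]

theorem cell_zero : cell ι h σ 0 = (σ ∩ {x | 0 ≤ h (ι x)}) ∩ {x | 0 ≤ (-h) (ι x)} := by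
  ext x; simp only [cell, Set.mem_ofPred_eq, Set.mem_inter_iff, LinearMap.neg_apply]; simp [and_assoc]

theorem mem_cell_zero {x : X} : x ∈ cell ι h σ 0 ↔ x ∈ σ ∧ h (ι x) = 0 := by
  simp only [cell, Set.mem_ofPred_eq, le_antisymm_iff]
  simp only [ne_eq, show ¬ (0 : SignType) = -1 by decide, show ¬ (0 : SignType) = 1 by decide,
    not_false_eq_true, true_imp_iff]
  tauto

theorem exists_mem_cell {x : X} (hx : x ∈ σ) : ∃ b, x ∈ cell ι h σ b := by
  rcases le_total 0 (h (ι x)) with h0 | h0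
  · exact ⟨1, by rw [cell_one]; exact ⟨hx, h0⟩⟩
  · exact ⟨-1, by rw [cell_neg_one]; exact ⟨hx, by simpa using h0⟩⟩

theorem isEmbCone_cell [TopologicalSpace X] [FiniteDimensional ℝ N] (hσ : IsEmbCone ι σ)
    (b : SignType) : IsEmbCone ι (cell ι h σ b) := by
  cases b
  · exact cell_zero (ι := ι) ▸ (hσ.halfSpace h).halfSpace (-h)
  · exact cell_neg_one (ι := ι) ▸ hσ.halfSpace (-h)
  · exact cell_one (ι := ι) ▸ hσ.halfSpace h

theorem FaceOf.cell (hρ : FaceOf ι ρ σ) {b b' : SignType} (hb : b' = b ∨ b' = 0) :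
    FaceOf ι (cell ι h ρ b') (cell ι h σ b) := by
  have aux : FaceOf ι (Conical.cell ι h σ 0) (Conical.cell ι h σ b) := by
    cases b
    · exact FaceOf.refl _ _
    · refine ⟨-h, fun x hx => by simpa using hx.2.2 (by decide), ?_⟩
      ext x
      simp only [mem_cell_zero, Set.mem_ofPred_eq, LinearMap.neg_apply, neg_eq_zero]
      exact ⟨fun hx => ⟨⟨hx.1, by simp [hx.2], by simp [hx.2]⟩, hx.2⟩, fun hx => ⟨hx.1.1, hx.2⟩⟩
    · refine ⟨h, fun x hx => hx.2.1 (by decide), ?_⟩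
      ext x
      simp only [mem_cell_zero, Set.mem_ofPred_eq]
      exact ⟨fun hx => ⟨⟨hx.1, by simp [hx.2], by simp [hx.2]⟩, hx.2⟩, fun hx => ⟨hx.1.1, hx.2⟩⟩
  have aux2 : FaceOf ι (Conical.cell ι h ρ b) (Conical.cell ι h σ b) := by
    obtain ⟨ℓ, h1, rfl⟩ := hρ
    refine ⟨ℓ, fun x hx => h1 x hx.1, ?_⟩
    ext x
    simp only [Conical.cell, Set.mem_ofPred_eq]
    tauto
  rcases hb with rfl | rfl
  · exact aux2
  · convert aux.inter aux2 using 1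
    ext x
    simp only [mem_cell_zero, Set.mem_inter_iff]
    constructor
    · rintro ⟨h1, h2⟩
      exact ⟨⟨hρ.subset h1, h2⟩, h1, by simp [h2], by simp [h2]⟩
    · rintro ⟨⟨h1, h2⟩, h3, -⟩
      exact ⟨h3, h2⟩

/-- By `exists_sub_smul_nonneg`, a form nonnegative on the cell is a form nonnegative on all of `σ`
plus a multiple `t` of `h` that is nonnegative on the cell. If `t = 0` the sign of the cell is kept;
otherwise `h` vanishes on the face too. -/
theorem exists_cell_of_faceOf (hσ : IsPolyCone (ι '' σ)) {b : SignType}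
    (hτ : FaceOf ι τ (cell ι h σ b)) : ∃ ρ b', FaceOf ι ρ σ ∧ τ = cell ι h ρ b' := by
  obtain ⟨u, hu, rfl⟩ := hτ
  obtain ⟨t, ht1, ht2, ht⟩ : ∃ t : ℝ, (b = 1 → 0 ≤ t) ∧ (b = -1 → t ≤ 0) ∧
      ∀ x ∈ σ, 0 ≤ u (ι x) - t * h (ι x) := by
    cases b
    -- The cell in the hyperplane is half of a half: first `-h` is eliminated on the upper half,
    -- then `h` on the whole cone.
    · have hK := hσ.inter_halfSpace h
      obtain ⟨t, -, h2⟩ := hK.exists_sub_smul_nonneg (u := u) (h := -h) (by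
        rintro _ ⟨⟨x, hx, rfl⟩, h1⟩ h2
        exact hu x ⟨hx, fun _ => h1, fun _ => by simpa using h2⟩)
      obtain ⟨s, -, h4⟩ := hσ.exists_sub_smul_nonneg (u := u - t • (-h)) (h := h) (by
        rintro _ ⟨x, hx, rfl⟩ h3
        simpa using h2 _ ⟨mem_image_of_mem _ hx, h3⟩)
      refine ⟨s - t, fun e => by simp at e, fun e => by simp at e, fun x hx => ?_⟩
      have := h4 _ (mem_image_of_mem _ hx)
      simp only [LinearMap.sub_apply, LinearMap.smul_apply, LinearMap.neg_apply, smul_eq_mul]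
        at this
      linarith
    · obtain ⟨t, h1, h2⟩ := hσ.exists_sub_smul_nonneg (u := u) (h := -h) (by
        rintro _ ⟨x, hx, rfl⟩ h1
        exact hu x ⟨hx, fun h => absurd rfl h, fun _ => by simpa using h1⟩)
      refine ⟨-t, fun e => by simp at e, fun _ => by linarith, fun x hx => ?_⟩
      have := h2 _ (mem_image_of_mem _ hx)
      simp only [LinearMap.neg_apply] at this
      linarith
    · obtain ⟨t, h1, h2⟩ := hσ.exists_sub_smul_nonneg (u := u) (h := h) (by
        rintro _ ⟨x, hx, rfl⟩ h1
        exact hu x ⟨hx, fun _ => h1, fun h => absurd rfl h⟩)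
      exact ⟨t, fun _ => h1, fun e => by simp at e, fun x hx => h2 _ (mem_image_of_mem _ hx)⟩
  have hth : ∀ x ∈ cell ι h σ b, 0 ≤ t * h (ι x) := by
    rintro x ⟨-, h1, h2⟩
    cases b
    · rw [le_antisymm (h2 (by decide)) (h1 (by decide)), mul_zero]
    · exact mul_nonneg_of_nonpos_of_nonpos (ht2 rfl) (h2 (by decide))
    · exact mul_nonneg (ht1 rfl) (h1 (by decide))
  refine ⟨_, if t = 0 then b else 0,
    ⟨u - t • h, fun x hx => by simpa using ht x hx, rfl⟩, ?_⟩
  ext x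
  split_ifs with h0
  · subst h0
    simp only [cell, Set.mem_ofPred_eq, zero_smul, sub_zero]
    tauto
  · simp only [mem_cell_zero, Set.mem_ofPred_eq, LinearMap.sub_apply, LinearMap.smul_apply,
      smul_eq_mul]
    constructor
    · rintro ⟨hx, hux⟩
      have h1 := hth x hx
      have h2 := ht x hx.1
      have h3 : t * h (ι x) = 0 := by linarith
      exact ⟨⟨hx.1, by linarith⟩, (mul_eq_zero.1 h3).resolve_left h0⟩
    · rintro ⟨⟨hx, h1⟩, h2⟩
      refine ⟨⟨hx, by simp [h2], by simp [h2]⟩, ?_⟩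
      rw [h2] at h1; linarith

end Cells

/-! ### Complexes built from embedded cones. -/

section OfCones

variable {X N : Type*} [TopologicalSpace X] [NormedAddCommGroup N] [InnerProductSpace ℝ N]

/-- The restrictions to `σ` of the linear forms on `N`. -/
def linearForms (ι : X → N) (σ : Set X) : Submodule ℝ (σ → ℝ) :=
  LinearMap.range (LinearMap.pi fun v : σ => Module.Dual.eval ℝ N (ι v))

theorem mem_linearForms {ι : X → N} {σ : Set X} {u : σ → ℝ} :
    u ∈ linearForms ι σ ↔ ∃ ℓ : Module.Dual ℝ N, ∀ v : σ, u v = ℓ (ι v) := by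
  simp only [linearForms, LinearMap.mem_range, funext_iff]
  exact exists_congr fun ℓ => forall_congr' fun v => eq_comm

theorem isFace_linearForms {ι : X → N} {σ τ : Set X} :
    IsFace (linearForms ι σ) τ ↔ FaceOf ι τ σ := by
  constructor
  · rintro ⟨u, hu, h0, rfl⟩
    obtain ⟨ℓ, hℓ⟩ := mem_linearForms.1 hu
    refine ⟨ℓ, fun x hx => (hℓ ⟨x, hx⟩) ▸ h0 ⟨x, hx⟩, ?_⟩
    ext x
    constructor
    · rintro ⟨v, hv, rfl⟩; exact ⟨v.2, (hℓ v) ▸ hv⟩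
    · rintro ⟨hx, h⟩; exact ⟨⟨x, hx⟩, (hℓ ⟨x, hx⟩).trans h, rfl⟩
  · rintro ⟨ℓ, h0, rfl⟩
    refine ⟨fun v => ℓ (ι v), mem_linearForms.2 ⟨ℓ, fun _ => rfl⟩, fun v => h0 v v.2, ?_⟩
    ext x
    constructor
    · rintro ⟨hx, h⟩; exact ⟨⟨x, hx⟩, h, rfl⟩
    · rintro ⟨v, hv, rfl⟩; exact ⟨v.2, hv⟩

/-- Dualizing the surjection `A` from linear forms to their restrictions embeds the dual of
`linearForms ι σ` in the bidual of `N`, where evaluation at `v` becomes the point `ι v`. The axioms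
of a chart are pulled back along this embedding. -/
theorem isConeChart_linearForms [FiniteDimensional ℝ N] {ι : X → N} {σ : Set X}
    (h : IsEmbCone ι σ) : IsConeChart (linearForms ι σ) := by
  let A : Module.Dual ℝ N →ₗ[ℝ] linearForms ι σ := LinearMap.rangeRestrict _
  have hA : Function.Surjective A := LinearMap.surjective_rangeRestrict _
  let T : N →ₗ[ℝ] Module.Dual ℝ (Module.Dual ℝ N) := Module.Dual.eval ℝ N
  have hev : ∀ (v : σ) (ℓ : Module.Dual ℝ N), evalMap (linearForms ι σ) v (A ℓ) = ℓ (ι v) :=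
    fun _ _ => rfl
  have hinj : Function.Injective (A.dualMap) := LinearMap.dualMap_injective_of_surjective hA
  have hAev : ∀ v : σ, A.dualMap (evalMap (linearForms ι σ) v) = T (ι v) := fun _ => rfl
  obtain ⟨s, hs⟩ := id h.poly
  obtain ⟨x₀, hx₀, -⟩ := h.exists_ri
  have : Nonempty σ := ⟨⟨x₀, hx₀⟩⟩
  have hfin : FiniteDimensional ℝ (linearForms ι σ) := by
    unfold linearForms; infer_instance
  refine ⟨hfin, ?_, ?_, ?_, ?_, ?_⟩
  · intro u hu
    obtain ⟨ℓ, hℓ⟩ := mem_linearForms.1 hu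
    rw [funext hℓ]
    exact (LinearMap.continuous_of_finiteDimensional ℓ).comp h.isEmbedding.continuous
  · have hf : Continuous fun (v : σ) (u : linearForms ι σ) => evalMap (linearForms ι σ) v u := by
      refine continuous_pi fun u => ?_
      obtain ⟨ℓ, rfl⟩ := hA u
      exact (LinearMap.continuous_of_finiteDimensional ℓ).comp h.isEmbedding.continuous
    have hg : Continuous fun (w : linearForms ι σ → ℝ) (ℓ : Module.Dual ℝ N) => w (A ℓ) :=
      continuous_pi fun ℓ => continuous_apply (A ℓ)
    refine IsEmbedding.of_comp hf hg ?_
    change IsEmbedding ((fun (n : N) (ℓ : Module.Dual ℝ N) => ℓ n) ∘ fun v : σ => ι v)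
    refine IsEmbedding.comp ?_ h.isEmbedding
    let b := Module.finBasis ℝ N
    have hf' : Continuous fun (n : N) (ℓ : Module.Dual ℝ N) => ℓ n := continuous_pi fun ℓ =>
      LinearMap.continuous_of_finiteDimensional ℓ
    have hg' : Continuous fun (w : Module.Dual ℝ N → ℝ) => ∑ i, w (b.coord i) • b i :=
      continuous_finsetSum _ fun i _ => (continuous_apply _).smul continuous_const
    refine IsEmbedding.of_comp hf' hg' ?_
    convert IsEmbedding.id using 1
    ext n
    exact b.sum_repr n
  · classical
    have hex : ∀ g ∈ s, ∃ v : σ, ι v = g := by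
      intro g hg
      have : g ∈ ι '' σ := hs ▸ PointedCone.subset_hull (by exact_mod_cast hg)
      obtain ⟨x, hx, rfl⟩ := this
      exact ⟨⟨x, hx⟩, rfl⟩
    choose! w hw using hex
    refine ⟨s.image fun g => evalMap (linearForms ι σ) (w g), ?_⟩
    have key : ∀ d : Module.Dual ℝ (linearForms ι σ),
        d ∈ PointedCone.hull ℝ ((s.image fun g => evalMap (linearForms ι σ) (w g) :
          Finset _) : Set (Module.Dual ℝ (linearForms ι σ))) ↔
        ∃ n ∈ PointedCone.hull ℝ (s : Set N), T n = A.dualMap d := by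
      intro d
      have e1 : (PointedCone.hull ℝ ((s.image fun g => evalMap (linearForms ι σ) (w g) :
          Finset _) : Set (Module.Dual ℝ (linearForms ι σ)))).map A.dualMap =
          (PointedCone.hull ℝ (s : Set N)).map T := by
        unfold PointedCone.hull PointedCone.map
        rw [Submodule.map_span, Submodule.map_span, Finset.coe_image, image_image]
        congr 1
        refine image_congr fun g hg => ?_
        change A.dualMap (evalMap (linearForms ι σ) (w g)) = T g
        rw [hAev, hw g (by exact_mod_cast hg)]
      rw [← PointedCone.mem_map, ← e1, PointedCone.mem_map]
      exact ⟨fun hd => ⟨d, hd, rfl⟩, fun ⟨d', hd', e⟩ => hinj e ▸ hd'⟩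
    ext d
    rw [SetLike.mem_coe, key]
    constructor
    · rintro ⟨v, rfl⟩
      refine ⟨ι v, ?_, (hAev v).symm⟩
      have : ι v ∈ ι '' σ := mem_image_of_mem _ v.2
      rw [hs] at this; exact this
    · rintro ⟨n, hn, e⟩
      have : n ∈ ι '' σ := by rw [hs]; exact hn
      obtain ⟨x, hx, rfl⟩ := this
      exact ⟨⟨x, hx⟩, hinj ((hAev ⟨x, hx⟩).trans e)⟩
  · rintro _ ⟨v, rfl⟩ ⟨w, hw⟩
    have h1 : ι w = -ι v := by
      rw [← sub_eq_zero, ← Module.forall_dual_apply_eq_zero_iff ℝ]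
      intro ℓ
      have := LinearMap.congr_fun hw (A ℓ)
      rw [LinearMap.neg_apply, hev, hev] at this
      rw [map_sub, map_neg, this, sub_self]
    have h2 := h.pointed (ι v) (mem_image_of_mem _ v.2) (h1 ▸ mem_image_of_mem _ w.2)
    apply hinj
    rw [hAev, h2, map_zero, map_zero]
  · by_contra hne
    obtain ⟨f, hf, hle⟩ := Submodule.exists_le_ker_of_lt_top _ (lt_top_iff_ne_top.2 hne)
    obtain ⟨u, rfl⟩ := (Module.evalEquiv ℝ (linearForms ι σ)).surjective f
    apply hf
    have : u = 0 := by
      ext v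
      exact hle (Submodule.subset_span (mem_range_self v))
    rw [this, map_zero]

/-- A conical complex given by a finite set of embedded cones. -/
def ofCones [FiniteDimensional ℝ N] (ι : X → N) (S : Finset (Set X))
    (hS : ∀ σ ∈ S, IsEmbCone ι σ) (hcover : ∀ x, ∃ σ ∈ S, x ∈ σ)
    (hface : ∀ σ ∈ S, ∀ τ, FaceOf ι τ σ → τ ∈ S)
    (hinter : ∀ σ ∈ S, ∀ τ ∈ S, ∀ x ∈ σ, x ∈ τ → ∃ ρ, x ∈ ρ ∧ FaceOf ι ρ σ ∧ FaceOf ι ρ τ) :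
    ConicalComplex X where
  cones := S
  M := linearForms ι
  isClosed σ hσ := (hS σ hσ).isClosed
  cover := eq_univ_of_forall fun x => by
    obtain ⟨σ, hσ, hx⟩ := hcover x
    exact mem_biUnion hσ hx
  chart σ hσ := isConeChart_linearForms (hS σ hσ)
  face_mem σ hσ τ h := hface σ hσ τ (isFace_linearForms.1 h)
  face_M σ hσ τ _ h := by
    rw [linearForms, linearForms, ← LinearMap.range_comp]
    rfl
  inter σ hσ τ hτ := by
    refine ⟨{ρ | FaceOf ι ρ σ ∧ FaceOf ι ρ τ},
      fun ρ hρ => ⟨isFace_linearForms.2 hρ.1, isFace_linearForms.2 hρ.2⟩, ?_⟩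
    ext x
    constructor
    · rintro ⟨h1, h2⟩
      obtain ⟨ρ, hx, hρ⟩ := hinter σ hσ τ hτ x h1 h2
      exact ⟨ρ, hρ, hx⟩
    · rintro ⟨ρ, hρ, hx⟩
      exact ⟨hρ.1.subset hx, hρ.2.subset hx⟩

end OfCones

/-! ### Subdivisions by hyperplanes. -/

namespace ConicalComplex

variable {X N : Type*} [TopologicalSpace X] [NormedAddCommGroup N] [InnerProductSpace ℝ N]
  [FiniteDimensional ℝ N] {P Q : ConicalComplex X} {ι : X → N}

/-- The linear form `h` has a constant sign (in the weak sense) on each cone. -/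
def Signed (P : ConicalComplex X) (ι : X → N) (h : Module.Dual ℝ N) : Prop :=
  ∀ σ ∈ P.cones, (∀ x ∈ σ, 0 ≤ h (ι x)) ∨ ∀ x ∈ σ, h (ι x) ≤ 0

open Classical in
/-- The subdivision of a complex by a hyperplane. -/
def cut (hP : P.QuasiEmbeds ι) (h : Module.Dual ℝ N) : ConicalComplex X :=
  ofCones ι (Finset.image₂ (cell ι h) P.cones Finset.univ)
    (by
      intro _ hσ'
      obtain ⟨σ, hσ, b, -, rfl⟩ := Finset.mem_image₂.1 hσ'
      exact isEmbCone_cell (hP.isEmbCone hσ) b)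
    (fun x => by
      obtain ⟨σ, hσ, hx⟩ := hP.exists_ri x
      obtain ⟨b, hb⟩ := exists_mem_cell (h := h) (ι := ι) (ri_subset hx)
      exact ⟨_, Finset.mem_image₂_of_mem hσ (Finset.mem_univ b), hb⟩)
    (by
      intro _ hσ' τ hτ
      obtain ⟨σ, hσ, b, -, rfl⟩ := Finset.mem_image₂.1 hσ'
      obtain ⟨ρ, b', hρ, rfl⟩ := exists_cell_of_faceOf (hP.isEmbCone hσ).poly hτ
      exact Finset.mem_image₂_of_mem (hP.face_mem hσ hρ) (Finset.mem_univ b'))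
    (by
      intro _ hσ' _ hτ' x hxσ hxτ
      obtain ⟨σ, hσ, b, -, rfl⟩ := Finset.mem_image₂.1 hσ'
      obtain ⟨τ, hτ, b', -, rfl⟩ := Finset.mem_image₂.1 hτ'
      obtain ⟨ρ, hx, h1, h2⟩ := hP.exists_faces hσ hτ hxσ.1 hxτ.1
      by_cases hb : b = b'
      · subst hb
        exact ⟨cell ι h ρ b, ⟨hx, hxσ.2⟩, h1.cell (.inl rfl), h2.cell (.inl rfl)⟩
      -- Cells of different signs can only meet on the hyperplane, hence the cell of sign `0`.
      · refine ⟨cell ι h ρ 0, mem_cell_zero.2 ⟨hx, le_antisymm ?_ ?_⟩, h1.cell (.inr rfl),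
          h2.cell (.inr rfl)⟩
        · by_cases hb1 : b = 1
          · exact hxτ.2.2 (fun e => hb (hb1.trans e.symm))
          · exact hxσ.2.2 hb1
        · by_cases hb1 : b = -1
          · exact hxτ.2.1 (fun e => hb (hb1.trans e.symm))
          · exact hxσ.2.1 hb1)

section Cut

variable (hP : P.QuasiEmbeds ι) (h : Module.Dual ℝ N)

theorem mem_cut {σ : Set X} : σ ∈ (cut hP h).cones ↔ ∃ ρ ∈ P.cones, ∃ b, cell ι h ρ b = σ := by
  classical
  change σ ∈ Finset.image₂ (cell ι h) P.cones Finset.univ ↔ _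
  simp [Finset.mem_image₂]

theorem cut_quasiEmbeds : (cut hP h).QuasiEmbeds ι := by
  refine ⟨fun ℓ σ _ => mem_linearForms.2 ⟨ℓ, fun _ => rfl⟩, fun σ hσ => ?_⟩
  obtain ⟨ρ, hρ, b, rfl⟩ := (mem_cut hP h).1 hσ
  exact (hP.2 ρ hρ).mono cell_subset

theorem cut_isSubdivision : (cut hP h).IsSubdivision P := by
  rw [hP.isSubdivision_iff (cut_quasiEmbeds hP h)]
  intro σ hσ
  obtain ⟨ρ, hρ, b, rfl⟩ := (mem_cut hP h).1 hσ
  exact ⟨ρ, hρ, cell_subset⟩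

theorem cut_signed : (cut hP h).Signed ι h := by
  intro σ hσ
  obtain ⟨ρ, hρ, b, rfl⟩ := (mem_cut hP h).1 hσ
  by_cases hb : b = -1
  · exact .inr fun x hx => hx.2.2 (by rw [hb]; decide)
  · exact .inl fun x hx => hx.2.1 hb

end Cut

theorem IsSubdivision.refl (hP : P.QuasiEmbeds ι) : P.IsSubdivision P :=
  (hP.isSubdivision_iff hP).2 fun σ hσ => ⟨σ, hσ, Subset.rfl⟩

theorem IsSubdivision.trans {R : ConicalComplex X} (h : R.IsSubdivision Q)
    (h' : Q.IsSubdivision P) : R.IsSubdivision P := by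
  intro σ hσ
  obtain ⟨τ, hτ, h1, h2⟩ := h σ hσ
  obtain ⟨ρ, hρ, h3, h4⟩ := h' τ hτ
  refine ⟨ρ, hρ, h1.trans h3, ?_⟩
  rintro _ ⟨u, hu, rfl⟩
  exact h2 ⟨restr h3 u, h4 ⟨u, hu, rfl⟩, rfl⟩

theorem QuasiEmbeds.of_isSubdivision (hP : P.QuasiEmbeds ι) (h : Q.IsSubdivision P) :
    Q.QuasiEmbeds ι := by
  refine ⟨fun ℓ σ hσ => ?_, fun σ hσ => ?_⟩
  · obtain ⟨ρ, hρ, h1, h2⟩ := h σ hσ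
    exact h2 ⟨_, hP.1 ℓ ρ hρ, rfl⟩
  · obtain ⟨ρ, hρ, h1, h2⟩ := h σ hσ
    exact (hP.2 ρ hρ).mono h1

theorem LinearOn.of_isSubdivision {φ : X → ℝ} (hφ : P.LinearOn φ) (h : Q.IsSubdivision P) :
    Q.LinearOn φ := by
  intro σ hσ
  obtain ⟨ρ, hρ, h1, h2⟩ := h σ hσ
  exact h2 ⟨_, hφ ρ hρ, rfl⟩

theorem Signed.of_isSubdivision {ℓ : Module.Dual ℝ N} (hs : P.Signed ι ℓ)
    (h : Q.IsSubdivision P) : Q.Signed ι ℓ := by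
  intro σ hσ
  obtain ⟨ρ, hρ, h1, h2⟩ := h σ hσ
  exact (hs ρ hρ).imp (fun h x hx => h x (h1 hx)) fun h x hx => h x (h1 hx)

/-- A complex can be subdivided so that finitely many given linear forms have constant signs. -/
theorem exists_signed (hP : P.QuasiEmbeds ι) (H : List (Module.Dual ℝ N)) :
    ∃ Q : ConicalComplex X, Q.IsSubdivision P ∧ ∀ h ∈ H, Q.Signed ι h := by
  induction H with
  | nil => exact ⟨P, .refl hP, by simp⟩
  | cons h H ih =>
    obtain ⟨Q, hQ, hH⟩ := ih
    have hQ' := hP.of_isSubdivision hQ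
    refine ⟨cut hQ' h, (cut_isSubdivision hQ' h).trans hQ, fun ℓ hℓ => ?_⟩
    rcases List.mem_cons.1 hℓ with rfl | hℓ
    · exact cut_signed hQ' _
    · exact (hH ℓ hℓ).of_isSubdivision (cut_isSubdivision hQ' h)

theorem QuasiEmbeds.exists_ri_subset (hP : P.QuasiEmbeds ι) (h : Q.IsSubdivision P)
    {σ : Set X} (hσ : σ ∈ P.cones) {x : X} (hx : x ∈ σ) : ∃ τ ∈ Q.cones, x ∈ ri ι τ ∧ τ ⊆ σ := by
  have hQ := hP.of_isSubdivision h
  obtain ⟨τ, hτ, hxτ⟩ := hQ.exists_ri x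
  exact ⟨τ, hτ, hxτ, hP.subset_of_ri hQ h hτ hσ hxτ hx⟩

/-- For every subdivision `R` of `P` there are finitely many linear forms such that `R` is
subdivided by each subdivision of `P` on which they have constant signs. -/
theorem exists_forms (hP : P.QuasiEmbeds ι) {R : ConicalComplex X} (hR : R.IsSubdivision P) :
    ∃ H : List (Module.Dual ℝ N), ∀ Q : ConicalComplex X, Q.IsSubdivision P →
      (∀ h ∈ H, Q.Signed ι h) → Q.IsSubdivision R := by
  classical
  have hR' := hP.of_isSubdivision hR
  -- The required forms are those of the half-spaces that define the cones of `R`.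
  have := fun σ (hσ : σ ∈ R.cones) => (hR'.isEmbCone hσ).poly.exists_halfSpaces
  choose! L hL using this
  refine ⟨(R.cones.biUnion L).toList, fun Q hQ hs => ?_⟩
  have hQ' := hP.of_isSubdivision hQ
  rw [hR'.isSubdivision_iff hQ']
  intro ρ hρ
  obtain ⟨p, hp⟩ := (hQ'.isEmbCone hρ).exists_ri
  obtain ⟨σ, hσ, hρσ, -⟩ := hQ ρ hρ
  obtain ⟨τ, hτ, hpτ, hτσ⟩ := hP.exists_ri_subset hR hσ (hρσ (ri_subset hp))
  refine ⟨τ, hτ, fun y hy => ?_⟩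
  have : ι y ∈ ι '' τ := by
    rw [hL τ hτ]
    intro ℓ hℓ
    have hp0 : 0 ≤ ℓ (ι p) := (hL τ hτ _).1 (mem_image_of_mem _ (ri_subset hpτ)) ℓ hℓ
    -- A defining form of `τ` is nonnegative at the interior point `p` of `ρ`. If its constant sign
    -- on `ρ` is nonpositive, it vanishes at `p` and hence on `ρ`.
    rcases hs ℓ (by simp only [Finset.mem_toList, Finset.mem_biUnion]; exact ⟨τ, hτ, hℓ⟩) ρ hρ
      with h1 | h1
    · exact h1 y hy
    · have h2 := (mem_ri_iff.1 hp).2 (-ℓ) (fun z hz => by simpa using h1 z hz)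
        (by simpa using le_antisymm (h1 p (ri_subset hp)) hp0) y hy
      rw [LinearMap.neg_apply, neg_eq_zero] at h2
      exact h2.ge
  obtain ⟨z, hz, hzy⟩ := this
  rwa [← hP.2 σ hσ (hτσ hz) (hρσ hy) hzy]

end ConicalComplex

/-! ### Common subdivisions. -/

namespace EuclideanConicalSpace

variable {X N : Type*} [TopologicalSpace X] [NormedAddCommGroup N] [InnerProductSpace ℝ N]
  [FiniteDimensional ℝ N] (E : EuclideanConicalSpace X N)

theorem mem_R_of_isSubdivision {Q : ConicalComplex X} (h : Q.IsSubdivision E.base) : Q ∈ E.R :=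
  have hQ := E.quasiEmbeds.of_isSubdivision h
  ⟨⟨Q, .refl hQ, h⟩, hQ⟩

/-- Finitely many complexes have a common subdivision, on which moreover finitely many
linear forms have constant signs. -/
theorem exists_common (Ps : List (ConicalComplex X)) (hPs : ∀ P ∈ Ps, P ∈ E.R)
    (H : List (Module.Dual ℝ N)) : ∃ Q : ConicalComplex X, Q.IsSubdivision E.base ∧
      (∀ P ∈ Ps, Q.IsSubdivision P) ∧ ∀ h ∈ H, Q.Signed E.ι h := by
  -- Being fine enough is encoded by finitely many sign conditions on subdivisions of the base,
  -- which can simply be concatenated.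
  suffices h : ∃ H' : List (Module.Dual ℝ N), ∀ Q : ConicalComplex X, Q.IsSubdivision E.base →
      (∀ h ∈ H', Q.Signed E.ι h) → ∀ P ∈ Ps, Q.IsSubdivision P by
    obtain ⟨H', hH'⟩ := h
    obtain ⟨Q, hQ, hs⟩ := ConicalComplex.exists_signed E.quasiEmbeds (H' ++ H)
    exact ⟨Q, hQ, hH' Q hQ fun h hh => hs h (List.mem_append_left _ hh),
      fun h hh => hs h (List.mem_append_right _ hh)⟩
  induction Ps with
  | nil => exact ⟨[], by simp⟩
  | cons P Ps ih =>
    obtain ⟨H₁, h₁⟩ := ih fun P hP => hPs P (List.mem_cons_of_mem _ hP)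
    obtain ⟨R, hR, hRb⟩ := (hPs P List.mem_cons_self).1
    obtain ⟨H₂, h₂⟩ := ConicalComplex.exists_forms E.quasiEmbeds hRb
    refine ⟨H₂ ++ H₁, fun Q hQ hs P' hP' => ?_⟩
    rcases List.mem_cons.1 hP' with rfl | hP'
    · exact (h₂ Q hQ fun h hh => hs h (List.mem_append_left _ hh)).trans hR
    · exact h₁ Q hQ (fun h hh => hs h (List.mem_append_right _ hh)) P' hP'

end EuclideanConicalSpace


/-! ### Normal vectors -/

section Subspaces

variable {N : Type*} [NormedAddCommGroup N] [InnerProductSpace ℝ N] [FiniteDimensional ℝ N]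

/-- A linear form is represented on a subspace by a vector of this subspace. -/
theorem exists_inner_eq (S : Submodule ℝ N) (ℓ : Module.Dual ℝ N) :
    ∃ w ∈ S, ∀ q ∈ S, inner ℝ w q = ℓ q := by
  let w₀ : S := (InnerProductSpace.toDual ℝ S).symm
    (LinearMap.toContinuousLinearMap (ℓ ∘ₗ S.subtype))
  refine ⟨w₀, w₀.2, fun q hq => ?_⟩
  have := InnerProductSpace.toDual_symm_apply (𝕜 := ℝ) (x := (⟨q, hq⟩ : S))
    (y := LinearMap.toContinuousLinearMap (ℓ ∘ₗ S.subtype))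
  rw [Submodule.coe_inner] at this
  simpa using this

theorem exists_smul_of_finrank_eq_one {W : Submodule ℝ N} (hW : Module.finrank ℝ W = 1) {v w : N}
    (hv : v ∈ W) (hv0 : v ≠ 0) (hw : w ∈ W) : ∃ a : ℝ, w = a • v := by
  obtain ⟨a, ha⟩ := (finrank_eq_one_iff_of_nonzero' (⟨v, hv⟩ : W) (by simpa using hv0)).1 hW ⟨w, hw⟩
  exact ⟨a, (congrArg Subtype.val ha).symm⟩

theorem finrank_orthogonal_inf {T S : Submodule ℝ N} (hTS : T ≤ S) {k : ℕ}
    (hk : Module.finrank ℝ S = Module.finrank ℝ T + k) :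
    Module.finrank ℝ (Tᗮ ⊓ S : Submodule ℝ N) = k := by
  have := Submodule.finrank_add_inf_finrank_orthogonal hTS
  omega

end Subspaces

namespace EuclideanConicalSpace

variable {X N : Type*} [TopologicalSpace X] [NormedAddCommGroup N] [InnerProductSpace ℝ N]
  [FiniteDimensional ℝ N] (E : EuclideanConicalSpace X N)

variable {E} {σ τ : Set X} {v w : N}

theorem mem_orthogonal_iff : v ∈ (cspan E.ι τ)ᗮ ↔ ∀ x ∈ τ, inner ℝ v (E.ι x) = 0 := by
  rw [Submodule.mem_orthogonal']
  constructor
  · exact fun h x hx => h _ (mem_cspan hx)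
  · intro h q hq
    exact eq_zero_of_mem_cspan (ι := E.ι) (σ := τ) (ℓ := (innerₗ N v)) h hq

theorem IsNormal.mem (h : E.IsNormal σ τ v) : v ∈ (cspan E.ι τ)ᗮ ⊓ cspan E.ι σ :=
  ⟨mem_orthogonal_iff.2 h.2.2.1, h.2.1⟩

theorem IsNormal.ne_zero (h : E.IsNormal σ τ v) : v ≠ 0 := by
  rintro rfl
  have := h.1
  simp at this

theorem IsNormal.exists_pos (h : E.IsNormal σ τ v) : ∃ x ∈ σ, 0 < inner ℝ v (E.ι x) := by
  by_contra! hcon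
  have h0 : ∀ x ∈ σ, inner ℝ v (E.ι x) = 0 := fun x hx => le_antisymm (hcon x hx) (h.2.2.2 x hx)
  have := eq_zero_of_mem_cspan (ι := E.ι) (σ := σ) (ℓ := (innerₗ N v)) h0 h.2.1
  rw [innerₗ_apply_apply, inner_self_eq_zero] at this
  exact h.ne_zero this

/-- The normal is the normalized vector that represents, in the span of `σ`, the form cutting out
the face. -/
theorem exists_isNormal (hf : FaceOf E.ι τ σ) (hne : τ ≠ σ) : ∃ v, E.IsNormal σ τ v := by
  obtain ⟨ℓ, h0, h1⟩ := hf
  obtain ⟨w, hw, hℓ⟩ := exists_inner_eq (cspan E.ι σ) ℓ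
  have hw0 : w ≠ 0 := by
    rintro rfl
    apply hne
    rw [h1]
    ext x
    refine ⟨fun hx => hx.1, fun hx => ⟨hx, ?_⟩⟩
    rw [← hℓ _ (mem_cspan hx), inner_zero_left]
  have hn : 0 < ‖w‖ := norm_pos_iff.2 hw0
  refine ⟨‖w‖⁻¹ • w, ?_, Submodule.smul_mem _ _ hw, fun x hx => ?_, fun x hx => ?_⟩
  · rw [norm_smul, norm_inv, norm_norm, inv_mul_cancel₀ hn.ne']
  · rw [h1] at hx
    rw [real_inner_smul_left, hℓ _ (mem_cspan hx.1), hx.2, mul_zero]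
  · rw [real_inner_smul_left, hℓ _ (mem_cspan hx)]
    exact mul_nonneg (inv_nonneg.2 hn.le) (h0 x hx)

theorem eq_or_eq_neg_of_unit (hs : τ ⊆ σ) (hd : cdim E.ι σ = cdim E.ι τ + 1)
    (hv : v ∈ (cspan E.ι τ)ᗮ ⊓ cspan E.ι σ) (hv1 : ‖v‖ = 1)
    (hw : w ∈ (cspan E.ι τ)ᗮ ⊓ cspan E.ι σ) (hw1 : ‖w‖ = 1) : w = v ∨ w = -v := by
  have h1 := finrank_orthogonal_inf (cspan_mono (ι := E.ι) hs) hd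
  obtain ⟨a, rfl⟩ := exists_smul_of_finrank_eq_one h1 hv (norm_ne_zero_iff.1 (by rw [hv1]; simp)) hw
  rw [norm_smul, hv1, mul_one, Real.norm_eq_abs] at hw1
  rcases eq_or_eq_neg_of_abs_eq hw1 with rfl | rfl
  · left; rw [one_smul]
  · right; rw [neg_smul, one_smul]

theorem IsNormal.eq_of_inner_nonneg (h : E.IsNormal σ τ v) (hs : τ ⊆ σ)
    (hd : cdim E.ι σ = cdim E.ι τ + 1) (hw : w ∈ (cspan E.ι τ)ᗮ ⊓ cspan E.ι σ) (hw1 : ‖w‖ = 1)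
    (h0 : 0 ≤ inner ℝ v w) : w = v := by
  rcases eq_or_eq_neg_of_unit hs hd h.mem h.1 hw hw1 with h1 | h1
  · exact h1
  · rw [h1, inner_neg_right, real_inner_self_eq_norm_sq, h.1] at h0
    norm_num at h0

theorem IsNormal.unique (h : E.IsNormal σ τ v) (hw : E.IsNormal σ τ w) (hs : τ ⊆ σ)
    (hd : cdim E.ι σ = cdim E.ι τ + 1) : w = v := by
  rcases eq_or_eq_neg_of_unit hs hd h.mem h.1 hw.mem hw.1 with h1 | h1
  · exact h1
  · obtain ⟨x, hx, h2⟩ := h.exists_pos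
    have := hw.2.2.2 x hx
    rw [h1, inner_neg_left] at this
    linarith

theorem isNormal_normal (hf : FaceOf E.ι τ σ) (hd : cdim E.ι σ = cdim E.ι τ + 1) :
    E.IsNormal σ τ (E.normal σ τ) :=
  Classical.epsilon_spec (exists_isNormal hf (by rintro rfl; omega))

theorem normal_eq (hf : FaceOf E.ι τ σ) (hd : cdim E.ι σ = cdim E.ι τ + 1)
    (hv : E.IsNormal σ τ v) : E.normal σ τ = v :=
  hv.unique (isNormal_normal hf hd) hf.subset hd

theorem IsNormal.sub_mem (h : E.IsNormal σ τ v) (hs : τ ⊆ σ)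
    (hd : cdim E.ι σ = cdim E.ι τ + 1) {q : N} (hq : q ∈ cspan E.ι σ) :
    q - inner ℝ v q • v ∈ cspan E.ι τ := by
  have h1 := finrank_orthogonal_inf (cspan_mono (ι := E.ι) hs) hd
  have ht : q - (cspan E.ι τ).starProjection q ∈ (cspan E.ι τ)ᗮ ⊓ cspan E.ι σ :=
    ⟨Submodule.sub_starProjection_mem_orthogonal q, Submodule.sub_mem _ hq
      (cspan_mono hs (Submodule.starProjection_apply_mem _ q))⟩
  obtain ⟨a, ha⟩ := exists_smul_of_finrank_eq_one h1 h.mem h.ne_zero ht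
  have h2 : inner ℝ v ((cspan E.ι τ).starProjection q) = 0 :=
    (Submodule.mem_orthogonal' _ _).1 h.mem.1 _ (Submodule.starProjection_apply_mem _ q)
  have h3 : inner ℝ v q = a := by
    have := congrArg (inner ℝ v) ha
    rw [inner_sub_right, h2, sub_zero, real_inner_smul_right, real_inner_self_eq_norm_sq, h.1]
      at this
    simpa using this
  rw [h3, ← ha, sub_sub_cancel]
  exact Submodule.starProjection_apply_mem _ q

/-- Starting at a point in the relative interior of a facet, the normal vector points to the
relative interior of the cone. -/
theorem IsNormal.exists_ri (h : E.IsNormal σ τ v) (hf : FaceOf E.ι τ σ)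
    (hd : cdim E.ι σ = cdim E.ι τ + 1) (hτ : IsEmbCone E.ι τ) (hσ : IsEmbCone E.ι σ) {p : X}
    (hp : p ∈ ri E.ι τ) : ∃ ε : ℝ, 0 < ε ∧ ∀ t : ℝ, 0 < t → t ≤ ε →
      ∃ y ∈ ri E.ι σ, E.ι y = E.ι p + t • v := by
  obtain ⟨x₀, hx₀⟩ := hσ.exists_ri
  have ha : 0 < inner ℝ v (E.ι x₀) := by
    refine lt_of_le_of_ne (h.2.2.2 _ (ri_subset hx₀)) fun h0 => ?_
    obtain ⟨x, hx, h2⟩ := h.exists_pos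
    exact h2.ne' ((mem_ri_iff.1 hx₀).2 (innerₗ N v) (fun y hy => h.2.2.2 y hy) h0.symm x hx)
  set a := inner ℝ v (E.ι x₀)
  have hq := h.sub_mem hf.subset hd (mem_cspan (ri_subset hx₀))
  set q := E.ι x₀ - a • v with hqdef
  obtain ⟨ε, hε, h1⟩ := hτ.poly.exists_add_smul_mem hp.2 hq
  refine ⟨ε * a, by positivity, fun t ht htε => ?_⟩
  -- Since `ι x₀ = q + a • v` with `q` in the span of `τ`, the displaced point is a positive
  -- multiple of the interior point `ι x₀` plus a point of `τ` near `ι p`.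
  have h2 : E.ι p + t • v = (t / a) • E.ι x₀ + (E.ι p + (-(t / a)) • q) := by
    rw [hqdef, smul_sub, smul_smul, neg_mul, div_mul_cancel₀ _ ha.ne']; module
  have h3 : E.ι p + (-(t / a)) • q ∈ E.ι '' τ := by
    apply h1
    rw [abs_neg, abs_of_pos (by positivity), div_le_iff₀ ha]
    exact htε
  have h4 : E.ι p + t • v ∈ relint (E.ι '' σ) := by
    rw [h2]
    exact hσ.poly.add_mem_relint (hσ.poly.smul_mem_relint hx₀.2 (by positivity))
      (image_mono hf.subset h3)
  obtain ⟨y, hy, hy'⟩ := h4.1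
  exact ⟨y, ⟨hy, hy' ▸ h4⟩, hy'⟩

/-! ### Stars in subdivisions -/

section Star

variable {P Q : ConicalComplex X} (hP : P.QuasiEmbeds E.ι) (hQP : Q.IsSubdivision P)

include hP hQP

/-- Both cones contain in their relative interiors the point over `ι p + t • v` for small `t`, with
`p` interior to `τ`. It is the same point since `ι` is injective on `σ`. -/
theorem star_unique {σ₁ σ₂ : Set X} (hσ : σ ∈ P.cones) (hτ : τ ∈ Q.cones) (h₁ : σ₁ ∈ Q.cones)
    (h₂ : σ₂ ∈ Q.cones) (hs₁ : σ₁ ⊆ σ) (hs₂ : σ₂ ⊆ σ) (hf₁ : FaceOf E.ι τ σ₁)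
    (hf₂ : FaceOf E.ι τ σ₂) (hd₁ : cdim E.ι σ₁ = cdim E.ι τ + 1)
    (hd₂ : cdim E.ι σ₂ = cdim E.ι τ + 1) (hv₁ : E.IsNormal σ₁ τ v) (hv₂ : E.IsNormal σ₂ τ v) :
    σ₁ = σ₂ := by
  have hQ := hP.of_isSubdivision hQP
  obtain ⟨p, hp⟩ := (hQ.isEmbCone hτ).exists_ri
  obtain ⟨ε₁, hε₁, k₁⟩ := hv₁.exists_ri hf₁ hd₁ (hQ.isEmbCone hτ) (hQ.isEmbCone h₁) hp
  obtain ⟨ε₂, hε₂, k₂⟩ := hv₂.exists_ri hf₂ hd₂ (hQ.isEmbCone hτ) (hQ.isEmbCone h₂) hp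
  obtain ⟨y₁, hy₁, e₁⟩ := k₁ (min ε₁ ε₂) (lt_min hε₁ hε₂) (min_le_left _ _)
  obtain ⟨y₂, hy₂, e₂⟩ := k₂ (min ε₁ ε₂) (lt_min hε₁ hε₂) (min_le_right _ _)
  have : y₁ = y₂ := hP.2 σ hσ (hs₁ (ri_subset hy₁)) (hs₂ (ri_subset hy₂)) (e₁.trans e₂.symm)
  subst this
  exact hQ.eq_of_ri h₁ h₂ hy₁ hy₂

/-- As `t` tends to zero, the points over `ι p + t • v` run through finitely many cones, so one cone
contains infinitely many of them. Being closed it contains `p`, and so has `τ` as a face. -/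
theorem star_exists (hσ : σ ∈ P.cones) (hτ : τ ∈ Q.cones) {p : X} (hp : p ∈ ri E.ι τ)
    (hτσ : τ ⊆ σ) (hd : cdim E.ι σ = cdim E.ι τ + 1)
    (hv : v ∈ (cspan E.ι τ)ᗮ ⊓ cspan E.ι σ) (hv1 : ‖v‖ = 1) {ε : ℝ} (hε : 0 < ε)
    (hdir : ∀ t : ℝ, 0 < t → t ≤ ε → E.ι p + t • v ∈ E.ι '' σ) :
    ∃ σ' ∈ Q.cones, σ' ⊆ σ ∧ FaceOf E.ι τ σ' ∧ cdim E.ι σ' = cdim E.ι τ + 1 ∧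
      E.IsNormal σ' τ v := by
  have hQ := hP.of_isSubdivision hQP
  let t : ℕ → ℝ := fun k => ε / (k + 1)
  have ht0 : ∀ k, 0 < t k := fun k => by positivity
  have htε : ∀ k, t k ≤ ε := fun k => by
    apply div_le_self hε.le
    linarith [(Nat.cast_nonneg k : (0 : ℝ) ≤ k)]
  have htl : Tendsto t atTop (𝓝 0) := by
    have := (tendsto_one_div_add_atTop_nhds_zero_nat (𝕜 := ℝ)).const_mul ε
    simpa [t, div_eq_mul_inv] using this
  choose y hy hyt using fun k => hdir (t k) (ht0 k) (htε k)
  choose s hs hys hsσ using fun k => hP.exists_ri_subset hQP hσ (hy k)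
  obtain ⟨⟨σ', hσ'⟩, hinf⟩ := Finite.exists_infinite_fiber
    (fun k => (⟨s k, hs k⟩ : {x // x ∈ Q.cones}))
  have hfr : ∃ᶠ k in atTop, s k = σ' := by
    rw [Nat.frequently_atTop_iff_infinite]
    have := Set.infinite_coe_iff.1 hinf
    refine this.mono fun k hk => ?_
    exact congrArg Subtype.val hk
  obtain ⟨k, hk⟩ := hfr.exists
  have hσ'σ : σ' ⊆ σ := hk ▸ hsσ k
  have hyk : y k ∈ σ' := hk ▸ ri_subset (hys k)
  have hlim : Tendsto (fun k => E.ι (y k)) atTop (𝓝 (E.ι p)) := by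
    simp only [hyt]
    simpa using (htl.smul_const v).const_add (E.ι p)
  have hp' : E.ι p ∈ E.ι '' σ' :=
    (hQ.isEmbCone hσ').poly.isClosed.mem_of_frequently_of_tendsto
      (hfr.mono fun k hk => mem_image_of_mem _ (hk ▸ ri_subset (hys k))) hlim
  have hpσ' : p ∈ σ' := by
    obtain ⟨z, hz, hzp⟩ := hp'
    rwa [← hP.2 σ hσ (hσ'σ hz) (hτσ (ri_subset hp)) hzp]
  have hf := hQ.faceOf_of_ri hτ hσ' hp hpσ'
  have hvs : v ∈ cspan E.ι σ' := by
    have h1 : t k • v ∈ cspan E.ι σ' := by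
      have : t k • v = E.ι (y k) - E.ι p := by rw [hyt, add_sub_cancel_left]
      rw [this]
      exact Submodule.sub_mem _ (mem_cspan hyk) (mem_cspan hpσ')
    simpa [smul_smul, (ht0 k).ne'] using Submodule.smul_mem _ (t k)⁻¹ h1
  have hv0 : v ≠ 0 := norm_ne_zero_iff.1 (by rw [hv1]; simp)
  have hne : τ ≠ σ' := by
    rintro rfl
    have := (Submodule.mem_orthogonal' _ _).1 hv.1 v hvs
    exact hv0 (inner_self_eq_zero.1 this)
  have hd' : cdim E.ι σ' = cdim E.ι τ + 1 := by
    refine le_antisymm (hd ▸ cdim_mono hσ'σ) ?_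
    by_contra hlt
    exact hne (hf.eq_of_cdim_le (by omega))
  obtain ⟨v₀, hv₀⟩ := exists_isNormal hf hne
  refine ⟨σ', hσ', hσ'σ, hf, hd', ?_⟩
  rwa [hv₀.eq_of_inner_nonneg hf.subset hd' ⟨hv.1, hvs⟩ hv1]
  have h2 := hv₀.2.2.2 (y k) hyk
  rw [hyt, inner_add_right, hv₀.2.2.1 p (ri_subset hp), zero_add, real_inner_smul_right] at h2
  exact nonneg_of_mul_nonneg_right h2 (ht0 k)

end Star

/-! ### Products and subdivisions -/

section Inter

variable {P Q : ConicalComplex X} (hP : P.QuasiEmbeds E.ι)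

include hP

theorem linearPart_apply {φ : X → ℝ} (hφ : P.LinearOn φ) (hσ : σ ∈ P.cones) {x : X} (hx : x ∈ σ) :
    E.linearPart φ σ (E.ι x) = φ x := by
  obtain ⟨ℓ, hℓ⟩ := (hP.mem_M_iff hσ).1 (hφ σ hσ)
  have : ∃ ℓ : Module.Dual ℝ N, ∀ x ∈ σ, φ x = ℓ (E.ι x) := ⟨ℓ, fun x hx => hℓ ⟨x, hx⟩⟩
  exact (Classical.epsilon_spec this x hx).symm

theorem linearPart_eq {φ : X → ℝ} (hφ : P.LinearOn φ) (hσ : σ ∈ P.cones)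
    {ℓ : Module.Dual ℝ N} (h : ∀ x ∈ σ, φ x = ℓ (E.ι x)) {q : N} (hq : q ∈ cspan E.ι σ) :
    E.linearPart φ σ q = ℓ q :=
  eq_of_mem_cspan (fun x hx => (linearPart_apply hP hφ hσ hx).trans (h x hx)) hq

theorem linearPart_subset (hQP : Q.IsSubdivision P) {φ : X → ℝ} (hφ : P.LinearOn φ)
    (hσ : σ ∈ P.cones) (hτ : τ ∈ Q.cones) (hs : τ ⊆ σ) {q : N} (hq : q ∈ cspan E.ι τ) :
    E.linearPart φ τ q = E.linearPart φ σ q :=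
  linearPart_eq (hP.of_isSubdivision hQP) (hφ.of_isSubdivision hQP) hτ
    (fun _ hx => (linearPart_apply hP hφ hσ (hs hx)).symm) hq

theorem linearPart_face {φ : X → ℝ} (hφ : P.LinearOn φ)
    (hσ : σ ∈ P.cones) (hτ : τ ∈ P.cones) (hs : τ ⊆ σ) {q : N} (hq : q ∈ cspan E.ι τ) :
    E.linearPart φ τ q = E.linearPart φ σ q :=
  linearPart_eq hP hφ hτ (fun _ hx => (linearPart_apply hP hφ hσ (hs hx)).symm) hq

omit hP in
open Classical in
/-- The cones that have `τ` as a facet. -/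
def star (E : EuclideanConicalSpace X N) (P : ConicalComplex X) (τ : Set X) : Finset (Set X) :=
  P.cones.filter fun σ => FaceOf E.ι τ σ ∧ cdim E.ι σ = cdim E.ι τ + 1

omit hP in
theorem mem_star : σ ∈ E.star P τ ↔
    σ ∈ P.cones ∧ FaceOf E.ι τ σ ∧ cdim E.ι σ = cdim E.ι τ + 1 := by
  simp [star]

theorem inter_eq (φ : X → ℝ) (c : Set X → ℝ) (hτ : τ ∈ P.cones) :
    E.inter P φ c τ = ∑ σ ∈ E.star P τ, -(E.linearPart φ σ (E.normal σ τ)) * c σ := by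
  classical
  refine Finset.sum_congr (Finset.filter_congr fun σ hσ => ?_) fun _ _ => rfl
  rw [hP.face_iff hσ, hP.dim_eq hσ, hP.dim_eq hτ]

omit hP in
theorem inter_of_notMem (φ : X → ℝ) (c : Set X → ℝ) (hτ : τ ∉ P.cones) :
    E.inter P φ c τ = 0 := by
  classical
  refine Finset.sum_eq_zero fun σ hσ => ?_
  rw [Finset.mem_filter] at hσ
  exact absurd (P.face_mem σ hσ.1 τ hσ.2.1) hτ

variable (hQP : Q.IsSubdivision P)

include hQP

theorem ri_of_subset_of_cdim_eq (hσ : σ ∈ P.cones) (hτ : τ ∈ Q.cones) (hs : τ ⊆ σ)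
    (hd : cdim E.ι σ = cdim E.ι τ) {x : X} (hx : x ∈ ri E.ι τ) : x ∈ ri E.ι σ := by
  have hQ := hP.of_isSubdivision hQP
  obtain ⟨ρ, hρ, hxρ⟩ := hP.exists_ri x
  have h1 := hP.subset_of_ri hQ hQP hτ hρ hx (ri_subset hxρ)
  have h2 := hP.faceOf_of_ri hρ hσ hxρ (hs (ri_subset hx))
  rwa [← h2.eq_of_cdim_le (hd ▸ cdim_mono h1)]

theorem pullback_of_subset (c : Set X → ℝ) (hσ : σ ∈ P.cones) (hτ : τ ∈ Q.cones) (hs : τ ⊆ σ)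
    (hd : cdim E.ι σ = cdim E.ι τ) : P.pullback Q c τ = c σ := by
  have hQ := hP.of_isSubdivision hQP
  obtain ⟨x, hx⟩ := (hQ.isEmbCone hτ).exists_ri
  rw [hP.pullback_eq hQ hQP c hτ hσ hx (ri_of_subset_of_cdim_eq hP hQP hσ hτ hs hd hx), if_pos hd]

theorem exists_of_pullback_ne_zero {c : Set X → ℝ} (h : P.pullback Q c τ ≠ 0) :
    τ ∈ Q.cones ∧ ∃ σ ∈ P.cones, τ ⊆ σ ∧ cdim E.ι σ = cdim E.ι τ ∧ P.pullback Q c τ = c σ := by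
  have hQ := hP.of_isSubdivision hQP
  have hτ : τ ∈ Q.cones := by
    by_contra hτ
    exact h (if_neg hτ)
  obtain ⟨x, hx⟩ := (hQ.isEmbCone hτ).exists_ri
  obtain ⟨σ, hσ, hxσ⟩ := hP.exists_ri x
  rw [hP.pullback_eq hQ hQP c hτ hσ hx hxσ] at h ⊢
  have hd : cdim E.ι σ = cdim E.ι τ := by
    by_contra hd
    exact h (if_neg hd)
  exact ⟨hτ, σ, hσ, hP.subset_of_ri hQ hQP hτ hσ hx (ri_subset hxσ), hd, if_pos hd⟩

/-- Let `τ` be the carrier in `P` of the cone `τ'` of `Q`. If the dimensions agree, the weighted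
parts of the two stars correspond through their normal vectors. If `τ` has one dimension more, the
only weights come from the two halves of `τ` along `τ'`; their normals are opposite and `φ` is
linear on `τ`, so they cancel. If `τ` is still larger, nothing in the star carries weight. -/
theorem inter_pullback {φ : X → ℝ} (hφ : P.LinearOn φ) (c : Set X → ℝ) :
    E.inter Q φ (P.pullback Q c) = P.pullback Q (E.inter P φ c) := by
  have hQ := hP.of_isSubdivision hQP
  ext τ'
  by_cases hτ' : τ' ∈ Q.cones
  swap
  · rw [inter_of_notMem _ _ hτ', ConicalComplex.pullback, if_neg hτ']
  obtain ⟨p, hp⟩ := (hQ.isEmbCone hτ').exists_ri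
  obtain ⟨τ, hτ, hpτ⟩ := hP.exists_ri p
  have hττ : τ' ⊆ τ := hP.subset_of_ri hQ hQP hτ' hτ hp (ri_subset hpτ)
  rw [hP.pullback_eq hQ hQP _ hτ' hτ hp hpτ, inter_eq hQ _ _ hτ']
  have hle : cdim E.ι τ' ≤ cdim E.ι τ := cdim_mono hττ
  -- a cone of the star that carries a nonzero weight lies in a cone of the same dimension
  have key : ∀ σ' ∈ E.star Q τ', P.pullback Q c σ' ≠ 0 → ∃ σ ∈ P.cones, σ' ⊆ σ ∧
      FaceOf E.ι τ σ ∧ cdim E.ι σ = cdim E.ι τ' + 1 ∧ cdim E.ι σ' = cdim E.ι σ := by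
    intro σ' hσ' h0
    obtain ⟨h1, h2, h3⟩ := mem_star.1 hσ'
    obtain ⟨-, σ, hσ, hs, hd, -⟩ := exists_of_pullback_ne_zero hP hQP h0
    exact ⟨σ, hσ, hs, hP.faceOf_of_ri hτ hσ hpτ (hs (h2.subset (ri_subset hp))),
      hd.trans h3, hd.symm⟩
  by_cases hd : cdim E.ι τ = cdim E.ι τ'
  · rw [if_pos hd, inter_eq hP _ _ hτ]
    have hspan : cspan E.ι τ' = cspan E.ι τ :=
      Submodule.eq_of_le_of_finrank_le (cspan_mono hττ) hd.le
    have hex : ∀ σ ∈ E.star P τ, ∃ σ' ∈ Q.cones, σ' ⊆ σ ∧ FaceOf E.ι τ' σ' ∧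
        cdim E.ι σ' = cdim E.ι τ' + 1 ∧ E.IsNormal σ' τ' (E.normal σ τ) := by
      intro σ hσ
      obtain ⟨h1, h2, h3⟩ := mem_star.1 hσ
      have hn := isNormal_normal h2 h3
      obtain ⟨ε, hε, hy⟩ := hn.exists_ri h2 h3 (hP.isEmbCone hτ) (hP.isEmbCone h1) hpτ
      refine star_exists hP hQP h1 hτ' hp (hττ.trans h2.subset) (h3.trans (by rw [hd]))
        (hspan ▸ hn.mem) hn.1 hε fun t ht htε => ?_
      obtain ⟨y, hy, e⟩ := hy t ht htε
      exact ⟨y, ri_subset hy, e⟩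
    choose! e he1 he2 he3 he4 he5 using hex
    symm
    refine Finset.sum_of_injOn e ?_ ?_ ?_ ?_
    · intro σ₁ h₁ σ₂ h₂ h12
      obtain ⟨a1, a2, a3⟩ := mem_star.1 h₁
      obtain ⟨b1, b2, b3⟩ := mem_star.1 h₂
      obtain ⟨x, hx⟩ := (hQ.isEmbCone (he1 _ h₁)).exists_ri
      have k1 := ri_of_subset_of_cdim_eq hP hQP a1 (he1 _ h₁) (he2 _ h₁)
        (by rw [a3, he4 _ h₁, hd]) hx
      have k2 := ri_of_subset_of_cdim_eq hP hQP b1 (he1 _ h₂) (he2 _ h₂)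
        (by rw [b3, he4 _ h₂, hd]) (h12 ▸ hx)
      exact hP.eq_of_ri a1 b1 k1 k2
    · intro σ hσ
      exact mem_star.2 ⟨he1 σ hσ, he3 σ hσ, he4 σ hσ⟩
    · intro σ' hσ' hnot
      by_contra h0
      obtain ⟨σ, hσ, hs, hf, hd1, hd2⟩ := key σ' hσ' (right_ne_zero_of_mul h0)
      have hst : σ ∈ E.star P τ := mem_star.2 ⟨hσ, hf, by rw [hd1, hd]⟩
      obtain ⟨h1, h2, h3⟩ := mem_star.1 hσ'
      apply hnot
      refine ⟨σ, hst, ?_⟩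
      have hn := isNormal_normal hf (by rw [hd1, hd])
      have hn' : E.IsNormal σ' τ' (E.normal σ τ) := by
        refine ⟨hn.1, ?_, fun x hx => hn.2.2.1 x (hττ hx), fun x hx => hn.2.2.2 x (hs hx)⟩
        have : cspan E.ι σ' = cspan E.ι σ :=
          Submodule.eq_of_le_of_finrank_le (cspan_mono hs) hd2.ge
        exact (this ▸ hn.2.1 : E.normal σ τ ∈ cspan E.ι σ')
      exact star_unique hP hQP hσ hτ' (he1 σ hst) h1 (he2 σ hst) hs (he3 σ hst) h2 (he4 σ hst) h3
        (he5 σ hst) hn'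
    · intro σ hσ
      obtain ⟨h1, h2, h3⟩ := mem_star.1 hσ
      have hdσ : cdim E.ι σ = cdim E.ι (e σ) := by rw [h3, he4 σ hσ, hd]
      rw [pullback_of_subset hP hQP c h1 (he1 σ hσ) (he2 σ hσ) hdσ,
        normal_eq (he3 σ hσ) (he4 σ hσ) (he5 σ hσ),
        linearPart_subset hP hQP hφ h1 (he1 σ hσ) (he2 σ hσ) (he5 σ hσ).2.1]
  rw [if_neg hd]
  by_cases hd1 : cdim E.ι τ = cdim E.ι τ' + 1
  · have hW := finrank_orthogonal_inf (cspan_mono (ι := E.ι) hττ) hd1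
    obtain ⟨w, hw, hw0⟩ := Submodule.exists_mem_ne_zero_of_ne_bot
      (p := (cspan E.ι τ')ᗮ ⊓ cspan E.ι τ) (by intro h; rw [h] at hW; simp at hW)
    obtain ⟨v, hv, hv1⟩ : ∃ v ∈ (cspan E.ι τ')ᗮ ⊓ cspan E.ι τ, ‖v‖ = 1 :=
      ⟨‖w‖⁻¹ • w, Submodule.smul_mem _ _ hw, by
        rw [norm_smul, norm_inv, norm_norm, inv_mul_cancel₀ (norm_ne_zero_iff.2 hw0)]⟩
    have hdir := (hP.isEmbCone hτ).poly.exists_add_smul_mem hpτ.2 hv.2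
    obtain ⟨ε, hε, hdir⟩ := hdir
    obtain ⟨σ₁, a1, a2, a3, a4, a5⟩ := star_exists hP hQP hτ hτ' hp hττ hd1 hv hv1 hε
      fun t ht htε => hdir t (by rwa [abs_of_pos ht])
    obtain ⟨σ₂, b1, b2, b3, b4, b5⟩ := star_exists hP hQP hτ hτ' hp hττ hd1
      (v := -v) (Submodule.neg_mem _ hv) (by rwa [norm_neg]) hε
      fun t ht htε => by
        rw [smul_neg, ← neg_smul]; exact hdir (-t) (by rwa [abs_neg, abs_of_pos ht])
    have hne : σ₁ ≠ σ₂ := by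
      rintro rfl
      have := a5.unique b5 a3.subset a4
      have h2 : v = 0 := by
        have h3 : (2 : ℝ) • v = 0 := by rw [two_smul]; nth_rewrite 1 [← this]; simp
        simpa using h3
      exact a5.ne_zero h2
    rw [Finset.sum_eq_add_of_mem σ₁ σ₂ (mem_star.2 ⟨a1, a3, a4⟩) (mem_star.2 ⟨b1, b3, b4⟩) hne]
    · rw [normal_eq a3 a4 a5, normal_eq b3 b4 b5,
        linearPart_subset hP hQP hφ hτ a1 a2 a5.2.1, linearPart_subset hP hQP hφ hτ b1 b2 b5.2.1,
        pullback_of_subset hP hQP c hτ a1 a2 (hd1.trans a4.symm),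
        pullback_of_subset hP hQP c hτ b1 b2 (hd1.trans b4.symm), map_neg]
      ring
    · rintro σ' hσ' ⟨hn1, hn2⟩
      by_contra h0
      obtain ⟨σ, hσ, hs, hf, hd2, hd3⟩ := key σ' hσ' (right_ne_zero_of_mul h0)
      have hτσ : τ = σ := hf.eq_of_cdim_le (by omega)
      subst hτσ
      obtain ⟨h1, h2, h3⟩ := mem_star.1 hσ'
      have hn := isNormal_normal h2 h3
      have hm : E.normal σ' τ' ∈ (cspan E.ι τ')ᗮ ⊓ cspan E.ι τ :=
        ⟨hn.mem.1, cspan_mono hs hn.2.1⟩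
      rcases eq_or_eq_neg_of_unit hττ hd1 hv hv1 hm hn.1 with h4 | h4
      · exact hn1 (star_unique hP hQP hτ hτ' h1 a1 hs a2 h2 a3 h3 a4 (h4 ▸ hn) a5)
      · exact hn2 (star_unique hP hQP hτ hτ' h1 b1 hs b2 h2 b3 h3 b4 (h4 ▸ hn) b5)
  · refine Finset.sum_eq_zero fun σ' hσ' => ?_
    by_contra h0
    obtain ⟨σ, hσ, hs, hf, hd2, hd3⟩ := key σ' hσ' (right_ne_zero_of_mul h0)
    have := cdim_mono (ι := E.ι) hf.subset
    omega

theorem foldr_inter_pullback {φs : List (X → ℝ)} (hφ : ∀ φ ∈ φs, P.LinearOn φ) (c : Set X → ℝ) :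
    φs.foldr (E.inter Q) (P.pullback Q c) = P.pullback Q (φs.foldr (E.inter P) c) := by
  induction φs with
  | nil => rfl
  | cons φ φs ih =>
    rw [List.foldr_cons, List.foldr_cons, ih fun ψ hψ => hφ ψ (List.mem_cons_of_mem _ hψ),
      inter_pullback hP hQP (hφ φ List.mem_cons_self)]

theorem pullback_pullback {R : ConicalComplex X} (hRQ : R.IsSubdivision Q) (c : Set X → ℝ) :
    Q.pullback R (P.pullback Q c) = P.pullback R c := by
  have hQ := hP.of_isSubdivision hQP
  have hR := hQ.of_isSubdivision hRQ
  ext ρ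
  by_cases hρ : ρ ∈ R.cones
  swap
  · rw [ConicalComplex.pullback, if_neg hρ, ConicalComplex.pullback, if_neg hρ]
  obtain ⟨x, hx⟩ := (hR.isEmbCone hρ).exists_ri
  obtain ⟨τ, hτ, hxτ⟩ := hQ.exists_ri x
  obtain ⟨σ, hσ, hxσ⟩ := hP.exists_ri x
  rw [hQ.pullback_eq hR hRQ _ hρ hτ hx hxτ, hP.pullback_eq hQ hQP _ hτ hσ hxτ hxσ,
    hP.pullback_eq hR (hRQ.trans hQP) _ hρ hσ hx hxσ]
  have h1 := cdim_mono (ι := E.ι) (hQ.subset_of_ri hR hRQ hρ hτ hx (ri_subset hxτ))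
  have h2 := cdim_mono (ι := E.ι) (hP.subset_of_ri hQ hQP hτ hσ hxτ (ri_subset hxσ))
  split_ifs <;> first | rfl | omega

end Inter

end EuclideanConicalSpace


/-! ### Faces of codimension two and commutativity of the product -/

namespace EuclideanConicalSpace

variable {X N : Type*} [TopologicalSpace X] [NormedAddCommGroup N] [InnerProductSpace ℝ N]
  [FiniteDimensional ℝ N] {E : EuclideanConicalSpace X N} {σ τ : Set X}

/-- A cone has exactly two facets that contain a given face of codimension two. -/
theorem exists_two_facets (hσ : IsEmbCone E.ι σ) (hf : FaceOf E.ι τ σ)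
    (hd : cdim E.ι σ = cdim E.ι τ + 2) : ∃ ρ₁ ρ₂ : Set X, ρ₁ ≠ ρ₂ ∧
      ∀ ρ, (FaceOf E.ι ρ σ ∧ τ ⊆ ρ ∧ cdim E.ι ρ = cdim E.ι τ + 1) ↔ ρ = ρ₁ ∨ ρ = ρ₂ := by
  -- Modulo the span of `τ` the cone is a pointed sector in the plane `W`. The form `ℓ` is positive
  -- off `τ`, and `m` is a second coordinate; the facets sought are the two sides of the sector,
  -- where the slope `m / ℓ` takes its extreme values over the generators.
  classical
  set S := cspan E.ι σ
  set T := cspan E.ι τ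
  have hTS : T ≤ S := cspan_mono hf.subset
  have hW : Module.finrank ℝ (Tᗮ ⊓ S : Submodule ℝ N) = 2 := finrank_orthogonal_inf hTS hd
  set W := Tᗮ ⊓ S
  -- linear forms that vanish on `τ` are represented by vectors of `W`
  have rep : ∀ u : Module.Dual ℝ N, (∀ x ∈ τ, u (E.ι x) = 0) →
      ∃ w ∈ W, ∀ q ∈ S, inner ℝ w q = u q := by
    intro u hu
    obtain ⟨w, hw, h⟩ := exists_inner_eq S u
    exact ⟨w, ⟨mem_orthogonal_iff.2 fun x hx => (h _ (hTS (mem_cspan hx))).trans (hu x hx), hw⟩, h⟩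
  obtain ⟨ℓ, hℓ0, hℓτ⟩ := hf
  have hτ0 : ∀ x ∈ τ, ℓ (E.ι x) = 0 := fun x hx => by rw [hℓτ] at hx; exact hx.2
  have hτσ : τ ⊆ σ := fun x hx => by rw [hℓτ] at hx; exact hx.1
  have hτmem : ∀ x ∈ σ, ℓ (E.ι x) = 0 → x ∈ τ := fun x hx h => by rw [hℓτ]; exact ⟨hx, h⟩
  obtain ⟨wℓ, hwℓ, hwℓ'⟩ := rep ℓ hτ0
  have hwℓ0 : wℓ ≠ 0 := by
    rintro rfl
    have : σ ⊆ τ := fun x hx => hτmem x hx (by rw [← hwℓ' _ (mem_cspan hx), inner_zero_left])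
    have := cdim_mono (ι := E.ι) this
    omega
  have hW1 : Module.finrank ℝ ((ℝ ∙ wℓ)ᗮ ⊓ W : Submodule ℝ N) = 1 :=
    finrank_orthogonal_inf ((Submodule.span_singleton_le_iff_mem _ _).2 hwℓ)
      (by rw [hW, finrank_span_singleton hwℓ0])
  obtain ⟨wm, hwm, hwm0⟩ := Submodule.exists_mem_ne_zero_of_ne_bot
      (p := (ℝ ∙ wℓ)ᗮ ⊓ W) (by intro h; rw [h] at hW1; simp at hW1)
  have horth : inner ℝ wℓ wm = 0 :=
    (Submodule.mem_orthogonal _ _).1 hwm.1 _ (Submodule.mem_span_singleton_self _)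
  let m : Module.Dual ℝ N := innerₗ N wm
  have hmτ : ∀ x ∈ τ, m (E.ι x) = 0 := mem_orthogonal_iff.1 hwm.2.1
  have comb : ∀ u : Module.Dual ℝ N, (∀ x ∈ τ, u (E.ι x) = 0) →
      ∃ α β : ℝ, ∀ x ∈ σ, u (E.ι x) = α * ℓ (E.ι x) + β * m (E.ι x) := by
    intro u hu
    obtain ⟨w, hw, h⟩ := rep u hu
    set α := inner ℝ wℓ w / inner ℝ wℓ wℓ
    have hne : inner ℝ wℓ wℓ ≠ (0 : ℝ) := by simpa using hwℓ0
    have h1 : w - α • wℓ ∈ (ℝ ∙ wℓ)ᗮ ⊓ W := by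
      refine ⟨?_, Submodule.sub_mem _ hw (Submodule.smul_mem _ _ hwℓ)⟩
      rw [SetLike.mem_coe, Submodule.mem_orthogonal_singleton_iff_inner_right, inner_sub_right,
        real_inner_smul_right, div_mul_cancel₀ _ hne, sub_self]
    obtain ⟨β, hβ⟩ := exists_smul_of_finrank_eq_one hW1 hwm hwm0 h1
    refine ⟨α, β, fun x hx => ?_⟩
    have h2 : w = α • wℓ + β • wm := by rw [← hβ]; abel
    rw [← h _ (mem_cspan hx), h2, inner_add_left, real_inner_smul_left, real_inner_smul_left,
      hwℓ' _ (mem_cspan hx)]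
    rfl
  have indep : ∀ α β : ℝ, (∀ x ∈ σ, α * ℓ (E.ι x) + β * m (E.ι x) = 0) → β = 0 := by
    intro α β h
    have h1 : ∀ q ∈ S, inner ℝ (α • wℓ + β • wm) q = (0 : ℝ) := fun q hq => by
      refine eq_zero_of_mem_cspan (ι := E.ι) (σ := σ) (ℓ := innerₗ N (α • wℓ + β • wm))
        (fun x hx => ?_) hq
      rw [innerₗ_apply_apply, inner_add_left, real_inner_smul_left, real_inner_smul_left,
        hwℓ' _ (mem_cspan hx)]
      exact h x hx
    have h2 := h1 wm hwm.2.2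
    rw [inner_add_left, real_inner_smul_left, real_inner_smul_left, horth, mul_zero, zero_add] at h2
    exact (mul_eq_zero.1 h2).resolve_right (by simpa using hwm0)
  obtain ⟨s, hs, hgen⟩ := hσ.poly.exists_generators
  have hsσ : ∀ g ∈ s, ∃ x ∈ σ, E.ι x = g := hs
  let G := s.filter fun g => 0 < ℓ g
  have hℓs : ∀ g ∈ s, 0 ≤ ℓ g := fun g hg => by
    obtain ⟨x, hx, rfl⟩ := hsσ g hg
    exact hℓ0 x hx
  have hms : ∀ g ∈ s, g ∉ G → ℓ g = 0 ∧ m g = 0 := by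
    intro g hg hgG
    have h0 : ℓ g = 0 := le_antisymm
      (not_lt.1 fun h => hgG (Finset.mem_filter.2 ⟨hg, h⟩)) (hℓs g hg)
    obtain ⟨x, hx, rfl⟩ := hsσ g hg
    exact ⟨h0, hmτ x (hτmem x hx h0)⟩
  -- a form vanishing on `τ` is tested on the generators in `G`
  have test : ∀ α β : ℝ, (∀ g ∈ G, 0 ≤ α + β * (m g / ℓ g)) →
      ∀ x ∈ σ, 0 ≤ α * ℓ (E.ι x) + β * m (E.ι x) := by
    intro α β h x hx
    obtain ⟨a, ha, hax⟩ := (hgen _).1 (mem_image_of_mem E.ι hx)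
    have e : α * ℓ (E.ι x) + β * m (E.ι x) = ∑ g ∈ s, a g * (α * ℓ g + β * m g) := by
      rw [hax]
      simp only [map_sum, map_smul, smul_eq_mul, Finset.mul_sum, ← Finset.sum_add_distrib]
      exact Finset.sum_congr rfl fun g _ => by ring
    rw [e]
    refine Finset.sum_nonneg fun g hg => mul_nonneg (ha g) ?_
    by_cases hgG : g ∈ G
    · have h1 := (Finset.mem_filter.1 hgG).2
      have h2 := mul_nonneg (h g hgG) h1.le
      rwa [add_mul, mul_assoc, div_mul_cancel₀ _ h1.ne'] at h2
    · obtain ⟨h1, h2⟩ := hms g hg hgG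
      rw [h1, h2]; simp
  have hGne : G.Nonempty := by
    rw [Finset.nonempty_iff_ne_empty]
    intro h
    have h1 := test (-1) 0 (by simp [h])
    have : σ ⊆ τ := fun x hx => hτmem x hx (le_antisymm (by have := h1 x hx; linarith) (hℓ0 x hx))
    have := cdim_mono (ι := E.ι) this
    omega
  obtain ⟨g₁, hg₁, hmin⟩ := G.exists_min_image (fun g => m g / ℓ g) hGne
  obtain ⟨g₂, hg₂, hmax⟩ := G.exists_max_image (fun g => m g / ℓ g) hGne
  set r₁ := m g₁ / ℓ g₁
  set r₂ := m g₂ / ℓ g₂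
  have hu₁ := test (-r₁) 1 fun g hg => by have := hmin g hg; linarith
  have hu₂ := test r₂ (-1) fun g hg => by have := hmax g hg; linarith
  have hr : r₁ < r₂ := by
    refine lt_of_le_of_ne (hmin g₂ hg₂) fun h => ?_
    have := indep (-r₁) 1 fun x hx => by
      have h1 := hu₁ x hx
      have h2 := hu₂ x hx
      rw [← h] at h2
      linarith
    exact one_ne_zero this
  let ρ₁ : Set X := {x | x ∈ σ ∧ (-r₁ • ℓ + m) (E.ι x) = 0}
  let ρ₂ : Set X := {x | x ∈ σ ∧ (r₂ • ℓ - m) (E.ι x) = 0}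
  have hρ₁ : FaceOf E.ι ρ₁ σ := ⟨_, fun x hx => by
    have := hu₁ x hx
    simp only [LinearMap.add_apply, LinearMap.smul_apply, smul_eq_mul]; linarith, rfl⟩
  have hρ₂ : FaceOf E.ι ρ₂ σ := ⟨_, fun x hx => by
    have := hu₂ x hx
    simp only [LinearMap.sub_apply, LinearMap.smul_apply, smul_eq_mul]; linarith, rfl⟩
  have dimlem : ∀ ρ, FaceOf E.ι ρ σ → τ ⊆ ρ → (∃ x ∈ ρ, ℓ (E.ι x) ≠ 0) → (∃ x ∈ σ, x ∉ ρ) →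
      cdim E.ι ρ = cdim E.ι τ + 1 := by
    rintro ρ hρ hτρ ⟨x, hx, hx0⟩ ⟨y, hy, hyρ⟩
    have hf : FaceOf E.ι τ σ := ⟨ℓ, hℓ0, hℓτ⟩
    have h1 : ¬ cdim E.ι σ ≤ cdim E.ι ρ := fun h => hyρ (hρ.eq_of_cdim_le h ▸ hy)
    have h2 : ¬ cdim E.ι ρ ≤ cdim E.ι τ := fun h =>
      hx0 (hτ0 x ((hf.mono hτρ hρ.subset).eq_of_cdim_le h ▸ hx))
    omega
  have hτρ₁ : τ ⊆ ρ₁ := fun x hx => ⟨hτσ hx, by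
    simp [hτ0 x hx, hmτ x hx]⟩
  have hτρ₂ : τ ⊆ ρ₂ := fun x hx => ⟨hτσ hx, by
    simp [hτ0 x hx, hmτ x hx]⟩
  have hd₁ : cdim E.ι ρ₁ = cdim E.ι τ + 1 := by
    refine dimlem ρ₁ hρ₁ hτρ₁ ?_ ?_
    · obtain ⟨h1, h2⟩ := Finset.mem_filter.1 hg₁
      obtain ⟨x, hx, e⟩ := hsσ g₁ h1
      refine ⟨x, ⟨hx, ?_⟩, by rw [e]; exact h2.ne'⟩
      rw [e]
      simp only [LinearMap.add_apply, LinearMap.smul_apply, smul_eq_mul, r₁]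
      rw [neg_mul, div_mul_cancel₀ _ h2.ne', neg_add_cancel]
    · by_contra! h
      refine one_ne_zero (indep (-r₁) 1 fun x hx => ?_)
      have := (h x hx).2
      simp only [LinearMap.add_apply, LinearMap.smul_apply, smul_eq_mul] at this
      linarith
  have hd₂ : cdim E.ι ρ₂ = cdim E.ι τ + 1 := by
    refine dimlem ρ₂ hρ₂ hτρ₂ ?_ ?_
    · obtain ⟨h1, h2⟩ := Finset.mem_filter.1 hg₂
      obtain ⟨x, hx, e⟩ := hsσ g₂ h1
      refine ⟨x, ⟨hx, ?_⟩, by rw [e]; exact h2.ne'⟩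
      rw [e]
      simp only [LinearMap.sub_apply, LinearMap.smul_apply, smul_eq_mul, r₂]
      rw [div_mul_cancel₀ _ h2.ne', sub_self]
    · by_contra! h
      have : (-1 : ℝ) = 0 := indep r₂ (-1) fun x hx => by
        have := (h x hx).2
        simp only [LinearMap.sub_apply, LinearMap.smul_apply, smul_eq_mul] at this
        linarith
      norm_num at this
  refine ⟨ρ₁, ρ₂, ?_, fun ρ => ⟨?_, ?_⟩⟩
  · intro h
    have : ρ₁ ⊆ τ := fun x hx => by
      have h1 := hx.2
      have h2 := (h ▸ hx : x ∈ ρ₂).2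
      simp only [LinearMap.add_apply, LinearMap.sub_apply, LinearMap.smul_apply, smul_eq_mul]
        at h1 h2
      refine hτmem x hx.1 ?_
      have h3 : (r₂ - r₁) * ℓ (E.ι x) = 0 := by linarith
      exact (mul_eq_zero.1 h3).resolve_left (by linarith)
    have := cdim_mono (ι := E.ι) this
    omega
  · rintro ⟨⟨u, hu0, hρ⟩, hτρ, hdρ⟩
    have huτ : ∀ x ∈ τ, u (E.ι x) = 0 := fun x hx => by
      have := hτρ hx
      rw [hρ] at this
      exact this.2
    obtain ⟨α, β, hαβ⟩ := comb u huτ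
    have hGu : ∀ g ∈ G, 0 ≤ α + β * (m g / ℓ g) := by
      intro g hg
      obtain ⟨h1, h2⟩ := Finset.mem_filter.1 hg
      obtain ⟨x, hx, rfl⟩ := hsσ g h1
      have h3 := hu0 x hx
      rw [hαβ x hx] at h3
      have h4 : α + β * (m (E.ι x) / ℓ (E.ι x)) =
          (α * ℓ (E.ι x) + β * m (E.ι x)) / ℓ (E.ι x) := by field_simp
      rw [h4]
      exact div_nonneg h3 h2.le
    -- If the form were positive at every generator in `G`, a positive multiple of `ℓ` could be
    -- subtracted from it, and its zero locus would reduce to `τ`.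
    obtain ⟨g, hg, hgu⟩ : ∃ g ∈ G, α + β * (m g / ℓ g) = 0 := by
      by_contra! hcon
      have hpos : ∀ g ∈ G, 0 < α + β * (m g / ℓ g) := fun g hg =>
        lt_of_le_of_ne (hGu g hg) (Ne.symm (hcon g hg))
      obtain ⟨g₀, hg₀, hg₀min⟩ := G.exists_min_image (fun g => α + β * (m g / ℓ g)) hGne
      have h1 := test (α - (α + β * (m g₀ / ℓ g₀))) β fun g hg => by
        have := hg₀min g hg; linarith
      have : ρ ⊆ τ := fun x hx => by
        rw [hρ] at hx
        have h2 := h1 x hx.1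
        have h3 := hx.2
        rw [hαβ x hx.1] at h3
        refine hτmem x hx.1 (le_antisymm ?_ (hℓ0 x hx.1))
        have h4 : (α + β * (m g₀ / ℓ g₀)) * ℓ (E.ι x) ≤ 0 := by linarith
        exact nonpos_of_mul_nonpos_right h4 (hpos g₀ hg₀)
      have := cdim_mono (ι := E.ι) this
      omega
    have hρ' : ρ = {x | x ∈ σ ∧ α * ℓ (E.ι x) + β * m (E.ι x) = 0} := by
      rw [hρ]
      ext x
      exact and_congr_right fun hx => by rw [hαβ x hx]
    rcases lt_trichotomy β 0 with hβ | hβ | hβ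
    · right
      have h1 : m g / ℓ g = r₂ := by
        refine le_antisymm (hmax g hg) ?_
        have h2 := hGu g₂ hg₂
        have h3 : β * (m g / ℓ g) ≤ β * r₂ := by linarith
        exact (mul_le_mul_left_of_neg hβ).1 h3
      rw [hρ']
      ext x
      refine and_congr_right fun _ => ?_
      have h2 : α = -β * r₂ := by rw [h1] at hgu; linarith
      have h3 : α * ℓ (E.ι x) + β * m (E.ι x) = -β * ((r₂ • ℓ - m) (E.ι x)) := by
        simp only [LinearMap.sub_apply, LinearMap.smul_apply, smul_eq_mul]; rw [h2]; ring
      rw [h3, mul_eq_zero]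
      exact ⟨fun h => h.resolve_left (by linarith), Or.inr⟩
    · exfalso
      rw [hβ, zero_mul, add_zero] at hgu
      have : σ ⊆ ρ := fun x hx => by rw [hρ']; exact ⟨hx, by rw [hgu, hβ]; ring⟩
      have := cdim_mono (ι := E.ι) this
      omega
    · left
      have h1 : m g / ℓ g = r₁ := by
        refine le_antisymm ?_ (hmin g hg)
        have h2 := hGu g₁ hg₁
        have h3 : β * (m g / ℓ g) ≤ β * r₁ := by linarith
        exact le_of_mul_le_mul_left h3 hβ
      rw [hρ']
      ext x
      refine and_congr_right fun _ => ?_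
      have h2 : α = -β * r₁ := by rw [h1] at hgu; linarith
      have h3 : α * ℓ (E.ι x) + β * m (E.ι x) = β * ((-r₁ • ℓ + m) (E.ι x)) := by
        simp only [LinearMap.add_apply, LinearMap.smul_apply, smul_eq_mul]; rw [h2]; ring
      rw [h3, mul_eq_zero]
      exact ⟨fun h => h.resolve_left (by linarith), Or.inr⟩
  · rintro (rfl | rfl)
    · exact ⟨hρ₁, hτρ₁, hd₁⟩
    · exact ⟨hρ₂, hτρ₂, hd₂⟩

/-- The normal vector of a cone relative to a facet `ρ₁`, in terms of the normal vectors of `ρ₁` and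
of a second facet `ρ₂` relative to a common face of codimension two. -/
theorem normal_eq_of_two_facets {ρ₁ ρ₂ : Set X} {a₁ a₂ b : N} (h₁ : FaceOf E.ι ρ₁ σ)
    (h₂ : FaceOf E.ι ρ₂ σ) (hτ₁ : τ ⊆ ρ₁) (hτ₂ : τ ⊆ ρ₂) (hne : ρ₁ ≠ ρ₂)
    (hd₁ : cdim E.ι ρ₁ = cdim E.ι τ + 1) (hd₂ : cdim E.ι ρ₂ = cdim E.ι τ + 1)
    (hd : cdim E.ι σ = cdim E.ι τ + 2) (ha₁ : E.IsNormal ρ₁ τ a₁) (ha₂ : E.IsNormal ρ₂ τ a₂)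
    (hb : E.IsNormal σ ρ₁ b) :
    0 < √(1 - inner ℝ a₁ a₂ ^ 2) ∧
      b = (√(1 - inner ℝ a₁ a₂ ^ 2))⁻¹ • (a₂ - inner ℝ a₁ a₂ • a₁) := by
  set x : ℝ := inner ℝ a₁ a₂
  -- The component of `a₂` orthogonal to `a₁` is orthogonal to all of `ρ₁` and lies on the side of
  -- `σ`. Its norm is the sine of the angle between the facets, nonzero because they have different
  -- spans.
  set u := a₂ - x • a₁ with hu
  have hdσ : cdim E.ι σ = cdim E.ι ρ₁ + 1 := by omega
  have ha₁σ : a₁ ∈ cspan E.ι σ := cspan_mono h₁.subset ha₁.2.1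
  have ha₂σ : a₂ ∈ cspan E.ι σ := cspan_mono h₂.subset ha₂.2.1
  have hinner : inner ℝ a₁ u = (0 : ℝ) := by
    rw [hu, inner_sub_right, real_inner_smul_right, real_inner_self_eq_norm_sq, ha₁.1]
    simp [x]
  have huW : u ∈ (cspan E.ι ρ₁)ᗮ ⊓ cspan E.ι σ := by
    refine ⟨?_, Submodule.sub_mem _ ha₂σ (Submodule.smul_mem _ _ ha₁σ)⟩
    rw [SetLike.mem_coe, Submodule.mem_orthogonal']
    intro q hq
    have h3 := ha₁.sub_mem hτ₁ hd₁ hq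
    have h4 : u ∈ (cspan E.ι τ)ᗮ :=
      Submodule.sub_mem _ ha₂.mem.1 (Submodule.smul_mem _ _ ha₁.mem.1)
    have h5 := (Submodule.mem_orthogonal' _ _).1 h4 _ h3
    rw [inner_sub_right, real_inner_smul_right, real_inner_comm a₁ u, hinner, mul_zero, sub_zero]
      at h5
    exact h5
  have hu0 : u ≠ 0 := by
    intro h0
    have h3 : a₂ = x • a₁ := sub_eq_zero.1 h0
    apply hne
    have h4 : cspan E.ι ρ₂ ≤ cspan E.ι ρ₁ := fun q hq => by
      have := ha₂.sub_mem hτ₂ hd₂ hq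
      have h6 : q = (q - inner ℝ a₂ q • a₂) + inner ℝ a₂ q • a₂ := by abel
      rw [h6]
      refine Submodule.add_mem _ (cspan_mono hτ₁ this) (Submodule.smul_mem _ _ ?_)
      rw [h3]
      exact Submodule.smul_mem _ _ ha₁.2.1
    have h5 : ρ₂ ⊆ ρ₁ := fun y hy => h₁.mem_of_mem_cspan (h₂.subset hy) (h4 (mem_cspan hy))
    exact ((h₂.mono h5 h₁.subset).eq_of_cdim_le (by omega)).symm
  have hnorm : ‖u‖ ^ 2 = 1 - x ^ 2 := by
    rw [← real_inner_self_eq_norm_sq]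
    nth_rewrite 1 [hu]
    rw [inner_sub_left, real_inner_smul_left, hinner, mul_zero, sub_zero, hu, inner_sub_right,
      real_inner_smul_right, real_inner_self_eq_norm_sq, ha₂.1, real_inner_comm]
    ring
  have hsqrt : √(1 - x ^ 2) = ‖u‖ := by rw [← hnorm, Real.sqrt_sq (norm_nonneg _)]
  have hn : 0 < ‖u‖ := norm_pos_iff.2 hu0
  rw [hsqrt]
  refine ⟨hn, ?_⟩
  symm
  refine hb.eq_of_inner_nonneg h₁.subset hdσ (Submodule.smul_mem _ _ huW) ?_ ?_
  · rw [norm_smul, norm_inv, norm_norm, inv_mul_cancel₀ hn.ne']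
  · rw [real_inner_smul_right]
    refine mul_nonneg (inv_nonneg.2 hn.le) ?_
    have hba : inner ℝ b a₁ = (0 : ℝ) := (Submodule.mem_orthogonal' _ _).1 hb.mem.1 _ ha₁.2.1
    rw [hu, inner_sub_right, real_inner_smul_right, hba, mul_zero, sub_zero]
    obtain ⟨y, hy, hy0⟩ := ha₂.exists_pos
    have h3 := ha₂.sub_mem hτ₂ hd₂ (mem_cspan hy)
    have h4 := (Submodule.mem_orthogonal' _ _).1 hb.mem.1 _ (cspan_mono hτ₁ h3)
    rw [inner_sub_right, real_inner_smul_right, sub_eq_zero] at h4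
    have h5 := hb.2.2.2 y (h₂.subset hy)
    rw [h4] at h5
    exact nonneg_of_mul_nonneg_right h5 hy0

/-- Both sides are sums over the cones `σ` above `τ` in codimension two, with two terms for the two
intermediate facets. If `a₁, a₂` are their normals and `x`, `s` the cosine and sine of the angle
between these, the factor of `c σ` is `s⁻¹` times `φ(a₁) (ψ(a₂) - x ψ(a₁)) + φ(a₂) (ψ(a₁) - x
ψ(a₂))`, which is symmetric in `φ` and `ψ`. The argument works for each `σ` separately, so the
weight need not be balanced. -/
theorem inter_comm {P : ConicalComplex X} (hP : P.QuasiEmbeds E.ι) {φ ψ : X → ℝ}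
    (hφ : P.LinearOn φ) (hψ : P.LinearOn ψ) (c : Set X → ℝ) :
    E.inter P φ (E.inter P ψ c) = E.inter P ψ (E.inter P φ c) := by
  classical
  ext τ
  by_cases hτ : τ ∈ P.cones
  swap
  · rw [inter_of_notMem _ _ hτ, inter_of_notMem _ _ hτ]
  let F : (X → ℝ) → (X → ℝ) → Set X → Set X → ℝ := fun φ ψ ρ σ =>
    -(E.linearPart φ ρ (E.normal ρ τ)) * -(E.linearPart ψ σ (E.normal σ ρ))
  let mid : Set X → Finset (Set X) := fun σ => P.cones.filter fun ρ =>
    FaceOf E.ι ρ σ ∧ τ ⊆ ρ ∧ cdim E.ι ρ = cdim E.ι τ + 1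
  let S := P.cones.filter fun σ => FaceOf E.ι τ σ ∧ cdim E.ι σ = cdim E.ι τ + 2
  have expand : ∀ φ ψ : X → ℝ, E.inter P φ (E.inter P ψ c) τ =
      ∑ σ ∈ S, ∑ ρ ∈ mid σ, F φ ψ ρ σ * c σ := by
    intro φ ψ
    rw [inter_eq hP _ _ hτ]
    have : ∀ ρ ∈ E.star P τ, -(E.linearPart φ ρ (E.normal ρ τ)) * E.inter P ψ c ρ =
        ∑ σ ∈ E.star P ρ, F φ ψ ρ σ * c σ := by
      intro ρ hρ
      rw [inter_eq hP _ _ (mem_star.1 hρ).1, Finset.mul_sum]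
      exact Finset.sum_congr rfl fun σ _ => by simp only [F]; ring
    rw [Finset.sum_congr rfl this]
    refine Finset.sum_comm' fun ρ σ => ?_
    simp only [mem_star, S, mid, Finset.mem_filter]
    constructor
    · rintro ⟨⟨h1, h2, h3⟩, h4, h5, h6⟩
      obtain ⟨p, hp⟩ := (hP.isEmbCone hτ).exists_ri
      exact ⟨⟨h1, h5, h2.subset, h3⟩, h4,
        hP.faceOf_of_ri hτ h4 hp (h5.subset (h2.subset (ri_subset hp))), by omega⟩
    · rintro ⟨⟨h1, h2, h3, h4⟩, h5, h6, h7⟩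
      exact ⟨⟨h1, h6.mono h3 h2.subset, h4⟩, h5, h2, by omega⟩
  rw [expand, expand]
  refine Finset.sum_congr rfl fun σ hσ => ?_
  obtain ⟨hσ, hf, hd⟩ := Finset.mem_filter.1 hσ
  obtain ⟨ρ₁, ρ₂, hne, hρ⟩ := exists_two_facets (hP.isEmbCone hσ) hf hd
  have hmid : mid σ = {ρ₁, ρ₂} := by
    ext ρ
    simp only [mid, Finset.mem_filter, Finset.mem_insert, Finset.mem_singleton, ← hρ]
    exact ⟨fun h => h.2, fun h => ⟨hP.face_mem hσ h.1, h⟩⟩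
  obtain ⟨f₁, t₁, d₁⟩ := (hρ ρ₁).2 (.inl rfl)
  obtain ⟨f₂, t₂, d₂⟩ := (hρ ρ₂).2 (.inr rfl)
  have m₁ := hP.face_mem hσ f₁
  have m₂ := hP.face_mem hσ f₂
  have n₁ := isNormal_normal (hf.mono t₁ f₁.subset) d₁
  have n₂ := isNormal_normal (hf.mono t₂ f₂.subset) d₂
  have k₁ := isNormal_normal f₁ (by omega)
  have k₂ := isNormal_normal f₂ (by omega)
  obtain ⟨hs, e₁⟩ := normal_eq_of_two_facets f₁ f₂ t₁ t₂ hne d₁ d₂ hd n₁ n₂ k₁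
  obtain ⟨-, e₂⟩ := normal_eq_of_two_facets f₂ f₁ t₂ t₁ hne.symm d₂ d₁ hd n₂ n₁ k₂
  rw [real_inner_comm] at e₂
  rw [hmid, Finset.sum_pair hne, Finset.sum_pair hne]
  simp only [F]
  rw [e₁, e₂, linearPart_face hP hφ hσ m₁ f₁.subset n₁.2.1,
    linearPart_face hP hφ hσ m₂ f₂.subset n₂.2.1, linearPart_face hP hψ hσ m₁ f₁.subset n₁.2.1,
    linearPart_face hP hψ hσ m₂ f₂.subset n₂.2.1]
  simp only [map_smul, map_sub, smul_eq_mul]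
  ring

end EuclideanConicalSpace


/-! ### Rays and degrees -/

namespace EuclideanConicalSpace

variable {X N : Type*} [TopologicalSpace X] [NormedAddCommGroup N] [InnerProductSpace ℝ N]
  [FiniteDimensional ℝ N] {E : EuclideanConicalSpace X N} {P Q : ConicalComplex X} {σ τ : Set X}

/-- The unit vector of a ray. -/
theorem exists_unit_of_ray (hσ : IsEmbCone E.ι σ) (hd : cdim E.ι σ = 1) :
    ∃ x ∈ ri E.ι σ, ‖E.ι x‖ = 1 ∧ ∀ y ∈ σ, E.ι y = ‖E.ι y‖ • E.ι x := by
  obtain ⟨y, hy, hy0⟩ : ∃ y ∈ σ, E.ι y ≠ 0 := by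
    by_contra! h
    have : cspan E.ι σ = ⊥ := by
      rw [cspan, Submodule.span_eq_bot]
      rintro _ ⟨y, hy, rfl⟩
      exact h y hy
    rw [cdim, this, finrank_bot] at hd
    omega
  have hn : 0 < ‖E.ι y‖ := norm_pos_iff.2 hy0
  obtain ⟨x, hx, e⟩ := hσ.poly.smul_mem (inv_nonneg.2 hn.le) (mem_image_of_mem E.ι hy)
  have hx1 : ‖E.ι x‖ = 1 := by
    rw [e, norm_smul, norm_inv, norm_norm, inv_mul_cancel₀ hn.ne']
  have hx0 : E.ι x ≠ 0 := norm_ne_zero_iff.1 (by rw [hx1]; simp)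
  have key : ∀ z ∈ σ, E.ι z = ‖E.ι z‖ • E.ι x := by
    intro z hz
    obtain ⟨a, ha⟩ := exists_smul_of_finrank_eq_one hd (mem_cspan hx) hx0 (mem_cspan hz)
    have ha0 : 0 ≤ a := by
      by_contra hneg
      push Not at hneg
      have h1 := hσ.poly.smul_mem (t := (-a)⁻¹) (inv_nonneg.2 (by linarith))
        (mem_image_of_mem E.ι hz)
      have h2 : (-a)⁻¹ • E.ι z = -E.ι x := by
        rw [ha, smul_smul, inv_neg, neg_mul, inv_mul_cancel₀ hneg.ne, neg_one_smul]
      rw [h2] at h1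
      exact hx0 (hσ.pointed _ (mem_image_of_mem _ hx) h1)
    have : ‖E.ι z‖ = a := by rw [ha, norm_smul, hx1, mul_one, Real.norm_of_nonneg ha0]
    rw [this, ha]
  refine ⟨x, mem_ri_iff.2 ⟨hx, fun ℓ _ h0 z hz => ?_⟩, hx1, key⟩
  rw [key z hz, map_smul, h0, smul_zero]

theorem eq_of_unit (hσ : IsEmbCone E.ι σ) (hd : cdim E.ι σ = 1) {x y : X} (hx : x ∈ σ) (hy : y ∈ σ)
    (hx1 : ‖E.ι x‖ = 1) (hy1 : ‖E.ι y‖ = 1) : x = y := by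
  obtain ⟨z, -, -, h⟩ := exists_unit_of_ray hσ hd
  apply hσ.injOn hx hy
  rw [h x hx, h y hy, hx1, hy1]

theorem evalRay_eq (f : E.sphere → ℝ) (hσ : IsEmbCone E.ι σ) (hd : cdim E.ι σ = 1)
    (x : E.sphere) (hx : (x : X) ∈ σ) : E.evalRay f σ = f x := by
  have h : ∃ x : E.sphere, (x : X) ∈ σ := ⟨x, hx⟩
  rw [evalRay, dif_pos h]
  congr 1
  exact Subtype.ext (eq_of_unit hσ hd h.choose_spec hx h.choose.2 x.2)

theorem mem_conesOfDim (hP : P.QuasiEmbeds E.ι) {k : ℕ} :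
    σ ∈ P.conesOfDim k ↔ σ ∈ P.cones ∧ cdim E.ι σ = k := by
  classical
  rw [ConicalComplex.conesOfDim, Finset.mem_filter]
  exact and_congr_right fun hσ => by rw [hP.dim_eq hσ]

/-- The integral of `f` with respect to the discrete measure of the weight `z`. -/
def raySum (E : EuclideanConicalSpace X N) (P : ConicalComplex X) (z : Set X → ℝ)
    (f : E.sphere → ℝ) : ℝ :=
  ∑ ρ ∈ P.conesOfDim 1, z ρ * E.evalRay f ρ

/-- Each ray of `P` contains exactly one ray of `Q`, with the same unit vector, and the other rays
of `Q` get weight zero. -/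
theorem raySum_pullback (hP : P.QuasiEmbeds E.ι) (hQP : Q.IsSubdivision P) (z : Set X → ℝ)
    (f : E.sphere → ℝ) : E.raySum Q (P.pullback Q z) f = E.raySum P z f := by
  have hQ := hP.of_isSubdivision hQP
  symm
  have hex : ∀ σ ∈ P.conesOfDim 1, ∃ x ∈ ri E.ι σ, ‖E.ι x‖ = 1 ∧ ∃ τ ∈ Q.cones, x ∈ ri E.ι τ ∧
      τ ⊆ σ ∧ cdim E.ι τ = 1 := by
    intro σ hσ
    obtain ⟨h1, h2⟩ := (mem_conesOfDim hP).1 hσ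
    obtain ⟨x, hx, hx1, -⟩ := exists_unit_of_ray (hP.isEmbCone h1) h2
    obtain ⟨τ, hτ, hxτ, hτσ⟩ := hP.exists_ri_subset hQP h1 (ri_subset hx)
    refine ⟨x, hx, hx1, τ, hτ, hxτ, hτσ, le_antisymm (h2 ▸ cdim_mono hτσ) ?_⟩
    by_contra hlt
    have h0 : cdim E.ι τ = 0 := by omega
    have : cspan E.ι τ = ⊥ := Submodule.finrank_eq_zero.1 h0
    have h3 : E.ι x ∈ cspan E.ι τ := mem_cspan (ri_subset hxτ)
    rw [this, Submodule.mem_bot] at h3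
    rw [h3, norm_zero] at hx1
    norm_num at hx1
  -- The empty space is treated apart, because `choose!` needs a default point.
  rcases isEmpty_or_nonempty X with hX | hX
  · have h : ∀ P : ConicalComplex X, P.QuasiEmbeds E.ι → P.conesOfDim 1 = ∅ := fun P hP =>
      Finset.eq_empty_of_forall_notMem fun σ hσ => by
        obtain ⟨x, -⟩ := (hP.isEmbCone ((mem_conesOfDim hP).1 hσ).1).exists_ri
        exact hX.elim x
    rw [raySum, raySum, h P hP, h Q hQ, Finset.sum_empty, Finset.sum_empty]
  choose! x hx hx1 e he hxe hes hed using hex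
  refine Finset.sum_of_injOn e ?_ ?_ ?_ ?_
  · intro σ₁ h₁ σ₂ h₂ h12
    have h3 := eq_of_unit (hQ.isEmbCone (he _ h₁)) (hed _ h₁) (ri_subset (hxe _ h₁))
      (h12 ▸ ri_subset (hxe _ h₂)) (hx1 _ h₁) (hx1 _ h₂)
    exact hP.eq_of_ri ((mem_conesOfDim hP).1 h₁).1 ((mem_conesOfDim hP).1 h₂).1 (hx _ h₁)
      (h3 ▸ hx _ h₂)
  · intro σ hσ
    exact (mem_conesOfDim hQ).2 ⟨he σ hσ, hed σ hσ⟩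
  · intro τ hτ hnot
    obtain ⟨h1, h2⟩ := (mem_conesOfDim hQ).1 hτ
    by_contra h0
    obtain ⟨-, σ, hσ, hs, hd, -⟩ := exists_of_pullback_ne_zero hP hQP (left_ne_zero_of_mul h0)
    have hσ' : σ ∈ P.conesOfDim 1 := (mem_conesOfDim hP).2 ⟨hσ, hd.trans h2⟩
    apply hnot
    refine ⟨σ, hσ', ?_⟩
    obtain ⟨y, hy, hy1, -⟩ := exists_unit_of_ray (hQ.isEmbCone h1) h2
    have h3 := eq_of_unit (hP.isEmbCone hσ) (hd.trans h2) (hs (ri_subset hy)) (ri_subset (hx σ hσ'))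
      hy1 (hx1 σ hσ')
    exact hQ.eq_of_ri (he σ hσ') h1 (hxe σ hσ') (h3 ▸ hy)
  · intro σ hσ
    obtain ⟨h1, h2⟩ := (mem_conesOfDim hP).1 hσ
    rw [pullback_of_subset hP hQP z h1 (he σ hσ) (hes σ hσ) (h2.trans (hed σ hσ).symm),
      evalRay_eq f (hP.isEmbCone h1) h2 ⟨x σ, hx1 σ hσ⟩ (ri_subset (hx σ hσ)),
      evalRay_eq f (hQ.isEmbCone (he σ hσ)) (hed σ hσ) ⟨x σ, hx1 σ hσ⟩ (ri_subset (hxe σ hσ))]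

/-- After exchanging the sums, each ray has its apex as only vertex, and the normal there is its
unit vector, at which the linear part of `φ` takes the value of `φ`. -/
theorem degree_inter (hP : P.QuasiEmbeds E.ι) {φ : X → ℝ} (hφ : P.LinearOn φ) (z : Set X → ℝ) :
    P.degree (E.inter P φ z) = -E.raySum P z (fun x => φ x) := by
  classical
  have h1 : P.degree (E.inter P φ z) = ∑ v ∈ P.conesOfDim 0, ∑ ρ ∈ E.star P v,
      -(E.linearPart φ ρ (E.normal ρ v)) * z ρ :=
    Finset.sum_congr rfl fun v hv => inter_eq hP _ _ ((mem_conesOfDim hP).1 hv).1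
  have h2 : P.degree (E.inter P φ z) = ∑ ρ ∈ P.conesOfDim 1,
      ∑ v ∈ (P.conesOfDim 0).filter fun v => FaceOf E.ι v ρ,
      -(E.linearPart φ ρ (E.normal ρ v)) * z ρ := by
    rw [h1]
    refine Finset.sum_comm' fun v ρ => ?_
    simp only [mem_star, mem_conesOfDim hP, Finset.mem_filter]
    constructor
    · rintro ⟨⟨a1, a2⟩, a3, a4, a5⟩
      exact ⟨⟨⟨a1, a2⟩, a4⟩, a3, by omega⟩
    · rintro ⟨⟨⟨a1, a2⟩, a4⟩, a3, a5⟩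
      exact ⟨⟨a1, a2⟩, a3, a4, by omega⟩
  rw [h2, raySum, ← Finset.sum_neg_distrib]
  refine Finset.sum_congr rfl fun ρ hρ => ?_
  obtain ⟨hρ, hd⟩ := (mem_conesOfDim hP).1 hρ
  have hρe := hP.isEmbCone hρ
  obtain ⟨x, hx, hx1, hray⟩ := exists_unit_of_ray hρe hd
  obtain ⟨o, ho, ho0⟩ := hρe.poly.zero_mem
  have hface : FaceOf E.ι {o} ρ := by
    refine ⟨innerₗ N (E.ι x), fun y hy => ?_, ?_⟩
    · rw [innerₗ_apply_apply, hray y hy, real_inner_smul_right, real_inner_self_eq_norm_sq, hx1]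
      positivity
    · ext y
      constructor
      · rintro rfl
        exact ⟨ho, by rw [ho0, map_zero]⟩
      · rintro ⟨hy, h⟩
        rw [innerₗ_apply_apply, hray y hy, real_inner_smul_right, real_inner_self_eq_norm_sq, hx1]
          at h
        refine hρe.injOn hy ho ?_
        rw [ho0, ← norm_eq_zero]
        simpa using h
  have hspan : cspan E.ι {o} = ⊥ := by
    rw [cspan, image_singleton, ho0, Submodule.span_zero_singleton]
  have hd0 : cdim E.ι {o} = 0 := by rw [cdim, hspan, finrank_bot]
  have hfil : ((P.conesOfDim 0).filter fun v => FaceOf E.ι v ρ) = {{o}} := by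
    ext v
    simp only [Finset.mem_filter, Finset.mem_singleton, mem_conesOfDim hP]
    constructor
    · rintro ⟨⟨a1, a2⟩, a3⟩
      have hb : cspan E.ι v = ⊥ := Submodule.finrank_eq_zero.1 a2
      have hv : ∀ y ∈ v, y = o := fun y hy => by
        have : E.ι y ∈ cspan E.ι v := mem_cspan hy
        rw [hb, Submodule.mem_bot] at this
        exact hρe.injOn (a3.subset hy) ho (this.trans ho0.symm)
      obtain ⟨y, hy⟩ := (hP.isEmbCone a1).exists_ri
      exact Set.Subset.antisymm (fun z hz => hv z hz) (by
        rintro _ rfl; exact hv y (ri_subset hy) ▸ ri_subset hy)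
    · rintro rfl
      exact ⟨⟨hP.face_mem hρ hface, hd0⟩, hface⟩
  have hn : E.IsNormal ρ {o} (E.ι x) := by
    refine ⟨hx1, mem_cspan (ri_subset hx), ?_, fun y hy => ?_⟩
    · rintro _ rfl; rw [ho0, inner_zero_right]
    · rw [hray y hy, real_inner_smul_right, real_inner_self_eq_norm_sq, hx1]
      positivity
  rw [hfil, Finset.sum_singleton, normal_eq hface (by omega) hn,
    linearPart_apply hP hφ hρ (ri_subset hx), evalRay_eq _ hρe hd ⟨x, hx1⟩ (ri_subset hx)]
  ring

/-! ### Linearity and balancing -/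

theorem inter_zero (φ : X → ℝ) : E.inter P φ 0 = 0 := by
  ext τ
  simp [inter]

theorem inter_add_left (hP : P.QuasiEmbeds E.ι) {φ ψ : X → ℝ} (hφ : P.LinearOn φ)
    (hψ : P.LinearOn ψ) (c : Set X → ℝ) :
    E.inter P (φ + ψ) c = E.inter P φ c + E.inter P ψ c := by
  ext τ
  by_cases hτ : τ ∈ P.cones
  swap
  · simp [inter_of_notMem _ _ hτ]
  rw [Pi.add_apply, inter_eq hP _ _ hτ, inter_eq hP _ _ hτ, inter_eq hP _ _ hτ,
    ← Finset.sum_add_distrib]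
  refine Finset.sum_congr rfl fun σ hσ => ?_
  obtain ⟨h1, h2, h3⟩ := mem_star.1 hσ
  have hadd : P.LinearOn (φ + ψ) := fun σ hσ => Submodule.add_mem _ (hφ σ hσ) (hψ σ hσ)
  rw [linearPart_eq hP hadd h1 (ℓ := E.linearPart φ σ + E.linearPart ψ σ) (fun x hx => by
    rw [LinearMap.add_apply, linearPart_apply hP hφ h1 hx, linearPart_apply hP hψ h1 hx,
      Pi.add_apply]) (isNormal_normal h2 h3).2.1, LinearMap.add_apply]
  ring

theorem inter_smul_left (hP : P.QuasiEmbeds E.ι) {φ : X → ℝ} (hφ : P.LinearOn φ) (t : ℝ)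
    (c : Set X → ℝ) : E.inter P (t • φ) c = t • E.inter P φ c := by
  ext τ
  by_cases hτ : τ ∈ P.cones
  swap
  · simp [inter_of_notMem _ _ hτ]
  rw [Pi.smul_apply, inter_eq hP _ _ hτ, inter_eq hP _ _ hτ, Finset.smul_sum]
  refine Finset.sum_congr rfl fun σ hσ => ?_
  obtain ⟨h1, h2, h3⟩ := mem_star.1 hσ
  have hsm : P.LinearOn (t • φ) := fun σ hσ => Submodule.smul_mem _ t (hφ σ hσ)
  rw [linearPart_eq hP hsm h1 (ℓ := t • E.linearPart φ σ) (fun x hx => by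
    rw [LinearMap.smul_apply, linearPart_apply hP hφ h1 hx, Pi.smul_apply])
    (isNormal_normal h2 h3).2.1, LinearMap.smul_apply, smul_eq_mul, smul_eq_mul]
  ring

/-- The weight `c` is balanced: its product with every linear form vanishes. -/
def Balanced (E : EuclideanConicalSpace X N) (P : ConicalComplex X) (c : Set X → ℝ) : Prop :=
  ∀ ℓ : Module.Dual ℝ N, E.inter P (fun x => ℓ (E.ι x)) c = 0

theorem inter_linear (hP : P.QuasiEmbeds E.ι) (ℓ : Module.Dual ℝ N) (c : Set X → ℝ)
    (hτ : τ ∈ P.cones) : E.inter P (fun x => ℓ (E.ι x)) c τ =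
      -ℓ (∑ σ ∈ E.star P τ, c σ • E.normal σ τ) := by
  rw [inter_eq hP _ _ hτ, map_sum, ← Finset.sum_neg_distrib]
  refine Finset.sum_congr rfl fun σ hσ => ?_
  obtain ⟨h1, h2, h3⟩ := mem_star.1 hσ
  rw [linearPart_eq hP (hP.1 ℓ) h1 (fun x _ => rfl) (isNormal_normal h2 h3).2.1, map_smul,
    smul_eq_mul]
  ring

/-- Testing the balancing identity against linear forms turns it into the vanishing of products with
linear functions. With commutativity, products of balanced weights are then balanced for free. -/
theorem isMinkowski_iff (hP : P.QuasiEmbeds E.ι) {k : ℕ} {c : Set X → ℝ} :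
    E.IsMinkowski P k c ↔ (∀ σ, σ ∉ P.conesOfDim k → c σ = 0) ∧ E.Balanced P c := by
  classical
  refine and_congr_right fun hc => ?_
  have hsum : ∀ τ ∈ P.cones, cdim E.ι τ + 1 = k →
      ∑ σ ∈ (P.conesOfDim k).filter (fun σ => P.Face τ σ), c σ • E.normal σ τ =
      ∑ σ ∈ E.star P τ, c σ • E.normal σ τ := by
    intro τ _ hd
    refine Finset.sum_congr ?_ fun _ _ => rfl
    ext σ
    simp only [Finset.mem_filter, mem_conesOfDim hP, mem_star]
    constructor
    · rintro ⟨⟨a1, a2⟩, a3⟩; exact ⟨a1, (hP.face_iff a1).1 a3, by omega⟩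
    · rintro ⟨a1, a2, a3⟩; exact ⟨⟨a1, by omega⟩, (hP.face_iff a1).2 a2⟩
  constructor
  · intro h ℓ
    ext τ
    by_cases hτ : τ ∈ P.cones
    swap
    · rw [inter_of_notMem _ _ hτ]; rfl
    by_cases hd : cdim E.ι τ + 1 = k
    · rw [inter_linear hP ℓ c hτ, ← hsum τ hτ hd, h τ hτ (by rw [hP.dim_eq hτ, hd]), map_zero,
        neg_zero]
      rfl
    · rw [inter_eq hP _ _ hτ]
      refine Finset.sum_eq_zero fun σ hσ => ?_
      obtain ⟨h1, h2, h3⟩ := mem_star.1 hσ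
      rw [hc σ fun h => hd (by rw [← h3]; exact ((mem_conesOfDim hP).1 h).2), mul_zero]
  · intro h τ hτ hd
    rw [hP.dim_eq hτ] at hd
    rw [hsum τ hτ hd, ← Module.forall_dual_apply_eq_zero_iff ℝ]
    intro ℓ
    have := congrFun (h ℓ) τ
    rw [inter_linear hP ℓ c hτ, Pi.zero_apply, neg_eq_zero] at this
    exact this

theorem Balanced.inter (hP : P.QuasiEmbeds E.ι) {c : Set X → ℝ} (hc : E.Balanced P c) {φ : X → ℝ}
    (hφ : P.LinearOn φ) : E.Balanced P (E.inter P φ c) := fun ℓ => by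
  rw [inter_comm hP (hP.1 ℓ) hφ, hc ℓ, inter_zero]

theorem pullback_zero : P.pullback Q 0 = 0 := by
  ext τ
  simp [ConicalComplex.pullback]

theorem Balanced.pullback (hP : P.QuasiEmbeds E.ι) (hQP : Q.IsSubdivision P) {c : Set X → ℝ}
    (hc : E.Balanced P c) : E.Balanced Q (P.pullback Q c) := fun ℓ => by
  rw [inter_pullback hP hQP (hP.1 ℓ), hc ℓ, pullback_zero]

theorem foldr_inter_perm (hP : P.QuasiEmbeds E.ι) {φs ψs : List (X → ℝ)} (h : φs.Perm ψs)
    (hφ : ∀ φ ∈ φs, P.LinearOn φ) (c : Set X → ℝ) :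
    φs.foldr (E.inter P) c = ψs.foldr (E.inter P) c := by
  induction h with
  | nil => rfl
  | cons φ _ ih =>
    rw [List.foldr_cons, List.foldr_cons, ih fun ψ hψ => hφ ψ (List.mem_cons_of_mem _ hψ)]
  | swap φ ψ l =>
    simp only [List.foldr_cons]
    exact inter_comm hP (hφ _ (by simp)) (hφ _ (by simp)) _
  | trans h₁ _ ih₁ ih₂ => rw [ih₁ hφ, ih₂ fun ψ hψ => hφ ψ (h₁.mem_iff.2 hψ)]

theorem pullback_nonneg {c : Set X → ℝ} (hc : ∀ σ, 0 ≤ c σ) (τ : Set X) :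
    0 ≤ P.pullback Q c τ := by
  unfold ConicalComplex.pullback
  split_ifs
  · exact Finset.sum_nonneg fun σ _ => hc σ
  · exact le_rfl

theorem inter_ne_zero {φ : X → ℝ} {c : Set X → ℝ} (hP : P.QuasiEmbeds E.ι)
    (h : E.inter P φ c τ ≠ 0) : τ ∈ P.cones ∧ ∃ σ ∈ E.star P τ, c σ ≠ 0 := by
  have hτ : τ ∈ P.cones := by
    by_contra hτ
    exact h (inter_of_notMem _ _ hτ)
  rw [inter_eq hP _ _ hτ] at h
  obtain ⟨σ, hσ, h0⟩ := Finset.exists_ne_zero_of_sum_ne_zero h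
  exact ⟨hτ, σ, hσ, right_ne_zero_of_mul h0⟩

end EuclideanConicalSpace

/-! ### Products with the fundamental cycle -/

namespace BalancedSpace

open EuclideanConicalSpace

variable {X N : Type*} [TopologicalSpace X] [NormedAddCommGroup N] [InnerProductSpace ℝ N]
  [FiniteDimensional ℝ N] {n : ℕ} (E : BalancedSpace X N n) {P Q R : ConicalComplex X}

/-- The weight `φ₁ ⋯ φ_r · [X]` on a subdivision of the base complex. -/
def prod (φs : List (X → ℝ)) (Q : ConicalComplex X) : Set X → ℝ :=
  φs.foldr (E.inter Q) (E.base.pullback Q E.weight)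

variable {E}

theorem prod_cons (φ : X → ℝ) (φs : List (X → ℝ)) (Q : ConicalComplex X) :
    E.prod (φ :: φs) Q = E.inter Q φ (E.prod φs Q) := rfl

theorem quasiEmbeds_of_base (hQ : Q.IsSubdivision E.base) : Q.QuasiEmbeds E.ι :=
  E.quasiEmbeds.of_isSubdivision hQ

theorem prod_pullback (hQ : Q.IsSubdivision E.base) (hR : R.IsSubdivision Q) {φs : List (X → ℝ)}
    (hφ : ∀ φ ∈ φs, Q.LinearOn φ) : E.prod φs R = Q.pullback R (E.prod φs Q) := by
  rw [prod, prod, ← foldr_inter_pullback (quasiEmbeds_of_base hQ) hR hφ,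
    pullback_pullback E.quasiEmbeds hQ hR]

theorem prod_perm (hQ : Q.IsSubdivision E.base) {φs ψs : List (X → ℝ)} (h : φs.Perm ψs)
    (hφ : ∀ φ ∈ φs, Q.LinearOn φ) : E.prod φs Q = E.prod ψs Q :=
  foldr_inter_perm (quasiEmbeds_of_base hQ) h hφ _

theorem prod_balanced (hQ : Q.IsSubdivision E.base) {φs : List (X → ℝ)}
    (hφ : ∀ φ ∈ φs, Q.LinearOn φ) : E.Balanced Q (E.prod φs Q) := by
  induction φs with
  | nil => exact (((isMinkowski_iff E.quasiEmbeds).1 E.isMinkowski).2).pullback E.quasiEmbeds hQ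
  | cons φ φs ih =>
    exact (ih fun ψ hψ => hφ ψ (List.mem_cons_of_mem _ hψ)).inter (quasiEmbeds_of_base hQ)
      (hφ φ List.mem_cons_self)

theorem weight_nonneg (σ : Set X) : 0 ≤ E.weight σ := by
  by_cases h : σ ∈ E.base.conesOfDim n
  · exact (E.weight_pos σ h).le
  · exact (E.isMinkowski.1 σ h).ge

theorem prod_ne_zero (hQ : Q.IsSubdivision E.base) {φs : List (X → ℝ)} {σ : Set X}
    (h : E.prod φs Q σ ≠ 0) : σ ∈ Q.cones ∧ cdim E.ι σ + φs.length = n := by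
  induction φs generalizing σ with
  | nil =>
    obtain ⟨h1, τ, hτ, -, h2, h3⟩ := exists_of_pullback_ne_zero E.quasiEmbeds hQ h
    refine ⟨h1, ?_⟩
    have : τ ∈ E.base.conesOfDim n := by
      by_contra hn
      rw [E.isMinkowski.1 τ hn] at h3
      exact h h3
    rw [← h2, List.length_nil, add_zero]
    exact ((mem_conesOfDim E.quasiEmbeds).1 this).2
  | cons φ φs ih =>
    obtain ⟨h1, τ, hτ, h2⟩ := inter_ne_zero (quasiEmbeds_of_base hQ) h
    have h3 := ih h2
    obtain ⟨-, -, h4⟩ := mem_star.1 hτ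
    refine ⟨h1, ?_⟩
    rw [List.length_cons]
    omega

theorem represents_prod (hQ : Q.IsSubdivision E.base) {φs : List (X → ℝ)}
    (hφ : ∀ φ ∈ φs, Q.LinearOn φ) : E.Represents φs Q (E.prod φs Q) := by
  have hQ' := quasiEmbeds_of_base hQ
  refine ⟨E.mem_R_of_isSubdivision hQ, hφ, E.base.pullback Q E.weight, ?_, ?_, rfl⟩
  · refine (isMinkowski_iff hQ').2 ⟨fun σ hσ => ?_,
      prod_balanced (φs := []) hQ (by simp)⟩
    by_contra h
    have := prod_ne_zero (φs := []) hQ h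
    exact hσ ((mem_conesOfDim hQ').2 ⟨this.1, by simpa using this.2⟩)
  · exact ⟨Q, E.mem_R_of_isSubdivision hQ, .refl hQ', hQ,
      pullback_pullback E.quasiEmbeds hQ (.refl hQ') _⟩

/-- The definition of `SameCycle` provides a subdivision of both complexes on which the two weights
of `[X]` agree; products commute with the pull-back to it. -/
theorem Represents.exists_common {φs : List (X → ℝ)} {z : Set X → ℝ} (h : E.Represents φs P z) :
    ∃ Q : ConicalComplex X, Q.IsSubdivision E.base ∧ Q.IsSubdivision P ∧
      P.pullback Q z = E.prod φs Q := by
  obtain ⟨hP, hφ, c, -, ⟨Q, -, hQP, hQ, hc⟩, rfl⟩ := h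
  exact ⟨Q, hQ, hQP, by rw [← foldr_inter_pullback hP.2 hQP hφ, hc]; rfl⟩

theorem exists_linearOn {φs : List (X → ℝ)} (hφ : ∀ φ ∈ φs, φ ∈ E.PL)
    (Ps : List (ConicalComplex X)) (hPs : ∀ P ∈ Ps, P ∈ E.R) (H : List (Module.Dual ℝ N)) :
    ∃ Q : ConicalComplex X, Q.IsSubdivision E.base ∧ (∀ φ ∈ φs, Q.LinearOn φ) ∧
      (∀ P ∈ Ps, Q.IsSubdivision P) ∧ ∀ h ∈ H, Q.Signed E.ι h := by
  have : Nonempty (ConicalComplex X) := ⟨E.base⟩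
  choose! P hP hPφ using hφ
  obtain ⟨Q, h1, h2, h3⟩ := E.exists_common (φs.map P ++ Ps) (by
    intro R hR
    rcases List.mem_append.1 hR with hR | hR
    · obtain ⟨φ, hφ, rfl⟩ := List.mem_map.1 hR
      exact hP φ hφ
    · exact hPs R hR) H
  exact ⟨Q, h1, fun φ hφ => (hPφ φ hφ).of_isSubdivision
    (h2 _ (List.mem_append_left _ (List.mem_map_of_mem hφ))),
    fun P hP => h2 _ (List.mem_append_right _ hP), h3⟩

theorem Represents.raySum_eq {φs : List (X → ℝ)} {z : Set X → ℝ} (h : E.Represents φs P z)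
    (hQ : Q.IsSubdivision E.base) (hφ : ∀ φ ∈ φs, Q.LinearOn φ) (f : E.sphere → ℝ) :
    E.raySum P z f = E.raySum Q (E.prod φs Q) f := by
  obtain ⟨Q', hQ', hP, e⟩ := h.exists_common
  obtain ⟨R, hR, hs, -⟩ := E.exists_common [Q, Q'] (by
    simp [E.mem_R_of_isSubdivision hQ, E.mem_R_of_isSubdivision hQ']) []
  have hRQ := hs Q (by simp)
  have hRQ' := hs Q' (by simp)
  have hφ' : ∀ φ ∈ φs, Q'.LinearOn φ := fun φ hφ => (h.2.1 φ hφ).of_isSubdivision hP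
  rw [← raySum_pullback h.1.2 hP z f, e,
    ← raySum_pullback (quasiEmbeds_of_base hQ') hRQ' _ f, ← prod_pullback hQ' hRQ' hφ',
    prod_pullback hQ hRQ hφ, raySum_pullback (quasiEmbeds_of_base hQ) hRQ]

/-- The number chosen by `epsilon` does not depend on the representative, since two representatives
agree on a common subdivision. -/
theorem discreteMeasure_eq {φs : List (X → ℝ)} (hQ : Q.IsSubdivision E.base)
    (hφ : ∀ φ ∈ φs, Q.LinearOn φ) (f : C(E.sphere, ℝ)) :
    E.discreteMeasure φs f = E.raySum Q (E.prod φs Q) f := by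
  have hex : ∃ I, ∃ P z, E.Represents φs P z ∧ I = ∑ ρ ∈ P.conesOfDim 1, z ρ * E.evalRay f ρ :=
    ⟨_, Q, _, represents_prod hQ hφ, rfl⟩
  obtain ⟨P, z, h, e⟩ := Classical.epsilon_spec hex
  exact e.trans (h.raySum_eq hQ hφ f)

/-- Peeling off the first factor turns the degree into minus a sum over rays, whose independence of
the representative is known. -/
theorem deg_eq {m : ℕ} {E : BalancedSpace X N (m + 1)} {φ : Fin (m + 1) → X → ℝ}
    (hQ : Q.IsSubdivision E.base) (hφ : ∀ i, Q.LinearOn (φ i)) :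
    E.deg φ = Q.degree (E.prod (List.ofFn φ) Q) := by
  have hφ' : ∀ ψ ∈ List.ofFn φ, Q.LinearOn ψ := by
    intro ψ hψ
    obtain ⟨i, rfl⟩ := (List.mem_ofFn' φ ψ).1 hψ
    exact hφ i
  have hex : ∃ d, ∃ P z, E.Represents (List.ofFn φ) P z ∧ d = P.degree z :=
    ⟨_, Q, _, represents_prod hQ hφ', rfl⟩
  obtain ⟨P, z, h, e⟩ := Classical.epsilon_spec hex
  refine e.trans ?_
  obtain ⟨hP, hPφ, c, hc1, hc2, rfl⟩ := h
  rw [List.ofFn_succ] at hPφ hφ' ⊢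
  have hr : E.Represents (List.ofFn fun i => φ (Fin.succ i)) P
      ((List.ofFn fun i => φ (Fin.succ i)).foldr (E.inter P) c) :=
    ⟨hP, fun ψ hψ => hPφ ψ (List.mem_cons_of_mem _ hψ), c, hc1, hc2, rfl⟩
  rw [List.foldr_cons, degree_inter hP.2 (hPφ _ List.mem_cons_self),
    hr.raySum_eq hQ (fun ψ hψ => hφ' ψ (List.mem_cons_of_mem _ hψ)), prod_cons,
    degree_inter (quasiEmbeds_of_base hQ) (hφ 0)]

end BalancedSpace


/-! ### Slices of the fundamental cycle -/

/-- The subspace `W` of `V` is cut out by the independent linear forms of the list. -/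
def Cuts {N : Type*} [AddCommGroup N] [Module ℝ N] (V : Submodule ℝ N) :
    List (Module.Dual ℝ N) → Submodule ℝ N → Prop
  | [], W => W = V
  | ℓ :: ℓs, W => ∃ W', Cuts V ℓs W' ∧ W = W' ⊓ LinearMap.ker ℓ ∧ ¬ W' ≤ LinearMap.ker ℓ

section Cuts

variable {N : Type*} [AddCommGroup N] [Module ℝ N] [FiniteDimensional ℝ N]

theorem finrank_inf_ker_add_one {W : Submodule ℝ N} {ℓ : Module.Dual ℝ N}
    (h : ¬ W ≤ LinearMap.ker ℓ) :
    Module.finrank ℝ (W ⊓ LinearMap.ker ℓ : Submodule ℝ N) + 1 = Module.finrank ℝ W := by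
  have h1 := LinearMap.finrank_range_add_finrank_ker (ℓ.domRestrict W)
  have h2 : LinearMap.range (ℓ.domRestrict W) = ⊤ := by
    apply LinearMap.range_eq_top.2
    apply LinearMap.surjective
    intro h0
    exact h fun w hw => LinearMap.congr_fun h0 ⟨w, hw⟩
  have h3 : LinearMap.ker (ℓ.domRestrict W) = (W ⊓ LinearMap.ker ℓ).comap W.subtype := by
    ext w
    simp
  have h4 : Module.finrank ℝ ((W ⊓ LinearMap.ker ℓ).comap W.subtype) =
      Module.finrank ℝ (W ⊓ LinearMap.ker ℓ : Submodule ℝ N) :=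
    (Submodule.comapSubtypeEquivOfLe inf_le_left).finrank_eq
  rw [h2, h3, h4, finrank_top, Module.finrank_self] at h1
  omega

theorem Cuts.le {V W : Submodule ℝ N} {ℓs : List (Module.Dual ℝ N)} (h : Cuts V ℓs W) : W ≤ V := by
  induction ℓs generalizing W with
  | nil => exact le_of_eq h
  | cons ℓ ℓs ih =>
    obtain ⟨W', h, rfl, -⟩ := h
    exact inf_le_left.trans (ih h)

theorem exists_cuts {V W : Submodule ℝ N} (h : W ≤ V) : ∃ ℓs, Cuts V ℓs W := by
  obtain ⟨k, hk⟩ : ∃ k, Module.finrank ℝ V = Module.finrank ℝ W + k :=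
    Nat.exists_eq_add_of_le (Submodule.finrank_mono h)
  induction k generalizing W with
  | zero => exact ⟨[], Submodule.eq_of_le_of_finrank_eq h (by omega)⟩
  | succ k ih =>
    have hlt : W < V := lt_of_le_of_ne h fun e => by rw [e] at hk; omega
    obtain ⟨u, huV, huW⟩ := SetLike.exists_of_lt hlt
    obtain ⟨ℓ, hu, hW⟩ := Submodule.exists_le_ker_of_notMem huW
    have hcap : (W ⊔ Submodule.span ℝ {u}) ⊓ LinearMap.ker ℓ = W := by
      refine le_antisymm ?_ (le_inf le_sup_left hW)
      rintro w ⟨hw1, hw2⟩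
      obtain ⟨a, ha, b, hb, rfl⟩ := Submodule.mem_sup.1 hw1
      obtain ⟨t, rfl⟩ := Submodule.mem_span_singleton.1 hb
      have h1 : ℓ a = 0 := hW ha
      have h2 : ℓ (a + t • u) = 0 := hw2
      rw [map_add, h1, zero_add, map_smul, smul_eq_mul] at h2
      rw [(mul_eq_zero.1 h2).resolve_right hu, zero_smul, add_zero]
      exact ha
    have hnot : ¬ W ⊔ Submodule.span ℝ {u} ≤ LinearMap.ker ℓ := fun hle =>
      hu (hle (Submodule.mem_sup_right (Submodule.mem_span_singleton_self u)))
    have hd := finrank_inf_ker_add_one hnot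
    rw [hcap] at hd
    obtain ⟨ℓs, hℓs⟩ := ih (W := W ⊔ Submodule.span ℝ {u})
      (sup_le h ((Submodule.span_singleton_le_iff_mem u V).2 huV)) (by omega)
    exact ⟨ℓ :: ℓs, _, hℓs, hcap.symm, hnot⟩

end Cuts

theorem IsPolyCone.eventually_mem_relint {N : Type*} [NormedAddCommGroup N]
    [InnerProductSpace ℝ N] [FiniteDimensional ℝ N] {K : Set N} (hK : IsPolyCone K) {p q : N}
    (hp : p ∈ relint K) (hq : q ∈ Submodule.span ℝ K) :
    ∀ᶠ t : ℝ in 𝓝[>] 0, p + t • q ∈ relint K := by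
  obtain ⟨ε, hε, h⟩ := hK.exists_add_smul_mem hp hq
  filter_upwards [Ioc_mem_nhdsGT (show (0 : ℝ) < ε / 2 by positivity)] with t ht
  have h1 := h (2 * t) (by rw [abs_of_pos (by linarith [ht.1])]; linarith [ht.2])
  have h2 := hK.add_mem_relint (hK.smul_mem_relint hp (t := 1 / 2) (by norm_num))
    (hK.smul_mem (t := 1 / 2) (by norm_num) h1)
  convert h2 using 1
  module

theorem IsEmbCone.exists_pos_forall_mem {X N : Type*} [TopologicalSpace X] [NormedAddCommGroup N]
    [InnerProductSpace ℝ N] {ι : X → N} {σ : Set X} (hσ : IsEmbCone ι σ) {x : X}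
    (hx : x ∈ σ) {U : Set X} (hU : U ∈ 𝓝 x) :
    ∃ ε > 0, ∀ y ∈ σ, ‖ι y - ι x‖ < ε → y ∈ U := by
  have h1 : (Subtype.val ⁻¹' U : Set σ) ∈ 𝓝 (⟨x, hx⟩ : σ) :=
    continuous_subtype_val.continuousAt.preimage_mem_nhds hU
  rw [hσ.isEmbedding.nhds_eq_comap, mem_comap] at h1
  obtain ⟨V, hV, hVU⟩ := h1
  obtain ⟨ε, hε, hb⟩ := Metric.mem_nhds_iff.1 hV
  refine ⟨ε, hε, fun y hy hd => ?_⟩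
  exact hVU (show (⟨y, hy⟩ : σ) ∈ _ from hb (mem_ball_iff_norm.2 hd))

theorem ConicalComplex.eventually_mem_of_mem {X : Type*} [TopologicalSpace X]
    (P : ConicalComplex X) (x : X) : ∀ᶠ y in 𝓝 x, ∀ σ ∈ P.cones, y ∈ σ → x ∈ σ := by
  refine (Filter.eventually_all_finset P.cones).2 fun σ hσ => ?_
  by_cases hx : x ∈ σ
  · exact Eventually.of_forall fun _ _ => hx
  · filter_upwards [(P.isClosed σ hσ).isOpen_compl.mem_nhds hx] with y hy hyσ
    exact absurd hyσ hy

namespace EuclideanConicalSpace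

variable {X N : Type*} [TopologicalSpace X] [NormedAddCommGroup N] [InnerProductSpace ℝ N]
  [FiniteDimensional ℝ N] {E : EuclideanConicalSpace X N} {P Q : ConicalComplex X} {σ τ : Set X}
  {ℓ : Module.Dual ℝ N}

theorem eq_zero_of_signed (hS : P.Signed E.ι ℓ) (hσ : σ ∈ P.cones) {x : X}
    (hx : x ∈ ri E.ι σ) (h0 : ℓ (E.ι x) = 0) : ∀ y ∈ σ, ℓ (E.ι y) = 0 := by
  rcases hS σ hσ with h | h
  · exact (mem_ri_iff.1 hx).2 ℓ h h0
  · intro y hy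
    have := (mem_ri_iff.1 hx).2 (-ℓ) (fun y hy => by simpa using h y hy) (by simpa using h0) y hy
    simpa using this

/-- The concave function `min(0, ℓ)` on `X`. -/
def minForm (E : EuclideanConicalSpace X N) (ℓ : Module.Dual ℝ N) : X → ℝ :=
  fun x => min 0 (ℓ (E.ι x))

theorem minForm_linearOn (hP : P.QuasiEmbeds E.ι) (hS : P.Signed E.ι ℓ) :
    P.LinearOn (E.minForm ℓ) := by
  intro σ hσ
  refine (hP.mem_M_iff hσ).2 ?_
  rcases hS σ hσ with h | h
  · exact ⟨0, fun v => by simpa [minForm] using h v v.2⟩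
  · exact ⟨ℓ, fun v => by simpa [minForm] using h v v.2⟩

theorem linearPart_minForm_of_nonneg (hP : P.QuasiEmbeds E.ι) (hS : P.Signed E.ι ℓ)
    (hσ : σ ∈ P.cones) (h : ∀ x ∈ σ, 0 ≤ ℓ (E.ι x)) {q : N} (hq : q ∈ cspan E.ι σ) :
    E.linearPart (E.minForm ℓ) σ q = 0 := by
  rw [linearPart_eq hP (minForm_linearOn hP hS) hσ (ℓ := 0)
    (fun x hx => by simpa [minForm] using h x hx) hq, LinearMap.zero_apply]

theorem linearPart_minForm_of_nonpos (hP : P.QuasiEmbeds E.ι) (hS : P.Signed E.ι ℓ)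
    (hσ : σ ∈ P.cones) (h : ∀ x ∈ σ, ℓ (E.ι x) ≤ 0) {q : N} (hq : q ∈ cspan E.ι σ) :
    E.linearPart (E.minForm ℓ) σ q = ℓ q :=
  linearPart_eq hP (minForm_linearOn hP hS) hσ (fun x hx => by simpa [minForm] using h x hx) hq

/-- At a point of the hyperplane, the derivative of `min 0 ℓ` in a direction is `min 0` of the
derivative of `ℓ`. -/
theorem linearPart_minForm (hP : P.QuasiEmbeds E.ι) (hS : P.Signed E.ι ℓ) (hτ : τ ∈ P.cones)
    {p : X} (hp : p ∈ ri E.ι τ) (h0 : ℓ (E.ι p) = 0) (hσ : σ ∈ E.star P τ) :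
    E.linearPart (E.minForm ℓ) σ (E.normal σ τ) = min 0 (ℓ (E.normal σ τ)) := by
  obtain ⟨h1, h2, h3⟩ := mem_star.1 hσ
  have hn := isNormal_normal h2 h3
  obtain ⟨ε, hε, h⟩ := hn.exists_ri h2 h3 (hP.isEmbCone hτ) (hP.isEmbCone h1) hp
  obtain ⟨y, hy, e⟩ := h ε hε le_rfl
  have hy' : ℓ (E.ι y) = ε * ℓ (E.normal σ τ) := by
    rw [e, map_add, h0, zero_add, map_smul, smul_eq_mul]
  rcases hS σ h1 with hs | hs
  · have := hs y (ri_subset hy)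
    rw [linearPart_minForm_of_nonneg hP hS h1 hs hn.2.1, min_eq_left]
    rw [hy'] at this
    exact nonneg_of_mul_nonneg_right this hε
  · have := hs y (ri_subset hy)
    rw [linearPart_minForm_of_nonpos hP hS h1 hs hn.2.1, min_eq_right]
    rw [hy'] at this
    exact nonpos_of_mul_nonpos_right this hε

theorem inter_minForm (hP : P.QuasiEmbeds E.ι) (hS : P.Signed E.ι ℓ) (hτ : τ ∈ P.cones)
    {p : X} (hp : p ∈ ri E.ι τ) (h0 : ℓ (E.ι p) = 0) (c : Set X → ℝ) :
    E.inter P (E.minForm ℓ) c τ = ∑ σ ∈ E.star P τ, -min 0 (ℓ (E.normal σ τ)) * c σ := by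
  rw [inter_eq hP _ _ hτ]
  exact Finset.sum_congr rfl fun σ hσ => by rw [linearPart_minForm hP hS hτ hp h0 hσ]

/-- Off the hyperplane, `min 0 ℓ` coincides locally with `ℓ` or with `0`, and a balanced weight has
zero product with both. -/
theorem inter_minForm_of_ne (hP : P.QuasiEmbeds E.ι) (hS : P.Signed E.ι ℓ) (hτ : τ ∈ P.cones)
    {p : X} (hp : p ∈ τ) (h0 : ℓ (E.ι p) ≠ 0) {c : Set X → ℝ} (hc : E.Balanced P c) :
    E.inter P (E.minForm ℓ) c τ = 0 := by
  rcases lt_or_gt_of_ne h0 with h | h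
  · refine Eq.trans ?_ (congrFun (hc ℓ) τ)
    rw [inter_eq hP _ _ hτ, inter_eq hP _ _ hτ]
    refine Finset.sum_congr rfl fun σ hσ => ?_
    obtain ⟨h1, h2, h3⟩ := mem_star.1 hσ
    have hn := (isNormal_normal h2 h3).2.1
    have hs : ∀ x ∈ σ, ℓ (E.ι x) ≤ 0 :=
      (hS σ h1).resolve_left fun hs => absurd (hs p (h2.subset hp)) (not_le.2 h)
    rw [linearPart_minForm_of_nonpos hP hS h1 hs hn,
      linearPart_eq hP (hP.1 ℓ) h1 (fun x _ => rfl) hn]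
  · rw [inter_eq hP _ _ hτ]
    refine Finset.sum_eq_zero fun σ hσ => ?_
    obtain ⟨h1, h2, h3⟩ := mem_star.1 hσ
    have hs : ∀ x ∈ σ, 0 ≤ ℓ (E.ι x) :=
      (hS σ h1).resolve_right fun hs => absurd (hs p (h2.subset hp)) (not_le.2 h)
    rw [linearPart_minForm_of_nonneg hP hS h1 hs (isNormal_normal h2 h3).2.1, neg_zero, zero_mul]

theorem inter_minForm_nonneg (hP : P.QuasiEmbeds E.ι) (hS : P.Signed E.ι ℓ) {c : Set X → ℝ}
    (hc : E.Balanced P c) (h0 : ∀ σ, 0 ≤ c σ) (τ : Set X) :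
    0 ≤ E.inter P (E.minForm ℓ) c τ := by
  by_cases hτ : τ ∈ P.cones
  swap
  · exact (inter_of_notMem _ _ hτ).ge
  obtain ⟨p, hp⟩ := (hP.isEmbCone hτ).exists_ri
  by_cases h : ℓ (E.ι p) = 0
  · rw [inter_minForm hP hS hτ hp h]
    exact Finset.sum_nonneg fun σ _ => mul_nonneg (neg_nonneg.2 (min_le_left _ _)) (h0 σ)
  · exact (inter_minForm_of_ne hP hS hτ (ri_subset hp) h hc).ge

theorem foldr_minForm_nonneg (hP : P.QuasiEmbeds E.ι) {ℓs : List (Module.Dual ℝ N)}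
    (hS : ∀ ℓ ∈ ℓs, P.Signed E.ι ℓ) {c : Set X → ℝ} (hc : E.Balanced P c) (h0 : ∀ σ, 0 ≤ c σ) :
    E.Balanced P ((ℓs.map E.minForm).foldr (E.inter P) c) ∧
      ∀ σ, 0 ≤ (ℓs.map E.minForm).foldr (E.inter P) c σ := by
  induction ℓs with
  | nil => exact ⟨hc, h0⟩
  | cons ℓ ℓs ih =>
    obtain ⟨h1, h2⟩ := ih fun ℓ h => hS ℓ (List.mem_cons_of_mem _ h)
    have hs := hS ℓ List.mem_cons_self
    exact ⟨h1.inter hP (minForm_linearOn hP hs), inter_minForm_nonneg hP hs h1 h2⟩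

theorem mem_of_cuts {β : Set X} {ℓs : List (Module.Dual ℝ N)} {W : Submodule ℝ N}
    (hW : Cuts (cspan E.ι β) ℓs W) (hS : ∀ ℓ ∈ ℓs, Q.Signed E.ι ℓ) (hσ : σ ∈ Q.cones)
    (hs : σ ⊆ β) {y : X} (hy : y ∈ ri E.ι σ) (hyW : E.ι y ∈ W) : ∀ x ∈ σ, E.ι x ∈ W := by
  induction ℓs generalizing W with
  | nil =>
    obtain rfl : W = cspan E.ι β := hW
    exact fun x hx => mem_cspan (hs hx)
  | cons ℓ ℓs ih =>
    obtain ⟨W', h1, rfl, -⟩ := hW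
    intro x hx
    exact ⟨ih h1 (fun ℓ h => hS ℓ (List.mem_cons_of_mem _ h)) hyW.1 x hx,
      eq_zero_of_signed (hS ℓ List.mem_cons_self) hσ hy hyW.2 x hx⟩

/-- Small displacements of `x` inside a cone stay in cones that contain `x`. -/
theorem eventually_exists_carrier (hP : P.QuasiEmbeds E.ι) (hQP : Q.IsSubdivision P)
    {β : Set X} (hβ : β ∈ P.cones) {x : X} (hx : x ∈ β) {d : N}
    (hd : ∀ᶠ t : ℝ in 𝓝[>] 0, E.ι x + t • d ∈ E.ι '' β) :
    ∀ᶠ t : ℝ in 𝓝[>] 0, ∃ σ ∈ Q.cones, σ ⊆ β ∧ x ∈ σ ∧ ∃ y ∈ ri E.ι σ, E.ι y = E.ι x + t • d := by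
  obtain ⟨ε, hε, h⟩ := (hP.isEmbCone hβ).exists_pos_forall_mem hx (Q.eventually_mem_of_mem x)
  have hlim : Tendsto (fun t : ℝ => ‖t • d‖) (𝓝[>] 0) (𝓝 0) := by
    have : Tendsto (fun t : ℝ => ‖t • d‖) (𝓝 0) (𝓝 ‖(0 : ℝ) • d‖) :=
      ((continuous_id.smul continuous_const).norm).tendsto 0
    rw [zero_smul, norm_zero] at this
    exact this.mono_left nhdsWithin_le_nhds
  filter_upwards [hd, hlim.eventually_lt_const hε] with t ht hlt
  obtain ⟨y, hy, e⟩ := ht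
  obtain ⟨σ, hσ, hyσ, hs⟩ := hP.exists_ri_subset hQP hβ hy
  exact ⟨σ, hσ, hs, h y hy (by rwa [e, add_sub_cancel_left]) σ hσ (ri_subset hyσ), y, hyσ, e⟩

end EuclideanConicalSpace

/-! ### Support and positivity of slices. -/

namespace BalancedSpace

open EuclideanConicalSpace

variable {X N : Type*} [TopologicalSpace X] [NormedAddCommGroup N] [InnerProductSpace ℝ N]
  [FiniteDimensional ℝ N] {n : ℕ} {E : BalancedSpace X N n} {Q : ConicalComplex X} {β σ : Set X}

/-- The product of `[X]` with the concave functions attached to linear forms. -/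
def slice (E : BalancedSpace X N n) (ℓs : List (Module.Dual ℝ N)) (Q : ConicalComplex X) :
    Set X → ℝ :=
  E.prod (ℓs.map E.minForm) Q

theorem slice_nonneg (hQ : Q.IsSubdivision E.base) {ℓs : List (Module.Dual ℝ N)}
    (hS : ∀ ℓ ∈ ℓs, Q.Signed E.ι ℓ) : E.Balanced Q (E.slice ℓs Q) ∧ ∀ σ, 0 ≤ E.slice ℓs Q σ :=
  foldr_minForm_nonneg (quasiEmbeds_of_base hQ) hS (prod_balanced (φs := []) hQ (by simp))
    (pullback_nonneg weight_nonneg)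

/-- Around an interior point of the maximal cone `β` only cones inside `β` carry weight, and each
factor `min 0 ℓ` leaves only those where `ℓ` vanishes. -/
theorem slice_support (hQ : Q.IsSubdivision E.base) (hβ : β ∈ E.base.cones)
    (hd : cdim E.ι β = n) {ℓs : List (Module.Dual ℝ N)} {W : Submodule ℝ N}
    (hW : Cuts (cspan E.ι β) ℓs W) (hS : ∀ ℓ ∈ ℓs, Q.Signed E.ι ℓ) {p : X} (hp : p ∈ ri E.ι β)
    (hpσ : p ∈ σ) (h : E.slice ℓs Q σ ≠ 0) : σ ⊆ β ∧ ∀ x ∈ σ, E.ι x ∈ W := by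
  have hQ' := quasiEmbeds_of_base hQ
  induction ℓs generalizing W σ with
  | nil =>
    obtain rfl : W = cspan E.ι β := hW
    have h1 := (prod_ne_zero (φs := []) hQ h).2
    obtain ⟨-, β', hβ', hs, h2, -⟩ := exists_of_pullback_ne_zero E.quasiEmbeds hQ h
    have hf := E.quasiEmbeds.faceOf_of_ri hβ hβ' hp (hs hpσ)
    obtain rfl := hf.eq_of_cdim_le (by rw [hd, h2]; simp at h1; omega)
    exact ⟨hs, fun x hx => mem_cspan (hs hx)⟩
  | cons ℓ ℓs ih =>
    obtain ⟨W', h1, rfl, -⟩ := hW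
    have hS' : ∀ ℓ ∈ ℓs, Q.Signed E.ι ℓ := fun ℓ h => hS ℓ (List.mem_cons_of_mem _ h)
    have hs := hS ℓ List.mem_cons_self
    obtain ⟨hσ, σ', hσ', h0⟩ := inter_ne_zero hQ' h
    obtain ⟨h2, h3, -⟩ := mem_star.1 hσ'
    obtain ⟨h4, h5⟩ := ih h1 hS' (h3.subset hpσ) h0
    refine ⟨h3.subset.trans h4, fun x hx => ⟨h5 x (h3.subset hx), ?_⟩⟩
    obtain ⟨q, hq⟩ := (hQ'.isEmbCone hσ).exists_ri
    refine eq_zero_of_signed hs hσ hq ?_ x hx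
    by_contra hne
    exact h (inter_minForm_of_ne hQ' hs hσ (ri_subset hq) hne (slice_nonneg hQ hS').1)

/-- The last cut is undone: from `p` one moves slightly inside `W'` to the side `ℓ < 0`, staying in
the interior of `β`. The cone reached has `σ` as a facet, has positive weight by induction, and
enters with the coefficient `-ℓ` of its normal, which is positive; all other terms are nonnegative.
-/
theorem slice_pos (hQ : Q.IsSubdivision E.base) (hβ : β ∈ E.base.cones)
    (hd : cdim E.ι β = n) {ℓs : List (Module.Dual ℝ N)} {W : Submodule ℝ N}
    (hW : Cuts (cspan E.ι β) ℓs W) (hS : ∀ ℓ ∈ ℓs, Q.Signed E.ι ℓ) {p : X} (hp : p ∈ ri E.ι β)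
    (hσ : σ ∈ Q.cones) (hs : σ ⊆ β) (hσW : ∀ x ∈ σ, E.ι x ∈ W) (hpσ : p ∈ ri E.ι σ)
    (hdσ : cdim E.ι σ = Module.finrank ℝ W) : 0 < E.slice ℓs Q σ := by
  have hQ' := quasiEmbeds_of_base hQ
  induction ℓs generalizing W σ p with
  | nil =>
    obtain rfl : W = cspan E.ι β := hW
    have h1 : E.slice [] Q σ = E.weight β :=
      pullback_of_subset E.quasiEmbeds hQ E.weight hβ hσ hs hdσ.symm
    rw [h1]
    exact E.weight_pos β ((mem_conesOfDim E.quasiEmbeds).2 ⟨hβ, hd⟩)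
  | cons ℓ ℓs ih =>
    obtain ⟨W', h1, rfl, hnot⟩ := hW
    have hS' : ∀ ℓ ∈ ℓs, Q.Signed E.ι ℓ := fun ℓ h => hS ℓ (List.mem_cons_of_mem _ h)
    have hsℓ := hS ℓ List.mem_cons_self
    have hW' := h1.le
    obtain ⟨u, hu, hu0⟩ : ∃ u ∈ W', ℓ u < 0 := by
      obtain ⟨u, hu, hu0⟩ := SetLike.not_le_iff_exists.1 hnot
      rcases lt_or_gt_of_ne (show ℓ u ≠ 0 from hu0) with h | h
      · exact ⟨u, hu, h⟩
      · exact ⟨-u, neg_mem hu, by rw [map_neg]; linarith⟩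
    have hpℓ : ℓ (E.ι p) = 0 := (hσW p (ri_subset hpσ)).2
    have hβe := E.quasiEmbeds.isEmbCone hβ
    have hev := hβe.poly.eventually_mem_relint hp.2 (hW' hu)
    have hev' := eventually_exists_carrier E.quasiEmbeds hQ hβ (ri_subset hp)
      (hev.mono fun t ht => relint_subset ht)
    obtain ⟨t, ⟨ht0, htr⟩, σ', hσ', hs', hpσ', y, hy, e⟩ :=
      ((eventually_mem_nhdsWithin.and hev).and hev').exists
    rw [mem_Ioi] at ht0
    have hyβ : y ∈ ri E.ι β := ⟨hs' (ri_subset hy), by rw [e]; exact htr⟩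
    have hyW : E.ι y ∈ W' := by
      rw [e]; exact add_mem (hσW p (ri_subset hpσ)).1 (W'.smul_mem t hu)
    have hyℓ : ℓ (E.ι y) < 0 := by
      rw [e, map_add, hpℓ, zero_add, map_smul, smul_eq_mul]
      exact mul_neg_of_pos_of_neg ht0 hu0
    have hσW' := mem_of_cuts h1 hS' hσ' hs' hy hyW
    have hf := hQ'.faceOf_of_ri hσ hσ' hpσ hpσ'
    have hdim := finrank_inf_ker_add_one hnot
    have hle : cdim E.ι σ' ≤ Module.finrank ℝ W' := by
      refine Submodule.finrank_mono (Submodule.span_le.2 ?_)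
      rintro _ ⟨x, hx, rfl⟩
      exact hσW' x hx
    have hlt : cdim E.ι σ < cdim E.ι σ' := by
      by_contra hge
      have := hf.eq_of_cdim_le (not_lt.1 hge)
      rw [← this] at hy
      exact hyℓ.ne (hσW y (ri_subset hy)).2
    have hstar : σ' ∈ E.star Q σ := mem_star.2 ⟨hσ', hf, by omega⟩
    have hpos := ih h1 hS' hyβ hσ' hs' hσW' hy (by omega)
    have hn := isNormal_normal hf (by omega)
    have hneg : ℓ (E.normal σ' σ) < 0 := by
      have h2 := hn.sub_mem hf.subset (by omega) (mem_cspan (ri_subset hy))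
      have h3 : ℓ (E.ι y - inner ℝ (E.normal σ' σ) (E.ι y) • E.normal σ' σ) = 0 :=
        eq_zero_of_mem_cspan (fun x hx => (hσW x hx).2) h2
      rw [map_sub, map_smul, smul_eq_mul, sub_eq_zero] at h3
      have h4 := hn.2.2.2 y (ri_subset hy)
      rw [h3] at hyℓ
      exact (pos_iff_neg_of_mul_neg hyℓ).1 (lt_of_le_of_ne h4 fun h0 => by
        rw [← h0, zero_mul] at hyℓ; exact lt_irrefl _ hyℓ)
    have heq : E.slice (ℓ :: ℓs) Q σ =
        ∑ ρ ∈ E.star Q σ, -min 0 (ℓ (E.normal ρ σ)) * E.slice ℓs Q ρ :=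
      inter_minForm hQ' hsℓ hσ hpσ hpℓ _
    rw [heq]
    refine Finset.sum_pos' (fun ρ _ => mul_nonneg (neg_nonneg.2 (min_le_left _ _))
      ((slice_nonneg hQ hS').2 ρ)) ⟨σ', hstar, mul_pos ?_ hpos⟩
    rw [min_eq_right hneg.le]
    linarith

end BalancedSpace


/-! ### Concavity on the maximal cones -/

/-- A continuous function on an interval that has a line of support from above at each interior
point is concave. -/
theorem add_le_two_mul_of_locally_supported {u : ℝ → ℝ} (hu : ContinuousOn u (Icc 0 1))
    (h : ∀ t ∈ Ioo (0 : ℝ) 1, ∃ s : ℝ, ∀ᶠ r in 𝓝 (0 : ℝ), u (t + r) ≤ u t + r * s) :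
    u 0 + u 1 ≤ 2 * u (1 / 2) := by
  -- After subtraction of the chord, `w` vanishes at both ends. If its minimum is negative, let `t₀`
  -- be the first point where it is attained: comparison on the right shows that the support line
  -- has slope at least zero, so the minimum is attained to the left of `t₀` as well, a
  -- contradiction.
  set w : ℝ → ℝ := fun t => u t - ((1 - t) * u 0 + t * u 1) with hw
  have hwc : ContinuousOn w (Icc 0 1) := hu.sub (by fun_prop)
  have hws : ∀ t ∈ Ioo (0 : ℝ) 1, ∃ s : ℝ, ∀ᶠ r in 𝓝 (0 : ℝ), w (t + r) ≤ w t + r * s := by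
    intro t ht
    obtain ⟨s, hs⟩ := h t ht
    refine ⟨s + u 0 - u 1, hs.mono fun r hr => ?_⟩
    simp only [hw]
    linarith
  by_contra hlt
  have hneg : w (1 / 2) < 0 := by simp only [hw]; linarith
  obtain ⟨t₁, ht₁, hmin⟩ := isCompact_Icc.exists_isMinOn (nonempty_Icc.2 zero_le_one) hwc
  have hm : w t₁ < 0 := lt_of_le_of_lt (hmin (show (1 / 2 : ℝ) ∈ Icc (0 : ℝ) 1 by norm_num)) hneg
  set A : Set ℝ := Icc 0 1 ∩ w ⁻¹' {w t₁} with hA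
  have hAc : IsClosed A := hwc.preimage_isClosed_of_isClosed isClosed_Icc isClosed_singleton
  have hbdd : BddBelow A := ⟨0, fun t ht => ht.1.1⟩
  have hmem : sInf A ∈ A := hAc.csInf_mem ⟨t₁, ht₁, rfl⟩ hbdd
  set t₀ := sInf A with ht₀
  have h0 : w t₀ = w t₁ := hmem.2
  have ht : t₀ ∈ Ioo (0 : ℝ) 1 := by
    refine ⟨lt_of_le_of_ne hmem.1.1 fun e => ?_, lt_of_le_of_ne hmem.1.2 fun e => ?_⟩
    · rw [← h0, ← e] at hm; simp [hw] at hm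
    · rw [← h0, e] at hm; simp [hw] at hm
  obtain ⟨s, hs⟩ := hws t₀ ht
  obtain ⟨ε, hε, hb⟩ := Metric.eventually_nhds_iff.1 hs
  obtain ⟨δ, hδ, hδε, hδ0, hδ1⟩ : ∃ δ > 0, δ < ε ∧ δ < t₀ ∧ δ < 1 - t₀ := by
    refine ⟨min (ε / 2) (min (t₀ / 2) ((1 - t₀) / 2)), ?_, ?_, ?_, ?_⟩
    · have := ht.1; have := ht.2
      exact lt_min (by linarith) (lt_min (by linarith) (by linarith))
    · exact lt_of_le_of_lt (min_le_left _ _) (by linarith)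
    · exact lt_of_le_of_lt ((min_le_right _ _).trans (min_le_left _ _)) (by linarith [ht.1])
    · exact lt_of_le_of_lt ((min_le_right _ _).trans (min_le_right _ _)) (by linarith [ht.2])
  have h1 := hb (y := δ) (by simpa [abs_of_pos hδ] using hδε)
  have h2 := hb (y := -δ) (by simpa [abs_of_pos hδ] using hδε)
  have h3 : w t₁ ≤ w (t₀ + δ) := hmin ⟨by linarith [ht.1], by linarith⟩
  have hI : t₀ + -δ ∈ Icc (0 : ℝ) 1 := ⟨by linarith, by linarith [ht.2]⟩
  have h4 : w t₁ ≤ w (t₀ + -δ) := hmin hI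
  have h5 : 0 ≤ δ * s := by linarith
  have h6 : w (t₀ + -δ) = w t₁ := le_antisymm (by linarith) h4
  have := csInf_le hbdd (show t₀ + -δ ∈ A from ⟨hI, h6⟩)
  rw [← ht₀] at this
  linarith

theorem ConicalComplex.continuous_of_continuousOn {X Y : Type*} [TopologicalSpace X]
    [TopologicalSpace Y] (P : ConicalComplex X) {f : X → Y} (h : ∀ σ ∈ P.cones, ContinuousOn f σ) :
    Continuous f := by
  refine LocallyFinite.continuous (f := fun σ : P.cones => (σ : Set X)) (locallyFinite_of_finite _)
    ?_ (fun σ => P.isClosed σ σ.2) (fun σ => h σ σ.2)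
  rw [← P.cover, iUnion_subtype]

namespace EuclideanConicalSpace

variable {X N : Type*} [TopologicalSpace X] [NormedAddCommGroup N] [InnerProductSpace ℝ N]
  [FiniteDimensional ℝ N] {E : EuclideanConicalSpace X N} {P Q : ConicalComplex X} {σ τ β : Set X}

theorem continuous_ι (E : EuclideanConicalSpace X N) : Continuous E.ι :=
  E.base.continuous_of_continuousOn fun _ hσ => (E.quasiEmbeds.isEmbCone hσ).continuousOn

theorem continuous_of_linearOn (hP : P.QuasiEmbeds E.ι) {φ : X → ℝ} (hφ : P.LinearOn φ) :
    Continuous φ := by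
  refine P.continuous_of_continuousOn fun σ hσ => ?_
  have h : ContinuousOn (fun x => E.linearPart φ σ (E.ι x)) σ :=
    ((E.linearPart φ σ).continuous_of_finiteDimensional.comp E.continuous_ι).continuousOn
  exact h.congr fun x hx => (linearPart_apply hP hφ hσ hx).symm

/-- The function on the image of the cone `β` that corresponds to `φ`. -/
def onCone (E : EuclideanConicalSpace X N) (φ : X → ℝ) (β : Set X) : N → ℝ :=
  Function.extend (fun x : β => E.ι x) (fun x => φ x) 0

theorem onCone_apply (hβ : IsEmbCone E.ι β) (φ : X → ℝ) {y : X} (hy : y ∈ β) :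
    E.onCone φ β (E.ι y) = φ y :=
  hβ.isEmbedding.injective.extend_apply (fun x : β => φ x) 0 ⟨y, hy⟩

theorem continuousOn_onCone (hβ : IsEmbCone E.ι β) {φ : X → ℝ} (hφ : Continuous φ) :
    ContinuousOn (E.onCone φ β) (E.ι '' β) := by
  rintro _ ⟨y, hy, rfl⟩
  have h := hβ.isEmbedding.map_nhds_eq ⟨y, hy⟩
  have hr : range (fun x : β => E.ι x) = E.ι '' β := by rw [image_eq_range]
  rw [hr] at h
  rw [ContinuousWithinAt, ← h, tendsto_map'_iff, onCone_apply hβ φ hy]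
  refine Tendsto.congr (fun x => (onCone_apply hβ φ x.2).symm) ?_
  exact (hφ.comp continuous_subtype_val).continuousAt

theorem onCone_smul (hQ : Q.IsSubdivision E.base) {φ : X → ℝ} (hφ : Q.LinearOn φ)
    (hβ : β ∈ E.base.cones) {q : N} (hq : q ∈ E.ι '' β) {t : ℝ} (ht : 0 ≤ t) :
    E.onCone φ β (t • q) = t * E.onCone φ β q := by
  have hQ' := E.quasiEmbeds.of_isSubdivision hQ
  have hβe := E.quasiEmbeds.isEmbCone hβ
  obtain ⟨y, hy, rfl⟩ := hq
  obtain ⟨τ, hτ, hyτ, hs⟩ := E.quasiEmbeds.exists_ri_subset hQ hβ hy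
  obtain ⟨y', hy', e⟩ := (hQ'.isEmbCone hτ).poly.smul_mem ht (mem_image_of_mem _ (ri_subset hyτ))
  rw [← e, onCone_apply hβe φ (hs hy'), onCone_apply hβe φ hy,
    ← linearPart_apply hQ' hφ hτ hy', ← linearPart_apply hQ' hφ hτ (ri_subset hyτ), e, map_smul,
    smul_eq_mul]

end EuclideanConicalSpace

namespace BalancedSpace

open EuclideanConicalSpace

variable {X N : Type*} [TopologicalSpace X] [NormedAddCommGroup N] [InnerProductSpace ℝ N]
  [FiniteDimensional ℝ N] {n : ℕ} {E : BalancedSpace X N n} {Q R : ConicalComplex X}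
  {β σ ρ : Set X} {φ : X → ℝ}

theorem exists_linearOn_one (hφ : φ ∈ E.PL) :
    ∃ Q : ConicalComplex X, Q.IsSubdivision E.base ∧ Q.LinearOn φ := by
  obtain ⟨Q, hQ, h, -⟩ := exists_linearOn (φs := [φ]) (by simpa using hφ) [] (by simp) []
  exact ⟨Q, hQ, h φ (by simp)⟩

theorem continuous_of_mem_PL (hφ : φ ∈ E.PL) : Continuous φ := by
  obtain ⟨Q, hQ, h⟩ := exists_linearOn_one hφ
  exact continuous_of_linearOn (quasiEmbeds_of_base hQ) h

theorem IsPositive.exists_nonneg {φs : List (X → ℝ)} (h : E.IsPositive φs)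
    (hR : R.IsSubdivision E.base) : ∃ Q : ConicalComplex X, Q.IsSubdivision E.base ∧
      Q.IsSubdivision R ∧ (∀ φ ∈ φs, Q.LinearOn φ) ∧ ∀ σ, 0 ≤ E.prod φs Q σ := by
  obtain ⟨P, z, hz, h0⟩ := h
  obtain ⟨Q₀, hQ₀, hP, e⟩ := hz.exists_common
  obtain ⟨Q, hQ, hs, -⟩ := E.exists_common [Q₀, R] (by
    simp [E.mem_R_of_isSubdivision hQ₀, E.mem_R_of_isSubdivision hR]) []
  have hφ : ∀ φ ∈ φs, Q₀.LinearOn φ := fun φ hφ => (hz.2.1 φ hφ).of_isSubdivision hP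
  refine ⟨Q, hQ, hs R (by simp), fun φ h => (hφ φ h).of_isSubdivision (hs Q₀ (by simp)), ?_⟩
  rw [prod_pullback hQ₀ (hs Q₀ (by simp)) hφ, ← e]
  exact pullback_nonneg (pullback_nonneg h0)

/-- By commutativity the product is the slice of `φ · [X]` instead of `[X]`, and products with the
functions `min 0 ℓ` preserve positivity. -/
theorem inter_slice_nonneg (hQ : Q.IsSubdivision E.base) {ℓs : List (Module.Dual ℝ N)}
    (hS : ∀ ℓ ∈ ℓs, Q.Signed E.ι ℓ) (hφ : Q.LinearOn φ) (h0 : ∀ σ, 0 ≤ E.prod [φ] Q σ)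
    (τ : Set X) : 0 ≤ E.inter Q φ (E.slice ℓs Q) τ := by
  have hQ' := quasiEmbeds_of_base hQ
  have hg : ∀ ψ ∈ φ :: ℓs.map E.minForm, Q.LinearOn ψ := by
    intro ψ hψ
    rcases List.mem_cons.1 hψ with rfl | hψ
    · exact hφ
    · obtain ⟨ℓ, hℓ, rfl⟩ := List.mem_map.1 hψ
      exact minForm_linearOn hQ' (hS ℓ hℓ)
  have h1 : E.inter Q φ (E.slice ℓs Q) = E.prod (ℓs.map E.minForm ++ [φ]) Q := by
    rw [slice, ← prod_cons]
    exact prod_perm hQ (List.perm_append_singleton _ _).symm hg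
  rw [h1, prod, List.foldr_append]
  exact (foldr_minForm_nonneg hQ' hS (prod_balanced (φs := [φ]) hQ (by simpa using hφ)) h0).2 τ

/-- The balancing inequality of a concave function along a slice. -/
theorem sum_star_slice_le (hQ : Q.IsSubdivision E.base) {ℓs : List (Module.Dual ℝ N)}
    (hS : ∀ ℓ ∈ ℓs, Q.Signed E.ι ℓ) (hφ : Q.LinearOn φ) (h0 : ∀ σ, 0 ≤ E.prod [φ] Q σ)
    (hρ : ρ ∈ Q.cones) :
    ∑ σ ∈ E.star Q ρ, E.linearPart φ σ (E.normal σ ρ) * E.slice ℓs Q σ ≤ 0 := by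
  have h := inter_slice_nonneg hQ hS hφ h0 ρ
  rw [inter_eq (quasiEmbeds_of_base hQ) _ _ hρ] at h
  simp only [neg_mul, Finset.sum_neg_distrib] at h
  linarith

/-- A complex on which a given point of `β` spans a ray, and where given forms have signs. -/
theorem exists_ray (hβ : β ∈ E.base.cones) {x : X} (hx : x ∈ β) (ℓs : List (Module.Dual ℝ N)) :
    ∃ R : ConicalComplex X, R.IsSubdivision E.base ∧ (∀ ℓ ∈ ℓs, R.Signed E.ι ℓ) ∧
      ∀ Q : ConicalComplex X, Q.IsSubdivision R →
        ∃ ρ ∈ Q.cones, x ∈ ri E.ι ρ ∧ cspan E.ι ρ = Submodule.span ℝ {E.ι x} := by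
  obtain ⟨ks, hks⟩ := exists_cuts (V := cspan E.ι β) (W := Submodule.span ℝ {E.ι x})
    ((Submodule.span_singleton_le_iff_mem _ _).2 (mem_cspan hx))
  obtain ⟨R, hR, -, hS⟩ := E.exists_common [] (by simp) (ℓs ++ ks)
  refine ⟨R, hR, fun ℓ hℓ => hS ℓ (List.mem_append_left _ hℓ), fun Q hQ => ?_⟩
  obtain ⟨ρ, hρ, hxρ, hs⟩ := E.quasiEmbeds.exists_ri_subset (hQ.trans hR) hβ hx
  have h := mem_of_cuts hks (Q := Q)
    (fun ℓ hℓ => (hS ℓ (List.mem_append_right _ hℓ)).of_isSubdivision hQ) hρ hs hxρ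
    (Submodule.mem_span_singleton_self _)
  refine ⟨ρ, hρ, hxρ, le_antisymm (Submodule.span_le.2 ?_)
    ((Submodule.span_singleton_le_iff_mem _ _).2 (mem_cspan (ri_subset hxρ)))⟩
  rintro _ ⟨y, hy, rfl⟩
  exact h y hy

theorem finrank_span_pair {x d : N} (hx : x ≠ 0) (hd : d ∉ Submodule.span ℝ {x}) :
    Module.finrank ℝ (Submodule.span ℝ {x, d}) = 2 := by
  have h : LinearIndependent ℝ ![x, d] := by
    refine (LinearIndependent.pair_iff' hx).2 fun a ha => hd ?_
    rw [← ha]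
    exact Submodule.smul_mem _ _ (Submodule.mem_span_singleton_self _)
  have := finrank_span_eq_card h
  rwa [Matrix.range_cons, Matrix.range_cons, Matrix.range_empty, union_empty, singleton_union,
    Fintype.card_fin] at this

/-- The cone of a slice that contains small displacements of `x` in a given direction. -/
theorem exists_sector (hQ : Q.IsSubdivision E.base) (hβ : β ∈ E.base.cones) {x : X} (hx : x ∈ β)
    (hx0 : E.ι x ≠ 0) {d : N} (hd : d ∉ Submodule.span ℝ {E.ι x}) {ℓs : List (Module.Dual ℝ N)}
    (hW : Cuts (cspan E.ι β) ℓs (Submodule.span ℝ {E.ι x, d})) (hS : ∀ ℓ ∈ ℓs, Q.Signed E.ι ℓ)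
    (hρ : ρ ∈ Q.cones) (hxρ : x ∈ ri E.ι ρ) (hρs : cspan E.ι ρ = Submodule.span ℝ {E.ι x})
    {S : ℝ → Prop} (hT : ∀ᶠ t : ℝ in 𝓝[>] 0, E.ι x + t • d ∈ E.ι '' β ∧ S t) :
    ∃ σ ∈ E.star Q ρ, σ ⊆ β ∧ cspan E.ι σ = Submodule.span ℝ {E.ι x, d} ∧
      0 < inner ℝ (E.normal σ ρ) d ∧
      ∃ t : ℝ, 0 < t ∧ S t ∧ ∃ y ∈ ri E.ι σ, E.ι y = E.ι x + t • d := by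
  have hQ' := quasiEmbeds_of_base hQ
  obtain ⟨t, ⟨ht0, -, hSt⟩, σ, hσ, hs, hxσ, y, hy, e⟩ := ((eventually_mem_nhdsWithin.and hT).and
    (eventually_exists_carrier E.quasiEmbeds hQ hβ hx (hT.mono fun t ht => ht.1))).exists
  rw [mem_Ioi] at ht0
  have hxW : E.ι x ∈ Submodule.span ℝ {E.ι x, d} := Submodule.subset_span (by simp)
  have hdW : d ∈ Submodule.span ℝ {E.ι x, d} := Submodule.subset_span (by simp)
  have hyW : E.ι y ∈ Submodule.span ℝ {E.ι x, d} := by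
    rw [e]; exact add_mem hxW (Submodule.smul_mem _ _ hdW)
  have hσW := mem_of_cuts hW hS hσ hs hy hyW
  have hf := hQ'.faceOf_of_ri hρ hσ hxρ hxσ
  have hle : cspan E.ι σ ≤ Submodule.span ℝ {E.ι x, d} := by
    refine Submodule.span_le.2 ?_
    rintro _ ⟨z, hz, rfl⟩
    exact hσW z hz
  have hge : Submodule.span ℝ {E.ι x, d} ≤ cspan E.ι σ := by
    refine Submodule.span_le.2 ?_
    rintro q hq
    rcases hq with rfl | hq
    · exact mem_cspan hxσ
    · rw [mem_singleton_iff.1 hq]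
      have h1 : d = t⁻¹ • (E.ι y - E.ι x) := by
        rw [e, add_sub_cancel_left, smul_smul, inv_mul_cancel₀ ht0.ne', one_smul]
      rw [h1]
      exact Submodule.smul_mem _ _ (sub_mem (mem_cspan (ri_subset hy)) (mem_cspan hxσ))
  have hσs := le_antisymm hle hge
  have hdρ : cdim E.ι ρ = 1 := by rw [cdim, hρs, finrank_span_singleton hx0]
  have hdσ : cdim E.ι σ = cdim E.ι ρ + 1 := by rw [hdρ, cdim, hσs, finrank_span_pair hx0 hd]
  have hn := isNormal_normal hf hdσ
  refine ⟨σ, mem_star.2 ⟨hσ, hf, hdσ⟩, hs, hσs, ?_, t, ht0, hSt, y, hy, e⟩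
  have h1 := hn.2.2.2 y (ri_subset hy)
  rw [e, inner_add_right, hn.2.2.1 x (ri_subset hxρ), zero_add, real_inner_smul_right] at h1
  refine lt_of_le_of_ne (nonneg_of_mul_nonneg_right h1 ht0) fun h2 => hd ?_
  have h3 := hn.sub_mem hf.subset hdσ (q := d) (hσs ▸ hdW)
  rwa [← h2, zero_smul, sub_zero, hρs] at h3

/-- Along a segment of a cone of a complex on which `φ` is linear, `φ` is affine. -/
theorem onCone_add_smul (hQ : Q.IsSubdivision E.base) (hφ : Q.LinearOn φ) (hβ : β ∈ E.base.cones)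
    (hσ : σ ∈ Q.cones) (hs : σ ⊆ β) {x y : X} (hx : x ∈ σ) (hy : y ∈ σ) {d : N} {t : ℝ}
    (ht : 0 < t) (e : E.ι y = E.ι x + t • d) {s : ℝ} (hs0 : 0 ≤ s) (hst : s ≤ t) :
    E.onCone φ β (E.ι x + s • d) = φ x + s * E.linearPart φ σ d := by
  have hQ' := quasiEmbeds_of_base hQ
  have hmem : E.ι x + s • d ∈ E.ι '' σ := by
    have := (hQ'.isEmbCone hσ).poly.convex (mem_image_of_mem E.ι hx) (mem_image_of_mem E.ι hy)
      (a := 1 - s / t) (b := s / t) (by rw [sub_nonneg, div_le_one ht]; exact hst) (by positivity)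
      (by ring)
    rw [e] at this
    convert this using 1
    rw [smul_add, smul_smul, div_mul_cancel₀ _ ht.ne']
    module
  obtain ⟨z, hz, ez⟩ := hmem
  rw [← ez, onCone_apply (E.quasiEmbeds.isEmbCone hβ) φ (hs hz), ← linearPart_apply hQ' hφ hσ hz,
    ez, map_add, linearPart_apply hQ' hφ hσ hx, map_smul, smul_eq_mul]

/-- `[X]` is sliced by the plane of `p` and `d`. As `p` is interior to a maximal cone, only the two
sectors on either side of the ray through `p` carry weight. Balancing makes their weights equal,
positivity makes them nonzero, so the inequality says that the slopes of `φ` along `d` and `-d` have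
nonpositive sum. -/
theorem exists_support (hφ : E.IsPositive [φ]) (hβ : β ∈ E.base.cones) (hdβ : cdim E.ι β = n)
    {p : X} (hp : p ∈ ri E.ι β) (hp0 : E.ι p ≠ 0) {d : N} (hdc : d ∈ cspan E.ι β)
    (hd : d ∉ Submodule.span ℝ {E.ι p}) :
    ∃ s : ℝ, ∀ᶠ r in 𝓝 (0 : ℝ), E.onCone φ β (E.ι p + r • d) ≤ E.onCone φ β (E.ι p) + r * s := by
  obtain ⟨ℓs, hℓs⟩ := exists_cuts (V := cspan E.ι β) (W := Submodule.span ℝ {E.ι p, d})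
    (Submodule.span_le.2 (by
      rintro q (rfl | hq)
      · exact mem_cspan (ri_subset hp)
      · exact mem_singleton_iff.1 hq ▸ hdc))
  obtain ⟨R, hR, hRS, hray⟩ := exists_ray hβ (ri_subset hp) ℓs
  obtain ⟨Q, hQ, hQR, hQφ, hpos⟩ := hφ.exists_nonneg hR
  replace hQφ : Q.LinearOn φ := hQφ φ (by simp)
  have hS : ∀ ℓ ∈ ℓs, Q.Signed E.ι ℓ := fun ℓ h => (hRS ℓ h).of_isSubdivision hQR
  obtain ⟨ρ, hρ, hpρ, hρs⟩ := hray Q hQR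
  have hQ' := quasiEmbeds_of_base hQ
  have hβe := E.quasiEmbeds.isEmbCone hβ
  have hd' : -d ∉ Submodule.span ℝ {E.ι p} := fun h => hd (by simpa using neg_mem h)
  have hpair : Submodule.span ℝ {E.ι p, -d} = Submodule.span ℝ {E.ι p, d} := by
    refine le_antisymm (Submodule.span_le.2 ?_) (Submodule.span_le.2 ?_)
    · rintro q (rfl | hq)
      · exact Submodule.subset_span (by simp)
      · rw [mem_singleton_iff.1 hq]; exact neg_mem (Submodule.subset_span (by simp))
    · rintro q (rfl | hq)
      · exact Submodule.subset_span (by simp)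
      · rw [mem_singleton_iff.1 hq, ← neg_neg d]
        exact neg_mem (Submodule.subset_span (by simp))
  have hev : ∀ q ∈ cspan E.ι β, ∀ᶠ t : ℝ in 𝓝[>] 0, E.ι p + t • q ∈ E.ι '' β ∧
      E.ι p + t • q ∈ relint (E.ι '' β) := fun q hq =>
    (hβe.poly.eventually_mem_relint hp.2 hq).mono fun t ht => ⟨relint_subset ht, ht⟩
  obtain ⟨σ₁, hσ₁, hs₁, hW₁, hpos₁, t₁, ht₁, hr₁, y₁, hy₁, e₁⟩ := exists_sector hQ hβ
    (ri_subset hp) hp0 hd hℓs hS hρ hpρ hρs (hev d hdc)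
  obtain ⟨σ₂, hσ₂, hs₂, hW₂, hpos₂, t₂, ht₂, hr₂, y₂, hy₂, e₂⟩ := exists_sector hQ hβ
    (ri_subset hp) hp0 hd' (hpair.symm ▸ hℓs) hS hρ hpρ hρs (hev (-d) (neg_mem hdc))
  rw [hpair] at hW₂
  obtain ⟨hc₁, hf₁, hd₁⟩ := mem_star.1 hσ₁
  obtain ⟨hc₂, hf₂, hd₂⟩ := mem_star.1 hσ₂
  have hn₁ := isNormal_normal hf₁ hd₁
  have hn₂ := isNormal_normal hf₂ hd₂
  have hcl : ∀ v : N, v ∈ (cspan E.ι ρ)ᗮ ⊓ Submodule.span ℝ {E.ι p, d} → ‖v‖ = 1 →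
      v = E.normal σ₁ ρ ∨ v = -E.normal σ₁ ρ := fun v hv hv1 =>
    eq_or_eq_neg_of_unit hf₁.subset hd₁ hn₁.mem hn₁.1 (by rwa [hW₁]) hv1
  have hn21 : E.normal σ₂ ρ = -E.normal σ₁ ρ := by
    refine (hcl _ (hW₂ ▸ hn₂.mem) hn₂.1).resolve_left fun h => ?_
    rw [h, inner_neg_right] at hpos₂
    linarith
  have hne : σ₁ ≠ σ₂ := by
    rintro rfl
    rw [inner_neg_right] at hpos₂
    linarith
  have huniq : ∀ σ ∈ E.star Q ρ, σ ≠ σ₁ ∧ σ ≠ σ₂ → E.slice ℓs Q σ = 0 := by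
    rintro σ hσ ⟨hne₁, hne₂⟩
    by_contra h0
    obtain ⟨hc, hf, hdσ⟩ := mem_star.1 hσ
    obtain ⟨hs, hσW⟩ := slice_support hQ hβ hdβ hℓs hS hp (hf.subset (ri_subset hpρ)) h0
    have hn := isNormal_normal hf hdσ
    have hspan : cspan E.ι σ ≤ Submodule.span ℝ {E.ι p, d} := by
      refine Submodule.span_le.2 ?_
      rintro _ ⟨z, hz, rfl⟩
      exact hσW z hz
    rcases hcl _ ⟨hn.mem.1, hspan hn.mem.2⟩ hn.1 with h | h
    · exact hne₁ (star_unique E.quasiEmbeds hQ hβ hρ hc hc₁ hs hs₁ hf hf₁ hdσ hd₁ (h ▸ hn) hn₁)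
    · rw [← hn21] at h
      exact hne₂ (star_unique E.quasiEmbeds hQ hβ hρ hc hc₂ hs hs₂ hf hf₂ hdσ hd₂ (h ▸ hn) hn₂)
  have hsum : ∀ f : Set X → ℝ, ∑ σ ∈ E.star Q ρ, f σ * E.slice ℓs Q σ =
      f σ₁ * E.slice ℓs Q σ₁ + f σ₂ * E.slice ℓs Q σ₂ := fun f =>
    Finset.sum_eq_add_of_mem σ₁ σ₂ hσ₁ hσ₂ hne fun σ hσ h => by rw [huniq σ hσ h, mul_zero]
  have hfin : Module.finrank ℝ (Submodule.span ℝ {E.ι p, d}) = 2 := finrank_span_pair hp0 hd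
  have hA : 0 < E.slice ℓs Q σ₁ := by
    refine slice_pos hQ hβ hdβ hℓs hS (p := y₁) ⟨hs₁ (ri_subset hy₁), by rw [e₁]; exact hr₁⟩ hc₁ hs₁
      (fun x hx => hW₁ ▸ mem_cspan hx) hy₁ ?_
    rw [cdim, hW₁]
  have hAB : E.slice ℓs Q σ₁ = E.slice ℓs Q σ₂ := by
    have h1 := congrFun ((slice_nonneg hQ hS).1 (innerₗ N (E.normal σ₁ ρ))) ρ
    rw [inter_eq hQ' _ _ hρ, hsum fun σ => -(E.linearPart _ σ (E.normal σ ρ)),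
      linearPart_eq hQ' (hQ'.1 _) hc₁ (fun x _ => rfl) hn₁.2.1,
      linearPart_eq hQ' (hQ'.1 _) hc₂ (fun x _ => rfl) hn₂.2.1, hn21, map_neg,
      innerₗ_apply_apply, real_inner_self_eq_norm_sq, hn₁.1, Pi.zero_apply] at h1
    linarith
  have hineq := sum_star_slice_le hQ hS hQφ hpos hρ
  rw [hsum fun σ => E.linearPart φ σ (E.normal σ ρ), ← hAB, ← add_mul] at hineq
  have hle : E.linearPart φ σ₁ (E.normal σ₁ ρ) + E.linearPart φ σ₂ (E.normal σ₂ ρ) ≤ 0 := by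
    by_contra h
    exact absurd (mul_pos (not_le.1 h) hA) (not_lt.2 hineq)
  -- The direction `d` is a positive multiple of the normal plus a vector in the span of the ray, on
  -- which both linear parts agree; so the inequality for the normals gives the one for `d` and
  -- `-d`.
  have hr := hn₁.sub_mem hf₁.subset hd₁ (q := d) (by rw [hW₁]; exact Submodule.subset_span (by simp))
  have hr12 : E.linearPart φ σ₁ (d - inner ℝ (E.normal σ₁ ρ) d • E.normal σ₁ ρ) =
      E.linearPart φ σ₂ (d - inner ℝ (E.normal σ₁ ρ) d • E.normal σ₁ ρ) := by
    rw [← linearPart_face hQ' hQφ hc₁ hρ hf₁.subset hr, linearPart_face hQ' hQφ hc₂ hρ hf₂.subset hr]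
  have hslope : E.linearPart φ σ₁ d + E.linearPart φ σ₂ (-d) ≤ 0 := by
    rw [hn21] at hle
    simp only [map_sub, map_smul, map_neg, smul_eq_mul] at hr12 hle ⊢
    nlinarith [mul_nonneg hpos₁.le (neg_nonneg.2 hle)]
  refine ⟨E.linearPart φ σ₁ d, ?_⟩
  filter_upwards [Ioo_mem_nhds (neg_lt_zero.2 ht₂) ht₁] with r hr
  have hpφ := onCone_apply hβe φ (ri_subset hp)
  rcases le_total 0 r with h | h
  · rw [onCone_add_smul hQ hQφ hβ hc₁ hs₁ (hf₁.subset (ri_subset hpρ)) (ri_subset hy₁) ht₁ e₁ h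
      hr.2.le, hpφ]
  · have h1 := onCone_add_smul hQ hQφ hβ hc₂ hs₂ (hf₂.subset (ri_subset hpρ)) (ri_subset hy₂) ht₂ e₂
      (s := -r) (by linarith) (by linarith [hr.1])
    rw [smul_neg, neg_smul, neg_neg] at h1
    rw [h1, hpφ]
    nlinarith [mul_nonneg (neg_nonneg.2 h) (neg_nonneg.2 hslope)]

end BalancedSpace


/-! ### Superadditivity on the maximal cones. -/

namespace BalancedSpace

open EuclideanConicalSpace

variable {X N : Type*} [TopologicalSpace X] [NormedAddCommGroup N] [InnerProductSpace ℝ N]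
  [FiniteDimensional ℝ N] {n : ℕ} {E : BalancedSpace X N n} {Q R : ConicalComplex X}
  {β σ ρ : Set X} {φ : X → ℝ}

theorem onCone_smul_of_mem_PL (hφ : φ ∈ E.PL) (hβ : β ∈ E.base.cones) {q : N} (hq : q ∈ E.ι '' β)
    {t : ℝ} (ht : 0 ≤ t) : E.onCone φ β (t • q) = t * E.onCone φ β q := by
  obtain ⟨Q, hQ, h⟩ := exists_linearOn_one hφ
  exact onCone_smul hQ h hβ hq ht

/-- By homogeneity this is midpoint concavity on the segment from `a` to `b`, which follows from the
support lines. These exist only in directions not proportional to the point, so proportional `a` and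
`b` are handled by homogeneity. -/
theorem onCone_add_of_mem_relint (hPL : φ ∈ E.PL) (hφ : E.IsPositive [φ]) (hβ : β ∈ E.base.cones)
    (hdβ : cdim E.ι β = n) {a b : N} (ha : a ∈ relint (E.ι '' β)) (hb : b ∈ relint (E.ι '' β)) :
    E.onCone φ β a + E.onCone φ β b ≤ E.onCone φ β (a + b) := by
  have hβe := E.quasiEmbeds.isEmbCone hβ
  have haK := relint_subset ha
  have hbK := relint_subset hb
  rcases eq_or_ne a 0 with rfl | ha0
  · have h0 := onCone_smul_of_mem_PL hPL hβ hbK (t := 0) le_rfl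
    rw [zero_smul, zero_mul] at h0
    rw [h0, zero_add, zero_add]
  by_cases hli : LinearIndependent ℝ ![a, b]
  swap
  · rw [LinearIndependent.pair_iff' ha0] at hli
    push Not at hli
    obtain ⟨c, rfl⟩ := hli
    rcases le_or_gt 0 c with hc | hc
    · have h1 : a + c • a = (1 + c) • a := by module
      rw [h1, onCone_smul_of_mem_PL hPL hβ haK hc,
        onCone_smul_of_mem_PL hPL hβ haK (t := 1 + c) (by linarith)]
      linarith
    · have h1 := hβe.poly.smul_mem (t := (-c)⁻¹) (inv_nonneg.2 (by linarith)) hbK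
      rw [smul_smul, inv_neg, neg_mul, inv_mul_cancel₀ hc.ne, neg_one_smul] at h1
      exact absurd (hβe.pointed a haK h1) ha0
  rw [LinearIndependent.pair_iff] at hli
  have hseg : ∀ t ∈ Icc (0 : ℝ) 1, a + t • (b - a) ∈ E.ι '' β := by
    intro t ht
    have := hβe.poly.convex haK hbK (a := 1 - t) (b := t) (by linarith [ht.2]) ht.1 (by ring)
    convert this using 1
    module
  have key := add_le_two_mul_of_locally_supported (u := fun t => E.onCone φ β (a + t • (b - a))) ?_ ?_
  · have h1 : a + (1 / 2 : ℝ) • (b - a) = (1 / 2 : ℝ) • (a + b) := by module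
    simp only [zero_smul, add_zero, one_smul, add_sub_cancel] at key
    rw [h1, onCone_smul_of_mem_PL hPL hβ (hβe.poly.add_mem haK hbK) (by norm_num)] at key
    linarith
  · exact (continuousOn_onCone hβe (continuous_of_mem_PL hPL)).comp (by fun_prop) hseg
  · intro t ht
    have hp : a + t • (b - a) ∈ relint (E.ι '' β) := by
      have := hβe.poly.add_mem_relint (hβe.poly.smul_mem_relint ha (t := 1 - t) (by linarith [ht.2]))
        (hβe.poly.smul_mem ht.1.le hbK)
      convert this using 1
      module
    obtain ⟨p, hpβ, e⟩ := relint_subset hp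
    have hd : b - a ∈ cspan E.ι β := sub_mem (Submodule.subset_span hbK) (Submodule.subset_span haK)
    have hp0 : E.ι p ≠ 0 := by
      rw [e]
      intro h0
      obtain ⟨h1, h2⟩ := hli (1 - t) t (by rw [← h0]; module)
      linarith
    have hdp : b - a ∉ Submodule.span ℝ {E.ι p} := by
      rw [e]
      intro h
      obtain ⟨c, hc⟩ := Submodule.mem_span_singleton.1 h
      obtain ⟨h1, h2⟩ := hli (c * (1 - t) + 1) (c * t - 1) (by
        rw [← sub_eq_zero] at hc
        rw [← hc]
        module)
      have : c = 0 := by linarith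
      rw [this] at h2
      linarith
    obtain ⟨s, hs⟩ := exists_support hφ hβ hdβ (p := p) ⟨hpβ, e ▸ hp⟩ hp0 hd hdp
    refine ⟨s, hs.mono fun r hr => ?_⟩
    rw [e] at hr
    simp only [add_smul, ← add_assoc]
    exact hr

/-- Points of the boundary are moved inside by `t • w`, with `w` an interior vector, and `t` tends
to zero; the sum of two such points is moved by `2 * t`. -/
theorem onCone_add_le (hPL : φ ∈ E.PL) (hφ : E.IsPositive [φ]) (hβ : β ∈ E.base.cones)
    (hdβ : cdim E.ι β = n) {a b : N} (ha : a ∈ E.ι '' β) (hb : b ∈ E.ι '' β) :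
    E.onCone φ β a + E.onCone φ β b ≤ E.onCone φ β (a + b) := by
  have hβe := E.quasiEmbeds.isEmbCone hβ
  obtain ⟨w, hw⟩ := hβe.poly.relint_nonempty
  have hcont := continuousOn_onCone hβe (continuous_of_mem_PL hPL)
  have hrel : ∀ q ∈ E.ι '' β, ∀ t : ℝ, 0 < t → q + t • w ∈ relint (E.ι '' β) := by
    intro q hq t ht
    rw [add_comm]
    exact hβe.poly.add_mem_relint (hβe.poly.smul_mem_relint hw ht) hq
  have hlim : ∀ q ∈ E.ι '' β, Tendsto (fun t : ℝ => E.onCone φ β (q + t • w)) (𝓝[>] 0)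
      (𝓝 (E.onCone φ β q)) := by
    intro q hq
    refine (hcont q hq).tendsto.comp (tendsto_nhdsWithin_iff.2 ⟨?_, ?_⟩)
    · have : Tendsto (fun t : ℝ => q + t • w) (𝓝 0) (𝓝 (q + (0 : ℝ) • w)) :=
        Continuous.tendsto (by fun_prop) 0
      rw [zero_smul, add_zero] at this
      exact this.mono_left nhdsWithin_le_nhds
    · filter_upwards [self_mem_nhdsWithin] with t ht using relint_subset (hrel q hq t ht)
  refine le_of_tendsto_of_tendsto ((hlim a ha).add (hlim b hb))
    ((hlim _ (hβe.poly.add_mem ha hb)).comp (f := fun t : ℝ => 2 * t) (x := 𝓝[>] 0) ?_) ?_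
  · refine tendsto_nhdsWithin_iff.2 ⟨?_, ?_⟩
    · have : Tendsto (fun t : ℝ => 2 * t) (𝓝 0) (𝓝 (2 * 0)) := Continuous.tendsto (by fun_prop) 0
      rw [mul_zero] at this
      exact this.mono_left nhdsWithin_le_nhds
    · filter_upwards [self_mem_nhdsWithin] with t ht
      rw [mem_Ioi] at ht ⊢
      linarith
  · filter_upwards [self_mem_nhdsWithin] with t ht
    have := onCone_add_of_mem_relint hPL hφ hβ hdβ (hrel a ha t ht) (hrel b hb t ht)
    have e : a + b + (2 * t) • w = a + t • w + (b + t • w) := by module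
    simpa only [Function.comp_apply, e] using this

/-! ### Estimates at a point -/

theorem exists_cone_of_dim (hσ : σ ∈ E.base.cones) : ∃ β ∈ E.base.cones, cdim E.ι β = n ∧ σ ⊆ β := by
  obtain ⟨β, hle, hβ⟩ := E.base.cones.exists_le_maximal hσ
  refine ⟨β, hβ.prop, ?_, hle⟩
  rw [← E.quasiEmbeds.dim_eq hβ.prop]
  exact E.pureDim β hβ.prop fun σ' hσ' h => (hβ.eq_of_le hσ' h).symm

theorem exists_sub_mem (E : BalancedSpace X N n) (x : X) : ∃ c > (0 : ℝ), ∀ β ∈ E.base.cones,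
    x ∈ β → ∀ y ∈ E.ι '' β, ∀ δ : ℝ, ‖y - E.ι x‖ ≤ c * δ → y - (1 - δ) • E.ι x ∈ E.ι '' β := by
  obtain ⟨τ, hτ, hx⟩ := E.quasiEmbeds.exists_ri x
  have h : ∀ β : Set X, ∃ c > (0 : ℝ), β ∈ E.base.cones → x ∈ β → ∀ y ∈ E.ι '' β, ∀ δ : ℝ,
      ‖y - E.ι x‖ ≤ c * δ → y - (1 - δ) • E.ι x ∈ E.ι '' β := by
    intro β
    by_cases hβ : β ∈ E.base.cones ∧ x ∈ β
    · have hf := E.quasiEmbeds.faceOf_of_ri hτ hβ.1 hx hβ.2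
      obtain ⟨c, hc, r, hr, h⟩ := (E.quasiEmbeds.isEmbCone hβ.1).poly.exists_sub_smul_mem
        (image_mono hf.subset) hx.2
      exact ⟨c, hc, fun _ _ => h _ (mem_image_of_mem _ (ri_subset hx)) (by simpa using hr.le)⟩
    · exact ⟨1, one_pos, fun h1 h2 => absurd ⟨h1, h2⟩ hβ⟩
  choose c hc h using h
  obtain ⟨c₀, hc₀, hle⟩ := exists_pos_le_of_ne_zero E.base.cones c fun β _ => (hc β).le
  refine ⟨c₀, hc₀, fun β hβ hx y hy δ hδ => h β hβ hx y hy δ (hδ.trans ?_)⟩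
  have h0 : 0 ≤ δ := nonneg_of_mul_nonneg_right ((norm_nonneg _).trans hδ) hc₀
  exact mul_le_mul_of_nonneg_right (hle β hβ (hc β).ne') h0

/-- Write `y = (1 - δ) x + z` with `z` in the cone and `δ` proportional to the distance from `x` to
`y`. Superadditivity bounds `φ y` below by `(1 - δ) φ x + φ z`, and `z` is small. For `δ > 1` the
global bound suffices. -/
theorem sub_le_apply (hPL : φ ∈ E.PL) (hφ : E.IsPositive [φ]) {B : ℝ} (hB0 : 0 ≤ B)
    (hB : ∀ x, |φ x| ≤ B * ‖E.ι x‖) {x : X} {c : ℝ} (hc : 0 < c)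
    (h : ∀ β ∈ E.base.cones, x ∈ β → ∀ y ∈ E.ι '' β, ∀ δ : ℝ, ‖y - E.ι x‖ ≤ c * δ →
      y - (1 - δ) • E.ι x ∈ E.ι '' β) (hβ : β ∈ E.base.cones) (hx : x ∈ β) {y : X} (hy : y ∈ β) :
    φ x - B * (1 + 2 * ‖E.ι x‖ / c) * ‖E.ι y - E.ι x‖ ≤ φ y := by
  obtain ⟨β', hβ', hd, hs⟩ := exists_cone_of_dim hβ
  have hβe := E.quasiEmbeds.isEmbCone hβ'
  set δ := ‖E.ι y - E.ι x‖ / c with hδ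
  have hδ0 : 0 ≤ δ := by positivity
  have hcδ : ‖E.ι y - E.ι x‖ = c * δ := by rw [hδ]; field_simp
  have hfact : B * (1 + 2 * ‖E.ι x‖ / c) * ‖E.ι y - E.ι x‖ =
      B * ‖E.ι y - E.ι x‖ + 2 * (B * ‖E.ι x‖) * δ := by
    rw [hδ]; field_simp
  rw [hfact]
  have h1 := abs_le.1 (hB x)
  have hBx : 0 ≤ B * ‖E.ι x‖ := by positivity
  rcases le_or_gt δ 1 with hle | hgt
  · obtain ⟨z, hz, e⟩ := h β' hβ' (hs hx) _ (mem_image_of_mem E.ι (hs hy)) δ hcδ.le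
    have hsup := onCone_add_le hPL hφ hβ' hd
      (hβe.poly.smul_mem (t := 1 - δ) (by linarith) (mem_image_of_mem E.ι (hs hx)))
      (mem_image_of_mem E.ι hz)
    rw [onCone_smul_of_mem_PL hPL hβ' (mem_image_of_mem E.ι (hs hx)) (by linarith),
      onCone_apply hβe φ (hs hx), onCone_apply hβe φ hz] at hsup
    rw [e, add_sub_cancel, onCone_apply hβe φ (hs hy)] at hsup
    have h2 := abs_le.1 (hB z)
    have h3 : ‖E.ι z‖ ≤ ‖E.ι y - E.ι x‖ + δ * ‖E.ι x‖ := by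
      rw [e]
      calc ‖E.ι y - (1 - δ) • E.ι x‖ = ‖(E.ι y - E.ι x) + δ • E.ι x‖ := by congr 1; module
        _ ≤ _ := (norm_add_le _ _).trans (by rw [norm_smul, Real.norm_of_nonneg hδ0])
    have h4 := mul_le_mul_of_nonneg_left h3 hB0
    have h5 := mul_le_mul_of_nonneg_left h1.2 hδ0
    linarith
  · have h2 := abs_le.1 (hB y)
    have h3 : ‖E.ι y‖ ≤ ‖E.ι x‖ + ‖E.ι y - E.ι x‖ := by
      have := norm_add_le (E.ι x) (E.ι y - E.ι x)
      rwa [add_sub_cancel] at this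
    have h4 := mul_le_mul_of_nonneg_left h3 hB0
    have h5 := mul_le_mul_of_nonneg_left hgt.le hBx
    linarith

/-- The weights on the star of a cone of a subdivision are bounded by those of the complex. -/
theorem sum_star_pullback_le (hR : R.QuasiEmbeds E.ι) (hQ : Q.IsSubdivision R) {ρ' : Set X}
    {x : X} (hρ : ρ ∈ Q.cones) (hxρ : x ∈ ri E.ι ρ) (hρ' : ρ' ∈ R.cones) (hxρ' : x ∈ ri E.ι ρ')
    (hsp : cspan E.ι ρ = cspan E.ι ρ') {c : Set X → ℝ} (hc : ∀ σ, 0 ≤ c σ) :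
    ∑ σ ∈ E.star Q ρ, R.pullback Q c σ ≤ ∑ σ ∈ R.cones, c σ := by
  classical
  have hQ' := hR.of_isSubdivision hQ
  have hex : ∀ σ ∈ (E.star Q ρ).filter (fun σ => R.pullback Q c σ ≠ 0), ∃ σ' ∈ R.cones,
      σ ⊆ σ' ∧ cdim E.ι σ' = cdim E.ι σ ∧ R.pullback Q c σ = c σ' := fun σ hσ =>
    (exists_of_pullback_ne_zero hR hQ (Finset.mem_filter.1 hσ).2).2
  choose! f hf hfs hfd hfc using hex
  rw [← Finset.sum_filter_ne_zero, Finset.sum_congr rfl hfc, ← Finset.sum_image]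
  · refine Finset.sum_le_sum_of_subset_of_nonneg (fun σ hσ => ?_) fun σ _ _ => hc σ
    obtain ⟨σ₁, h₁, rfl⟩ := Finset.mem_image.1 hσ
    exact hf σ₁ h₁
  -- A cone `σ` and the cone `f σ` containing it have the same normal along `ρ` and `ρ'`, and the
  -- normal determines `σ`; so `f` is injective.
  · have hnorm : ∀ σ ∈ (E.star Q ρ).filter (fun σ => R.pullback Q c σ ≠ 0),
        E.normal (f σ) ρ' = E.normal σ ρ := by
      intro σ hσ
      obtain ⟨h1, h2, h3⟩ := mem_star.1 (Finset.mem_filter.1 hσ).1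
      have hface := hR.faceOf_of_ri hρ' (hf σ hσ) hxρ' (hfs σ hσ (h2.subset (ri_subset hxρ)))
      have hd : cdim E.ι (f σ) = cdim E.ι ρ' + 1 := by
        rw [hfd σ hσ, h3, cdim, cdim, hsp]
      have hn := isNormal_normal h2 h3
      have hn' := isNormal_normal hface hd
      refine (hn'.eq_of_inner_nonneg hface.subset hd
        ⟨hsp ▸ hn.mem.1, cspan_mono (hfs σ hσ) hn.mem.2⟩ hn.1 ?_).symm
      obtain ⟨ε, hε, h⟩ := hn.exists_ri h2 h3 (hQ'.isEmbCone hρ) (hQ'.isEmbCone h1) hxρ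
      obtain ⟨y, hy, e⟩ := h ε hε le_rfl
      have h4 := hn'.2.2.2 y (hfs σ hσ (ri_subset hy))
      rw [e, inner_add_right, hn'.2.2.1 x (ri_subset hxρ'), zero_add, real_inner_smul_right] at h4
      exact nonneg_of_mul_nonneg_right h4 hε
    intro σ₁ h₁ σ₂ h₂ h12
    obtain ⟨hc₁, hf₁, hd₁⟩ := mem_star.1 (Finset.mem_filter.1 h₁).1
    obtain ⟨hc₂, hf₂, hd₂⟩ := mem_star.1 (Finset.mem_filter.1 h₂).1
    have e : E.normal σ₁ ρ = E.normal σ₂ ρ := by rw [← hnorm σ₁ h₁, ← hnorm σ₂ h₂, h12]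
    exact star_unique hR hQ (hf σ₁ h₁) hρ hc₁ hc₂ (hfs σ₁ h₁) (h12 ▸ hfs σ₂ h₂) hf₁ hf₂ hd₁ hd₂
      (isNormal_normal hf₁ hd₁) (e ▸ isNormal_normal hf₂ hd₂)

/-- `[X]` is sliced by the plane of `x` and `w`. The weighted sum of the slopes of `φ` at `x` is
nonpositive and each slope is at least `-M`, so the slope towards `w` is at most `M * Z / z₀`, with
`Z` the total weight of the slice and `z₀` its smallest nonzero weight. Both are read off a complex
`R` fixed before `φ`, so `K` does not depend on `φ`. -/
theorem exists_upper_of_notMem (hβ : β ∈ E.base.cones) (hdβ : cdim E.ι β = n) {x w : X}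
    (hx : x ∈ β) (hx0 : E.ι x ≠ 0) (hw : w ∈ ri E.ι β)
    (hd : E.ι w ∉ Submodule.span ℝ {E.ι x}) {B : ℝ} (hB0 : 0 ≤ B) :
    ∃ K : ℝ, ∀ φ ∈ E.PL, E.IsPositive [φ] → (∀ x, |φ x| ≤ B * ‖E.ι x‖) → ∀ s : ℝ, 0 < s →
      E.onCone φ β (E.ι x + s • E.ι w) ≤ φ x + s * K := by
  have hβe := E.quasiEmbeds.isEmbCone hβ
  obtain ⟨ℓs, hℓs⟩ := exists_cuts (V := cspan E.ι β) (W := Submodule.span ℝ {E.ι x, E.ι w})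
    (Submodule.span_le.2 (by
      rintro q (rfl | hq)
      · exact mem_cspan hx
      · exact mem_singleton_iff.1 hq ▸ mem_cspan (ri_subset hw)))
  obtain ⟨R, hR, hRS, hray⟩ := exists_ray hβ hx ℓs
  have hR' := quasiEmbeds_of_base hR
  obtain ⟨ρ', hρ', hxρ', hρs'⟩ := hray R (.refl hR')
  obtain ⟨c, hc, hsub⟩ := E.exists_sub_mem x
  have hz0 := (slice_nonneg hR hRS).2
  obtain ⟨z₀, hz₀, hzle⟩ := exists_pos_le_of_ne_zero R.cones (E.slice ℓs R) fun σ _ => hz0 σ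
  set M := B * (1 + 2 * ‖E.ι x‖ / c) with hM
  have hM0 : 0 ≤ M := by positivity
  set Z := ∑ σ ∈ R.cones, E.slice ℓs R σ with hZ
  have hZ0 : 0 ≤ Z := Finset.sum_nonneg fun σ _ => hz0 σ
  -- The vector `w` is `a x + η v` with `v` the unit normal, where `η ≤ ‖w‖` and `|a| ‖x‖ ≤ 2 ‖w‖`;
  -- the two terms bound the contributions of `x` and of `v`.
  refine ⟨2 * B * ‖E.ι w‖ + ‖E.ι w‖ * (M * Z / z₀), fun φ hPL hφ hB s hs => ?_⟩
  obtain ⟨Q, hQ, hQR, hQφ, hpos⟩ := hφ.exists_nonneg hR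
  replace hQφ : Q.LinearOn φ := hQφ φ (by simp)
  have hS : ∀ ℓ ∈ ℓs, Q.Signed E.ι ℓ := fun ℓ h => (hRS ℓ h).of_isSubdivision hQR
  obtain ⟨ρ, hρ, hxρ, hρs⟩ := hray Q hQR
  have hQ' := quasiEmbeds_of_base hQ
  have hxK := mem_image_of_mem E.ι hx
  have hwK := mem_image_of_mem E.ι (ri_subset hw)
  have hmem : ∀ t : ℝ, 0 ≤ t → E.ι x + t • E.ι w ∈ E.ι '' β := fun t ht =>
    hβe.poly.add_mem hxK (hβe.poly.smul_mem ht hwK)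
  obtain ⟨σ₁, hσ₁, hs₁, hW₁, hpos₁, t, ht, hts, y₁, hy₁, e₁⟩ := exists_sector (S := fun t => t < s)
    hQ hβ hx hx0 hd hℓs hS hρ hxρ hρs (by
      filter_upwards [Ioo_mem_nhdsGT hs] with t ht using ⟨hmem t ht.1.le, ht.2⟩)
  obtain ⟨hc₁, hf₁, hd₁⟩ := mem_star.1 hσ₁
  have hn₁ := isNormal_normal hf₁ hd₁
  have hgs : ∀ ψ ∈ ℓs.map E.minForm, R.LinearOn ψ := by
    intro ψ hψ
    obtain ⟨ℓ, hℓ, rfl⟩ := List.mem_map.1 hψ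
    exact minForm_linearOn hR' (hRS ℓ hℓ)
  -- The complex `Q` adapted to `φ` may be much finer than `R`, but its nonzero weights are weights
  -- of `R`.
  have hpull : E.slice ℓs Q = R.pullback Q (E.slice ℓs R) := prod_pullback hR hQR hgs
  have hA : 0 < E.slice ℓs Q σ₁ := by
    refine slice_pos hQ hβ hdβ hℓs hS (p := y₁) ⟨hs₁ (ri_subset hy₁), ?_⟩ hc₁ hs₁
      (fun x hx => hW₁ ▸ mem_cspan hx) hy₁ (by rw [cdim, hW₁])
    rw [e₁, add_comm]
    exact hβe.poly.add_mem_relint (hβe.poly.smul_mem_relint hw.2 ht) hxK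
  have hA' : z₀ ≤ E.slice ℓs Q σ₁ := by
    have hA2 := hA
    rw [hpull] at hA2 ⊢
    obtain ⟨-, σ', hσ', -, -, e⟩ := exists_of_pullback_ne_zero hR' hQR hA2.ne'
    rw [e] at hA2 ⊢
    exact hzle σ' hσ' hA2.ne'
  have hlow : ∀ σ ∈ E.star Q ρ, -M ≤ E.linearPart φ σ (E.normal σ ρ) := by
    intro σ hσ
    obtain ⟨h1, h2, h3⟩ := mem_star.1 hσ
    have hn := isNormal_normal h2 h3
    obtain ⟨ε, hε, h⟩ := hn.exists_ri h2 h3 (hQ'.isEmbCone hρ) (hQ'.isEmbCone h1) hxρ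
    obtain ⟨y, hy, e⟩ := h ε hε le_rfl
    obtain ⟨β', hβ', hσβ'⟩ := (E.quasiEmbeds.isSubdivision_iff hQ').1 hQ σ h1
    have hxσ := h2.subset (ri_subset hxρ)
    have h4 := sub_le_apply hPL hφ hB0 hB hc hsub hβ' (hσβ' hxσ) (hσβ' (ri_subset hy))
    rw [← hM, e, add_sub_cancel_left, norm_smul, hn.1, mul_one, Real.norm_of_nonneg hε.le,
      ← linearPart_apply hQ' hQφ h1 hxσ, ← linearPart_apply hQ' hQφ h1 (ri_subset hy), e, map_add,
      map_smul, smul_eq_mul] at h4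
    by_contra hlt
    have := mul_lt_mul_of_pos_left (not_le.1 hlt) hε
    linarith
  have hineq := sum_star_slice_le hQ hS hQφ hpos hρ
  have hslope : E.linearPart φ σ₁ (E.normal σ₁ ρ) ≤ M * Z / z₀ := by
    by_cases hneg : E.linearPart φ σ₁ (E.normal σ₁ ρ) ≤ 0
    · exact hneg.trans (by positivity)
    push Not at hneg
    have hsl := (slice_nonneg hQ hS).2
    have h1 : ∑ σ ∈ E.star Q ρ, (E.linearPart φ σ (E.normal σ ρ) + M) * E.slice ℓs Q σ ≤ M * Z := by
      simp only [add_mul, Finset.sum_add_distrib, ← Finset.mul_sum]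
      have h2 : ∑ σ ∈ E.star Q ρ, E.slice ℓs Q σ ≤ Z := by
        rw [hpull]
        exact sum_star_pullback_le hR' hQR hρ hxρ hρ' hxρ' (hρs.trans hρs'.symm) hz0
      have := mul_le_mul_of_nonneg_left h2 hM0
      linarith
    have h3 : (E.linearPart φ σ₁ (E.normal σ₁ ρ) + M) * E.slice ℓs Q σ₁ ≤ M * Z :=
      (Finset.single_le_sum (f := fun σ => (E.linearPart φ σ (E.normal σ ρ) + M) * E.slice ℓs Q σ)
        (fun σ hσ => mul_nonneg (by linarith [hlow σ hσ]) (hsl σ)) hσ₁).trans h1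
    rw [le_div_iff₀ hz₀]
    have h4 := mul_le_mul_of_nonneg_left hA' hneg.le
    have h5 := mul_nonneg hM0 hA.le
    linarith
  set η : ℝ := inner ℝ (E.normal σ₁ ρ) (E.ι w) with hη
  have hηw : η ≤ ‖E.ι w‖ := by
    have := real_inner_le_norm (E.normal σ₁ ρ) (E.ι w)
    rwa [hn₁.1, one_mul] at this
  have hr := hn₁.sub_mem hf₁.subset hd₁ (q := E.ι w) (by
    rw [hW₁]; exact Submodule.subset_span (by simp))
  rw [hρs] at hr
  obtain ⟨a, ha⟩ := Submodule.mem_span_singleton.1 hr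
  have hφx := linearPart_apply hQ' hQφ hc₁ (hf₁.subset (ri_subset hxρ))
  have hwlin : E.linearPart φ σ₁ (E.ι w) ≤ 2 * B * ‖E.ι w‖ + ‖E.ι w‖ * (M * Z / z₀) := by
    have h1 : E.linearPart φ σ₁ (E.ι w) = a * φ x + η * E.linearPart φ σ₁ (E.normal σ₁ ρ) := by
      have := congrArg (E.linearPart φ σ₁) ha
      rw [map_smul, map_sub, map_smul, hφx, smul_eq_mul, smul_eq_mul] at this
      linarith
    have h2 : |a| * ‖E.ι x‖ ≤ 2 * ‖E.ι w‖ := by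
      rw [← Real.norm_eq_abs, ← norm_smul, ha]
      calc ‖E.ι w - η • E.normal σ₁ ρ‖ ≤ ‖E.ι w‖ + ‖η • E.normal σ₁ ρ‖ := norm_sub_le _ _
        _ = ‖E.ι w‖ + η := by rw [norm_smul, hn₁.1, mul_one, Real.norm_of_nonneg hpos₁.le]
        _ ≤ _ := by linarith
    have h3 : a * φ x ≤ 2 * B * ‖E.ι w‖ := by
      calc a * φ x ≤ |a| * |φ x| := by rw [← abs_mul]; exact le_abs_self _
        _ ≤ |a| * (B * ‖E.ι x‖) := mul_le_mul_of_nonneg_left (hB x) (abs_nonneg _)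
        _ = B * (|a| * ‖E.ι x‖) := by ring
        _ ≤ B * (2 * ‖E.ι w‖) := mul_le_mul_of_nonneg_left h2 hB0
        _ = _ := by ring
    have h4 : η * E.linearPart φ σ₁ (E.normal σ₁ ρ) ≤ ‖E.ι w‖ * (M * Z / z₀) :=
      (mul_le_mul_of_nonneg_left hslope hpos₁.le).trans
        (mul_le_mul_of_nonneg_right hηw (by positivity))
    linarith
  have h5 := onCone_add_smul hQ hQφ hβ hc₁ hs₁ (hf₁.subset (ri_subset hxρ)) (ri_subset hy₁) ht e₁
    ht.le le_rfl
  -- The linear bound is known at some `t < s` only; by concavity along the half-line, the mean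
  -- slope up to `s` is at most the one up to `t`.
  have hts' : 0 ≤ 1 - t / s := by rw [sub_nonneg, div_le_one hs]; exact hts.le
  have h6 := onCone_add_le hPL hφ hβ hdβ (hβe.poly.smul_mem hts' hxK)
    (hβe.poly.smul_mem (t := t / s) (by positivity) (hmem s hs.le))
  rw [onCone_smul_of_mem_PL hPL hβ hxK hts',
    onCone_smul_of_mem_PL hPL hβ (hmem s hs.le) (by positivity), onCone_apply hβe φ hx] at h6
  have h7 : (1 - t / s) • E.ι x + (t / s) • (E.ι x + s • E.ι w) = E.ι x + t • E.ι w := by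
    rw [smul_add, smul_smul, div_mul_cancel₀ _ hs.ne']
    module
  rw [h7, h5] at h6
  have h8 : t / s * (E.onCone φ β (E.ι x + s • E.ι w) - φ x) ≤
      t / s * (s * E.linearPart φ σ₁ (E.ι w)) := by
    have : t / s * (s * E.linearPart φ σ₁ (E.ι w)) = t * E.linearPart φ σ₁ (E.ι w) := by
      field_simp
    rw [this]
    linarith
  have h9 := le_of_mul_le_mul_left h8 (by positivity)
  have h10 := mul_le_mul_of_nonneg_left hwlin hs.le
  linarith

end BalancedSpace


/-- The coefficients in a pointed cone can be bounded. -/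
theorem IsPolyCone.exists_coeff_bound {N : Type*} [NormedAddCommGroup N] [InnerProductSpace ℝ N]
    {K : Set N} (hK : IsPolyCone K) (hp : ∀ v ∈ K, -v ∈ K → v = 0) :
    ∃ s : Finset N, (∀ v ∈ s, v ∈ K) ∧ ∃ A : ℝ, 0 ≤ A ∧ ∀ x ∈ K, ∃ a : N → ℝ, (∀ v, 0 ≤ a v) ∧
      x = ∑ v ∈ s, a v • v ∧ ∑ v ∈ s, a v ≤ A * ‖x‖ := by
  classical
  obtain ⟨s₀, hs₀, hgen⟩ := hK.exists_generators
  set s := s₀.filter (fun v => v ≠ 0) with hs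
  have hsK : ∀ v ∈ s, v ∈ K := fun v hv => hs₀ v (Finset.mem_filter.1 hv).1
  -- By compactness of the simplex, the norm of a convex combination of the nonzero generators is
  -- bounded below; a combination equal to zero would put a line in the pointed cone.
  obtain ⟨c, hc, hmin⟩ := (isCompact_stdSimplex ℝ s).exists_forall_le'
    (f := fun a : s → ℝ => ‖∑ v : s, a v • (v : N)‖) (a := 0) (by fun_prop) (by
      rintro a ⟨ha0, ha1⟩
      rw [norm_pos_iff]
      intro h0
      obtain ⟨v₀, -, hv₀⟩ : ∃ v ∈ Finset.univ, a v ≠ 0 := by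
        apply Finset.exists_ne_zero_of_sum_ne_zero
        rw [ha1]
        exact one_ne_zero
      rw [← Finset.add_sum_erase _ _ (Finset.mem_univ v₀)] at h0
      have h1 := hK.sum_mem (Finset.univ.erase v₀) (fun v : s => a v • (v : N)) fun v _ =>
        hK.smul_mem (ha0 v) (hsK v v.2)
      rw [← neg_eq_of_add_eq_zero_right h0] at h1
      rcases smul_eq_zero.1 (hp _ (hK.smul_mem (ha0 v₀) (hsK v₀ v₀.2)) h1) with h | h
      · exact hv₀ h
      · exact (Finset.mem_filter.1 v₀.2).2 h)
  refine ⟨s, hsK, c⁻¹, inv_nonneg.2 hc.le, fun x hx => ?_⟩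
  obtain ⟨a, ha, rfl⟩ := (hgen x).1 hx
  have hsum : ∑ v ∈ s₀, a v • v = ∑ v ∈ s, a v • v := by
    rw [hs, Finset.sum_filter]
    refine Finset.sum_congr rfl fun v _ => ?_
    by_cases hv : v = 0
    · simp [hv]
    · simp [hv]
  refine ⟨a, ha, hsum, ?_⟩
  rw [hsum]
  set S := ∑ v ∈ s, a v with hS
  have hS0 : 0 ≤ S := Finset.sum_nonneg fun v _ => ha v
  rcases hS0.eq_or_lt with h0 | hpos
  · rw [← h0]; positivity
  have h1 := hmin (fun v : s => S⁻¹ * a v) ⟨fun v => mul_nonneg (inv_nonneg.2 hS0) (ha v), by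
    rw [← Finset.mul_sum, Finset.sum_coe_sort s a, inv_mul_cancel₀ hpos.ne']⟩
  have h2 : ∑ v : s, (S⁻¹ * a v) • (v : N) = S⁻¹ • ∑ v ∈ s, a v • v := by
    rw [Finset.smul_sum, ← Finset.sum_coe_sort s]
    simp only [smul_smul]
  rw [h2, norm_smul, Real.norm_of_nonneg (inv_nonneg.2 hS0)] at h1
  rw [inv_mul_eq_div, le_div_iff₀ hc]
  rwa [inv_mul_eq_div, le_div_iff₀ hpos, mul_comm] at h1

namespace BalancedSpace

open EuclideanConicalSpace

variable {X N : Type*} [TopologicalSpace X] [NormedAddCommGroup N] [InnerProductSpace ℝ N]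
  [FiniteDimensional ℝ N] {n : ℕ} {E : BalancedSpace X N n} {Q R : ConicalComplex X}
  {β σ ρ : Set X} {φ : X → ℝ}

theorem exists_upper (hβ : β ∈ E.base.cones) (hdβ : cdim E.ι β = n) {x w : X}
    (hx : x ∈ β) (hx0 : E.ι x ≠ 0) (hw : w ∈ ri E.ι β) {B : ℝ} (hB0 : 0 ≤ B) :
    ∃ K : ℝ, ∀ φ ∈ E.PL, E.IsPositive [φ] → (∀ x, |φ x| ≤ B * ‖E.ι x‖) → ∀ s : ℝ, 0 ≤ s →
      E.onCone φ β (E.ι x + s • E.ι w) ≤ φ x + s * K := by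
  have hβe := E.quasiEmbeds.isEmbCone hβ
  by_cases hd : E.ι w ∈ Submodule.span ℝ {E.ι x}
  · obtain ⟨c, hc⟩ := Submodule.mem_span_singleton.1 hd
    have hc0 : 0 ≤ c := by
      by_contra hneg
      push Not at hneg
      have h1 := hβe.poly.smul_mem (t := (-c)⁻¹) (inv_nonneg.2 (by linarith))
        (mem_image_of_mem E.ι (ri_subset hw))
      rw [← hc, smul_smul, inv_neg, neg_mul, inv_mul_cancel₀ hneg.ne, neg_one_smul] at h1
      exact hx0 (hβe.pointed _ (mem_image_of_mem _ hx) h1)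
    refine ⟨c * (B * ‖E.ι x‖), fun φ hPL hφ hB s hs => ?_⟩
    have e : E.ι x + s • E.ι w = (1 + s * c) • E.ι x := by rw [← hc]; module
    rw [e, onCone_smul_of_mem_PL hPL hβ (mem_image_of_mem _ hx) (by positivity),
      onCone_apply hβe φ hx]
    have := mul_le_mul_of_nonneg_left ((le_abs_self _).trans (hB x)) (mul_nonneg hs hc0)
    linarith
  · obtain ⟨K, hK⟩ := exists_upper_of_notMem hβ hdβ hx hx0 hw hd hB0
    refine ⟨K, fun φ hPL hφ hB s hs => ?_⟩
    rcases hs.eq_or_lt with rfl | hs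
    · rw [zero_smul, add_zero, zero_mul, add_zero, onCone_apply hβe φ hx]
    · exact hK φ hPL hφ hB s hs

/-- With `w` interior and `t` proportional to the distance, `x + t w - y` lies in the cone, so
superadditivity bounds `φ y` by `φ (x + t w) - φ (x + t w - y)`. The first term is controlled by
`exists_upper`, the second by the global bound. The lower estimate is `sub_le_apply`. -/
theorem exists_lipschitz_on_cone (hβ : β ∈ E.base.cones) (hdβ : cdim E.ι β = n) {x : X}
    (hx : x ∈ β) (hx0 : E.ι x ≠ 0) {B : ℝ} (hB0 : 0 ≤ B) :
    ∃ L : ℝ, ∀ φ ∈ E.PL, E.IsPositive [φ] → (∀ x, |φ x| ≤ B * ‖E.ι x‖) → ∀ y ∈ β,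
      |φ y - φ x| ≤ L * ‖E.ι y - E.ι x‖ := by
  have hβe := E.quasiEmbeds.isEmbCone hβ
  obtain ⟨w, hw⟩ := hβe.exists_ri
  obtain ⟨K, hK⟩ := exists_upper hβ hdβ hx hx0 hw hB0
  obtain ⟨η, hη, hball⟩ := hβe.poly.exists_ball hw.2
  obtain ⟨c, hc, hsub⟩ := E.exists_sub_mem x
  refine ⟨max (B * (1 + 2 * ‖E.ι x‖ / c)) (K / η + B + B * ‖E.ι w‖ / η),
    fun φ hPL hφ hB y hy => ?_⟩
  set h := ‖E.ι y - E.ι x‖ with hh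
  have hh0 : 0 ≤ h := norm_nonneg _
  rw [abs_le]
  constructor
  · have h1 := sub_le_apply hPL hφ hB0 hB hc hsub hβ hx hy
    have h2 := mul_le_mul_of_nonneg_right (le_max_left (B * (1 + 2 * ‖E.ι x‖ / c))
      (K / η + B + B * ‖E.ι w‖ / η)) hh0
    linarith
  · have h2 := mul_le_mul_of_nonneg_right (le_max_right (B * (1 + 2 * ‖E.ι x‖ / c))
      (K / η + B + B * ‖E.ι w‖ / η)) hh0
    set t := h / η with ht
    have ht0 : 0 ≤ t := by positivity
    have hmem : E.ι x + t • E.ι w - E.ι y ∈ E.ι '' β := by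
      rcases ht0.eq_or_lt with h0 | hpos
      · have : h = 0 := by
          rw [ht] at h0
          rcases div_eq_zero_iff.1 h0.symm with h | h
          · exact h
          · exact absurd h hη.ne'
        rw [hh, norm_eq_zero, sub_eq_zero] at this
        rw [← h0, this, zero_smul, add_zero, sub_self]
        exact hβe.poly.zero_mem
      · have h3 := hball (-(t⁻¹ • (E.ι y - E.ι x))) (neg_mem (Submodule.smul_mem _ _
          (sub_mem (mem_cspan hy) (mem_cspan hx)))) (by
            rw [norm_neg, norm_smul, norm_inv, Real.norm_of_nonneg ht0, ← hh, ht]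
            rw [inv_div, div_mul_cancel₀]
            intro h0
            rw [ht, h0, zero_div] at hpos
            exact lt_irrefl _ hpos)
        have h4 := hβe.poly.smul_mem ht0 h3
        convert h4 using 1
        rw [smul_add, smul_neg, smul_smul, mul_inv_cancel₀ hpos.ne']
        module
    have h3 := onCone_add_le hPL hφ hβ hdβ (mem_image_of_mem E.ι hy) hmem
    rw [add_sub_cancel, onCone_apply hβe φ hy] at h3
    have h4 := hK φ hPL hφ hB t ht0
    obtain ⟨z, hz, e⟩ := hmem
    rw [← e, onCone_apply hβe φ hz] at h3
    have h5 := (abs_le.1 (hB z)).1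
    have h6 : ‖E.ι z‖ ≤ h + t * ‖E.ι w‖ := by
      rw [e]
      calc ‖E.ι x + t • E.ι w - E.ι y‖ = ‖t • E.ι w - (E.ι y - E.ι x)‖ := by congr 1; module
        _ ≤ ‖t • E.ι w‖ + h := norm_sub_le _ _
        _ = _ := by rw [norm_smul, Real.norm_of_nonneg ht0, add_comm]
    have h7 := mul_le_mul_of_nonneg_left h6 hB0
    have h8 : t * K + B * (h + t * ‖E.ι w‖) = (K / η + B + B * ‖E.ι w‖ / η) * h := by
      rw [ht]; field_simp; ring
    linarith

/-- The constant depends on `x` and `B` but not on `φ`; this is the source of equicontinuity. -/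
theorem exists_lipschitz_at {x : X} (hx0 : E.ι x ≠ 0) {B : ℝ} (hB0 : 0 ≤ B) :
    ∃ L : ℝ, ∀ φ ∈ E.PL, E.IsPositive [φ] → (∀ x, |φ x| ≤ B * ‖E.ι x‖) →
      ∀ y, (∀ σ ∈ E.base.cones, y ∈ σ → x ∈ σ) → |φ y - φ x| ≤ L * ‖E.ι y - E.ι x‖ := by
  have h : ∀ β : Set X, ∃ L : ℝ, β ∈ E.base.cones → cdim E.ι β = n → x ∈ β → ∀ φ ∈ E.PL,
      E.IsPositive [φ] → (∀ x, |φ x| ≤ B * ‖E.ι x‖) → ∀ y ∈ β,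
      |φ y - φ x| ≤ L * ‖E.ι y - E.ι x‖ := by
    intro β
    by_cases hβ : β ∈ E.base.cones ∧ cdim E.ι β = n ∧ x ∈ β
    · obtain ⟨L, hL⟩ := exists_lipschitz_on_cone hβ.1 hβ.2.1 hβ.2.2 hx0 hB0
      exact ⟨L, fun _ _ _ => hL⟩
    · exact ⟨0, fun h1 h2 h3 => absurd ⟨h1, h2, h3⟩ hβ⟩
  choose L hL using h
  refine ⟨∑ β ∈ E.base.cones, |L β|, fun φ hPL hφ hB y hy => ?_⟩
  obtain ⟨σ, hσ, hyσ⟩ := E.quasiEmbeds.exists_ri y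
  obtain ⟨β, hβ, hd, hs⟩ := exists_cone_of_dim hσ
  have hyβ := hs (ri_subset hyσ)
  refine (hL β hβ hd (hy β hβ hyβ) φ hPL hφ hB y hyβ).trans
    (mul_le_mul_of_nonneg_right ((le_abs_self _).trans ?_) (norm_nonneg _))
  exact Finset.single_le_sum (f := fun β => |L β|) (fun _ _ => abs_nonneg _) hβ

theorem sum_onCone_le (hPL : φ ∈ E.PL) (hφ : E.IsPositive [φ]) (hβ : β ∈ E.base.cones)
    (hdβ : cdim E.ι β = n) {α : Type*} (s : Finset α) (f : α → N) (hf : ∀ i ∈ s, f i ∈ E.ι '' β) :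
    ∑ i ∈ s, E.onCone φ β (f i) ≤ E.onCone φ β (∑ i ∈ s, f i) := by
  classical
  have hβe := E.quasiEmbeds.isEmbCone hβ
  induction s using Finset.induction_on with
  | empty =>
    have h0 := onCone_smul_of_mem_PL hPL hβ hβe.poly.zero_mem (t := 0) le_rfl
    rw [zero_smul, zero_mul] at h0
    rw [Finset.sum_empty, Finset.sum_empty, h0]
  | insert i s hi ih =>
    rw [Finset.sum_insert hi, Finset.sum_insert hi]
    have h1 := ih fun j hj => hf j (Finset.mem_insert_of_mem hj)
    have h2 := onCone_add_le hPL hφ hβ hdβ (hf i (Finset.mem_insert_self _ _))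
      (hβe.poly.sum_mem s f fun j hj => hf j (Finset.mem_insert_of_mem hj))
    linarith

/-- From below, superadditivity is applied to a combination of generators with controlled
coefficients. From above, `w - r x` stays in the cone for an interior `w` and `r = η / ‖x‖`, so `r φ
x` is at most `φ w - φ (w - r x)`, where the lower bound applies. -/
theorem exists_bound_on_cone (hβ : β ∈ E.base.cones) (hdβ : cdim E.ι β = n) :
    ∃ T : Finset X, ∃ A : ℝ, 0 ≤ A ∧ ∀ φ ∈ E.PL, E.IsPositive [φ] → ∀ x ∈ β,
      |φ x| ≤ A * (∑ y ∈ T, |φ y|) * ‖E.ι x‖ := by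
  classical
  have hβe := E.quasiEmbeds.isEmbCone hβ
  obtain ⟨s, hsK, A, hA, hcoef⟩ := hβe.poly.exists_coeff_bound hβe.pointed
  obtain ⟨w, hw⟩ := hβe.exists_ri
  obtain ⟨η, hη, hball⟩ := hβe.poly.exists_ball hw.2
  have : Nonempty X := ⟨w⟩
  choose! g hg hgι using hsK
  set T := insert w (s.image g) with hT
  refine ⟨T, A + (1 + A * (‖E.ι w‖ + η)) / η, by positivity, fun φ hPL hφ => ?_⟩
  set D := ∑ y ∈ T, |φ y| with hD
  have hD0 : 0 ≤ D := Finset.sum_nonneg fun _ _ => abs_nonneg _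
  have hTD : ∀ y ∈ T, |φ y| ≤ D := fun y hy =>
    Finset.single_le_sum (f := fun y => |φ y|) (fun _ _ => abs_nonneg _) hy
  have hlow : ∀ x ∈ β, -(A * D * ‖E.ι x‖) ≤ φ x := by
    intro x hx
    obtain ⟨a, ha, e, hsum⟩ := hcoef _ (mem_image_of_mem E.ι hx)
    have h1 := sum_onCone_le hPL hφ hβ hdβ s (fun v => a v • v) fun v hv =>
      hβe.poly.smul_mem (ha v) (hgι v hv ▸ mem_image_of_mem _ (hg v hv))
    rw [← e, onCone_apply hβe φ hx] at h1
    refine le_trans ?_ h1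
    have h2 : ∀ v ∈ s, -(a v * D) ≤ E.onCone φ β (a v • v) := by
      intro v hv
      have hv' := hgι v hv
      have := onCone_apply hβe φ (hg v hv)
      rw [hv'] at this
      rw [onCone_smul_of_mem_PL hPL hβ (hv' ▸ mem_image_of_mem _ (hg v hv)) (ha v), this]
      have h3 := (abs_le.1 (hTD (g v)
        (Finset.mem_insert_of_mem (Finset.mem_image_of_mem _ hv)))).1
      have := mul_le_mul_of_nonneg_left h3 (ha v)
      linarith
    refine le_trans ?_ (Finset.sum_le_sum h2)
    rw [Finset.sum_neg_distrib, ← Finset.sum_mul, neg_le_neg_iff]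
    have := mul_le_mul_of_nonneg_right hsum hD0
    linarith
  intro x hx
  have hfact : (A + (1 + A * (‖E.ι w‖ + η)) / η) * D * ‖E.ι x‖ =
      A * D * ‖E.ι x‖ + (D + A * D * (‖E.ι w‖ + η)) * (‖E.ι x‖ / η) := by ring
  have hnn : 0 ≤ (D + A * D * (‖E.ι w‖ + η)) * (‖E.ι x‖ / η) := by positivity
  rw [hfact, abs_le]
  refine ⟨by linarith [hlow x hx], ?_⟩
  have hAD : 0 ≤ A * D * ‖E.ι x‖ := by positivity
  refine le_trans ?_ (le_add_of_nonneg_left hAD)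
  rcases (norm_nonneg (E.ι x)).eq_or_lt with h0 | hpos
  · have h1 := onCone_smul_of_mem_PL hPL hβ (mem_image_of_mem E.ι hx) (t := 0) le_rfl
    rw [zero_smul, zero_mul, ← norm_eq_zero.1 h0.symm, onCone_apply hβe φ hx] at h1
    rw [h1]
    exact hnn
  set r := η / ‖E.ι x‖ with hr
  have hr0 : 0 < r := by positivity
  obtain ⟨z, hz, e⟩ := hball (-(r • E.ι x)) (neg_mem (Submodule.smul_mem _ _ (mem_cspan hx))) (by
    rw [norm_neg, norm_smul, Real.norm_of_nonneg hr0.le, hr, div_mul_cancel₀ _ hpos.ne'])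
  have h1 := onCone_add_le hPL hφ hβ hdβ (mem_image_of_mem E.ι hz)
    (hβe.poly.smul_mem hr0.le (mem_image_of_mem E.ι hx))
  rw [onCone_smul_of_mem_PL hPL hβ (mem_image_of_mem E.ι hx) hr0.le, onCone_apply hβe φ hx,
    onCone_apply hβe φ hz, e, neg_add_cancel_right, onCone_apply hβe φ (ri_subset hw)] at h1
  have h2 := hlow z hz
  have h3 : ‖E.ι z‖ ≤ ‖E.ι w‖ + η := by
    rw [e]
    refine (norm_add_le _ _).trans ?_
    rw [norm_neg, norm_smul, Real.norm_of_nonneg hr0.le, hr, div_mul_cancel₀ _ hpos.ne']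
  have h4 := mul_le_mul_of_nonneg_left h3 (mul_nonneg hA hD0)
  have h5 := (abs_le.1 (hTD w (Finset.mem_insert_self _ _))).2
  have h6 : r * φ x ≤ D + A * D * (‖E.ι w‖ + η) := by linarith
  have h7 : ‖E.ι x‖ / η = r⁻¹ := by rw [hr, inv_div]
  rw [h7, ← div_eq_mul_inv, le_div_iff₀ hr0]
  linarith

theorem exists_bound (E : BalancedSpace X N n) :
    ∃ T : Finset X, ∃ A : ℝ, 0 ≤ A ∧ ∀ φ ∈ E.PL, E.IsPositive [φ] → ∀ x,
      |φ x| ≤ A * (∑ y ∈ T, |φ y|) * ‖E.ι x‖ := by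
  classical
  have h : ∀ β : Set X, ∃ T : Finset X, ∃ A : ℝ, 0 ≤ A ∧ (β ∈ E.base.cones → cdim E.ι β = n →
      ∀ φ ∈ E.PL, E.IsPositive [φ] → ∀ x ∈ β, |φ x| ≤ A * (∑ y ∈ T, |φ y|) * ‖E.ι x‖) := by
    intro β
    by_cases hβ : β ∈ E.base.cones ∧ cdim E.ι β = n
    · obtain ⟨T, A, hA, h⟩ := exists_bound_on_cone hβ.1 hβ.2
      exact ⟨T, A, hA, fun _ _ => h⟩
    · exact ⟨∅, 0, le_rfl, fun h1 h2 => absurd ⟨h1, h2⟩ hβ⟩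
  choose T A hA h using h
  refine ⟨E.base.cones.biUnion T, ∑ β ∈ E.base.cones, A β, Finset.sum_nonneg fun β _ => hA β,
    fun φ hPL hφ x => ?_⟩
  obtain ⟨σ, hσ, hxσ⟩ := E.quasiEmbeds.exists_ri x
  obtain ⟨β, hβ, hd, hs⟩ := exists_cone_of_dim hσ
  refine (h β hβ hd φ hPL hφ x (hs (ri_subset hxσ))).trans
    (mul_le_mul_of_nonneg_right (mul_le_mul ?_ ?_ ?_ ?_) (norm_nonneg _))
  · exact Finset.single_le_sum (f := A) (fun β _ => hA β) hβ
  · exact Finset.sum_le_sum_of_subset_of_nonneg (Finset.subset_biUnion_of_mem T hβ)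
      fun _ _ _ => abs_nonneg _
  · exact Finset.sum_nonneg fun _ _ => abs_nonneg _
  · exact Finset.sum_nonneg fun β _ => hA β

end BalancedSpace

/-! ### Topology of the sphere -/

namespace EuclideanConicalSpace

variable {X N : Type*} [TopologicalSpace X] [NormedAddCommGroup N] [InnerProductSpace ℝ N]
  [FiniteDimensional ℝ N]

theorem exists_mem_ultrafilter (E : EuclideanConicalSpace X N) (f : Ultrafilter X) :
    ∃ σ ∈ E.base.cones, σ ∈ f := by
  have h : (⋃ σ ∈ (E.base.cones : Set (Set X)), σ) ∈ f := by
    simp only [Finset.mem_coe, E.base.cover, Filter.univ_mem, ← Ultrafilter.mem_coe]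
  exact (Ultrafilter.finite_biUnion_mem_iff E.base.cones.finite_toSet).1 h

/-- An ultrafilter contains one of the finitely many closed cones, where `ι` is continuous and
injective, so its limit is unique. -/
theorem t2Space (E : EuclideanConicalSpace X N) : T2Space X := by
  refine t2_iff_ultrafilter.2 fun {x y} f hx hy => ?_
  obtain ⟨σ, hσ, hf⟩ := E.exists_mem_ultrafilter f
  have hc := E.base.isClosed σ hσ
  have hmem : ∀ z : X, (f : Filter X) ≤ 𝓝 z → z ∈ σ := fun z hz =>
    hc.mem_of_frequently_of_tendsto (b := (f : Filter X)) (f := id)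
      (Eventually.frequently hf) hz
  refine (E.quasiEmbeds.isEmbCone hσ).injOn (hmem x hx) (hmem y hy) ?_
  exact tendsto_nhds_unique ((E.continuous_ι.tendsto x).mono_left hx)
    ((E.continuous_ι.tendsto y).mono_left hy)

/-- An ultrafilter on the sphere lives on one cone, whose image is closed in `N` and meets the unit
sphere in a compact set; the limit there lifts to the cone. -/
theorem isCompact_sphere (E : EuclideanConicalSpace X N) : IsCompact E.sphere := by
  refine isCompact_iff_ultrafilter_le_nhds.2 fun f hf => ?_
  obtain ⟨σ, hσ, hfσ⟩ := E.exists_mem_ultrafilter f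
  have hσe := E.quasiEmbeds.isEmbCone hσ
  have hfS : E.sphere ∈ f := by simpa using hf
  have hm : ((f.map E.ι : Ultrafilter N) : Filter N) ≤ 𝓟 (Metric.sphere 0 1 ∩ E.ι '' σ) := by
    rw [le_principal_iff, Ultrafilter.coe_map, mem_map]
    have : E.sphere ∩ σ ∈ (f : Filter X) := inter_mem hfS hfσ
    refine mem_of_superset this ?_
    rintro x ⟨hx, hxσ⟩
    exact ⟨by simpa [sphere] using hx, mem_image_of_mem _ hxσ⟩
  obtain ⟨q, ⟨hq1, x, hx, rfl⟩, hq⟩ := isCompact_iff_ultrafilter_le_nhds.1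
    ((_root_.isCompact_sphere (0 : N) 1).inter_right hσe.poly.isClosed) _ hm
  refine ⟨x, by simpa [sphere] using hq1, fun U hU => ?_⟩
  obtain ⟨ε, hε, h⟩ := hσe.exists_pos_forall_mem hx hU
  have hb : E.ι ⁻¹' Metric.ball (E.ι x) ε ∈ (f : Filter X) := hq (Metric.ball_mem_nhds _ hε)
  filter_upwards [hb, hfσ] with y hy hyσ
  exact h y hyσ (mem_ball_iff_norm.1 hy)

end EuclideanConicalSpace

/-! ### Pointwise convergence is uniform -/

namespace BalancedSpace

open EuclideanConicalSpace

variable {X N : Type*} [TopologicalSpace X] [NormedAddCommGroup N] [InnerProductSpace ℝ N]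
  [FiniteDimensional ℝ N] {n : ℕ} {E : BalancedSpace X N n}

/-- Being close to `ψ` at the finitely many points of `T` already bounds the functions globally,
hence makes them equicontinuous on the sphere. For an equicontinuous family on a compact space,
pointwise convergence is uniform. -/
theorem tendstoUniformly_of_positive {C : Set (X → ℝ)} (hPL : C ⊆ E.PL)
    (hC : ∀ φ ∈ C, E.IsPositive [φ]) (ψ : X → ℝ) :
    TendstoUniformly (fun (φ : X → ℝ) (x : E.sphere) => φ x) (fun x : E.sphere => ψ x) (𝓝[C] ψ) := by
  have : CompactSpace E.sphere := isCompact_iff_compactSpace.1 E.isCompact_sphere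
  obtain ⟨T, A, hA, hbound⟩ := E.exists_bound
  set D := ∑ y ∈ T, |ψ y| + 1 with hD
  have hcont : Continuous fun φ : X → ℝ => ∑ y ∈ T, |φ y| :=
    continuous_finsetSum _ fun y _ => (continuous_apply y).abs
  have hev : ∀ᶠ φ in 𝓝[C] ψ, ∑ y ∈ T, |φ y| < D :=
    (hcont.tendsto ψ).mono_left nhdsWithin_le_nhds |>.eventually_lt_const (by rw [hD]; linarith)
  have hD0 : 0 ≤ D := by rw [hD]; positivity
  set G : Set (X → ℝ) := {φ | φ ∈ C ∧ ∀ x, |φ x| ≤ A * D * ‖E.ι x‖} with hG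
  have hevG : ∀ᶠ φ in 𝓝[C] ψ, φ ∈ G := by
    filter_upwards [hev, self_mem_nhdsWithin] with φ hφ hφC
    refine ⟨hφC, fun x => (hbound φ (hPL hφC) (hC φ hφC) x).trans ?_⟩
    exact mul_le_mul_of_nonneg_right (mul_le_mul_of_nonneg_left hφ.le hA) (norm_nonneg _)
  have hequi : Equicontinuous fun (φ : G) (x : E.sphere) => (φ : X → ℝ) x := by
    intro x
    rw [Metric.equicontinuousAt_iff_right]
    intro ε hε
    have hx1 : ‖E.ι x‖ = 1 := x.2
    have hx0 : E.ι x ≠ 0 := norm_ne_zero_iff.1 (by rw [hx1]; exact one_ne_zero)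
    obtain ⟨L, hL⟩ := exists_lipschitz_at (E := E) hx0 (mul_nonneg hA hD0)
    have h1 : ∀ᶠ y : E.sphere in 𝓝 x, ∀ σ ∈ E.base.cones, (y : X) ∈ σ → (x : X) ∈ σ :=
      continuous_subtype_val.continuousAt.eventually (E.base.eventually_mem_of_mem x)
    have h2 : ∀ᶠ y : E.sphere in 𝓝 x, L * ‖E.ι y - E.ι x‖ < ε := by
      have hc : Continuous fun y : E.sphere => L * ‖E.ι y - E.ι x‖ :=
        continuous_const.mul (((E.continuous_ι.comp continuous_subtype_val).sub
          continuous_const).norm)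
      exact (hc.tendsto x).eventually_lt_const (by simpa using hε)
    filter_upwards [h1, h2] with y hy1 hy2 φ
    rw [dist_comm, Real.dist_eq]
    exact (hL φ (hPL φ.2.1) (hC φ φ.2.1) φ.2.2 y hy1).trans_lt hy2
  have hlim : Tendsto (fun (φ : G) (x : E.sphere) => (φ : X → ℝ) x)
      (comap Subtype.val (𝓝[C] ψ)) (𝓝 fun x : E.sphere => ψ x) := by
    refine tendsto_pi_nhds.2 fun x => ?_
    exact (((continuous_apply (x : X)).tendsto ψ).mono_left nhdsWithin_le_nhds).comp tendsto_comap
  have hunif := UniformFun.tendsto_iff_tendstoUniformly.1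
    ((hequi.tendsto_uniformFun_iff_pi _ _).2 hlim)
  intro u hu
  have h := hunif u hu
  rw [eventually_comap] at h
  filter_upwards [h, hevG] with φ h hφ
  exact h ⟨φ, hφ⟩ rfl

end BalancedSpace


/-! ### Discrete Monge–Ampère measures -/

namespace EuclideanConicalSpace

variable {X N : Type*} [TopologicalSpace X] [NormedAddCommGroup N] [InnerProductSpace ℝ N]
  [FiniteDimensional ℝ N] {E : EuclideanConicalSpace X N} {P : ConicalComplex X}

theorem evalRay_add (f g : E.sphere → ℝ) (ρ : Set X) :
    E.evalRay (fun x => f x + g x) ρ = E.evalRay f ρ + E.evalRay g ρ := by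
  unfold evalRay
  split_ifs <;> simp

theorem evalRay_mul (t : ℝ) (f : E.sphere → ℝ) (ρ : Set X) :
    E.evalRay (fun x => t * f x) ρ = t * E.evalRay f ρ := by
  unfold evalRay
  split_ifs <;> simp

theorem evalRay_nonneg {f : E.sphere → ℝ} (hf : ∀ x, 0 ≤ f x) (ρ : Set X) : 0 ≤ E.evalRay f ρ := by
  unfold evalRay
  split_ifs
  · exact hf _
  · exact le_rfl

end EuclideanConicalSpace

namespace BalancedSpace

open EuclideanConicalSpace

variable {X N : Type*} [TopologicalSpace X] [NormedAddCommGroup N] [InnerProductSpace ℝ N]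
  [FiniteDimensional ℝ N] {n : ℕ} {E : BalancedSpace X N n} {φ φ' γ : X → ℝ} {φs : List (X → ℝ)}

/-- The restriction of a piecewise linear function to the sphere. -/
def onSphere (E : BalancedSpace X N n) {φ : X → ℝ} (hφ : φ ∈ E.PL) : C(E.sphere, ℝ) :=
  ⟨fun x => φ x, (continuous_of_mem_PL hφ).comp continuous_subtype_val⟩

theorem exists_linearOn_list (hφ : ∀ φ ∈ φs, φ ∈ E.PL) :
    ∃ Q : ConicalComplex X, Q.IsSubdivision E.base ∧ ∀ φ ∈ φs, Q.LinearOn φ := by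
  obtain ⟨Q, hQ, h, -⟩ := exists_linearOn hφ [] (by simp) []
  exact ⟨Q, hQ, h⟩

theorem discreteMeasure_perm {ψs : List (X → ℝ)} (hφ : ∀ φ ∈ φs, φ ∈ E.PL) (h : φs.Perm ψs)
    (f : C(E.sphere, ℝ)) : E.discreteMeasure φs f = E.discreteMeasure ψs f := by
  obtain ⟨Q, hQ, hl⟩ := exists_linearOn_list hφ
  rw [discreteMeasure_eq hQ hl, discreteMeasure_eq hQ (fun ψ hψ => hl ψ (h.mem_iff.2 hψ)),
    prod_perm hQ h hl]

theorem discreteMeasure_add (hφ : ∀ φ ∈ φs, φ ∈ E.PL) (f g : C(E.sphere, ℝ)) :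
    E.discreteMeasure φs (f + g) = E.discreteMeasure φs f + E.discreteMeasure φs g := by
  obtain ⟨Q, hQ, hl⟩ := exists_linearOn_list hφ
  simp only [discreteMeasure_eq hQ hl, raySum, ← Finset.sum_add_distrib, ← mul_add]
  exact Finset.sum_congr rfl fun ρ _ => by rw [← evalRay_add]; rfl

theorem discreteMeasure_smul (hφ : ∀ φ ∈ φs, φ ∈ E.PL) (t : ℝ) (f : C(E.sphere, ℝ)) :
    E.discreteMeasure φs (t • f) = t * E.discreteMeasure φs f := by
  obtain ⟨Q, hQ, hl⟩ := exists_linearOn_list hφ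
  simp only [discreteMeasure_eq hQ hl, raySum, Finset.mul_sum]
  exact Finset.sum_congr rfl fun ρ _ => by
    rw [mul_left_comm]; congr 1; rw [← evalRay_mul]; rfl

theorem discreteMeasure_sub (hφ : ∀ φ ∈ φs, φ ∈ E.PL) (f g : C(E.sphere, ℝ)) :
    E.discreteMeasure φs (f - g) = E.discreteMeasure φs f - E.discreteMeasure φs g := by
  rw [sub_eq_add_neg, discreteMeasure_add hφ, ← neg_one_smul ℝ g, discreteMeasure_smul hφ]
  ring

theorem discreteMeasure_nonneg (hφ : E.IsPositive φs) {f : C(E.sphere, ℝ)} (hf : 0 ≤ f) :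
    0 ≤ E.discreteMeasure φs f := by
  obtain ⟨Q, hQ, -, hl, h0⟩ := hφ.exists_nonneg (.refl E.quasiEmbeds)
  rw [discreteMeasure_eq hQ hl]
  exact Finset.sum_nonneg fun ρ _ => mul_nonneg (h0 ρ) (evalRay_nonneg (fun x => hf x) ρ)

theorem discreteMeasure_cons_add (h : φ ∈ E.PL) (h' : φ' ∈ E.PL) (hφ : ∀ φ ∈ φs, φ ∈ E.PL)
    (f : C(E.sphere, ℝ)) : E.discreteMeasure ((φ + φ') :: φs) f =
      E.discreteMeasure (φ :: φs) f + E.discreteMeasure (φ' :: φs) f := by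
  obtain ⟨Q, hQ, hl⟩ := exists_linearOn_list (φs := φ :: φ' :: φs)
    (List.forall_mem_cons.2 ⟨h, List.forall_mem_cons.2 ⟨h', hφ⟩⟩)
  simp only [List.forall_mem_cons] at hl
  obtain ⟨h1, h2, h3⟩ := hl
  have h12 : Q.LinearOn (φ + φ') := fun σ hσ => Submodule.add_mem _ (h1 σ hσ) (h2 σ hσ)
  rw [discreteMeasure_eq hQ (List.forall_mem_cons.2 ⟨h12, h3⟩),
    discreteMeasure_eq hQ (List.forall_mem_cons.2 ⟨h1, h3⟩),
    discreteMeasure_eq hQ (List.forall_mem_cons.2 ⟨h2, h3⟩), prod_cons, prod_cons, prod_cons,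
    inter_add_left (quasiEmbeds_of_base hQ) h1 h2]
  simp only [raySum, Pi.add_apply, add_mul, Finset.sum_add_distrib]

theorem discreteMeasure_cons_smul (h : φ ∈ E.PL) (hφ : ∀ φ ∈ φs, φ ∈ E.PL) (t : ℝ)
    (f : C(E.sphere, ℝ)) : E.discreteMeasure ((t • φ) :: φs) f =
      t * E.discreteMeasure (φ :: φs) f := by
  obtain ⟨Q, hQ, hl⟩ := exists_linearOn_list (φs := φ :: φs) (List.forall_mem_cons.2 ⟨h, hφ⟩)
  obtain ⟨h1, h3⟩ := List.forall_mem_cons.1 hl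
  have h12 : Q.LinearOn (t • φ) := fun σ hσ => Submodule.smul_mem _ t (h1 σ hσ)
  rw [discreteMeasure_eq hQ (List.forall_mem_cons.2 ⟨h12, h3⟩),
    discreteMeasure_eq hQ hl, prod_cons, prod_cons, inter_smul_left (quasiEmbeds_of_base hQ) h1]
  simp only [raySum, Pi.smul_apply, smul_eq_mul, mul_assoc, Finset.mul_sum]

/-- Both sides are minus the degree of the same product. This integration by parts drives all the
estimates on masses and limits. -/
theorem discreteMeasure_cons_comm (h : φ ∈ E.PL) (h' : γ ∈ E.PL) (hφ : ∀ φ ∈ φs, φ ∈ E.PL) :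
    E.discreteMeasure (φ :: φs) (E.onSphere h') = E.discreteMeasure (γ :: φs) (E.onSphere h) := by
  obtain ⟨Q, hQ, hl⟩ := exists_linearOn_list (φs := φ :: γ :: φs)
    (List.forall_mem_cons.2 ⟨h, List.forall_mem_cons.2 ⟨h', hφ⟩⟩)
  simp only [List.forall_mem_cons] at hl
  obtain ⟨h1, h2, h3⟩ := hl
  have hQ' := quasiEmbeds_of_base hQ
  rw [discreteMeasure_eq hQ (List.forall_mem_cons.2 ⟨h1, h3⟩),
    discreteMeasure_eq hQ (List.forall_mem_cons.2 ⟨h2, h3⟩), ← neg_inj]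
  refine (degree_inter hQ' h2 _).symm.trans (Eq.trans ?_ (degree_inter hQ' h1 _))
  rw [prod_cons, prod_cons, inter_comm hQ' h1 h2]

theorem perm_ofFn_removeNth {α : Type*} {m : ℕ} (φ : Fin (m + 1) → α) (i : Fin (m + 1)) :
    (List.ofFn φ).Perm (φ i :: List.ofFn (i.removeNth φ)) := by
  rw [← Multiset.coe_eq_coe, ← Multiset.cons_coe, ← Fin.univ_val_map, ← Fin.univ_val_map,
    Fin.univ_succAbove m i, Finset.cons_val, Multiset.map_cons, Finset.map_val, Multiset.map_map]
  rfl

theorem deg_eq_neg_discreteMeasure {m : ℕ} {E : BalancedSpace X N (m + 1)}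
    {φ : Fin (m + 1) → X → ℝ} (hφ : ∀ i, φ i ∈ E.PL) (i : Fin (m + 1)) :
    E.deg φ = -E.discreteMeasure (List.ofFn (i.removeNth φ)) (E.onSphere (hφ i)) := by
  obtain ⟨Q, hQ, hl⟩ := exists_linearOn_list (φs := List.ofFn φ) (E := E) (by
    rw [List.forall_mem_ofFn_iff]; exact hφ)
  have hl' := List.forall_mem_ofFn_iff.1 hl
  have hQ' := quasiEmbeds_of_base hQ
  rw [deg_eq hQ hl', prod_perm hQ (perm_ofFn_removeNth φ i) hl, prod_cons,
    degree_inter hQ' (hl' i), discreteMeasure_eq hQ]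
  · rfl
  · rw [List.forall_mem_ofFn_iff]
    exact fun j => hl' _

namespace AdmissibleFamily

variable {C : E.AdmissibleFamily}

theorem mem_PL (hφ : ∀ φ ∈ φs, φ ∈ C.carrier) : ∀ φ ∈ φs, φ ∈ E.PL := fun φ h =>
  C.subset_PL (hφ φ h)

theorem discreteMeasure_mono (hφ : ∀ φ ∈ φs, φ ∈ C.carrier) (hn : φs.length ≤ n)
    {f g : C(E.sphere, ℝ)} (hfg : f ≤ g) : E.discreteMeasure φs f ≤ E.discreteMeasure φs g := by
  have := discreteMeasure_nonneg (C.isPositive φs hn hφ) (sub_nonneg.2 hfg)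
  rw [discreteMeasure_sub (mem_PL hφ)] at this
  linarith

theorem abs_discreteMeasure_le (hφ : ∀ φ ∈ φs, φ ∈ C.carrier) (hn : φs.length ≤ n)
    {f : C(E.sphere, ℝ)} {δ : ℝ} (hf : ∀ x, |f x| ≤ δ) :
    |E.discreteMeasure φs f| ≤ δ * E.discreteMeasure φs 1 := by
  have h1 := discreteMeasure_mono hφ hn (f := f) (g := δ • 1) fun x => by
    simpa using (abs_le.1 (hf x)).2
  have h2 := discreteMeasure_mono hφ hn (f := (-δ) • 1) (g := f) fun x => by
    simpa using (abs_le.1 (hf x)).1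
  rw [discreteMeasure_smul (mem_PL hφ)] at h1 h2
  rw [abs_le]
  exact ⟨by linarith, h1⟩

variable (C) in
-- A difference of functions of the family within `1 / 2` of the constant `1` is at least `1 / 2`;
-- it is then doubled.
theorem exists_one_le_sub [CompactSpace E.sphere] :
    ∃ γ ∈ C.carrier, ∃ γ' ∈ C.carrier, ∀ x : E.sphere, 1 ≤ γ x - γ' x := by
  obtain ⟨f, hf, φ, hφ, φ', hφ', h⟩ := Metric.dense_iff.1 C.dense 1 (1 / 2) (by norm_num)
  refine ⟨_, C.smul_mem 2 two_pos φ hφ, _, C.smul_mem 2 two_pos φ' hφ', fun x => ?_⟩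
  have h1 := (ContinuousMap.dist_lt_iff (by norm_num)).1 (Metric.mem_ball.1 hf) x
  rw [Real.dist_eq, h x, ContinuousMap.one_apply] at h1
  have := (abs_lt.1 h1).1
  simp only [Pi.smul_apply, smul_eq_mul]
  linarith

end AdmissibleFamily

end BalancedSpace


/-! ### Limits of discrete Monge–Ampère measures -/

theorem exists_finiteMeasure_of_nonneg {S : Type*} [TopologicalSpace S] [CompactSpace S] [T2Space S]
    [MeasurableSpace S] [BorelSpace S] (Λ : C(S, ℝ) →ₗ[ℝ] ℝ) (hΛ : ∀ f, 0 ≤ f → 0 ≤ Λ f) :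
    ∃ μ : FiniteMeasure S, ∀ f : C(S, ℝ), ∫ x, f x ∂(μ : Measure S) = Λ f := by
  let Λ' : CompactlySupportedContinuousMap S ℝ →ₚ[ℝ] ℝ := PositiveLinearMap.mk₀
    { toFun := fun f => Λ f.toContinuousMap
      map_add' := fun f g => Λ.map_add _ _
      map_smul' := fun t f => Λ.map_smul t _ } fun f hf => hΛ _ hf
  have hfin : IsFiniteMeasure (RealRMK.rieszMeasure Λ') := by
    unfold RealRMK.rieszMeasure
    infer_instance
  refine ⟨⟨RealRMK.rieszMeasure Λ', hfin⟩, fun f => ?_⟩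
  exact RealRMK.integral_rieszMeasure Λ'
    (CompactlySupportedContinuousMap.continuousMapEquiv f)

/-- Second countability makes the compact Hausdorff space metrizable, where continuous functions
separate finite measures. -/
theorem finiteMeasure_eq_of_integral {S : Type*} [TopologicalSpace S] [CompactSpace S] [T2Space S]
    [SecondCountableTopology S] [MeasurableSpace S] [BorelSpace S] {μ ν : FiniteMeasure S}
    (h : ∀ f : C(S, ℝ), ∫ x, f x ∂(μ : Measure S) = ∫ x, f x ∂(ν : Measure S)) : μ = ν := by
  have := TopologicalSpace.metrizableSpace_of_t3_secondCountable S
  exact Subtype.ext (ext_of_forall_integral_eq_of_IsFiniteMeasure (μ := (μ : Measure S))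
    (ν := (ν : Measure S)) fun f => h f.toContinuousMap)

namespace BalancedSpace

namespace AdmissibleFamily

variable {X N : Type*} [TopologicalSpace X] [NormedAddCommGroup N] [InnerProductSpace ℝ N]
  [FiniteDimensional ℝ N] {n : ℕ} {E : BalancedSpace X N n} {C : E.AdmissibleFamily}

theorem discreteMeasure_one_nonneg {φs : List (X → ℝ)} (hφ : ∀ φ ∈ φs, φ ∈ C.carrier)
    (hn : φs.length ≤ n) : 0 ≤ E.discreteMeasure φs 1 :=
  discreteMeasure_nonneg (C.isPositive φs hn hφ) fun _ => zero_le_one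

variable (C) in
/-- The masses of the discrete measures of uniformly bounded functions are bounded. -/
theorem exists_mass_bound {B : ℝ} (hB : 0 ≤ B) (k : ℕ) :
    ∀ γs : List (X → ℝ), (∀ γ ∈ γs, γ ∈ C.carrier) → k + γs.length ≤ n → ∃ K : ℝ, 0 ≤ K ∧
      ∀ φs : List (X → ℝ), φs.length = k → (∀ φ ∈ φs, φ ∈ C.carrier) →
        (∀ φ ∈ φs, ∀ x : E.sphere, |φ x| ≤ B) → E.discreteMeasure (φs ++ γs) 1 ≤ K := by
  have : CompactSpace E.sphere := isCompact_iff_compactSpace.1 E.isCompact_sphere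
  induction k with
  | zero =>
    intro γs hγ hn
    refine ⟨_, discreteMeasure_one_nonneg hγ (by omega), fun φs hφs _ _ => ?_⟩
    rw [List.length_eq_zero_iff.1 hφs, List.nil_append]
  | succ k ih =>
    intro γs hγ hn
    -- The mass is at most the integral of `γ - γ'`. Exchanging `φ` with `γ` or `γ'` makes the
    -- latter a fixed factor of the measure and `φ`, bounded by `B`, the integrand, with one free
    -- factor fewer.
    obtain ⟨γ, hγC, γ', hγC', h1⟩ := C.exists_one_le_sub
    obtain ⟨K, hK, h⟩ := ih (γ :: γs) (List.forall_mem_cons.2 ⟨hγC, hγ⟩) (by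
      rw [List.length_cons]; omega)
    obtain ⟨K', hK', h'⟩ := ih (γ' :: γs) (List.forall_mem_cons.2 ⟨hγC', hγ⟩) (by
      rw [List.length_cons]; omega)
    refine ⟨B * (K + K'), by positivity, fun φs hlen hφ hbd => ?_⟩
    obtain ⟨φ, φs, rfl⟩ := List.exists_cons_of_length_eq_add_one hlen
    rw [List.length_cons, Nat.add_right_cancel_iff] at hlen
    obtain ⟨hφ0, hφ⟩ := List.forall_mem_cons.1 hφ
    obtain ⟨hb0, hbd⟩ := List.forall_mem_cons.1 hbd
    have hl : ∀ ψ ∈ φs ++ γs, ψ ∈ C.carrier := List.forall_mem_append.2 ⟨hφ, hγ⟩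
    have hlen' : (φs ++ γs).length + 1 ≤ n := by rw [List.length_append]; omega
    have hγPL := C.subset_PL hγC
    have hγPL' := C.subset_PL hγC'
    have hφPL := C.subset_PL hφ0
    have key : ∀ δ ∈ C.carrier, ∀ K : ℝ, (∀ φs : List (X → ℝ), φs.length = k →
        (∀ φ ∈ φs, φ ∈ C.carrier) → (∀ φ ∈ φs, ∀ x : E.sphere, |φ x| ≤ B) →
        E.discreteMeasure (φs ++ δ :: γs) 1 ≤ K) →
        |E.discreteMeasure (δ :: (φs ++ γs)) (E.onSphere hφPL)| ≤ B * K := by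
      intro δ hδ K h
      have hδl : ∀ ψ ∈ δ :: (φs ++ γs), ψ ∈ C.carrier := List.forall_mem_cons.2 ⟨hδ, hl⟩
      refine (abs_discreteMeasure_le hδl hlen' hb0).trans (mul_le_mul_of_nonneg_left ?_ hB)
      rw [discreteMeasure_perm (mem_PL hδl) List.perm_middle.symm]
      exact h φs hlen hφ hbd
    have h2 : E.discreteMeasure (φ :: (φs ++ γs)) 1 ≤
        E.discreteMeasure (φ :: (φs ++ γs)) (E.onSphere hγPL - E.onSphere hγPL') :=
      discreteMeasure_mono (List.forall_mem_cons.2 ⟨hφ0, hl⟩) hlen' fun x => h1 x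
    rw [discreteMeasure_sub (mem_PL (List.forall_mem_cons.2 ⟨hφ0, hl⟩)),
      discreteMeasure_cons_comm hφPL hγPL (mem_PL hl),
      discreteMeasure_cons_comm hφPL hγPL' (mem_PL hl)] at h2
    have h3 := (abs_le.1 (key γ hγC K h)).2
    have h4 := (abs_le.1 (key γ' hγC' K' h')).1
    rw [List.cons_append]
    linarith

/-- The discrete measures of nearby functions have nearby integrals. -/
theorem abs_sub_le_of_close {B δ K : ℝ} {r : ℕ} (hr : r ≤ n)
    (hK : ∀ φs : List (X → ℝ), φs.length = r → (∀ φ ∈ φs, φ ∈ C.carrier) →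
      (∀ φ ∈ φs, ∀ x : E.sphere, |φ x| ≤ B) → E.discreteMeasure φs 1 ≤ K)
    {γ : X → ℝ} (hγ : γ ∈ C.carrier) (hγB : ∀ x : E.sphere, |γ x| ≤ B) (hδ : 0 ≤ δ) (k : ℕ) :
    ∀ (φ φ' : Fin k → X → ℝ) (ωs : List (X → ℝ)), k + ωs.length = r →
      (∀ i, φ i ∈ C.carrier) → (∀ i, φ' i ∈ C.carrier) → (∀ ω ∈ ωs, ω ∈ C.carrier) →
      (∀ i, ∀ x : E.sphere, |φ i x| ≤ B) → (∀ i, ∀ x : E.sphere, |φ' i x| ≤ B) →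
      (∀ ω ∈ ωs, ∀ x : E.sphere, |ω x| ≤ B) → (∀ i, ∀ x : E.sphere, |φ i x - φ' i x| ≤ δ) →
      |E.discreteMeasure (List.ofFn φ ++ ωs) (E.onSphere (C.subset_PL hγ)) -
        E.discreteMeasure (List.ofFn φ' ++ ωs) (E.onSphere (C.subset_PL hγ))| ≤ k * (δ * K) := by
  induction k with
  | zero => intro φ φ' ωs _ _ _ _ _ _ _ _; simp
  | succ k ih =>
    intro φ φ' ωs hlen hφ hφ' hω hb hb' hωb hd
    rw [List.ofFn_succ, List.ofFn_succ, List.cons_append, List.cons_append]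
    have hl : ∀ ψ ∈ (List.ofFn fun i : Fin k => φ i.succ) ++ ωs, ψ ∈ C.carrier :=
      List.forall_mem_append.2 ⟨List.forall_mem_ofFn_iff.2 fun i => hφ _, hω⟩
    have hl' : ∀ ψ ∈ (List.ofFn fun i : Fin k => φ' i.succ) ++ ωs, ψ ∈ C.carrier :=
      List.forall_mem_append.2 ⟨List.forall_mem_ofFn_iff.2 fun i => hφ' _, hω⟩
    have hlb : ∀ ψ ∈ (List.ofFn fun i : Fin k => φ i.succ) ++ ωs, ∀ x : E.sphere, |ψ x| ≤ B :=
      List.forall_mem_append.2 ⟨List.forall_mem_ofFn_iff.2 fun i => hb _, hωb⟩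
    have hγPL := C.subset_PL hγ
    have hγl := List.forall_mem_cons.2 ⟨hγ, hl⟩
    have hlength : (γ :: ((List.ofFn fun i : Fin k => φ i.succ) ++ ωs)).length = r := by
      rw [List.length_cons, List.length_append, List.length_ofFn]; omega
    -- Only the first factor changes here. Exchanged with the integrand, it contributes the integral
    -- of `φ 0 - φ' 0`, at most `δ` in absolute value, against a measure of mass at most `K`.
    have h1 : |E.discreteMeasure (φ 0 :: ((List.ofFn fun i : Fin k => φ i.succ) ++ ωs))
          (E.onSphere hγPL) -
        E.discreteMeasure (φ' 0 :: ((List.ofFn fun i : Fin k => φ i.succ) ++ ωs))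
          (E.onSphere hγPL)| ≤ δ * K := by
      rw [discreteMeasure_cons_comm (C.subset_PL (hφ 0)) hγPL (mem_PL hl),
        discreteMeasure_cons_comm (C.subset_PL (hφ' 0)) hγPL (mem_PL hl),
        ← discreteMeasure_sub (mem_PL hγl)]
      exact (abs_discreteMeasure_le hγl (by omega) (hd 0)).trans (mul_le_mul_of_nonneg_left
        (hK _ hlength hγl (List.forall_mem_cons.2 ⟨hγB, hlb⟩)) hδ)
    have h2 := ih (fun i => φ i.succ) (fun i => φ' i.succ) (φ' 0 :: ωs)
      (by rw [List.length_cons]; omega) (fun i => hφ _) (fun i => hφ' _)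
      (List.forall_mem_cons.2 ⟨hφ' 0, hω⟩) (fun i => hb _) (fun i => hb' _)
      (List.forall_mem_cons.2 ⟨hb' 0, hωb⟩) fun i => hd _
    rw [discreteMeasure_perm (mem_PL (List.forall_mem_append.2 ⟨List.forall_mem_ofFn_iff.2
        fun i => hφ _, List.forall_mem_cons.2 ⟨hφ' 0, hω⟩⟩)) List.perm_middle,
      discreteMeasure_perm (mem_PL (List.forall_mem_append.2 ⟨List.forall_mem_ofFn_iff.2
        fun i => hφ' _, List.forall_mem_cons.2 ⟨hφ' 0, hω⟩⟩)) List.perm_middle] at h2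
    have h3 := abs_sub_le (E.discreteMeasure (φ 0 :: ((List.ofFn fun i : Fin k => φ i.succ) ++ ωs))
          (E.onSphere hγPL))
        (E.discreteMeasure (φ' 0 :: ((List.ofFn fun i : Fin k => φ i.succ) ++ ωs))
          (E.onSphere hγPL))
        (E.discreteMeasure (φ' 0 :: ((List.ofFn fun i : Fin k => φ' i.succ) ++ ωs))
          (E.onSphere hγPL))
    push_cast
    linarith

end AdmissibleFamily

end BalancedSpace

/-! ### Uniform convergence in the family and existence of the limits. -/

namespace BalancedSpace

namespace AdmissibleFamily

variable {X N : Type*} [TopologicalSpace X] [NormedAddCommGroup N] [InnerProductSpace ℝ N]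
  [FiniteDimensional ℝ N] {n : ℕ} {E : BalancedSpace X N n} {C : E.AdmissibleFamily}

variable (C) in
theorem tendstoUniformly (hn : 1 ≤ n) (ψ : X → ℝ) :
    TendstoUniformly (fun (φ : X → ℝ) (x : E.sphere) => φ x) (fun x : E.sphere => ψ x)
      (𝓝[C.carrier] ψ) :=
  tendstoUniformly_of_positive C.subset_PL
    (fun φ hφ => C.isPositive [φ] (by simpa using hn) (by simpa using hφ)) ψ

theorem eventually_abs_sub_lt (hn : 1 ≤ n) (ψ : X → ℝ) {δ : ℝ} (hδ : 0 < δ) :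
    ∀ᶠ φ in 𝓝[C.carrier] ψ, ∀ x : E.sphere, |φ x - ψ x| < δ := by
  filter_upwards [Metric.tendstoUniformly_iff.1 (C.tendstoUniformly hn ψ) δ hδ] with φ h x
  rw [← Real.dist_eq, dist_comm]
  exact h x

theorem continuous_of_mem_closure (hn : 1 ≤ n) {ψ : X → ℝ} (hψ : ψ ∈ closure C.carrier) :
    Continuous fun x : E.sphere => ψ x := by
  have := mem_closure_iff_nhdsWithin_neBot.1 hψ
  refine (C.tendstoUniformly hn ψ).continuous ?_
  refine Eventually.frequently ?_
  filter_upwards [self_mem_nhdsWithin] with φ hφ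
  exact (continuous_of_mem_PL (C.subset_PL hφ)).comp continuous_subtype_val

theorem exists_abs_le (hn : 1 ≤ n) {k : ℕ} {ψ : Fin k → X → ℝ} (hψ : ∀ i, ψ i ∈ closure C.carrier) :
    ∃ B : ℝ, 0 ≤ B ∧ ∀ i, ∀ x : E.sphere, |ψ i x| ≤ B := by
  have : CompactSpace E.sphere := isCompact_iff_compactSpace.1 E.isCompact_sphere
  let f : Fin k → C(E.sphere, ℝ) := fun i => ⟨_, continuous_of_mem_closure hn (hψ i)⟩
  refine ⟨∑ i, ‖f i‖, Finset.sum_nonneg fun _ _ => norm_nonneg _, fun i x => ?_⟩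
  exact ((f i).norm_coe_le_norm x).trans
    (Finset.single_le_sum (f := fun i => ‖f i‖) (fun _ _ => norm_nonneg _) (Finset.mem_univ i))

variable (C) in
/-- The filter of tuples in the family that converge pointwise to `ψ`. -/
def nhds {k : ℕ} (ψ : Fin k → X → ℝ) : Filter (Fin k → X → ℝ) :=
  Filter.pi fun i => 𝓝[C.carrier] (ψ i)

theorem neBot_nhds {k : ℕ} {ψ : Fin k → X → ℝ} (hψ : ∀ i, ψ i ∈ closure C.carrier) :
    (C.nhds ψ).NeBot := by
  have := fun i => mem_closure_iff_nhdsWithin_neBot.1 (hψ i)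
  exact Filter.pi_neBot.2 this

theorem eventually_nhds {k : ℕ} {ψ : Fin k → X → ℝ} {p : Fin k → (X → ℝ) → Prop}
    (h : ∀ i, ∀ᶠ φ in 𝓝[C.carrier] (ψ i), p i φ) : ∀ᶠ φ in C.nhds ψ, ∀ i, p i (φ i) :=
  eventually_all.2 fun i => (tendsto_eval_pi _ i).eventually (h i)

theorem eventually_mem {k : ℕ} (ψ : Fin k → X → ℝ) : ∀ᶠ φ in C.nhds ψ, ∀ i, φ i ∈ C.carrier :=
  eventually_nhds fun _ => self_mem_nhdsWithin

/-- Cauchy's criterion. The function `f` is replaced by a nearby difference `γ - γ'` of functions of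
the family, at a cost controlled by the masses, and the integrals of `γ` and `γ'` vary little by
`abs_sub_le_of_close`. -/
theorem exists_tendsto_discreteMeasure {m : ℕ} {E : BalancedSpace X N (m + 1)}
    {C : E.AdmissibleFamily} {ψ : Fin m → X → ℝ} (hψ : ∀ i, ψ i ∈ closure C.carrier)
    (f : C(E.sphere, ℝ)) :
    ∃ L : ℝ, Tendsto (fun φ => E.discreteMeasure (List.ofFn φ) f) (C.nhds ψ) (𝓝 L) := by
  have : CompactSpace E.sphere := isCompact_iff_compactSpace.1 E.isCompact_sphere
  have hne := neBot_nhds hψ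
  have hn : 1 ≤ m + 1 := by omega
  obtain ⟨B, hB, hψB⟩ := exists_abs_le hn hψ
  obtain ⟨K, hK, hmass⟩ := C.exists_mass_bound (B := B + 1) (by positivity) m [] (by simp) (by simp)
  simp only [List.append_nil] at hmass
  refine cauchy_map_iff_exists_tendsto.1 (Metric.cauchy_iff.2 ⟨inferInstance, fun ε hε => ?_⟩)
  -- The mass bound `K` is fixed before `γ` and `γ'` are chosen; each of the two replacements of `f`
  -- then costs less than `ε / 4`.
  set ε₁ := ε / (4 * (K + 1)) with hε₁
  have hε₁0 : 0 < ε₁ := by positivity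
  obtain ⟨g, hg, γ, hγ, γ', hγ', hgγ⟩ := Metric.dense_iff.1 C.dense f ε₁ hε₁0
  have hfg : ∀ x, |(f - g) x| ≤ ε₁ := fun x => by
    have := ((ContinuousMap.dist_lt_iff hε₁0).1 (Metric.mem_ball'.1 hg) x).le
    rwa [Real.dist_eq] at this
  have hgeq : g = E.onSphere (C.subset_PL hγ) - E.onSphere (C.subset_PL hγ') := by
    ext x; exact hgγ x
  -- The bound must now cover `γ` and `γ'` too, since they become factors of the measures; this
  -- leads to a second mass bound `K'`, and `δ` is chosen after it.
  set B' := B + 1 + ‖E.onSphere (C.subset_PL hγ)‖ + ‖E.onSphere (C.subset_PL hγ')‖ with hB'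
  have hB'0 : 0 ≤ B' := by positivity
  have hγB : ∀ x : E.sphere, |γ x| ≤ B' := fun x => by
    have h1 : |γ x| ≤ _ := (E.onSphere (C.subset_PL hγ)).norm_coe_le_norm x
    have h2 := norm_nonneg (E.onSphere (C.subset_PL hγ'))
    linarith
  have hγB' : ∀ x : E.sphere, |γ' x| ≤ B' := fun x => by
    have h1 : |γ' x| ≤ _ := (E.onSphere (C.subset_PL hγ')).norm_coe_le_norm x
    have h2 := norm_nonneg (E.onSphere (C.subset_PL hγ))
    linarith
  obtain ⟨K', hK', hmass'⟩ := C.exists_mass_bound hB'0 m [] (by simp) (by simp)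
  simp only [List.append_nil] at hmass'
  set δ := min 1 (ε / (16 * (m * K' + 1))) with hδ
  have hmK : 0 ≤ m * K' := by positivity
  have hδ0 : 0 < δ := lt_min one_pos (by positivity)
  have hδε : m * (2 * δ * K') < ε / 4 := by
    have h1 : δ * (16 * (m * K' + 1)) ≤ ε := (le_div_iff₀ (by positivity)).1 (min_le_right _ _)
    nlinarith
  have hev : ∀ᶠ φ in C.nhds ψ, ∀ i, φ i ∈ C.carrier ∧ ∀ x : E.sphere, |φ i x - ψ i x| < δ :=
    eventually_nhds fun i => Filter.Eventually.and self_mem_nhdsWithin (eventually_abs_sub_lt hn _ hδ0)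
  refine ⟨_, image_mem_map hev, ?_⟩
  rintro _ ⟨φ, hφ, rfl⟩ _ ⟨φ', hφ', rfl⟩
  have hbd : ∀ φ : Fin m → X → ℝ, (∀ i, φ i ∈ C.carrier ∧ ∀ x : E.sphere, |φ i x - ψ i x| < δ) →
      ∀ i, ∀ x : E.sphere, |φ i x| ≤ B + 1 := by
    intro φ hφ i x
    have h1 := abs_lt.1 ((hφ i).2 x)
    have h2 := abs_le.1 (hψB i x)
    have h3 : δ ≤ 1 := min_le_left _ _
    rw [abs_le]
    constructor <;> linarith
  have hBB' : B + 1 ≤ B' := by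
    have h1 := norm_nonneg (E.onSphere (C.subset_PL hγ'))
    have h2 := norm_nonneg (E.onSphere (C.subset_PL hγ))
    linarith
  have hC : ∀ ω ∈ List.ofFn φ, ω ∈ C.carrier := List.forall_mem_ofFn_iff.2 fun i => (hφ i).1
  have hC' : ∀ ω ∈ List.ofFn φ', ω ∈ C.carrier := List.forall_mem_ofFn_iff.2 fun i => (hφ' i).1
  have h1 : |E.discreteMeasure (List.ofFn φ) (f - g)| ≤ ε₁ * K :=
    (abs_discreteMeasure_le hC (by simp) hfg).trans (mul_le_mul_of_nonneg_left
      (hmass _ (by simp) hC (List.forall_mem_ofFn_iff.2 (hbd φ hφ))) hε₁0.le)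
  have h2 : |E.discreteMeasure (List.ofFn φ') (f - g)| ≤ ε₁ * K :=
    (abs_discreteMeasure_le hC' (by simp) hfg).trans (mul_le_mul_of_nonneg_left
      (hmass _ (by simp) hC' (List.forall_mem_ofFn_iff.2 (hbd φ' hφ'))) hε₁0.le)
  have hclose : ∀ i, ∀ x : E.sphere, |φ i x - φ' i x| ≤ 2 * δ := by
    intro i x
    have h1 := abs_lt.1 ((hφ i).2 x)
    have h2 := abs_lt.1 ((hφ' i).2 x)
    rw [abs_le]
    constructor <;> linarith
  have key : ∀ (γ : X → ℝ) (hγ : γ ∈ C.carrier), (∀ x : E.sphere, |γ x| ≤ B') →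
      |E.discreteMeasure (List.ofFn φ) (E.onSphere (C.subset_PL hγ)) -
        E.discreteMeasure (List.ofFn φ') (E.onSphere (C.subset_PL hγ))| ≤ m * (2 * δ * K') := by
    intro γ hγ hγB
    have := abs_sub_le_of_close (r := m) (by omega) hmass' hγ hγB (by positivity : 0 ≤ 2 * δ) m φ φ'
      [] (by simp) (fun i => (hφ i).1) (fun i => (hφ' i).1) (by simp)
      (fun i x => (hbd φ hφ i x).trans hBB') (fun i x => (hbd φ' hφ' i x).trans hBB') (by simp)
      hclose
    simpa only [List.append_nil] using this
  have h3 := abs_le.1 (key γ hγ hγB)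
  have h4 := abs_le.1 (key γ' hγ' hγB')
  rw [discreteMeasure_sub (mem_PL hC), hgeq, discreteMeasure_sub (mem_PL hC)] at h1
  rw [discreteMeasure_sub (mem_PL hC'), hgeq, discreteMeasure_sub (mem_PL hC')] at h2
  have h5 : ε₁ * K < ε / 4 := by
    have : ε₁ * (4 * (K + 1)) = ε := div_mul_cancel₀ _ (by positivity)
    nlinarith
  have h1' := abs_le.1 h1
  have h2' := abs_le.1 h2
  rw [Real.dist_eq, abs_lt]
  constructor <;> linarith

end AdmissibleFamily

end BalancedSpace


/-! ### Mixed Monge–Ampère measures -/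

/-- The integral of a continuous function, as a linear form on finite measures. -/
def integralLinear {S : Type*} [TopologicalSpace S] [CompactSpace S] [MeasurableSpace S]
    [BorelSpace S] (f : C(S, ℝ)) : FiniteMeasure S →ₗ[ℝ≥0] ℝ where
  toFun μ := ∫ x, f x ∂(μ : Measure S)
  map_add' μ ν := by
    have h (μ : FiniteMeasure S) : Integrable f (μ : Measure S) :=
      f.continuous.integrable_of_hasCompactSupport (HasCompactSupport.of_compactSpace f)
    rw [FiniteMeasure.toMeasure_add, integral_add_measure (h μ) (h ν)]
  map_smul' c μ := by
    rw [FiniteMeasure.toMeasure_smul, integral_smul_nnreal_measure]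
    rfl

/-- Taking `c` to be the indicator of `A` leaves the terms whose index has image inside `A`;
induction removes those with smaller image. -/
theorem sum_image_eq_zero {ι κ : Type*} [Fintype ι] [Fintype κ] [DecidableEq ι] [DecidableEq κ]
    {d : (κ → ι) → ℝ} (h : ∀ c : ι → ℝ≥0, ∑ I, (∏ k, c (I k)) • d I = 0) (A : Finset ι) :
    ∑ I with Finset.univ.image I = A, d I = 0 := by
  induction A using Finset.strongInduction with
  | H A ih =>
    have h1 : ∑ I with Finset.univ.image I ⊆ A, d I = 0 := by
      rw [← h fun i => if i ∈ A then 1 else 0, Finset.sum_filter]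
      refine Finset.sum_congr rfl fun I _ => ?_
      rw [Finset.prod_ite_zero, ite_smul, Finset.prod_const_one, one_smul, zero_smul]
      simp only [Finset.image_subset_iff]
      congr
    rw [← Finset.sum_fiberwise_of_maps_to (g := fun I => Finset.univ.image I) (t := A.powerset)
      (fun I hI => Finset.mem_powerset.2 (Finset.mem_filter.1 hI).2),
      Finset.sum_eq_single_of_mem A (Finset.mem_powerset.2 Finset.Subset.rfl)] at h1
    · rw [← h1, Finset.filter_filter]
      refine Finset.sum_congr (Finset.filter_congr fun I _ => ?_) fun _ _ => rfl
      exact ⟨fun h => ⟨h.le, h⟩, fun h => h.2⟩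
    · intro B hB hBA
      rw [Finset.filter_filter, ← ih B (lt_of_le_of_ne (Finset.mem_powerset.1 hB) hBA)]
      refine Finset.sum_congr (Finset.filter_congr fun I _ => ?_) fun _ _ => rfl
      exact ⟨fun h => h.2, fun h => ⟨h.le.trans (Finset.mem_powerset.1 hB), h⟩⟩

/-- A symmetric family of coefficients of a polynomial that vanishes for all nonnegative arguments
has no multilinear term. -/
theorem apply_id_eq_zero_of_symmetric {ι : Type*} [Fintype ι] [DecidableEq ι] {d : (ι → ι) → ℝ}
    (hd : ∀ (e : Equiv.Perm ι) (I : ι → ι), d (I ∘ e) = d I)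
    (h : ∀ c : ι → ℝ≥0, ∑ I, (∏ k, c (I k)) • d I = 0) : d id = 0 := by
  have h1 := sum_image_eq_zero h Finset.univ
  -- A map with full image is a permutation, so by symmetry all remaining terms equal `d id`.
  have h2 : ∀ I ∈ Finset.univ.filter fun I : ι → ι => Finset.univ.image I = Finset.univ,
      d I = d id := by
    intro I hI
    have hs : Function.Surjective I := by
      simpa [Finset.ext_iff, Function.Surjective] using (Finset.mem_filter.1 hI).2
    exact hd (Equiv.ofBijective I (Finite.surjective_iff_bijective.1 hs)) id
  rw [Finset.sum_congr rfl h2, Finset.sum_const, nsmul_eq_mul, mul_eq_zero, Nat.cast_eq_zero,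
    Finset.card_eq_zero] at h1
  refine h1.resolve_left fun h0 => ?_
  have : id ∈ Finset.univ.filter fun I : ι → ι => Finset.univ.image I = Finset.univ := by simp
  rw [h0] at this
  simp at this

namespace BalancedSpace

namespace AdmissibleFamily

variable {X N : Type*} [TopologicalSpace X] [NormedAddCommGroup N] [InnerProductSpace ℝ N]
  [FiniteDimensional ℝ N] {m : ℕ} {E : BalancedSpace X N (m + 1)} {C : E.AdmissibleFamily}

theorem tendsto_update {k : ℕ} (ψ : Fin k → X → ℝ) (i : Fin k) {α : Type*} {l : Filter α}
    {g : α → X → ℝ} {a : X → ℝ} {p : α → Fin k → X → ℝ} (hp : Tendsto p l (C.nhds ψ))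
    (hg : Tendsto g l (𝓝[C.carrier] a)) :
    Tendsto (fun x => Function.update (p x) i (g x)) l (C.nhds (Function.update ψ i a)) := by
  refine tendsto_pi.2 fun j => ?_
  rcases eq_or_ne j i with rfl | hj
  · simpa using hg
  · simp only [Function.update_of_ne hj]
    exact (tendsto_eval_pi _ j).comp hp

theorem tendsto_nhds_iff {k : ℕ} {ψ : Fin k → X → ℝ} {α : Type*} {l : Filter α}
    {p : α → Fin k → X → ℝ} :
    Tendsto p l (C.nhds ψ) ↔ ∀ i, Tendsto (fun x => p x i) l (𝓝[C.carrier] (ψ i)) :=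
  tendsto_pi

theorem tendsto_removeNth {k : ℕ} (ψ : Fin (k + 1) → X → ℝ) (i : Fin (k + 1)) :
    Tendsto (fun φ => i.removeNth φ) (C.nhds ψ) (C.nhds (i.removeNth ψ)) :=
  tendsto_nhds_iff.2 fun j => tendsto_eval_pi _ (i.succAbove j)

variable [SecondCountableTopology X] [MeasurableSpace X] [BorelSpace X]

/-- The limits form a positive linear form on the continuous functions of a compact Hausdorff space,
and the Riesz theorem applies. -/
theorem exists_finiteMeasure {ψ : Fin m → X → ℝ} (hψ : ∀ i, ψ i ∈ closure C.carrier) :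
    ∃ μ : FiniteMeasure E.sphere, ∀ f : C(E.sphere, ℝ),
      Tendsto (fun φ => E.discreteMeasure (List.ofFn φ) f) (C.nhds ψ)
        (𝓝 (∫ x, f x ∂(μ : Measure E.sphere))) := by
  have : T2Space X := E.t2Space
  have : CompactSpace E.sphere := isCompact_iff_compactSpace.1 E.isCompact_sphere
  have := neBot_nhds hψ
  choose Λ hΛ using exists_tendsto_discreteMeasure hψ
  have hmem : ∀ᶠ φ in C.nhds ψ, ∀ ω ∈ List.ofFn φ, ω ∈ C.carrier :=
    (eventually_mem ψ).mono fun φ hφ => List.forall_mem_ofFn_iff.2 hφ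
  obtain ⟨μ, hμ⟩ := exists_finiteMeasure_of_nonneg
    { toFun := Λ
      map_add' := fun f g => by
        refine tendsto_nhds_unique (hΛ _) (((hΛ f).add (hΛ g)).congr' ?_)
        filter_upwards [hmem] with φ hφ using (discreteMeasure_add (mem_PL hφ) f g).symm
      map_smul' := fun t f => by
        refine tendsto_nhds_unique (hΛ _) (((hΛ f).const_mul t).congr' ?_)
        filter_upwards [hmem] with φ hφ using (discreteMeasure_smul (mem_PL hφ) t f).symm }
    (fun f hf => by
      refine ge_of_tendsto (hΛ f) ?_
      filter_upwards [hmem] with φ hφ using discreteMeasure_nonneg (C.isPositive _ (by simp) hφ) hf)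
  exact ⟨μ, fun f => by rw [hμ]; exact hΛ f⟩

variable (C) in
/-- The weak limit of the discrete Monge–Ampère measures. -/
def mixedMeasure (ψ : Fin m → C.concave) : FiniteMeasure E.sphere :=
  (exists_finiteMeasure fun i => (ψ i).2.2).choose

theorem tendsto_mixedMeasure (ψ : Fin m → C.concave) (f : C(E.sphere, ℝ)) :
    Tendsto (fun φ => E.discreteMeasure (List.ofFn φ) f) (C.nhds fun i => (ψ i : X → ℝ))
      (𝓝 (∫ x, f x ∂(C.mixedMeasure ψ : Measure E.sphere))) :=
  (exists_finiteMeasure fun i => (ψ i).2.2).choose_spec f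

/-- The mixed Monge–Ampère measure is determined along every filter of approximations. -/
theorem eq_mixedMeasure {ψ : Fin m → C.concave} {μ : FiniteMeasure E.sphere} {α : Type*}
    {l : Filter α} [l.NeBot] {p : α → Fin m → X → ℝ}
    (hp : Tendsto p l (C.nhds fun i => (ψ i : X → ℝ)))
    (h : ∀ f : C(E.sphere, ℝ), Tendsto (fun x => E.discreteMeasure (List.ofFn (p x)) f) l
      (𝓝 (∫ x, f x ∂(μ : Measure E.sphere)))) : μ = C.mixedMeasure ψ := by
  have : T2Space X := E.t2Space
  have : CompactSpace E.sphere := isCompact_iff_compactSpace.1 E.isCompact_sphere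
  exact finiteMeasure_eq_of_integral fun f =>
    tendsto_nhds_unique (h f) ((tendsto_mixedMeasure ψ f).comp hp)

theorem mixedMeasure_comp_perm (e : Equiv.Perm (Fin m)) (ψ : Fin m → C.concave) :
    C.mixedMeasure (ψ ∘ e) = C.mixedMeasure ψ := by
  have := neBot_nhds (C := C) fun i => (ψ i).2.2
  refine (eq_mixedMeasure (p := fun φ => φ ∘ e) (l := C.nhds fun i => (ψ i : X → ℝ))
    (tendsto_nhds_iff.2 fun i => tendsto_eval_pi _ (e i)) fun f => ?_).symm
  refine (tendsto_mixedMeasure ψ f).congr' ?_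
  filter_upwards [eventually_mem _] with φ hφ
  exact discreteMeasure_perm (mem_PL (List.forall_mem_ofFn_iff.2 hφ))
    (Equiv.Perm.ofFn_comp_perm e φ).symm f

theorem coe_update (ψ : Fin m → C.concave) (i : Fin m) (a : C.concave) :
    (fun j => (Function.update ψ i a j : X → ℝ)) =
      Function.update (fun j => (ψ j : X → ℝ)) i (a : X → ℝ) :=
  (Function.apply_update (fun _ (b : C.concave) => (b : X → ℝ)) ψ i a · ) |> funext

theorem perm_ofFn_update {α : Type*} {k : ℕ} (φ : Fin (k + 1) → α) (i : Fin (k + 1)) (a : α) :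
    (List.ofFn (Function.update φ i a)).Perm (a :: List.ofFn (i.removeNth φ)) := by
  simpa using perm_ofFn_removeNth (Function.update φ i a) i

theorem discreteMeasure_update_add {φ : Fin m → X → ℝ} (hφ : ∀ i, φ i ∈ C.carrier) (i : Fin m)
    {a b : X → ℝ} (ha : a ∈ C.carrier) (hb : b ∈ C.carrier) (f : C(E.sphere, ℝ)) :
    E.discreteMeasure (List.ofFn (Function.update φ i (a + b))) f =
      E.discreteMeasure (List.ofFn (Function.update φ i a)) f +
        E.discreteMeasure (List.ofFn (Function.update φ i b)) f := by
  obtain ⟨k, rfl⟩ := Nat.exists_eq_succ_of_ne_zero (Fin.pos i).ne'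
  have h (a) (ha : a ∈ C.carrier) := discreteMeasure_perm (mem_PL (List.forall_mem_ofFn_iff.2
    ((Function.forall_update_iff φ fun _ ω => ω ∈ C.carrier).2 ⟨ha, fun j _ => hφ j⟩)))
    (perm_ofFn_update φ i a) f
  rw [h _ (C.add_mem _ ha _ hb), h _ ha, h _ hb]
  exact discreteMeasure_cons_add (C.subset_PL ha) (C.subset_PL hb)
    (mem_PL (List.forall_mem_ofFn_iff.2 fun j => hφ (i.succAbove j))) f

theorem discreteMeasure_update_smul {φ : Fin m → X → ℝ} (hφ : ∀ i, φ i ∈ C.carrier) (i : Fin m)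
    {a : X → ℝ} (ha : a ∈ C.carrier) {t : ℝ} (ht : 0 < t) (f : C(E.sphere, ℝ)) :
    E.discreteMeasure (List.ofFn (Function.update φ i (t • a))) f =
      t * E.discreteMeasure (List.ofFn (Function.update φ i a)) f := by
  obtain ⟨k, rfl⟩ := Nat.exists_eq_succ_of_ne_zero (Fin.pos i).ne'
  have h (a) (ha : a ∈ C.carrier) := discreteMeasure_perm (mem_PL (List.forall_mem_ofFn_iff.2
    ((Function.forall_update_iff φ fun _ ω => ω ∈ C.carrier).2 ⟨ha, fun j _ => hφ j⟩)))
    (perm_ofFn_update φ i a) f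
  rw [h _ (C.smul_mem t ht _ ha), h _ ha]
  exact discreteMeasure_cons_smul (C.subset_PL ha)
    (mem_PL (List.forall_mem_ofFn_iff.2 fun j => hφ (i.succAbove j))) t f

/-- The tuple and the two summands are approximated independently, along a product filter, and
additivity of the discrete measures passes to the limit. -/
theorem mixedMeasure_update_add (ψ : Fin m → C.concave) (i : Fin m) (a b : C.concave) :
    C.mixedMeasure (Function.update ψ i (a + b)) =
      C.mixedMeasure (Function.update ψ i a) + C.mixedMeasure (Function.update ψ i b) := by
  have : CompactSpace E.sphere := isCompact_iff_compactSpace.1 E.isCompact_sphere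
  have := neBot_nhds (C := C) fun i => (ψ i).2.2
  have := mem_closure_iff_nhdsWithin_neBot.1 a.2.2
  have := mem_closure_iff_nhdsWithin_neBot.1 b.2.2
  set l := (C.nhds fun i => (ψ i : X → ℝ)) ×ˢ
    (𝓝[C.carrier] (a : X → ℝ) ×ˢ 𝓝[C.carrier] (b : X → ℝ))
  have hψ : Tendsto (fun p => p.1) l (C.nhds fun i => (ψ i : X → ℝ)) := tendsto_fst
  have ha : Tendsto (fun p => p.2.1) l (𝓝[C.carrier] (a : X → ℝ)) := tendsto_fst.comp tendsto_snd
  have hb : Tendsto (fun p => p.2.2) l (𝓝[C.carrier] (b : X → ℝ)) := tendsto_snd.comp tendsto_snd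
  have hab : Tendsto (fun p => p.2.1 + p.2.2) l (𝓝[C.carrier] ((a + b : C.concave) : X → ℝ)) := by
    refine tendsto_nhdsWithin_iff.2
      ⟨(tendsto_nhdsWithin_iff.1 ha).1.add (tendsto_nhdsWithin_iff.1 hb).1, ?_⟩
    filter_upwards [(tendsto_nhdsWithin_iff.1 ha).2, (tendsto_nhdsWithin_iff.1 hb).2] with p h1 h2
      using C.add_mem _ h1 _ h2
  refine (eq_mixedMeasure (l := l) (p := fun p => Function.update p.1 i (p.2.1 + p.2.2)) ?_
    fun f => ?_).symm
  · rw [coe_update]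
    exact tendsto_update _ i hψ hab
  · have h1 := tendsto_mixedMeasure (Function.update ψ i a) f
    have h2 := tendsto_mixedMeasure (Function.update ψ i b) f
    rw [coe_update] at h1 h2
    have h3 := (h1.comp (tendsto_update _ i hψ ha)).add (h2.comp (tendsto_update _ i hψ hb))
    refine Tendsto.congr' ?_ (h3.trans_eq (congrArg 𝓝 ((integralLinear f).map_add _ _).symm))
    filter_upwards [hψ.eventually (eventually_mem _), (tendsto_nhdsWithin_iff.1 ha).2,
      (tendsto_nhdsWithin_iff.1 hb).2] with p h h1 h2
    exact (discreteMeasure_update_add h i h1 h2 f).symm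

theorem mixedMeasure_update_smul (ψ : Fin m → C.concave) (i : Fin m) (c : ℝ≥0) (a : C.concave) :
    C.mixedMeasure (Function.update ψ i (c • a)) = c • C.mixedMeasure (Function.update ψ i a) := by
  have : T2Space X := E.t2Space
  have : CompactSpace E.sphere := isCompact_iff_compactSpace.1 E.isCompact_sphere
  -- The family is stable under positive factors only. For `c = 0`, additivity gives that the value
  -- at zero is twice itself.
  rcases eq_or_ne c 0 with rfl | hc
  · rw [zero_smul, zero_smul]
    have h := mixedMeasure_update_add ψ i 0 0
    rw [add_zero] at h
    refine finiteMeasure_eq_of_integral fun f => ?_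
    have h' := congrArg (integralLinear f) h
    rw [map_add, left_eq_add] at h'
    exact h'.trans (integralLinear f).map_zero.symm
  have hc : 0 < (c : ℝ) := NNReal.coe_pos.2 (pos_iff_ne_zero.2 hc)
  have := neBot_nhds (C := C) fun i => (ψ i).2.2
  have := mem_closure_iff_nhdsWithin_neBot.1 a.2.2
  set l := (C.nhds fun i => (ψ i : X → ℝ)) ×ˢ 𝓝[C.carrier] (a : X → ℝ)
  have hψ : Tendsto (fun p => p.1) l (C.nhds fun i => (ψ i : X → ℝ)) := tendsto_fst
  have ha : Tendsto (fun p => p.2) l (𝓝[C.carrier] (a : X → ℝ)) := tendsto_snd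
  have hca : Tendsto (fun p => (c : ℝ) • p.2) l (𝓝[C.carrier] ((c • a : C.concave) : X → ℝ)) := by
    refine tendsto_nhdsWithin_iff.2 ⟨(tendsto_nhdsWithin_iff.1 ha).1.const_smul (c : ℝ), ?_⟩
    filter_upwards [(tendsto_nhdsWithin_iff.1 ha).2] with p h1 using C.smul_mem _ hc _ h1
  refine (eq_mixedMeasure (l := l) (p := fun p => Function.update p.1 i ((c : ℝ) • p.2)) ?_
    fun f => ?_).symm
  · rw [coe_update]
    exact tendsto_update _ i hψ hca
  · have h1 := tendsto_mixedMeasure (Function.update ψ i a) f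
    rw [coe_update] at h1
    have h3 := (h1.comp (tendsto_update _ i hψ ha)).const_mul (c : ℝ)
    refine Tendsto.congr' ?_ (h3.trans_eq (congrArg 𝓝 ((integralLinear f).map_smul c _).symm))
    filter_upwards [hψ.eventually (eventually_mem _), (tendsto_nhdsWithin_iff.1 ha).2] with p h h1
    exact (discreteMeasure_update_smul h i h1 hc f).symm

variable (C) in
/-- The mixed Monge–Ampère measure as a multilinear map. -/
def mixedMeasureMultilinear :
    MultilinearMap ℝ≥0 (fun _ : Fin m => C.concave) (FiniteMeasure E.sphere) :=
  .mk' C.mixedMeasure mixedMeasure_update_add mixedMeasure_update_smul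

theorem isMongeAmpere_mixedMeasure (ψ : C.concave) :
    C.IsMongeAmpere ψ (C.mixedMeasure fun _ => ψ) := by
  intro f
  have h := (tendsto_mixedMeasure (fun _ => ψ) f).comp
    (tendsto_nhds_iff (p := fun φ : X → ℝ => fun _ => φ).2 fun _ => tendsto_id)
  simp only [Function.comp_def, List.ofFn_const] at h
  exact h

theorem IsMongeAmpere.eq {ψ : C.concave} {μ : FiniteMeasure E.sphere} (h : C.IsMongeAmpere ψ μ) :
    μ = C.mixedMeasure fun _ => ψ := by
  have := mem_closure_iff_nhdsWithin_neBot.1 ψ.2.2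
  refine eq_mixedMeasure (tendsto_nhds_iff (p := fun φ : X → ℝ => fun _ => φ).2
    fun _ => tendsto_id) fun f => ?_
  simp only [List.ofFn_const]
  exact h f

theorem isMixedMongeAmpere_mixedMeasure : C.IsMixedMongeAmpere C.mixedMeasure := by
  refine ⟨mixedMeasure_comp_perm, fun l c ψ => ?_⟩
  have h : C.mixedMeasure (fun _ => ∑ i, c i • ψ i) =
      ∑ I : Fin m → Fin l, (∏ k, c (I k)) • C.mixedMeasure (ψ ∘ I) := by
    have h1 := C.mixedMeasureMultilinear.map_sum fun (_ : Fin m) (i : Fin l) => c i • ψ i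
    have h2 (I : Fin m → Fin l) :=
      C.mixedMeasureMultilinear.map_smul_univ (fun k => c (I k)) fun k => ψ (I k)
    simp only [h2] at h1
    exact h1
  exact h ▸ isMongeAmpere_mixedMeasure _

/-- Integrating a fixed `f`, the difference of two candidates gives the symmetric coefficients of a
polynomial that vanishes at nonnegative arguments. With `l = m`, the coefficient at the identity map
is the difference at `ψ`. -/
theorem IsMixedMongeAmpere.eq {mu : (Fin m → C.concave) → FiniteMeasure E.sphere}
    (h : C.IsMixedMongeAmpere mu) : mu = C.mixedMeasure := by
  have : T2Space X := E.t2Space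
  have : CompactSpace E.sphere := isCompact_iff_compactSpace.1 E.isCompact_sphere
  funext ψ
  refine finiteMeasure_eq_of_integral fun f => sub_eq_zero.1 ?_
  refine apply_id_eq_zero_of_symmetric (d := fun I => integralLinear f (mu (ψ ∘ I)) -
    integralLinear f (C.mixedMeasure (ψ ∘ I))) (fun e I => ?_) fun c => ?_
  · rw [← Function.comp_assoc, h.1 e, mixedMeasure_comp_perm]
  · have h1 := (h.2 m c ψ).eq.trans (isMixedMongeAmpere_mixedMeasure.2 m c ψ).eq.symm
    have h2 := congrArg (integralLinear f) h1
    simp only [map_sum, map_smul] at h2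
    simp only [smul_sub, Finset.sum_sub_distrib]
    exact sub_eq_zero.2 h2

theorem integrable_concave (ψ : C.concave) (μ : FiniteMeasure E.sphere) :
    Integrable (fun x : E.sphere => (ψ : X → ℝ) x) (μ : Measure E.sphere) := by
  have : CompactSpace E.sphere := isCompact_iff_compactSpace.1 E.isCompact_sphere
  exact (continuous_of_mem_closure (by omega) ψ.2.2).integrable_of_hasCompactSupport
    (HasCompactSupport.of_compactSpace _)

/-- The degree is minus the integral of the factor of index `i` against the measure of the others.
That factor converges uniformly and the masses stay bounded, so it can be replaced by `ψ i` before
the weak limit is taken. -/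
theorem tendsto_deg (ψ : Fin (m + 1) → C.concave) (i : Fin (m + 1)) :
    Tendsto E.deg (C.nhds fun j => (ψ j : X → ℝ))
      (𝓝 (-∫ x : E.sphere, (ψ i : X → ℝ) x
        ∂(C.mixedMeasure (i.removeNth ψ) : Measure E.sphere))) := by
  have hn : 1 ≤ m + 1 := by omega
  let f : C(E.sphere, ℝ) := ⟨_, continuous_of_mem_closure hn (ψ i).2.2⟩
  have hlim (g : C(E.sphere, ℝ)) := (tendsto_mixedMeasure (i.removeNth ψ) g).comp
    (tendsto_removeNth (fun j => (ψ j : X → ℝ)) i)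
  refine tendsto_of_tendsto_of_dist (hlim f).neg (Metric.tendsto_nhds.2 fun ε hε => ?_)
  set M := ∫ x, (1 : C(E.sphere, ℝ)) x ∂(C.mixedMeasure (i.removeNth ψ) : Measure E.sphere) with hM
  have hM0 : 0 ≤ M := integral_nonneg fun _ => zero_le_one
  have hδ : 0 < ε / (M + 1) := by positivity
  filter_upwards [eventually_mem _, (hlim 1).eventually_lt_const (lt_add_one M),
    (tendsto_eval_pi _ i).eventually (eventually_abs_sub_lt hn _ hδ)] with φ hφ h1 h2
  have hl : ∀ ω ∈ List.ofFn (i.removeNth φ), ω ∈ C.carrier :=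
    List.forall_mem_ofFn_iff.2 fun j => hφ _
  have h3 := abs_discreteMeasure_le (f := E.onSphere (C.subset_PL (hφ i)) - f) hl (by simp)
    fun x => (h2 x).le
  rw [discreteMeasure_sub (mem_PL hl)] at h3
  have h4 := deg_eq_neg_discreteMeasure (fun j => C.subset_PL (hφ j)) i
  rw [Real.dist_0_eq_abs, abs_of_nonneg dist_nonneg, Real.dist_eq, h4, Function.comp_apply]
  refine lt_of_le_of_lt ?_ ((mul_lt_mul_of_pos_left h1 hδ).trans_eq
    (div_mul_cancel₀ _ (by positivity)))
  refine le_trans (le_of_eq ?_) h3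
  congr 1
  ring

/-- Both integrals are minus the limit of the same degrees, whichever factor is singled out. -/
theorem integral_removeNth_eq (ψ : Fin (m + 1) → C.concave) (i j : Fin (m + 1)) :
    ∫ x : E.sphere, (ψ i : X → ℝ) x ∂(C.mixedMeasure (i.removeNth ψ) : Measure E.sphere) =
      ∫ x : E.sphere, (ψ j : X → ℝ) x ∂(C.mixedMeasure (j.removeNth ψ) : Measure E.sphere) := by
  have := neBot_nhds (C := C) fun i => (ψ i).2.2
  exact neg_injective (tendsto_nhds_unique (tendsto_deg ψ i) (tendsto_deg ψ j))

end AdmissibleFamily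

end BalancedSpace

end Conical

end

/-! ### The main theorem. -/

theorem mainTheorem4 {X N : Type*} [TopologicalSpace X] [SecondCountableTopology X]
    [MeasurableSpace X] [BorelSpace X]
    [NormedAddCommGroup N] [InnerProductSpace ℝ N] [FiniteDimensional ℝ N]
    (m : ℕ) (E : Conical.BalancedSpace X N (m + 1)) (C : E.AdmissibleFamily) :
    -- each `C`-concave function has a unique Monge--Ampère measure, and minus its integral is its degree
    (∀ ψ : C.concave, ∃! μ : FiniteMeasure E.sphere, C.IsMongeAmpere ψ μ) ∧
    (∀ (ψ : C.concave) (μ : FiniteMeasure E.sphere), C.IsMongeAmpere ψ μ →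
      Integrable (fun x : E.sphere => (ψ : X → ℝ) x) (μ : Measure E.sphere) ∧
      ∀ φ : ℕ → X → ℝ, (∀ j, φ j ∈ C.carrier) → Tendsto φ atTop (𝓝 (ψ : X → ℝ)) →
        Tendsto (fun j => E.deg (fun _ => φ j)) atTop
          (𝓝 (-∫ x : E.sphere, (ψ : X → ℝ) x ∂(μ : Measure E.sphere)))) ∧
    -- there is a unique mixed Monge--Ampère measure; it is symmetric and multilinear
    (∃! mu : (Fin m → C.concave) → FiniteMeasure E.sphere, C.IsMixedMongeAmpere mu) ∧
    ∀ mu : (Fin m → C.concave) → FiniteMeasure E.sphere, C.IsMixedMongeAmpere mu →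
      (∃ L : MultilinearMap ℝ≥0 (fun _ : Fin m => C.concave) (FiniteMeasure E.sphere),
        ∀ ψ, mu ψ = L ψ) ∧
      -- the mixed degree is minus an integral
      ∀ ψ : Fin (m + 1) → C.concave,
        (∀ i, Integrable (fun x : E.sphere => (ψ i : X → ℝ) x)
          (mu (i.removeNth ψ) : Measure E.sphere)) ∧
        (∀ φ : Fin (m + 1) → ℕ → X → ℝ, (∀ i j, φ i j ∈ C.carrier) →
          (∀ i, Tendsto (φ i) atTop (𝓝 (ψ i : X → ℝ))) →
          Tendsto (fun j => E.deg (fun i => φ i j)) atTop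
            (𝓝 (-∫ x : E.sphere, (ψ 0 : X → ℝ) x
              ∂(mu (Fin.removeNth 0 ψ) : Measure E.sphere)))) ∧
        ∀ i, ∫ x : E.sphere, (ψ 0 : X → ℝ) x ∂(mu (Fin.removeNth 0 ψ) : Measure E.sphere) =
          ∫ x : E.sphere, (ψ i : X → ℝ) x ∂(mu (i.removeNth ψ) : Measure E.sphere) := by
  open Conical.BalancedSpace.AdmissibleFamily in
  refine ⟨fun ψ => ⟨_, isMongeAmpere_mixedMeasure ψ, fun μ h => h.eq⟩, fun ψ μ h =>
    ⟨integrable_concave ψ μ, fun φ hφ hlim => ?_⟩,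
    ⟨_, isMixedMongeAmpere_mixedMeasure, fun mu h => h.eq⟩, fun mu h => ?_⟩
  · rw [h.eq]
    -- Removing an entry from the constant tuple leaves the constant tuple that defines the
    -- Monge–Ampère measure of `ψ`.
    open Conical.BalancedSpace.AdmissibleFamily in
    exact (tendsto_deg (fun _ => ψ) 0).comp (tendsto_nhds_iff.2 fun _ =>
      tendsto_nhdsWithin_iff.2 ⟨hlim, .of_forall hφ⟩)
  · obtain rfl := h.eq
    open Conical.BalancedSpace.AdmissibleFamily in
    exact ⟨⟨C.mixedMeasureMultilinear, fun _ => rfl⟩, fun ψ =>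
      ⟨fun i => integrable_concave (ψ i) _, fun φ hφ hlim =>
        (tendsto_deg ψ 0).comp (tendsto_nhds_iff.2 fun i =>
          tendsto_nhdsWithin_iff.2 ⟨hlim i, .of_forall (hφ i)⟩), integral_removeNth_eq ψ 0⟩⟩
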